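/- **Systems.** Literals, clauses (finite sets of literals) and CNFs are as usual. A QBF $\Pi\phi$ is closed prenex with a CNF matrix; each variable is quantified once in $\Pi$, $\mathrm{lv}(x)$ is the index of the quantifier block of $x$ counted from the left, and $D_x$ is the set of universal variables left of the existential variable $x$. In this way a QBF is also an S-form DQBF $\forall U\,\exists x_1(D_{x_1})\dots x_q(D_{x_q})\,\phi$. For universal $u$ put $D_u=\{u\}$. Write $\phi\vdash_1\bot$ if unit propagation on $\phi$ yields the empty clause, $\bar C$ for the set of unit clauses negating $C$, and for a literal $l$ and a clause $D$ let $O_D=\{k\in D:\mathrm{lv}(k)\le \mathrm{lv}(l),\ \mathrm{var}(k)\ne\mathrm{var}(l)\}$ be the outer clause. *QRAT derivations* start from a closed QBF $\Pi\phi$ and use the following steps, where $\Pi'$ is an extension of the prefix by new variables inserted anywhere: (ATA) from $\Pi\phi$ to $\Pi'\,\phi\wedge C$ if $\phi\wedge\bar C\vdash_1\bot$; (QRATA) from $\Pi\phi$ to $\Pi'\,\phi\wedge(C\vee l)$, $l$ existential, if $\phi\wedge\bar C\wedge\bar l\wedge\bar O_D\vdash_1\bot$ for every $D\in\phi$ with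 $\bar l\in D$ ($O_D$ with respect to $\Pi'$); (QRATU) from $\Pi\,\phi\wedge(C\vee l)$ to $\Pi\,\phi\wedge C$, $l$ universal, $\bar l\notin C$, if $\phi\wedge\bar C\wedge\bar O_D\vdash_1\bot$ for every $D\in\phi$ with $\bar l\in D$; (EUR) from $\Pi\,\phi\wedge(C\vee l)$ to $\Pi\,\phi\wedge C$, $l$ universal, if no clause containing $\bar l$ lies on a resolution path of $\phi\wedge C$ from $C$ through the set $\mathcal S$ of existential variables right of $l$; here the $\mathcal S$-literals on the paths are the least set that contains all $\mathcal S$-literals of $C$ and that, for each of its elements $p$ and each clause $D$ with $\bar p\in D$, contains all $\mathcal S$-literals $q\neq\bar p$ of $D$, and the clauses on the paths are $C$ and all these $D$; deletion of any clause; extension of the prefix by new variables. A *QRAT refutation* is a derivation whose last formula contains the empty clause. A *QRAT proof that $\Pi\phi$ is true* rewrites $\Pi\phi$ into a formula with empty matrix, where a clause $K$ may be removed from $\phi\wedge K$ only if $\phi\wedge\bar K\vdash_1\bot$, or if $K$ has an existential literal $l$ such that $\phi\wedge\bar K\wedge\bar O_D\vdash_1\bot$ for every $D\in\phi$ with $\bar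 l\in D$; clauses may be added, universal literals removed from clauses, and new variables added to the prefix without side condition. *D-Frege+$\forall$red* is the line-based system for S-form DQBFs $\Pi\psi$ ($\psi$ a conjunction of propositional formulas) over an arbitrary Frege system $F$ (finitely many sound schematic rules in the connectives $0,1,\neg,\wedge,\vee,\to$, implicationally complete). Its steps are: a conjunct of $\psi$; an $F$-inference from earlier lines; independent extension, introducing a fresh existential variable $v$ with $D_v=(\bigcup_{y\in Y}D_{\mathrm{var}(y)})\setminus \mathrm{var}(\alpha)$ and the line $\alpha\to(v\leftrightarrow\bigwedge Y)$ or $\alpha\to(v\leftrightarrow\bigvee Y)$, where $\alpha$ is a conjunction of universal literals and $Y$ a finite set of literals; reduction, from a line $L(u)$ with $u$ universal to $L(0)$ or $L(1)$ if no existential $x$ in $L$ has $u\in D_x$; addition of a new variable to the prefix. A refutation is a derivation of the line $0$. **Theorem.** D-Frege+$\forall$red p-simulates QRAT on both false and true QBFs. Precisely, for every Frege system $F$: 1. There is a polynomial-time procedure that maps every QRAT derivation $\pi$ from a closed QBF $\Pi\phi$, with formulas $\Pi_0\phi_0=\Pi\phi,\ \Pi_1\phi_1,\dots,\Pi_n\phi_n$,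 to a D-Frege+$\forall$red derivation from $\Pi\phi$ that simulates $\pi$ line by line: for every $i\le n$ it contains a copy of $\phi_i$, that is, its clauses under an injective renaming of the variables of $\Pi_i$ that fixes the universal variables and sends each existential variable $x$ to an existential variable $x'$ with $D_{x'}\subseteq D_x$. If $\pi$ is a QRAT refutation of $\Pi\phi$, then the result is a D-Frege+$\forall$red refutation of $\Pi\phi$. 2. There is a polynomial-time procedure that maps every QRAT proof that $\Pi\phi$ is true to a D-Frege+$\forall$red refutation of $\overline{\Pi}\,\neg\phi$, where $\overline\Pi$ is $\Pi$ with $\forall$ and $\exists$ exchanged. -/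

import Mathlib

namespace QBFSim

/-! ### Literals, clauses, closed prenex QBFs in conjunctive normal form -/

/-- A literal: a variable (a natural number) with a polarity. -/
structure Lit where
  var : ℕ
  pos : Bool
  deriving DecidableEq

/-- The complementary literal. -/
def Lit.neg (l : Lit) : Lit := ⟨l.var, !l.pos⟩

/-- A clause, given by a list that enumerates its set of literals. -/
abbrev Clause := List Lit

/-- A CNF: a finite conjunction of clauses. -/
abbrev CNF := List Clause

inductive Quant where
  | all
  | ex
  deriving DecidableEq

def Quant.flip : Quant → Quant
  | .all => .ex
  | .ex => .all

/-- A linear quantifier prefix; the head of the list is the leftmost (outermost) quantifier. -/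
abbrev Prefix := List (Quant × ℕ)

/-- The quantified variables, from left to right. -/
def Prefix.names (Q : Prefix) : List ℕ := Q.map Prod.snd

/-- A prenex QBF with a CNF matrix. -/
structure PCNF where
  pre : Prefix
  matrix : CNF

/-- Every variable is quantified at most once, and all variables of the matrix are quantified. -/
def PCNF.Closed (Φ : PCNF) : Prop :=
  Φ.pre.names.Nodup ∧ ∀ C ∈ Φ.matrix, ∀ l ∈ C, l.var ∈ Φ.pre.names

/-- `Q'` extends `Q` by new variables, inserted anywhere. -/
def Prefix.Extends (Q' Q : Prefix) : Prop := Q.Sublist Q' ∧ Q'.names.Nodup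

/-- Index of the quantifier block that contains `x`, when `n` is the index of the current block
and `q` is its quantifier. -/
def Prefix.levelFrom (q : Quant) (n : ℕ) : Prefix → ℕ → ℕ
  | [], _ => n
  | (q', y) :: Q, x =>
    let n' := if q' = q then n else n + 1
    if x = y then n' else Prefix.levelFrom q' n' Q x

/-- The quantifier level of a variable of the prefix: the index of its maximal block of equal
quantifiers, counted from the left. -/
def Prefix.level (Q : Prefix) (x : ℕ) : ℕ :=
  match Q with
  | [] => 0
  | (q, y) :: Q' => Prefix.levelFrom q 0 ((q, y) :: Q') x

/-- `x` is an existential variable to the right of the variable `u`. -/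
def Prefix.ExRightOf (Q : Prefix) (u x : ℕ) : Prop :=
  ∃ (Q₁ Q₂ : Prefix) (q : Quant), Q = Q₁ ++ (q, u) :: Q₂ ∧ (Quant.ex, x) ∈ Q₂

/-! ### Unit propagation, outer clauses, resolution paths -/

/-- The literals that unit propagation assigns: some clause contains `l`, and all other literals
of that clause are falsified by literals assigned before. -/
inductive UnitProp (φ : CNF) : Lit → Prop
  | unit (C : Clause) (l : Lit) (hC : C ∈ φ) (hl : l ∈ C)
      (h : ∀ k ∈ C, k ≠ l → UnitProp φ k.neg) : UnitProp φ l

/-- `φ ⊢₁ ⊥`: unit propagation produces the empty clause. -/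
def UPRefutes (φ : CNF) : Prop := ∃ C ∈ φ, ∀ k ∈ C, UnitProp φ k.neg

/-- The negation of a clause, as a conjunction of unit clauses. -/
def Clause.negUnits (C : Clause) : CNF := C.map fun k => [k.neg]

/-- The outer clause `O_D` with respect to the literal `l`. -/
def outerClause (Q : Prefix) (l : Lit) (D : Clause) : Clause :=
  D.filter fun k => decide (Q.level k.var ≤ Q.level l.var ∧ k.var ≠ l.var)

/-- The `S`-literals on the resolution paths from `χ`. -/
inductive PathLit (φ χ : CNF) (S : ℕ → Prop) : Lit → Prop
  | init (C : Clause) (l : Lit) (hC : C ∈ χ) (hl : l ∈ C) (hS : S l.var) : PathLit φ χ S l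
  | step (p q : Lit) (D : Clause) (hp : PathLit φ χ S p) (hD : D ∈ φ) (hpD : p.neg ∈ D)
      (hq : q ∈ D) (hne : q ≠ p.neg) (hS : S q.var) : PathLit φ χ S q

/-- The clauses on the resolution paths from `χ`. -/
def PathClause (φ χ : CNF) (S : ℕ → Prop) (D : Clause) : Prop :=
  D ∈ χ ∨ (D ∈ φ ∧ ∃ p, PathLit φ χ S p ∧ p.neg ∈ D)

/-- The clause `C` for which the given clause is `C ∨ l`. -/
def Clause.without (K : Clause) (l : Lit) : Clause := K.filter fun k => decide (k ≠ l)

/-! ### QRAT refutations -/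

/-- The steps of the refutational system QRAT. -/
inductive QRATStep where
  /-- Asymmetric tautology addition of `C`, with the new prefix `Q'`. -/
  | ata (Q' : Prefix) (C : Clause)
  /-- Addition of `C ∨ l` with `l` existential in the new prefix `Q'`. -/
  | qrata (Q' : Prefix) (C : Clause) (l : Lit)
  /-- Removal of the universal literal `l` from the clause `K`, by the QRATU rule. -/
  | qratu (K : Clause) (l : Lit)
  /-- Removal of the universal literal `l` from the clause `K`, by extended universal reduction. -/
  | eur (K : Clause) (l : Lit)
  /-- Deletion of the clause `K`. -/
  | del (K : Clause)
  /-- Extension of the prefix by new variables. -/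
  | newVars (Q' : Prefix)

/-- The formula that results from a step. -/
def QRATStep.apply (Φ : PCNF) : QRATStep → PCNF
  | .ata Q' C => ⟨Q', C :: Φ.matrix⟩
  | .qrata Q' C l => ⟨Q', (l :: C) :: Φ.matrix⟩
  | .qratu K l => ⟨Φ.pre, K.without l :: Φ.matrix.erase K⟩
  | .eur K l => ⟨Φ.pre, K.without l :: Φ.matrix.erase K⟩
  | .del K => ⟨Φ.pre, Φ.matrix.erase K⟩
  | .newVars Q' => ⟨Q', Φ.matrix⟩

/-- The side conditions of the steps. -/
def QRATStep.Ok (Φ : PCNF) : QRATStep → Prop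
  | .ata Q' C =>
      Q'.Extends Φ.pre ∧ (∀ k ∈ C, k.var ∈ Q'.names) ∧ UPRefutes (Φ.matrix ++ C.negUnits)
  | .qrata Q' C l =>
      Q'.Extends Φ.pre ∧ (∀ k ∈ C, k.var ∈ Q'.names) ∧ (Quant.ex, l.var) ∈ Q' ∧
      ∀ D ∈ Φ.matrix, l.neg ∈ D →
        UPRefutes (Φ.matrix ++ C.negUnits ++ [[l.neg]] ++ (outerClause Q' l D).negUnits)
  | .qratu K l =>
      K ∈ Φ.matrix ∧ l ∈ K ∧ l.neg ∉ K ∧ (Quant.all, l.var) ∈ Φ.pre ∧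
      ∀ D ∈ Φ.matrix.erase K, l.neg ∈ D →
        UPRefutes (Φ.matrix.erase K ++ (K.without l).negUnits ++
          (outerClause Φ.pre l D).negUnits)
  | .eur K l =>
      K ∈ Φ.matrix ∧ l ∈ K ∧ (Quant.all, l.var) ∈ Φ.pre ∧
      ∀ D, PathClause (K.without l :: Φ.matrix.erase K) [K.without l]
        (Φ.pre.ExRightOf l.var) D → l.neg ∉ D
  | .del K => K ∈ Φ.matrix
  | .newVars Q' => Q'.Extends Φ.pre

/-- A QRAT proof: the initial formula and the steps. -/
structure QRATProof where
  formula : PCNF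
  steps : List QRATStep

/-- All steps are correct, one after the other. -/
def QRATStep.AllOk : PCNF → List QRATStep → Prop
  | _, [] => True
  | Φ, s :: r => s.Ok Φ ∧ QRATStep.AllOk (s.apply Φ) r

/-- The formula after the first `i` steps. -/
def QRATProof.stage (π : QRATProof) (i : ℕ) : PCNF :=
  (π.steps.take i).foldl QRATStep.apply π.formula

/-- A correct QRAT derivation from a closed formula. -/
def QRATProof.IsDerivation (π : QRATProof) : Prop :=
  π.formula.Closed ∧ QRATStep.AllOk π.formula π.steps

/-- A QRAT refutation: a derivation that ends in a formula with the empty clause. -/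
def QRATProof.IsRefutation (π : QRATProof) : Prop :=
  π.IsDerivation ∧ [] ∈ (π.stage π.steps.length).matrix

/-! ### QRAT proofs of true formulas

To show that a formula is true, QRAT rewrites it into the empty matrix, and every step must be
such that truth of the new formula implies truth of the old one. So clauses may be removed only
by `ATE` and `QRATE` (the rules `ATA` and `QRATA` read backwards), while adding a clause, removing
a universal literal from a clause, or extending the prefix needs no side condition. In particular
the additions by `ATA` and `QRATA` and the literal removals by `QRATU` and `EUR` are allowed. -/

inductive QRATSatStep where
  /-- Asymmetric tautology elimination. -/
  | ate (K : Clause)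
  /-- Elimination of the clause `K` with respect to its existential literal `l`. -/
  | qrate (K : Clause) (l : Lit)
  /-- Addition of the clause `C`, with the new prefix `Q'`. -/
  | add (Q' : Prefix) (C : Clause)
  /-- Removal of the universal literal `l` from the clause `K`. -/
  | red (K : Clause) (l : Lit)
  /-- Extension of the prefix by new variables. -/
  | newVars (Q' : Prefix)

def QRATSatStep.apply (Φ : PCNF) : QRATSatStep → PCNF
  | .ate K => ⟨Φ.pre, Φ.matrix.erase K⟩
  | .qrate K _ => ⟨Φ.pre, Φ.matrix.erase K⟩
  | .add Q' C => ⟨Q', C :: Φ.matrix⟩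
  | .red K l => ⟨Φ.pre, K.without l :: Φ.matrix.erase K⟩
  | .newVars Q' => ⟨Q', Φ.matrix⟩

def QRATSatStep.Ok (Φ : PCNF) : QRATSatStep → Prop
  | .ate K => K ∈ Φ.matrix ∧ UPRefutes (Φ.matrix.erase K ++ K.negUnits)
  | .qrate K l =>
      K ∈ Φ.matrix ∧ l ∈ K ∧ (Quant.ex, l.var) ∈ Φ.pre ∧
      ∀ D ∈ Φ.matrix.erase K, l.neg ∈ D →
        UPRefutes (Φ.matrix.erase K ++ K.negUnits ++ (outerClause Φ.pre l D).negUnits)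
  | .add Q' C => Q'.Extends Φ.pre ∧ ∀ k ∈ C, k.var ∈ Q'.names
  | .red K l => K ∈ Φ.matrix ∧ l ∈ K ∧ (Quant.all, l.var) ∈ Φ.pre
  | .newVars Q' => Q'.Extends Φ.pre

structure QRATSatProof where
  formula : PCNF
  steps : List QRATSatStep

def QRATSatStep.AllOk : PCNF → List QRATSatStep → Prop
  | _, [] => True
  | Φ, s :: r => s.Ok Φ ∧ QRATSatStep.AllOk (s.apply Φ) r

/-- A QRAT proof that the closed formula `π.formula` is true: it ends in the empty matrix. -/
def QRATSatProof.IsSatisfactionProof (π : QRATSatProof) : Prop :=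
  π.formula.Closed ∧ QRATSatStep.AllOk π.formula π.steps ∧
    (π.steps.foldl QRATSatStep.apply π.formula).matrix = []

/-! ### Propositional formulas and Frege systems -/

/-- Propositional formulas in the connectives `0, 1, ¬, ∧, ∨, →`. -/
inductive Fm where
  | bot
  | top
  | var (x : ℕ)
  | neg (A : Fm)
  | and (A B : Fm)
  | or (A B : Fm)
  | imp (A B : Fm)

/-- `A ↔ B`. -/
def Fm.iff (A B : Fm) : Fm := .and (.imp A B) (.imp B A)

def Fm.eval (v : ℕ → Bool) : Fm → Bool
  | .bot => false
  | .top => true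
  | .var x => v x
  | .neg A => !A.eval v
  | .and A B => A.eval v && B.eval v
  | .or A B => A.eval v || B.eval v
  | .imp A B => !A.eval v || B.eval v

def Fm.subst (σ : ℕ → Fm) : Fm → Fm
  | .bot => .bot
  | .top => .top
  | .var x => σ x
  | .neg A => .neg (A.subst σ)
  | .and A B => .and (A.subst σ) (B.subst σ)
  | .or A B => .or (A.subst σ) (B.subst σ)
  | .imp A B => .imp (A.subst σ) (B.subst σ)

/-- The variables that occur in a formula. -/
def Fm.vars : Fm → List ℕ
  | .bot => []
  | .top => []
  | .var x => [x]
  | .neg A => A.vars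
  | .and A B => A.vars ++ B.vars
  | .or A B => A.vars ++ B.vars
  | .imp A B => A.vars ++ B.vars

/-- `0` or `1`. -/
def Fm.const (b : Bool) : Fm := if b then .top else .bot

/-- The formula in which the variable `u` is replaced by the constant `b`. -/
def Fm.setVar (A : Fm) (u : ℕ) (b : Bool) : Fm := A.subst (Function.update Fm.var u (Fm.const b))

def Lit.toFm (l : Lit) : Fm := if l.pos then .var l.var else .neg (.var l.var)

/-- The conjunction of a list of formulas; `1` for the empty list. -/
def bigAnd : List Fm → Fm
  | [] => .top
  | A :: r => .and A (bigAnd r)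

/-- The disjunction of a list of formulas; `0` for the empty list. -/
def bigOr : List Fm → Fm
  | [] => .bot
  | A :: r => .or A (bigOr r)

/-- The formula of a clause; the empty clause is `0`. -/
def Clause.toFm (C : Clause) : Fm := bigOr (C.map Lit.toFm)

/-- `Γ ⊨ A`. -/
def Entails (Γ : List Fm) (A : Fm) : Prop :=
  ∀ v : ℕ → Bool, (∀ B ∈ Γ, B.eval v = true) → A.eval v = true

/-- An inference rule, schematic in its variables; an axiom scheme is a rule without premises. -/
structure FregeRule where
  prems : List Fm
  concl : Fm

/-- `L` follows from the formulas in `Γ` by one substitution instance of one of the rules. -/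
def FregeInfers (R : List FregeRule) (Γ : List Fm) (L : Fm) : Prop :=
  ∃ r ∈ R, ∃ σ : ℕ → Fm, (∀ P ∈ r.prems, P.subst σ ∈ Γ) ∧ L = r.concl.subst σ

/-- Formulas derivable from the hypotheses `Γ` with the rules `R`. -/
inductive FregeDerives (R : List FregeRule) (Γ : List Fm) : Fm → Prop
  | hyp (A : Fm) (h : A ∈ Γ) : FregeDerives R Γ A
  | rule (r : FregeRule) (σ : ℕ → Fm) (hr : r ∈ R)
      (h : ∀ P ∈ r.prems, FregeDerives R Γ (P.subst σ)) : FregeDerives R Γ (r.concl.subst σ)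

/-- A Frege system: finitely many schematic rules that are sound and (implicationally) complete. -/
structure FregeSystem where
  rules : List FregeRule
  sound : ∀ r ∈ rules, Entails r.prems r.concl
  complete : ∀ (Γ : List Fm) (A : Fm), Entails Γ A → FregeDerives rules Γ A

/-! ### S-form DQBFs and the refutational system `D-Frege + ∀red` -/

/-- A DQBF prefix: the universal variables, and the existential variables with their dependency
sets. -/
structure DPrefix where
  univ : List ℕ
  exs : List (ℕ × List ℕ)

def DPrefix.exNames (P : DPrefix) : List ℕ := P.exs.map Prod.fst

def DPrefix.names (P : DPrefix) : List ℕ := P.univ ++ P.exNames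

/-- The dependency set of a variable; it is `{u}` for a universal variable `u`. -/
def DPrefix.dep (P : DPrefix) (y : ℕ) : List ℕ :=
  if y ∈ P.univ then [y] else (P.exs.lookup y).getD []

/-- A DQBF whose matrix is the conjunction of a list of formulas. -/
structure DQBF where
  pre : DPrefix
  matrix : List Fm

/-- The DQBF prefix together with the lines derived so far. -/
structure DState where
  pre : DPrefix
  lines : List Fm

inductive DStep where
  /-- A conjunct of the matrix. -/
  | ax (L : Fm)
  /-- A formula inferred by a rule of the Frege system from earlier lines. -/
  | frege (L : Fm)
  /-- Universal reduction of the line `L`: the universal variable `u` is replaced by `b`. -/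
  | red (L : Fm) (u : ℕ) (b : Bool)
  /-- Independent extension `α → (v ↔ ⋀ Y)`. -/
  | extAnd (v : ℕ) (α Y : List Lit)
  /-- Independent extension `α → (v ↔ ⋁ Y)`. -/
  | extOr (v : ℕ) (α Y : List Lit)
  /-- Prefix weakening by a new universal variable. -/
  | newAll (u : ℕ)
  /-- Prefix weakening by a new existential variable with dependency set `D`. -/
  | newEx (x : ℕ) (D : List ℕ)

/-- The dependency set `(⋃_{y ∈ Y} D_y) \ D_α` of an extension variable. -/
def DPrefix.extDep (P : DPrefix) (α Y : List Lit) : List ℕ :=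
  (Y.flatMap fun y => P.dep y.var).filter fun u => decide (u ∉ α.map Lit.var)

/-- The side condition of independent extension: `v` is fresh, `α` consists of universal literals,
and `Y` of literals of the prefix. -/
def DPrefix.ExtOk (P : DPrefix) (v : ℕ) (α Y : List Lit) : Prop :=
  v ∉ P.names ∧ (∀ l ∈ α, l.var ∈ P.univ) ∧ ∀ y ∈ Y, y.var ∈ P.names

def DStep.Ok (F : FregeSystem) (M : List Fm) (s : DState) : DStep → Prop
  | .ax L => L ∈ M
  | .frege L => (∀ x ∈ L.vars, x ∈ s.pre.names) ∧ FregeInfers F.rules s.lines L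
  | .red L u _ =>
      L ∈ s.lines ∧ u ∈ s.pre.univ ∧ ∀ x ∈ L.vars, x ∈ s.pre.exNames → u ∉ s.pre.dep x
  | .extAnd v α Y => s.pre.ExtOk v α Y
  | .extOr v α Y => s.pre.ExtOk v α Y
  | .newAll u => u ∉ s.pre.names
  | .newEx x D => x ∉ s.pre.names ∧ ∀ u ∈ D, u ∈ s.pre.univ

def DStep.apply (s : DState) : DStep → DState
  | .ax L => ⟨s.pre, L :: s.lines⟩
  | .frege L => ⟨s.pre, L :: s.lines⟩
  | .red L u b => ⟨s.pre, L.setVar u b :: s.lines⟩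
  | .extAnd v α Y =>
      ⟨⟨s.pre.univ, (v, s.pre.extDep α Y) :: s.pre.exs⟩,
        .imp (bigAnd (α.map Lit.toFm)) (.iff (.var v) (bigAnd (Y.map Lit.toFm))) :: s.lines⟩
  | .extOr v α Y =>
      ⟨⟨s.pre.univ, (v, s.pre.extDep α Y) :: s.pre.exs⟩,
        .imp (bigAnd (α.map Lit.toFm)) (.iff (.var v) (bigOr (Y.map Lit.toFm))) :: s.lines⟩
  | .newAll u => ⟨⟨u :: s.pre.univ, s.pre.exs⟩, s.lines⟩
  | .newEx x D => ⟨⟨s.pre.univ, (x, D) :: s.pre.exs⟩, s.lines⟩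

def DStep.AllOk (F : FregeSystem) (M : List Fm) : DState → List DStep → Prop
  | _, [] => True
  | s, a :: r => a.Ok F M s ∧ DStep.AllOk F M (a.apply s) r

/-- A proof in the DQBF system: the initial DQBF and the steps. -/
structure DProof where
  formula : DQBF
  steps : List DStep

/-- The final prefix, and all derived lines. -/
def DProof.final (π : DProof) : DState :=
  π.steps.foldl DStep.apply ⟨π.formula.pre, []⟩

def DProof.IsDerivation (F : FregeSystem) (π : DProof) : Prop :=
  DStep.AllOk F π.formula.matrix ⟨π.formula.pre, []⟩ π.steps

/-- A refutation: a derivation of the line `0`. -/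
def DProof.IsRefutation (F : FregeSystem) (π : DProof) : Prop :=
  π.IsDerivation F ∧ Fm.bot ∈ π.final.lines

/-! ### QBFs as DQBFs -/

/-- The existential variables of a linear prefix with the universal variables to their left;
`U` collects the universal variables seen so far. -/
def Prefix.exDeps (U : List ℕ) : Prefix → List (ℕ × List ℕ)
  | [] => []
  | (.all, u) :: Q => Prefix.exDeps (U ++ [u]) Q
  | (.ex, x) :: Q => (x, U) :: Prefix.exDeps U Q

/-- The DQBF prefix of a linear prefix. -/
def Prefix.toD (Q : Prefix) : DPrefix :=
  ⟨(Q.filter fun e => decide (e.1 = Quant.all)).map Prod.snd, Q.exDeps []⟩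

/-- The closed QBF `Π φ` as a DQBF; the clauses are the conjuncts of its matrix. -/
def PCNF.toDQBF (Φ : PCNF) : DQBF := ⟨Φ.pre.toD, Φ.matrix.map Clause.toFm⟩

/-- The prefix with `∀` and `∃` exchanged. -/
def Prefix.dual (Q : Prefix) : Prefix := Q.map fun e => (e.1.flip, e.2)

/-- The negation of `Π φ`, in prenex form: the matrix `¬ φ` under the dual prefix. -/
def PCNF.negDQBF (Φ : PCNF) : DQBF :=
  ⟨Φ.pre.dual.toD, [.neg (bigAnd (Φ.matrix.map Clause.toFm))]⟩

/-- The derived lines contain a copy of `Φ`: its clauses under an injective renaming that fixes the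
universal variables and sends every existential variable to an existential variable whose
dependency set is no larger. -/
def DState.ContainsCopy (s : DState) (Φ : PCNF) : Prop :=
  ∃ ρ : ℕ → ℕ, Set.InjOn ρ {x | x ∈ Φ.pre.names} ∧
    (∀ u, (Quant.all, u) ∈ Φ.pre → ρ u = u ∧ u ∈ s.pre.univ) ∧
    (∀ x, (Quant.ex, x) ∈ Φ.pre →
      ρ x ∈ s.pre.exNames ∧ s.pre.dep (ρ x) ⊆ Φ.pre.toD.dep x) ∧
    ∀ C ∈ Φ.matrix, Clause.toFm (C.map fun l => ⟨ρ l.var, l.pos⟩) ∈ s.lines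

/-! ### Polynomial time

Programs of a while language with a single register that holds a binary tree. Executing a construct
costs the size of the value it reads plus the size of the value it returns, in addition to the cost
of its parts, so that this cost is polynomially related to the running time of Turing machines. -/

/-- Binary trees. -/
inductive Data where
  | nil
  | cons (a b : Data)

def Data.size : Data → ℕ
  | .nil => 1
  | .cons a b => a.size + b.size + 1

/-- Programs. -/
inductive Prog where
  /-- Return the input. -/
  | id
  /-- Return the leaf. -/
  | nil
  /-- Run both programs on the input and pair the results. -/
  | cons (f g : Prog)
  /-- The left subtree (of a leaf: the leaf). -/
  | hd
  /-- The right subtree (of a leaf: the leaf). -/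
  | tl
  /-- First `f`, then `g`. -/
  | seq (f g : Prog)
  /-- If `c` returns a pair, then `f`, else `g`. -/
  | ite (c f g : Prog)
  /-- While `c` returns a pair, replace the register by the result of `f`. -/
  | loop (c f : Prog)

/-- `Runs f x y t`: on input `x` the program `f` halts with output `y` at cost `t`. -/
inductive Runs : Prog → Data → Data → ℕ → Prop
  | id (x : Data) : Runs .id x x (x.size + x.size)
  | nil (x : Data) : Runs .nil x .nil (x.size + Data.nil.size)
  | cons (f g : Prog) (x a b : Data) (s t : ℕ) (hf : Runs f x a s) (hg : Runs g x b t) :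
      Runs (.cons f g) x (.cons a b) (s + t + x.size + (Data.cons a b).size)
  | hd_nil : Runs .hd .nil .nil (Data.nil.size + Data.nil.size)
  | hd_cons (a b : Data) : Runs .hd (.cons a b) a ((Data.cons a b).size + a.size)
  | tl_nil : Runs .tl .nil .nil (Data.nil.size + Data.nil.size)
  | tl_cons (a b : Data) : Runs .tl (.cons a b) b ((Data.cons a b).size + b.size)
  | seq (f g : Prog) (x y z : Data) (s t : ℕ) (hf : Runs f x y s) (hg : Runs g y z t) :
      Runs (.seq f g) x z (s + t + x.size + z.size)
  | ite_true (c f g : Prog) (x a b y : Data) (s t : ℕ) (hc : Runs c x (.cons a b) s)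
      (hf : Runs f x y t) : Runs (.ite c f g) x y (s + t + x.size + y.size)
  | ite_false (c f g : Prog) (x y : Data) (s t : ℕ) (hc : Runs c x .nil s)
      (hg : Runs g x y t) : Runs (.ite c f g) x y (s + t + x.size + y.size)
  | loop_stop (c f : Prog) (x : Data) (s : ℕ) (hc : Runs c x .nil s) :
      Runs (.loop c f) x x (s + x.size + x.size)
  | loop_step (c f : Prog) (x a b y z : Data) (s t r : ℕ) (hc : Runs c x (.cons a b) s)
      (hf : Runs f x y t) (hl : Runs (.loop c f) y z r) :
      Runs (.loop c f) x z (s + t + r + x.size + z.size)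

/-- One program computes `f` on all (encoded) elements of `dom`, in time polynomial in the size of
the encoding of the input. -/
def PolyTimeOn {A B : Type} (encA : A → Data) (encB : B → Data) (dom : A → Prop) (f : A → B) :
    Prop :=
  ∃ (c : Prog) (P : Polynomial ℕ), ∀ a, dom a →
    ∃ t, Runs c (encA a) (encB (f a)) t ∧ t ≤ P.eval (encA a).size

/-! ### Encodings of proofs (numbers are written in binary) -/

def encBool : Bool → Data
  | false => .nil
  | true => .cons .nil .nil

def encList {A : Type} (e : A → Data) : List A → Data
  | [] => .nil
  | a :: r => .cons (e a) (encList e r)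

def encNat (n : ℕ) : Data := encList encBool n.bits

/-- A constructor number (in unary) with the encoded arguments of the constructor. -/
def encTag (k : ℕ) (args : List Data) : Data :=
  .cons (encList encBool (List.replicate k true)) (encList (fun d => d) args)

def encLit (l : Lit) : Data := .cons (encNat l.var) (encBool l.pos)

def encClause (C : Clause) : Data := encList encLit C

def encPrefix (Q : Prefix) : Data :=
  encList (fun e => .cons (encBool (decide (e.1 = Quant.all))) (encNat e.2)) Q

def encPCNF (Φ : PCNF) : Data := .cons (encPrefix Φ.pre) (encList encClause Φ.matrix)

def encQRATStep : QRATStep → Data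
  | .ata Q' C => encTag 0 [encPrefix Q', encClause C]
  | .qrata Q' C l => encTag 1 [encPrefix Q', encClause C, encLit l]
  | .qratu K l => encTag 2 [encClause K, encLit l]
  | .eur K l => encTag 3 [encClause K, encLit l]
  | .del K => encTag 4 [encClause K]
  | .newVars Q' => encTag 5 [encPrefix Q']

def encQRATProof (π : QRATProof) : Data :=
  .cons (encPCNF π.formula) (encList encQRATStep π.steps)

def encQRATSatStep : QRATSatStep → Data
  | .ate K => encTag 0 [encClause K]
  | .qrate K l => encTag 1 [encClause K, encLit l]
  | .add Q' C => encTag 2 [encPrefix Q', encClause C]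
  | .red K l => encTag 3 [encClause K, encLit l]
  | .newVars Q' => encTag 4 [encPrefix Q']

def encQRATSatProof (π : QRATSatProof) : Data :=
  .cons (encPCNF π.formula) (encList encQRATSatStep π.steps)

def encFm : Fm → Data
  | .bot => encTag 0 []
  | .top => encTag 1 []
  | .var x => encTag 2 [encNat x]
  | .neg A => encTag 3 [encFm A]
  | .and A B => encTag 4 [encFm A, encFm B]
  | .or A B => encTag 5 [encFm A, encFm B]
  | .imp A B => encTag 6 [encFm A, encFm B]

def encDPrefix (P : DPrefix) : Data :=
  .cons (encList encNat P.univ)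
    (encList (fun e => .cons (encNat e.1) (encList encNat e.2)) P.exs)

def encDQBF (Ψ : DQBF) : Data := .cons (encDPrefix Ψ.pre) (encList encFm Ψ.matrix)

def encDStep : DStep → Data
  | .ax L => encTag 0 [encFm L]
  | .frege L => encTag 1 [encFm L]
  | .red L u b => encTag 2 [encFm L, encNat u, encBool b]
  | .extAnd v α Y => encTag 3 [encNat v, encList encLit α, encList encLit Y]
  | .extOr v α Y => encTag 4 [encNat v, encList encLit α, encList encLit Y]
  | .newAll u => encTag 5 [encNat u]
  | .newEx x D => encTag 6 [encNat x, encList encNat D]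

def encDProof (π : DProof) : Data :=
  .cons (encDQBF π.formula) (encList encDStep π.steps)

end QBFSim

open QBFSim

namespace QBFSim

/-! ### Polynomial-time functions between encoded types -/

/-! Every QRAT step changes the formula in such a way that a winning strategy for the old formula
can be turned into one for the new formula, and the extension rule can write this change down. For
each stage the simulation keeps a copy `x'` of every existential variable `x`, defined from the
copies of the previous stage, with dependencies inside `D_x`, and it derives the clauses of the
stage for these copies. For a clause `C ∨ l` added by QRATA, a gate `n` says that some outer clause
`O_D` with `l̄ ∈ D` is false, and `l' = l ∨ n̄`. If `C ∨ l'` fails, then `l` fails and unit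
propagation makes all `O_D` true, against `n`; if `l` was switched on by `n̄`, every `D` with `l̄`
holds through `O_D` (`qrata_step`). For the removal of a universal `l`, independent extension `l̄ →
(v ↔ x)` yields variables `v` that no longer depend on `l` and give the value of `x` when `l` is
false. By reduction, all clauses without `l̄` hold for `v` even after `l` is removed from them.
QRATU takes `x` if `n` and `v` otherwise (`qratu_step`). EUR takes one of `x`, `v`, `x ∨ v`, `x ∧
v`, according to which of the literals `x`, `x̄` lie on resolution paths (`eur_step`). The remaining
steps only copy (`copy_step`). The dependency sets stay small enough because outer literals depend
on nothing beyond what the redefined variables may depend on (`depOf_level`, `depOf_level_right`).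
For a true formula the strategy is that of the opponent. Each clause `D` gets a name `c_D ↔ D`, and
the invariant is the disjunction of the literals `c̄_D`: some clause is false. Most steps transfer a
false clause to a false clause (`transfer_step`). QRATE has a literal that is universal in the dual
prefix and is handled by the same switch between `x` and `v` (`qrate_step`). For the empty matrix
the invariant is the empty clause. These arguments are written as scripts of definitions, reductions
and clauses that follow by unit propagation. The propagation claims are checked semantically, on
literal sets closed under propagation (`upRefutes_of`). A propagation becomes a derivation of lines
`l ∨ C` (`rupSteps_derives`), all of whose inferences are instances of finitely many sound rules;
completeness of the Frege system provides one fixed derivation for each of them (`schemaSeq_spec`,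
`inst_derives`), and `compile_correct` assembles the translation. Polynomial time follows from
closure of `PT` under composition, case distinction and list iteration with a size bound
(`PT.foldl_additive`). -/

theorem poly_eval_mono (P : Polynomial ℕ) {m n : ℕ} (h : m ≤ n) : P.eval m ≤ P.eval n := by
  rw [Polynomial.eval_eq_sum_range, Polynomial.eval_eq_sum_range]
  gcongr

theorem Data.one_le_size (d : Data) : 1 ≤ d.size := by
  cases d <;> simp [Data.size]

/-- Every construct pays for the value it returns. This is what allows time bounds to be composed: a
time bound is also a bound on the size of the next input. -/
theorem Runs.output_size_le {c : Prog} {x y : Data} {t : ℕ} (h : Runs c x y t) : y.size ≤ t := by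
  cases h <;> omega

/-- Types with an encoding by binary trees. -/
class Enc (A : Type) where
  enc : A → Data

/-- The size of an encoded value. -/
def esize {A : Type} [Enc A] (a : A) : ℕ := (Enc.enc a).size

/-- Polynomial-time functions on encoded types. -/
@[fun_prop]
def PT {A B : Type} [Enc A] [Enc B] (f : A → B) : Prop :=
  ∃ (c : Prog) (P : Polynomial ℕ), ∀ a,
    ∃ t, Runs c (Enc.enc a) (Enc.enc (f a)) t ∧ t ≤ P.eval (esize a)

instance : Enc Data := ⟨fun d => d⟩
instance : Enc Bool := ⟨encBool⟩
instance : Enc Unit := ⟨fun _ => .nil⟩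
instance {A B : Type} [Enc A] [Enc B] : Enc (A × B) := ⟨fun p => .cons (Enc.enc p.1) (Enc.enc p.2)⟩
instance {A : Type} [Enc A] : Enc (List A) := ⟨encList Enc.enc⟩
instance : Enc ℕ := ⟨encNat⟩

variable {A B C D : Type} [Enc A] [Enc B] [Enc C] [Enc D]

theorem enc_pair (a : A) (b : B) : Enc.enc (a, b) = Data.cons (Enc.enc a) (Enc.enc b) := rfl
theorem enc_nil : Enc.enc ([] : List A) = Data.nil := rfl
theorem enc_cons (a : A) (l : List A) :
    Enc.enc (a :: l) = Data.cons (Enc.enc a) (Enc.enc l) := rfl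
theorem enc_data (d : Data) : Enc.enc d = d := rfl
theorem enc_true : Enc.enc true = Data.cons .nil .nil := rfl
theorem enc_false : Enc.enc false = Data.nil := rfl
theorem esize_pair (a : A) (b : B) : esize (a, b) = esize a + esize b + 1 := rfl
theorem esize_nil : esize ([] : List A) = 1 := rfl
theorem esize_cons (a : A) (l : List A) : esize (a :: l) = esize a + esize l + 1 := rfl
theorem one_le_esize (a : A) : 1 ≤ esize a := Data.one_le_size _

theorem PT.size_bound {f : A → B} (hf : PT f) :
    ∃ P : Polynomial ℕ, ∀ a, esize (f a) ≤ P.eval (esize a) := by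
  obtain ⟨c, P, h⟩ := hf
  refine ⟨P, fun a => ?_⟩
  obtain ⟨t, hr, ht⟩ := h a
  exact hr.output_size_le.trans ht

@[fun_prop]
theorem PT.id : PT (fun a : A => a) :=
  ⟨.id, Polynomial.X + Polynomial.X, fun a => ⟨_, Runs.id _, by simp [esize]⟩⟩

/-- A program for a constant function. -/
def constProg : Data → Prog
  | .nil => .nil
  | .cons a b => .cons (constProg a) (constProg b)

theorem constProg_runs (d : Data) : ∃ P : Polynomial ℕ, ∀ x : Data,
    ∃ t, Runs (constProg d) x d t ∧ t ≤ P.eval x.size := by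
  induction d with
  | nil => exact ⟨Polynomial.X + 1, fun x => ⟨_, Runs.nil x, by simp [Data.size]⟩⟩
  | cons a b iha ihb =>
    obtain ⟨P, hP⟩ := iha
    obtain ⟨Q, hQ⟩ := ihb
    refine ⟨P + Q + Polynomial.X + Polynomial.C (Data.cons a b).size, fun x => ?_⟩
    obtain ⟨s, hs, hs'⟩ := hP x
    obtain ⟨t, ht, ht'⟩ := hQ x
    refine ⟨_, Runs.cons _ _ _ _ _ _ _ hs ht, ?_⟩
    simp
    omega

@[fun_prop]
theorem PT.const (b : B) : PT (fun _ : A => b) := by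
  obtain ⟨P, hP⟩ := constProg_runs (Enc.enc b)
  exact ⟨_, P, fun a => hP _⟩

@[fun_prop]
theorem PT.comp {g : B → C} {f : A → B} (hg : PT g) (hf : PT f) : PT (fun a => g (f a)) := by
  obtain ⟨c, P, hP⟩ := hf
  obtain ⟨d, Q, hQ⟩ := hg
  refine ⟨.seq c d, P + Q.comp P + Polynomial.X + Q.comp P, fun a => ?_⟩
  obtain ⟨s, hs, hs'⟩ := hP a
  obtain ⟨t, ht, ht'⟩ := hQ (f a)
  -- The intermediate value is no larger than the cost of computing it, hence `Q.comp P`.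
  have h1 : t ≤ Q.eval (P.eval (esize a)) :=
    ht'.trans (poly_eval_mono _ (hs.output_size_le.trans hs'))
  have h2 := ht.output_size_le
  refine ⟨_, Runs.seq _ _ _ _ _ _ _ hs ht, ?_⟩
  simp only [Polynomial.eval_add, Polynomial.eval_comp, Polynomial.eval_X]
  simp only [esize] at *
  omega

@[fun_prop]
theorem PT.pair {f : A → B} {g : A → C} (hf : PT f) (hg : PT g) : PT (fun a => (f a, g a)) := by
  obtain ⟨c, P, hP⟩ := hf
  obtain ⟨d, Q, hQ⟩ := hg
  refine ⟨.cons c d, P + Q + Polynomial.X + P + Q + 1, fun a => ?_⟩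
  obtain ⟨s, hs, hs'⟩ := hP a
  obtain ⟨t, ht, ht'⟩ := hQ a
  have h1 := ht.output_size_le
  have h2 := hs.output_size_le
  refine ⟨_, Runs.cons _ _ _ _ _ _ _ hs ht, ?_⟩
  simp only [Polynomial.eval_add, Polynomial.eval_one, Polynomial.eval_X, Data.size]
  simp only [esize] at *
  omega

@[fun_prop]
theorem PT.fst : PT (fun p : A × B => p.1) :=
  ⟨.hd, Polynomial.X + Polynomial.X, fun ⟨a, b⟩ => ⟨_, Runs.hd_cons _ _, by
    simp [esize, enc_pair, Data.size]; omega⟩⟩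

@[fun_prop]
theorem PT.snd : PT (fun p : A × B => p.2) :=
  ⟨.tl, Polynomial.X + Polynomial.X, fun ⟨a, b⟩ => ⟨_, Runs.tl_cons _ _, by
    simp [esize, enc_pair, Data.size]; omega⟩⟩

@[fun_prop]
theorem PT.cond {c : A → Bool} {f g : A → B} (hc : PT c) (hf : PT f) (hg : PT g) :
    PT (fun a => bif c a then f a else g a) := by
  obtain ⟨c, P, hP⟩ := hc
  obtain ⟨d, Q, hQ⟩ := hf
  obtain ⟨e, R, hR⟩ := hg
  refine ⟨.ite c d e, P + Q + Polynomial.X + Q + R + R, fun a => ?_⟩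
  obtain ⟨s, hs, hs'⟩ := hP a
  obtain ⟨t, ht, ht'⟩ := hQ a
  obtain ⟨u, hu, hu'⟩ := hR a
  have h1 := ht.output_size_le
  have h2 := hu.output_size_le
  simp only [Polynomial.eval_add, Polynomial.eval_X]
  simp only [esize] at *
  rename_i c'
  cases h : c' a
  · rw [h] at hs
    refine ⟨_, Runs.ite_false _ _ _ _ _ _ _ hs hu, ?_⟩
    simp only [cond_false]
    omega
  · rw [h] at hs
    refine ⟨_, Runs.ite_true _ _ _ _ _ _ _ _ _ hs ht, ?_⟩
    simp only [cond_true]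
    omega

/-- Functions that agree with a polynomial-time function on the encodings. -/
theorem PT.of_enc {f : A → B} {g : A → C} (hg : PT g) (h : ∀ a, Enc.enc (g a) = Enc.enc (f a)) :
    PT f := by
  obtain ⟨c, P, hP⟩ := hg
  refine ⟨c, P, fun a => ?_⟩
  rw [← h]
  exact hP a

theorem PT.toData : PT (fun a : A => Enc.enc a) := PT.of_enc (PT.id (A := A)) fun _ => rfl

/-- Destructors of encoded types are computed on the bare tree, so no decoding into the source type
is needed. -/
theorem PT.of_raw {f : A → B} (g : Data → Data) (hg : PT g)
    (h : ∀ a, g (Enc.enc a) = Enc.enc (f a)) : PT f :=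
  PT.of_enc (PT.comp hg PT.toData) h

@[fun_prop]
theorem PT.cons {f : A → B} {g : A → List B} (hf : PT f) (hg : PT g) :
    PT (fun a => f a :: g a) :=
  PT.of_enc (PT.pair hf hg) fun _ => rfl

def Data.hd : Data → Data
  | .nil => .nil
  | .cons a _ => a

def Data.tl : Data → Data
  | .nil => .nil
  | .cons _ b => b

def Data.isCons : Data → Bool
  | .nil => false
  | .cons _ _ => true

@[fun_prop]
theorem PT.hd : PT Data.hd :=
  ⟨.hd, Polynomial.X + Polynomial.X, fun d => by
    cases d
    · exact ⟨_, Runs.hd_nil, by simp [esize, enc_data]⟩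
    · exact ⟨_, Runs.hd_cons _ _, by simp [esize, enc_data, Data.size]; omega⟩⟩

@[fun_prop]
theorem PT.tl : PT Data.tl :=
  ⟨.tl, Polynomial.X + Polynomial.X, fun d => by
    cases d
    · exact ⟨_, Runs.tl_nil, by simp [esize, enc_data]⟩
    · exact ⟨_, Runs.tl_cons _ _, by simp [esize, enc_data, Data.size]; omega⟩⟩

@[fun_prop]
theorem PT.isCons : PT Data.isCons :=
  ⟨.ite .id (.cons .nil .nil) .nil, 100 * Polynomial.X + 100, fun d => by
    cases d with
    | nil =>
      refine ⟨_, Runs.ite_false _ _ _ _ _ _ _ (Runs.id _) (Runs.nil _), ?_⟩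
      simp [esize, enc_data, Data.size, Data.isCons, enc_false]
    | cons a b =>
      refine ⟨_, Runs.ite_true _ _ _ _ _ _ _ _ _ (Runs.id _)
        (Runs.cons _ _ _ _ _ _ _ (Runs.nil _) (Runs.nil _)), ?_⟩
      simp [esize, enc_data, Data.size, Data.isCons, enc_true]
      omega⟩

@[fun_prop]
theorem PT.isEmpty {f : A → List B} (hf : PT f) : PT (fun a => (f a).isEmpty) := by
  refine PT.comp (g := List.isEmpty) (PT.of_raw (fun d => Enc.enc (!d.isCons)) ?_ ?_) hf
  · refine PT.comp (g := fun b : Bool => Enc.enc b) PT.toData ?_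
    refine PT.of_enc (g := fun d => bif d.isCons then false else true) (by fun_prop) fun d => ?_
    cases d.isCons <;> rfl
  · intro l
    cases l <;> rfl

@[fun_prop]
theorem PT.tail {f : A → List B} (hf : PT f) : PT (fun a => (f a).tail) :=
  PT.comp (g := List.tail) (PT.of_raw Data.tl PT.tl (by intro l; cases l <;> rfl)) hf

/-! #### Iteration over a list -/

/-- The register holds the parameter, the accumulator and the remaining list, and the loop runs
until that list is a leaf. `N` bounds all registers that occur, each of which consists of the fold
over an initial part and the rest of the list. -/
theorem foldl_loop_runs {f : C → B → A → B} {c : Prog} {P : Polynomial ℕ}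
    (hf : ∀ p : C × (B × A), ∃ t, Runs c (Enc.enc p) (Enc.enc (f p.1 p.2.1 p.2.2)) t ∧
      t ≤ P.eval (esize p)) :
    ∃ (d : Prog) (Q : Polynomial ℕ), ∀ (x : C) (N : ℕ) (l : List A) (b : B),
      (∀ l₁ l₂, l = l₁ ++ l₂ → esize (x, (l₁.foldl (f x) b, l₂)) ≤ N) →
      ∃ t, Runs d (Enc.enc (x, (b, l))) (Enc.enc (x, (l.foldl (f x) b, ([] : List A)))) t ∧
        t ≤ (l.length + 1) * Q.eval N := by
  -- the condition and the body of the loop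
  have hcnd : PT (fun d : Data => d.tl.tl) := by fun_prop
  obtain ⟨cnd, Pc, hcnd⟩ := hcnd
  have harg : PT (fun d : Data => Data.cons d.hd (.cons d.tl.hd d.tl.tl.hd)) :=
    PT.of_enc (g := fun d : Data => (d.hd, (d.tl.hd, d.tl.tl.hd))) (by fun_prop) fun _ => rfl
  obtain ⟨arg, Pa, harg⟩ := harg
  have hrest : PT (fun d : Data => d.tl.tl.tl) := by fun_prop
  obtain ⟨rst, Pr, hrest⟩ := hrest
  let body : Prog := .cons .hd (.cons (.seq arg c) rst)
  -- The last factor bounds the cost of one round. The coefficients are slack: nested constructs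
  -- charge for the same values several times, and all of these are bounded by `N` or by the cost of
  -- a part.
  refine ⟨.loop cnd body, Pc + (Pa + P + 10 * Pr + 10 * P + 20 * Polynomial.X + 100)
    + 3 * Polynomial.X, ?_⟩
  intro x N l
  induction l with
  | nil =>
    intro b hN
    have h0 := hN [] [] rfl
    obtain ⟨s, hs, hs'⟩ := hcnd (Enc.enc (x, (b, ([] : List A))))
    refine ⟨_, Runs.loop_stop _ _ _ _ hs, ?_⟩
    have h1 := hs'.trans (poly_eval_mono Pc h0)
    simp only [List.foldl_nil, esize] at h0
    simp only [Polynomial.eval_add, Polynomial.eval_mul, Polynomial.eval_X, List.length_nil,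
      Polynomial.eval_ofNat]
    omega
  | cons a l ih =>
    intro b hN
    have h0 := hN [] (a :: l) rfl
    have h0' := hN [a] l rfl
    obtain ⟨s, hs, hs'⟩ := hcnd (Enc.enc (x, (b, a :: l)))
    obtain ⟨s1, hs1, hs1'⟩ := harg (Enc.enc (x, (b, a :: l)))
    obtain ⟨s2, hs2, hs2'⟩ := hf (x, (b, a))
    obtain ⟨s3, hs3, hs3'⟩ := hrest (Enc.enc (x, (b, a :: l)))
    obtain ⟨r, hr, hr'⟩ := ih (f x b a) (fun l₁ l₂ h => by
      have := hN (a :: l₁) l₂ (by simp [h])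
      simpa using this)
    have hb : Runs body (Enc.enc (x, (b, a :: l))) (Enc.enc (x, (f x b a, l))) _ :=
      Runs.cons _ _ _ _ _ _ _ (Runs.hd_cons _ _)
        (Runs.cons _ _ _ _ _ _ _ (Runs.seq _ _ _ _ _ _ _ hs1 hs2) hs3)
    refine ⟨_, Runs.loop_step _ _ _ _ _ _ _ _ _ _ hs hb hr, ?_⟩
    have e0 := hs'.trans (poly_eval_mono Pc h0)
    have e1 := hs1'.trans (poly_eval_mono Pa h0)
    have e3 := hs3'.trans (poly_eval_mono Pr h0)
    have e2 : s2 ≤ P.eval N := hs2'.trans (poly_eval_mono P (by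
      simp only [List.foldl_nil, esize_pair, esize_cons] at h0 ⊢; omega))
    have hN' := hr.output_size_le
    have o2 := hs2.output_size_le
    have o3 := hs3.output_size_le
    have hfin := hN (a :: l) [] (by simp)
    simp only [List.foldl_nil, List.foldl_cons, esize, enc_pair, enc_cons, enc_nil, Data.size,
      enc_data, Data.tl] at *
    simp only [Polynomial.eval_add, Polynomial.eval_mul, Polynomial.eval_X, List.length_cons,
      Polynomial.eval_ofNat] at *
    rw [Nat.add_one_mul (l.length + 1)]
    omega

/-- A polynomial number of polynomial-time rounds may still let the accumulator grow exponentially,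
which `hb` excludes. As `hb` speaks of all lists, it also bounds the accumulator after every initial
part, as the loop requires. -/
theorem PT.foldl_aux {f : C → B → A → B} (hf : PT fun p : C × (B × A) => f p.1 p.2.1 p.2.2)
    (hb : ∃ Q : Polynomial ℕ, ∀ x b l,
      esize (List.foldl (f x) b l) ≤ Q.eval (esize x + esize b + esize l)) :
    PT fun p : C × (B × List A) => p.2.2.foldl (f p.1) p.2.1 := by
  obtain ⟨c, P, hf⟩ := hf
  obtain ⟨R, hR⟩ := hb
  obtain ⟨d, Q, hd⟩ := foldl_loop_runs hf
  have hlen : ∀ l : List A, l.length + 1 ≤ esize l := by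
    intro l
    induction l with
    | nil => simp [esize_nil]
    | cons a l ih => simp only [esize_cons, List.length_cons]; have := one_le_esize a; omega
  have happ : ∀ l₁ l₂ : List A, esize l₁ ≤ esize (l₁ ++ l₂) ∧ esize l₂ ≤ esize (l₁ ++ l₂) := by
    intro l₁ l₂
    induction l₁ with
    | nil => have := one_le_esize l₂; simpa [esize_nil]
    | cons a l ih => simp only [List.cons_append, esize_cons]; omega
  have hloop : PT fun p : C × (B × List A) =>
      (p.1, (p.2.2.foldl (f p.1) p.2.1, ([] : List A))) := by
    refine ⟨d, Polynomial.X * Q.comp (Polynomial.X + R + 10), fun ⟨x, b, l⟩ => ?_⟩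
    obtain ⟨t, ht, ht'⟩ := hd x ((Polynomial.X + R + 10).eval (esize (x, (b, l)))) l b (by
      intro l₁ l₂ h
      have h1 := hR x b l₁
      have h2 := happ l₁ l₂
      rw [← h] at h2
      have h3 := h1.trans (poly_eval_mono R (n := esize (x, (b, l))) (by
        simp only [esize_pair]; omega))
      simp only [Polynomial.eval_add, Polynomial.eval_X, Polynomial.eval_ofNat, esize_pair] at *
      omega)
    refine ⟨t, ht, ht'.trans ?_⟩
    have := hlen l
    simp only [Polynomial.eval_mul, Polynomial.eval_X, Polynomial.eval_comp]
    refine Nat.mul_le_mul ?_ le_rfl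
    simp only [esize_pair]; omega
  exact PT.comp (g := fun q : C × (B × List A) => q.2.1) (by fun_prop) hloop

theorem PT.foldl {f : D → B → A → B} {b : D → B} {l : D → List A}
    (hf : PT fun p : D × (B × A) => f p.1 p.2.1 p.2.2) (hb : PT b) (hl : PT l)
    (hs : ∃ Q : Polynomial ℕ, ∀ x b l,
      esize (List.foldl (f x) b l) ≤ Q.eval (esize x + esize b + esize l)) :
    PT fun x => (l x).foldl (f x) (b x) :=
  PT.comp (g := fun p : D × (B × List A) => p.2.2.foldl (f p.1) p.2.1)
    (f := fun x => (x, (b x, l x))) (PT.foldl_aux hf hs) (by fun_prop)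

theorem list_length_le_esize (l : List A) : l.length ≤ esize l := by
  induction l with
  | nil => simp
  | cons a l ih => simp only [esize_cons, List.length_cons]; omega

theorem esize_mem_le {l : List A} {a : A} (h : a ∈ l) : esize a ≤ esize l := by
  induction l with
  | nil => simp at h
  | cons b l ih =>
    rcases List.mem_cons.1 h with rfl | h
    · simp only [esize_cons]; omega
    · have := ih h; simp only [esize_cons]; omega

/-- Iteration of a function that increases the size of the accumulator by an amount that does not
depend on the accumulator. -/
theorem PT.foldl_additive {f : D → B → A → B} {b : D → B} {l : D → List A}
    (hf : PT fun p : D × (B × A) => f p.1 p.2.1 p.2.2) (hb : PT b) (hl : PT l)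
    (hs : ∃ Q : Polynomial ℕ, ∀ x b a, esize (f x b a) ≤ esize b + Q.eval (esize x + esize a)) :
    PT fun x => (l x).foldl (f x) (b x) := by
  refine PT.foldl hf hb hl ?_
  obtain ⟨Q, hQ⟩ := hs
  refine ⟨Polynomial.X + Polynomial.X * Q, fun x b l => ?_⟩
  have key : ∀ (l : List A) (b : B) (N : ℕ), (∀ a ∈ l, esize a ≤ N) →
      esize (List.foldl (f x) b l) ≤ esize b + l.length * Q.eval (esize x + N) := by
    intro l
    induction l with
    | nil => intro b N _; simp
    | cons a l ih =>
      intro b N hN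
      have h1 := ih (f x b a) N fun a' ha' => hN a' (List.mem_cons_of_mem _ ha')
      have h2 := (hQ x b a).trans (Nat.add_le_add_left (poly_eval_mono Q
        (Nat.add_le_add_left (hN a List.mem_cons_self) (esize x))) _)
      simp only [List.foldl_cons, List.length_cons, Nat.add_one_mul]
      omega
  refine (key l b (esize l) fun a ha => esize_mem_le ha).trans ?_
  simp only [Polynomial.eval_add, Polynomial.eval_X, Polynomial.eval_mul]
  refine Nat.add_le_add (by omega) (Nat.mul_le_mul ?_ (poly_eval_mono Q (by omega)))
  have := list_length_le_esize l
  omega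

end QBFSim
namespace QBFSim
variable {A B C D : Type} [Enc A] [Enc B] [Enc C] [Enc D]

/-! ### Polynomial-time list operations -/

theorem esize_append (l m : List A) : esize (l ++ m) + 1 = esize l + esize m := by
  induction l with
  | nil => simp only [List.nil_append, esize_nil]; omega
  | cons a l ih => simp only [List.cons_append, esize_cons]; omega

@[fun_prop]
theorem PT.reverse {l : D → List A} (hl : PT l) : PT fun x => (l x).reverse := by
  have h : PT fun x => (l x).foldl (fun b a => a :: b) [] := by
    refine PT.foldl_additive (f := fun _ b a => a :: b) (by fun_prop) (by fun_prop) hl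
      ⟨Polynomial.X + 1, fun x b a => ?_⟩
    simp only [esize_cons, Polynomial.eval_add, Polynomial.eval_X, Polynomial.eval_one]
    omega
  refine PT.of_enc h fun x => ?_
  congr 1
  simp

@[fun_prop]
theorem PT.append {l m : D → List A} (hl : PT l) (hm : PT m) : PT fun x => l x ++ m x := by
  have h : PT fun x => (l x).reverse.foldl (fun b a => a :: b) (m x) := by
    refine PT.foldl_additive (f := fun _ b a => a :: b) (by fun_prop) (by fun_prop) (by fun_prop)
      ⟨Polynomial.X + 1, fun x b a => ?_⟩
    simp only [esize_cons, Polynomial.eval_add, Polynomial.eval_X, Polynomial.eval_one]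
    omega
  refine PT.of_enc h fun x => ?_
  congr 1
  simp

/-- Structural recursion with an additive size bound. -/
theorem PT.foldr_additive {f : D → A → B → B} {b : D → B} {l : D → List A}
    (hf : PT fun p : D × (A × B) => f p.1 p.2.1 p.2.2) (hb : PT b) (hl : PT l)
    (hs : ∃ Q : Polynomial ℕ, ∀ x a b, esize (f x a b) ≤ esize b + Q.eval (esize x + esize a)) :
    PT fun x => (l x).foldr (f x) (b x) := by
  have h : PT fun x => (l x).reverse.foldl (fun b a => f x a b) (b x) :=
    PT.foldl_additive (f := fun x b a => f x a b)
      (PT.comp (g := fun p : D × (A × B) => f p.1 p.2.1 p.2.2)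
        (f := fun p : D × (B × A) => (p.1, (p.2.2, p.2.1))) hf (by fun_prop)) hb (by fun_prop)
      (by obtain ⟨Q, hQ⟩ := hs; exact ⟨Q, fun x b a => hQ x a b⟩)
  refine PT.of_enc h fun x => ?_
  congr 1
  simp

@[fun_prop]
theorem PT.flatMap {f : D → A → List B} {l : D → List A}
    (hf : PT fun p : D × A => f p.1 p.2) (hl : PT l) : PT fun x => (l x).flatMap (f x) := by
  have h : PT fun x => (l x).foldr (fun a b => f x a ++ b) [] := by
    refine PT.foldr_additive (f := fun x a b => f x a ++ b) ?_ (by fun_prop) hl ?_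
    · have : PT fun p : D × (A × List B) => f p.1 p.2.1 :=
        PT.comp (g := fun p : D × A => f p.1 p.2) (f := fun p : D × (A × List B) => (p.1, p.2.1))
          hf (by fun_prop)
      fun_prop
    · obtain ⟨Q, hQ⟩ := hf.size_bound
      refine ⟨Q.comp (Polynomial.X + 1), fun x a b => ?_⟩
      have := hQ (x, a)
      have h2 := esize_append (f x a) b
      simp only [Polynomial.eval_comp, Polynomial.eval_add, Polynomial.eval_X,
        Polynomial.eval_one, esize_pair] at *
      omega
  refine PT.of_enc h fun x => ?_
  congr 1
  induction l x with
  | nil => rfl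
  | cons a l ih => simp [ih]

@[fun_prop]
theorem PT.map {f : D → A → B} {l : D → List A}
    (hf : PT fun p : D × A => f p.1 p.2) (hl : PT l) : PT fun x => (l x).map (f x) := by
  have h : PT fun x => (l x).flatMap (fun a => [f x a]) := by fun_prop
  refine PT.of_enc h fun x => ?_
  congr 1
  induction l x with
  | nil => rfl
  | cons a l ih => simp [ih]

@[fun_prop]
theorem PT.filter {f : D → A → Bool} {l : D → List A}
    (hf : PT fun p : D × A => f p.1 p.2) (hl : PT l) : PT fun x => (l x).filter (f x) := by
  have h : PT fun x => (l x).flatMap (fun a => bif f x a then [a] else []) := by fun_prop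
  refine PT.of_enc h fun x => ?_
  congr 1
  induction l x with
  | nil => rfl
  | cons a l ih => cases hfa : f x a <;> simp [ih, hfa]

@[fun_prop]
theorem PT.not {f : D → Bool} (hf : PT f) : PT fun x => !f x := by
  refine PT.of_enc (g := fun x => bif f x then false else true) (by fun_prop) fun x => ?_
  cases f x <;> rfl

@[fun_prop]
theorem PT.and {f g : D → Bool} (hf : PT f) (hg : PT g) : PT fun x => f x && g x := by
  refine PT.of_enc (g := fun x => bif f x then g x else false) (by fun_prop) fun x => ?_
  cases f x <;> rfl

@[fun_prop]
theorem PT.or {f g : D → Bool} (hf : PT f) (hg : PT g) : PT fun x => f x || g x := by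
  refine PT.of_enc (g := fun x => bif f x then true else g x) (by fun_prop) fun x => ?_
  cases f x <;> rfl

@[fun_prop]
theorem PT.all {f : D → A → Bool} {l : D → List A}
    (hf : PT fun p : D × A => f p.1 p.2) (hl : PT l) : PT fun x => (l x).all (f x) := by
  refine PT.of_enc (g := fun x => ((l x).filter (fun a => !f x a)).isEmpty) (by fun_prop)
    fun x => ?_
  congr 1
  induction l x with
  | nil => rfl
  | cons a l ih => cases hfa : f x a <;> simp_all

@[fun_prop]
theorem PT.any {f : D → A → Bool} {l : D → List A}
    (hf : PT fun p : D × A => f p.1 p.2) (hl : PT l) : PT fun x => (l x).any (f x) := by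
  refine PT.of_enc (g := fun x => !((l x).filter (f x)).isEmpty) (by fun_prop) fun x => ?_
  congr 1
  induction l x with
  | nil => rfl
  | cons a l ih => cases hfa : f x a <;> simp_all

/-- All suffixes `c :: R`, as pairs `(c, R)`, the longest first. -/
def suffixes {A : Type} : List A → List (A × List A)
  | [] => []
  | c :: R => (c, R) :: suffixes R

theorem suffixes_append {A : Type} (l m : List A) :
    suffixes (l ++ m) = (suffixes l).map (fun p => (p.1, p.2 ++ m)) ++ suffixes m := by
  induction l with
  | nil => rfl
  | cons a l ih => simp [suffixes, ih]

theorem mem_suffixes {A : Type} {l : List A} {p : A × List A} :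
    p ∈ suffixes l ↔ ∃ l₁, l = l₁ ++ p.1 :: p.2 := by
  induction l with
  | nil => simp [suffixes]
  | cons a l ih =>
    simp only [suffixes, List.mem_cons, ih]
    constructor
    · rintro (rfl | ⟨l₁, rfl⟩)
      · exact ⟨[], rfl⟩
      · exact ⟨a :: l₁, rfl⟩
    · rintro ⟨l₁, h⟩
      cases l₁ with
      | nil => simp at h; left; ext1 <;> simp [h]
      | cons b l₁ => simp at h; right; exact ⟨l₁, h.2⟩

-- Only folds are available as recursion. A recursion whose step needs the rest of the list, such as
-- the tail of a clause or the earlier steps of a proof, is written below as a map over `suffixes`.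
-- The accumulator copies a part of itself in each round, so the additive bound does not apply and a
-- quadratic one is proved by hand.
@[fun_prop]
theorem PT.suffixes {l : D → List A} (hl : PT l) : PT fun x => suffixes (l x) := by
  have hstep : ∀ (m R : List A) (out : List (A × List A)),
      m.foldl (fun (b : List A × List (A × List A)) a => (a :: b.1, (a, b.1) :: b.2)) (R, out) =
        (m.reverse ++ R, (QBFSim.suffixes m.reverse).map (fun p => (p.1, p.2 ++ R)) ++ out) := by
    intro m
    induction m with
    | nil => intro R out; simp [QBFSim.suffixes]
    | cons a m ih =>
      intro R out
      simp [ih, suffixes_append, QBFSim.suffixes]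
  have h : PT fun x => ((l x).reverse.foldl (fun (b : List A × List (A × List A)) a =>
      (a :: b.1, (a, b.1) :: b.2)) (([] : List A), ([] : List (A × List A)))).2 := by
    refine PT.comp (g := fun p : List A × List (A × List A) => p.2) (by fun_prop) ?_
    refine PT.foldl (f := fun _ (b : List A × List (A × List A)) a =>
      (a :: b.1, (a, b.1) :: b.2)) (by fun_prop) (by fun_prop) (by fun_prop) ?_
    refine ⟨Polynomial.X + Polynomial.X * (3 * Polynomial.X), fun x b m => ?_⟩
    have hsz : ∀ (m : List A) (R : List A) (out : List (A × List A)),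
        esize (m.foldl (fun (b : List A × List (A × List A)) a => (a :: b.1, (a, b.1) :: b.2))
          (R, out)) ≤ esize (R, out) + m.length * (3 * (esize R + esize m)) := by
      intro m
      induction m with
      | nil => intro R out; simp
      | cons a m ih =>
        intro R out
        have := ih (a :: R) ((a, R) :: out)
        -- An element only moves from the input to the current suffix, so the sum of the two sizes
        -- is constant and bounds every recorded pair.
        have e : esize (a :: R) + esize m = esize R + esize (a :: m) := by
          simp only [esize_cons]; omega
        rw [e] at this
        rw [List.foldl_cons, List.length_cons, Nat.add_one_mul]
        refine this.trans ?_
        generalize m.length * (3 * (esize R + esize (a :: m))) = z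
        simp only [esize_cons, esize_pair]
        omega
    refine (hsz m b.1 b.2).trans ?_
    simp only [Polynomial.eval_add, Polynomial.eval_X, Polynomial.eval_mul, Polynomial.eval_ofNat]
    refine Nat.add_le_add (by show esize b ≤ _; omega) (Nat.mul_le_mul ?_ ?_)
    · have := list_length_le_esize m; omega
    · have : esize b = esize b.1 + esize b.2 + 1 := rfl
      omega
  refine PT.of_enc h fun x => ?_
  rw [hstep]
  simp

/-! #### Decidable equality -/

/-- Types with polynomial-time equality test. -/
class PEq (A : Type) [Enc A] [DecidableEq A] : Prop where
  eq_aux : PT fun p : A × A => decide (p.1 = p.2)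

@[fun_prop]
theorem PT.eq [DecidableEq A] [PEq A] {f g : D → A} (hf : PT f) (hg : PT g) :
    PT fun x => decide (f x = g x) :=
  PT.comp (g := fun p : A × A => decide (p.1 = p.2)) (f := fun x => (f x, g x)) PEq.eq_aux
    (by fun_prop)

@[fun_prop]
theorem PT.ne [DecidableEq A] [PEq A] {f g : D → A} (hf : PT f) (hg : PT g) :
    PT fun x => decide (f x ≠ g x) := by
  refine PT.of_enc (g := fun x => !decide (f x = g x)) (by fun_prop) fun x => ?_
  congr 1
  simp

@[fun_prop]
theorem PT.mem [DecidableEq A] [PEq A] [BEq A] [LawfulBEq A] {f : D → A} {l : D → List A}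
    (hf : PT f) (hl : PT l) :
    PT fun x => @decide (f x ∈ l x) (List.instDecidableMemOfLawfulBEq (f x) (l x)) := by
  refine PT.of_enc (g := fun x => (l x).any fun a => decide (a = f x)) (by fun_prop) fun x => ?_
  congr 1
  by_cases h : f x ∈ l x <;> simp [h]
  intro a ha e
  exact h (e ▸ ha)

@[fun_prop]
theorem PT.not_mem [DecidableEq A] [PEq A] [BEq A] [LawfulBEq A] {f : D → A} {l : D → List A}
    (hf : PT f) (hl : PT l) :
    PT fun x => @decide (f x ∉ l x)
      (@instDecidableNot _ (List.instDecidableMemOfLawfulBEq (f x) (l x))) := by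
  refine PT.of_enc (g := fun x => !decide (f x ∈ l x)) (by fun_prop) fun x => ?_
  congr 1
  simp

instance : PEq Bool where
  eq_aux := by
    refine PT.of_enc (g := fun p : Bool × Bool => bif p.1 then p.2 else !p.2) (by fun_prop)
      fun ⟨a, b⟩ => ?_
    cases a <;> cases b <;> rfl

instance [DecidableEq A] [DecidableEq B] [PEq A] [PEq B] : PEq (A × B) where
  eq_aux := by
    refine PT.of_enc (g := fun p : (A × B) × (A × B) =>
      decide (p.1.1 = p.2.1) && decide (p.1.2 = p.2.2)) (by fun_prop) fun ⟨a, b⟩ => ?_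
    congr 1
    simp [Prod.ext_iff]

/-- The part of the second list that remains after removing the first list as a prefix. -/
def stripStep [DecidableEq A] (b : Bool × List A) (a : A) : Bool × List A :=
  (b.1 && (b.2.take 1).any (fun c => decide (c = a)), b.2.tail)

@[fun_prop]
theorem PT.take_one {l : D → List A} (hl : PT l) : PT fun x => (l x).take 1 := by
  refine PT.comp (g := fun l : List A => l.take 1) (PT.of_raw
    (fun d => bif d.isCons then Data.cons d.hd .nil else .nil) ?_ ?_) hl
  · have : PT fun d : Data => Data.cons d.hd .nil :=
      PT.of_enc (g := fun d : Data => (d.hd, Data.nil)) (by fun_prop) fun _ => rfl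
    fun_prop
  · intro l; cases l <;> rfl

/-- Two lists are equal if stripping the first from the second meets no mismatch and leaves nothing.
If the second list runs out early, `take 1` is empty and `any` reports the mismatch. -/
instance [DecidableEq A] [PEq A] : PEq (List A) where
  eq_aux := by
    have h : PT fun p : List A × List A => p.1.foldl stripStep (true, p.2) := by
      refine PT.foldl_additive (f := fun _ => stripStep) ?_ (by fun_prop) (by fun_prop) ?_
      · unfold stripStep; fun_prop
      · refine ⟨5, fun x b a => ?_⟩
        have h1 : esize (b.1 && (b.2.take 1).any (fun c => decide (c = a))) ≤ 3 := by
          cases (b.1 && (b.2.take 1).any (fun c => decide (c = a))) <;>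
            simp [esize, enc_true, enc_false, Data.size]
        have h2 : esize b.2.tail ≤ esize b.2 := by
          cases b.2 with
          | nil => exact le_rfl
          | cons a l => simp only [List.tail_cons, esize_cons]; omega
        have : esize b = esize b.1 + esize b.2 + 1 := rfl
        simp only [stripStep, esize_pair, Polynomial.eval_ofNat]
        omega
    refine PT.of_enc (g := fun p : List A × List A => (p.1.foldl stripStep (true, p.2)).1 &&
      (p.1.foldl stripStep (true, p.2)).2.isEmpty) (by fun_prop) fun ⟨l, m⟩ => ?_
    congr 1
    have hfalse : ∀ l m : List A, (l.foldl stripStep (false, m)).1 = false := by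
      intro l
      induction l with
      | nil => intro m; rfl
      | cons a l ih => intro m; simpa [stripStep] using ih _
    simp only
    induction l generalizing m with
    | nil => cases m <;> simp
    | cons a l ih =>
      cases m with
      | nil => simp [stripStep, hfalse]
      | cons b m =>
        by_cases hab : b = a
        · subst hab
          have := ih m
          simpa [stripStep] using this
        · have hba : ¬ a = b := fun h => hab h.symm
          simp [stripStep, hab, hba, hfalse]

@[fun_prop]
theorem PT.bits {f : D → ℕ} (hf : PT f) : PT fun x => (f x).bits :=
  PT.of_enc hf fun _ => rfl

theorem PT.of_bits {f : D → ℕ} (hf : PT fun x => (f x).bits) : PT f :=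
  PT.of_enc hf fun _ => rfl

/-- The number with the given binary digits, the least significant one first. -/
def ofBitList (l : List Bool) : ℕ := l.foldr Nat.bit 0

theorem ofBitList_bits (n : ℕ) : ofBitList n.bits = n := by
  induction n using Nat.binaryRec' with
  | zero => simp [ofBitList]
  | bit b n h ih =>
    rw [Nat.bits_append_bit n b h]
    exact congrArg (Nat.bit b) ih

theorem bits_injective : Function.Injective Nat.bits :=
  Function.LeftInverse.injective ofBitList_bits

/-- Not every list of bits is a binary expansion; those ending in `true` are. The closing `true`
thus lets arbitrary data be stored injectively in a number. -/
theorem bits_ofBitList (l : List Bool) :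
    (ofBitList (l ++ [true])).bits = l ++ [true] ∧ ofBitList (l ++ [true]) ≠ 0 := by
  induction l with
  | nil => simp [ofBitList, Nat.bit]
  | cons b l ih =>
    have h : ofBitList (b :: l ++ [true]) = Nat.bit b (ofBitList (l ++ [true])) := rfl
    rw [h, Nat.bits_append_bit _ _ fun h0 => absurd h0 ih.2, ih.1]
    refine ⟨rfl, fun h0 => ih.2 ?_⟩
    exact (Nat.bit_eq_zero_iff.1 h0).1

instance : PEq ℕ where
  eq_aux := by
    refine PT.of_enc (g := fun p : ℕ × ℕ => decide (p.1.bits = p.2.bits)) (by fun_prop)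
      fun ⟨a, b⟩ => ?_
    congr 1
    simp [bits_injective.eq_iff]

-- The Boolean in the accumulator records whether the first occurrence has already been dropped.
@[fun_prop]
theorem PT.erase [DecidableEq A] [PEq A] [BEq A] [LawfulBEq A] {f : D → A} {l : D → List A}
    (hf : PT f) (hl : PT l) :
    PT fun x => (l x).erase (f x) := by
  have hstep : ∀ (k : A) (l : List A) (b : Bool) (out : List A),
      (l.foldl (fun (b : Bool × List A) a =>
        bif b.1 || decide (a ≠ k) then (b.1, a :: b.2) else (true, b.2)) (b, out)).2.reverse =
      out.reverse ++ (bif b then l else l.erase k) := by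
    intro k l
    induction l with
    | nil => intro b out; cases b <;> simp
    | cons a l ih =>
      intro b out
      rw [List.foldl_cons]
      cases b
      · by_cases hak : a = k
        · subst hak
          simpa using ih true out
        · simpa [hak] using ih false (a :: out)
      · simpa using ih true (a :: out)
  have h : PT fun x => ((l x).foldl (fun (b : Bool × List A) a =>
      bif b.1 || decide (a ≠ f x) then (b.1, a :: b.2) else (true, b.2))
        (false, ([] : List A))).2.reverse := by
    refine PT.reverse (PT.comp (g := fun p : Bool × List A => p.2) (by fun_prop) ?_)
    refine PT.foldl_additive (f := fun x (b : Bool × List A) a =>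
      bif b.1 || decide (a ≠ f x) then (b.1, a :: b.2) else (true, b.2)) (by fun_prop)
      (by fun_prop) hl ?_
    refine ⟨Polynomial.X + 10, fun x b a => ?_⟩
    have : esize b = esize b.1 + esize b.2 + 1 := rfl
    have h3 : esize true = 3 := rfl
    have h4 := one_le_esize b.1
    simp only [Polynomial.eval_add, Polynomial.eval_X, Polynomial.eval_ofNat]
    cases (b.1 || decide (a ≠ f x)) <;> simp only [cond_true, cond_false, esize_pair, esize_cons] <;>
      omega
  refine PT.of_enc h fun x => ?_
  rw [hstep]
  rfl

end QBFSim
namespace QBFSim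
variable {A B C D : Type} [Enc A] [Enc B] [Enc C] [Enc D]

/-! #### Encodings of literals, prefixes, formulas, and proof steps -/

instance : Enc Lit := ⟨encLit⟩
instance : Enc Quant := ⟨fun q => encBool (decide (q = Quant.all))⟩
instance : Enc PCNF := ⟨encPCNF⟩
instance : Enc QRATStep := ⟨encQRATStep⟩
instance : Enc QRATProof := ⟨encQRATProof⟩
instance : Enc QRATSatStep := ⟨encQRATSatStep⟩
instance : Enc QRATSatProof := ⟨encQRATSatProof⟩
instance : Enc Fm := ⟨encFm⟩
instance : Enc DPrefix := ⟨encDPrefix⟩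
instance : Enc DQBF := ⟨encDQBF⟩
instance : Enc DStep := ⟨encDStep⟩
instance : Enc DProof := ⟨encDProof⟩

@[fun_prop]
theorem PT.lit_var {f : A → Lit} (hf : PT f) : PT fun a => (f a).var :=
  PT.comp (g := Lit.var) (PT.of_raw Data.hd PT.hd fun _ => rfl) hf

@[fun_prop]
theorem PT.lit_pos {f : A → Lit} (hf : PT f) : PT fun a => (f a).pos :=
  PT.comp (g := Lit.pos) (PT.of_raw Data.tl PT.tl fun _ => rfl) hf

@[fun_prop]
theorem PT.lit_mk {f : A → ℕ} {g : A → Bool} (hf : PT f) (hg : PT g) :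
    PT fun a => Lit.mk (f a) (g a) :=
  PT.of_enc (PT.pair hf hg) fun _ => rfl

@[fun_prop]
theorem PT.lit_neg {f : A → Lit} (hf : PT f) : PT fun a => (f a).neg := by
  unfold Lit.neg
  fun_prop

instance : PEq Lit where
  eq_aux := by
    refine PT.of_enc (g := fun p : Lit × Lit =>
      decide (p.1.var = p.2.var) && decide (p.1.pos = p.2.pos)) (by fun_prop) fun ⟨a, b⟩ => ?_
    cases a; cases b
    congr 1
    simp

@[fun_prop]
theorem PT.isAll {f : A → Quant} (hf : PT f) : PT fun a => decide (f a = Quant.all) :=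
  PT.of_enc hf fun _ => rfl

instance : PEq Quant where
  eq_aux := by
    refine PT.of_enc (g := fun p : Quant × Quant =>
      decide (decide (p.1 = Quant.all) = decide (p.2 = Quant.all))) (by fun_prop) fun ⟨a, b⟩ => ?_
    cases a <;> cases b <;> rfl

@[fun_prop]
theorem PT.flip {f : A → Quant} (hf : PT f) : PT fun a => (f a).flip := by
  refine PT.of_enc (g := fun a => bif decide (f a = Quant.all) then Quant.ex else Quant.all)
    (by fun_prop) fun a => ?_
  cases f a <;> rfl

@[fun_prop]
theorem PT.pcnf_pre {f : A → PCNF} (hf : PT f) : PT fun a => (f a).pre :=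
  PT.comp (g := PCNF.pre) (PT.of_raw Data.hd PT.hd fun _ => rfl) hf

@[fun_prop]
theorem PT.pcnf_matrix {f : A → PCNF} (hf : PT f) : PT fun a => (f a).matrix :=
  PT.comp (g := PCNF.matrix) (PT.of_raw Data.tl PT.tl fun _ => rfl) hf

@[fun_prop]
theorem PT.pcnf_mk {f : A → Prefix} {g : A → CNF} (hf : PT f) (hg : PT g) :
    PT fun a => PCNF.mk (f a) (g a) :=
  PT.of_enc (PT.pair hf hg) fun _ => rfl

@[fun_prop]
theorem PT.qrat_formula {f : A → QRATProof} (hf : PT f) : PT fun a => (f a).formula :=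
  PT.comp (g := QRATProof.formula) (PT.of_raw Data.hd PT.hd fun _ => rfl) hf

@[fun_prop]
theorem PT.qrat_steps {f : A → QRATProof} (hf : PT f) : PT fun a => (f a).steps :=
  PT.comp (g := QRATProof.steps) (PT.of_raw Data.tl PT.tl fun _ => rfl) hf

@[fun_prop]
theorem PT.qratSat_formula {f : A → QRATSatProof} (hf : PT f) : PT fun a => (f a).formula :=
  PT.comp (g := QRATSatProof.formula) (PT.of_raw Data.hd PT.hd fun _ => rfl) hf

@[fun_prop]
theorem PT.qratSat_steps {f : A → QRATSatProof} (hf : PT f) : PT fun a => (f a).steps :=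
  PT.comp (g := QRATSatProof.steps) (PT.of_raw Data.tl PT.tl fun _ => rfl) hf

@[fun_prop]
theorem PT.dprefix_mk {f : A → List ℕ} {g : A → List (ℕ × List ℕ)} (hf : PT f) (hg : PT g) :
    PT fun a => DPrefix.mk (f a) (g a) :=
  PT.of_enc (PT.pair hf hg) fun _ => rfl

@[fun_prop]
theorem PT.dqbf_mk {f : A → DPrefix} {g : A → List Fm} (hf : PT f) (hg : PT g) :
    PT fun a => DQBF.mk (f a) (g a) :=
  PT.of_enc (PT.pair hf hg) fun _ => rfl

@[fun_prop]
theorem PT.dproof_mk {f : A → DQBF} {g : A → List DStep} (hf : PT f) (hg : PT g) :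
    PT fun a => DProof.mk (f a) (g a) :=
  PT.of_enc (PT.pair hf hg) fun _ => rfl

/-- The encoding of a constructor number. -/
def tagData (k : ℕ) : Data := encList encBool (List.replicate k true)

-- `encTag` unfolds to a right-nested tuple that begins with `tagData` and ends in a leaf, the code
-- of `()`. So constructors of tagged types are pairings, here and in the lemmas below.
@[fun_prop]
theorem PT.fm_var {f : A → ℕ} (hf : PT f) : PT fun a => Fm.var (f a) :=
  PT.of_enc (g := fun a => (tagData 2, (f a, ()))) (by fun_prop) fun _ => rfl

@[fun_prop]
theorem PT.fm_neg {f : A → Fm} (hf : PT f) : PT fun a => Fm.neg (f a) :=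
  PT.of_enc (g := fun a => (tagData 3, (f a, ()))) (by fun_prop) fun _ => rfl

@[fun_prop]
theorem PT.fm_and {f g : A → Fm} (hf : PT f) (hg : PT g) : PT fun a => Fm.and (f a) (g a) :=
  PT.of_enc (g := fun a => (tagData 4, (f a, (g a, ())))) (by fun_prop) fun _ => rfl

@[fun_prop]
theorem PT.fm_or {f g : A → Fm} (hf : PT f) (hg : PT g) : PT fun a => Fm.or (f a) (g a) :=
  PT.of_enc (g := fun a => (tagData 5, (f a, (g a, ())))) (by fun_prop) fun _ => rfl

@[fun_prop]
theorem PT.fm_imp {f g : A → Fm} (hf : PT f) (hg : PT g) : PT fun a => Fm.imp (f a) (g a) :=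
  PT.of_enc (g := fun a => (tagData 6, (f a, (g a, ())))) (by fun_prop) fun _ => rfl

@[fun_prop]
theorem PT.dstep_ax {f : A → Fm} (hf : PT f) : PT fun a => DStep.ax (f a) :=
  PT.of_enc (g := fun a => (tagData 0, (f a, ()))) (by fun_prop) fun _ => rfl

@[fun_prop]
theorem PT.dstep_frege {f : A → Fm} (hf : PT f) : PT fun a => DStep.frege (f a) :=
  PT.of_enc (g := fun a => (tagData 1, (f a, ()))) (by fun_prop) fun _ => rfl

@[fun_prop]
theorem PT.dstep_red {f : A → Fm} {u : A → ℕ} {b : A → Bool} (hf : PT f) (hu : PT u)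
    (hb : PT b) : PT fun a => DStep.red (f a) (u a) (b a) :=
  PT.of_enc (g := fun a => (tagData 2, (f a, (u a, (b a, ()))))) (by fun_prop) fun _ => rfl

@[fun_prop]
theorem PT.dstep_extOr {v : A → ℕ} {α Y : A → List Lit} (hv : PT v) (hα : PT α)
    (hY : PT Y) : PT fun a => DStep.extOr (v a) (α a) (Y a) :=
  PT.of_enc (g := fun a => (tagData 4, (v a, (α a, (Y a, ()))))) (by fun_prop) fun _ => rfl

@[fun_prop]
theorem PT.dstep_newAll {u : A → ℕ} (hu : PT u) : PT fun a => DStep.newAll (u a) :=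
  PT.of_enc (g := fun a => (tagData 5, (u a, ()))) (by fun_prop) fun _ => rfl

@[fun_prop]
theorem PT.dstep_newEx {x : A → ℕ} {d : A → List ℕ} (hx : PT x) (hd : PT d) :
    PT fun a => DStep.newEx (x a) (d a) :=
  PT.of_enc (g := fun a => (tagData 6, (x a, (d a, ())))) (by fun_prop) fun _ => rfl

@[fun_prop]
theorem PT.lit_toFm {f : A → Lit} (hf : PT f) : PT fun a => (f a).toFm := by
  refine PT.of_enc (g := fun a => bif (f a).pos then Fm.var (f a).var
    else .neg (.var (f a).var)) (by fun_prop) fun a => ?_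
  unfold Lit.toFm
  cases (f a).pos <;> rfl

theorem esize_fm_or (a b : Fm) : esize (Fm.or a b) = esize a + esize b + 25 := by
  simp [esize, Enc.enc, encFm, encTag, encList, encBool, Data.size, List.replicate]
  omega

theorem esize_fm_and (a b : Fm) : esize (Fm.and a b) = esize a + esize b + 21 := by
  simp [esize, Enc.enc, encFm, encTag, encList, encBool, Data.size, List.replicate]
  omega

@[fun_prop]
theorem PT.bigOr {f : A → List Fm} (hf : PT f) : PT fun a => bigOr (f a) := by
  refine PT.of_enc (g := fun a => (f a).foldr Fm.or .bot) ?_ fun a => ?_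
  · refine PT.foldr_additive (f := fun _ => Fm.or) (by fun_prop) (by fun_prop) hf
      ⟨Polynomial.X + 100, fun x a b => ?_⟩
    simp only [esize_fm_or, Polynomial.eval_add, Polynomial.eval_X, Polynomial.eval_ofNat]
    omega
  · congr 1
    induction f a with
    | nil => rfl
    | cons a l ih => simp [QBFSim.bigOr, ih]

@[fun_prop]
theorem PT.bigAnd {f : A → List Fm} (hf : PT f) : PT fun a => bigAnd (f a) := by
  refine PT.of_enc (g := fun a => (f a).foldr Fm.and .top) ?_ fun a => ?_
  · refine PT.foldr_additive (f := fun _ => Fm.and) (by fun_prop) (by fun_prop) hf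
      ⟨Polynomial.X + 100, fun x a b => ?_⟩
    simp only [esize_fm_and, Polynomial.eval_add, Polynomial.eval_X, Polynomial.eval_ofNat]
    omega
  · congr 1
    induction f a with
    | nil => rfl
    | cons a l ih => simp [QBFSim.bigAnd, ih]

@[fun_prop]
theorem PT.clause_toFm {f : A → List Lit} (hf : PT f) : PT fun a => Clause.toFm (f a) := by
  unfold Clause.toFm
  fun_prop

@[fun_prop]
theorem PT.without {f : A → List Lit} {l : A → Lit} (hf : PT f) (hl : PT l) :
    PT fun a => Clause.without (f a) (l a) := by
  unfold Clause.without
  fun_prop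

/-- A fixed formula, instantiated with varying formulas. -/
theorem PT.fm_subst (F : Fm) {σ : A → ℕ → Fm} (hσ : ∀ n, PT fun a => σ a n) :
    PT fun a => F.subst (σ a) := by
  induction F with
  | bot => exact PT.const _
  | top => exact PT.const _
  | var x => exact hσ x
  | neg F ih => simp only [Fm.subst]; fun_prop
  | and F G ih1 ih2 => simp only [Fm.subst]; fun_prop
  | or F G ih1 ih2 => simp only [Fm.subst]; fun_prop
  | imp F G ih1 ih2 => simp only [Fm.subst]; fun_prop

/-- The substitution that replaces the first variables by the formulas of a list, and all other
variables by `1`. -/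
def argSubst (args : List Fm) (n : ℕ) : Fm := args.getD n .top

theorem PT.argSubst {args : A → List Fm} (h : PT args) (n : ℕ) :
    PT fun a => argSubst (args a) n := by
  induction n generalizing args with
  | zero =>
    refine PT.comp (g := fun l : List Fm => QBFSim.argSubst l 0) (PT.of_raw
      (fun d => bif d.isCons then d.hd else Enc.enc Fm.top) (by fun_prop) ?_) h
    intro l; cases l <;> rfl
  | succ n ih =>
    refine PT.of_enc (ih (args := fun a => (args a).tail) (by fun_prop)) fun a => ?_
    congr 1
    cases args a <;> rfl

end QBFSim
namespace QBFSim

/-! ### Derivations of fixed schemas -/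

/-- A list of formulas, each inferred from `Γ` and the formulas before it. -/
def FregeSeq (R : List FregeRule) : List Fm → List Fm → Prop
  | _, [] => True
  | Γ, L :: ds => FregeInfers R Γ L ∧ FregeSeq R (L :: Γ) ds

theorem FregeInfers.mono {R : List FregeRule} {Γ Δ : List Fm} {L : Fm} (h : FregeInfers R Γ L)
    (hs : Γ ⊆ Δ) : FregeInfers R Δ L := by
  obtain ⟨r, hr, σ, hp, e⟩ := h
  exact ⟨r, hr, σ, fun P hP => hs (hp P hP), e⟩

theorem FregeSeq.mono {R : List FregeRule} {ds : List Fm} : ∀ {Γ Δ : List Fm},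
    FregeSeq R Γ ds → Γ ⊆ Δ → FregeSeq R Δ ds := by
  induction ds with
  | nil => intro _ _ _ _; trivial
  | cons L ds ih =>
    intro Γ Δ h hs
    exact ⟨h.1.mono hs, ih h.2 (List.cons_subset_cons L hs)⟩

theorem FregeSeq.append {R : List FregeRule} {ds es : List Fm} : ∀ {Γ : List Fm},
    FregeSeq R Γ ds → FregeSeq R (ds ++ Γ) es → FregeSeq R Γ (ds ++ es) := by
  induction ds with
  | nil => intro _ _ h; exact h
  | cons L ds ih =>
    intro Γ h he
    refine ⟨h.1, ih h.2 (he.mono ?_)⟩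
    intro x hx
    simp only [List.cons_append, List.mem_cons, List.mem_append] at hx ⊢
    tauto

/-- A derivation tree is linearized premise by premise. The length is irrelevant, as this is only
applied to fixed rules. -/
theorem FregeDerives.exists_seq {R : List FregeRule} {Γ : List Fm} {A : Fm}
    (h : FregeDerives R Γ A) : ∃ ds, FregeSeq R Γ ds ∧ A ∈ ds ++ Γ := by
  induction h with
  | hyp A h => exact ⟨[], trivial, h⟩
  | rule r σ hr _ ih =>
    have key : ∀ ps : List Fm, (∀ P ∈ ps, ∃ ds, FregeSeq R Γ ds ∧ P.subst σ ∈ ds ++ Γ) →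
        ∃ ds, FregeSeq R Γ ds ∧ ∀ P ∈ ps, P.subst σ ∈ ds ++ Γ := by
      intro ps
      induction ps with
      | nil => intro _; exact ⟨[], trivial, by simp⟩
      | cons P ps ihp =>
        intro h
        obtain ⟨ds, h1, h2⟩ := h P List.mem_cons_self
        obtain ⟨es, h3, h4⟩ := ihp fun Q hQ => h Q (List.mem_cons_of_mem _ hQ)
        refine ⟨ds ++ es, h1.append (h3.mono (List.subset_append_right _ _)), ?_⟩
        intro Q hQ
        rcases List.mem_cons.1 hQ with rfl | hQ
        · simp only [List.mem_append] at h2 ⊢; tauto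
        · have := h4 Q hQ
          simp only [List.mem_append] at this ⊢; tauto
    obtain ⟨ds, h1, h2⟩ := key r.prems ih
    exact ⟨ds ++ [r.concl.subst σ],
      h1.append ⟨⟨r, hr, σ, fun P hP => by simpa using h2 P hP, rfl⟩, trivial⟩, by simp⟩

theorem Fm.subst_subst (A : Fm) (σ τ : ℕ → Fm) :
    (A.subst σ).subst τ = A.subst fun n => (σ n).subst τ := by
  induction A <;> simp_all [Fm.subst]

theorem Fm.mem_vars_subst {A : Fm} {σ : ℕ → Fm} {x : ℕ} (h : x ∈ (A.subst σ).vars) :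
    ∃ n, x ∈ (σ n).vars := by
  induction A with
  | bot => simp [Fm.subst, Fm.vars] at h
  | top => simp [Fm.subst, Fm.vars] at h
  | var n => exact ⟨n, h⟩
  | neg A ih => exact ih h
  | and A B ih1 ih2 => exact (List.mem_append.1 h).elim ih1 ih2
  | or A B ih1 ih2 => exact (List.mem_append.1 h).elim ih1 ih2
  | imp A B ih1 ih2 => exact (List.mem_append.1 h).elim ih1 ih2

/-- A fixed derivation of a sound rule in the given Frege system. -/
noncomputable def schemaSeq (F : FregeSystem) (r : FregeRule) : List Fm :=
  open Classical in
  if h : ∃ ds, FregeSeq F.rules r.prems ds ∧ r.concl ∈ ds ++ r.prems then h.choose else []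

/-- Here the arbitrary Frege system enters. The choice is made once for each of the finitely many
rules used below, so the chosen sequence is a constant of the translating program, and neither its
length nor the way to find it affects the running time. -/
theorem schemaSeq_spec (F : FregeSystem) {r : FregeRule} (h : Entails r.prems r.concl) :
    FregeSeq F.rules r.prems (schemaSeq F r) ∧ r.concl ∈ schemaSeq F r ++ r.prems := by
  have h' := (F.complete _ _ h).exists_seq
  unfold schemaSeq
  rw [dif_pos h']
  exact h'.choose_spec

/-- The derivation of an instance of a sound rule. -/
noncomputable def inst (F : FregeSystem) (r : FregeRule) (args : List Fm) : List DStep :=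
  (schemaSeq F r).map fun A => .frege (A.subst (argSubst args))

section
variable {A : Type} [Enc A]

@[fun_prop]
theorem PT.inst (F : FregeSystem) (r : FregeRule) {args : A → List Fm} (h : PT args) :
    PT fun a => inst F r (args a) := by
  unfold QBFSim.inst
  induction schemaSeq F r with
  | nil => exact PT.const _
  | cons L ds ih =>
    simp only [List.map_cons]
    have := PT.fm_subst L (σ := fun a => QBFSim.argSubst (args a)) (PT.argSubst h)
    fun_prop

end

/-! ### Correct sequences of steps -/

/-- The steps are correct, and the resulting state has the property `P`. -/
def DTr (F : FregeSystem) (M : List Fm) (s : DState) (steps : List DStep)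
    (P : DState → Prop) : Prop :=
  DStep.AllOk F M s steps ∧ P (steps.foldl DStep.apply s)

variable {F : FregeSystem} {M : List Fm} {s : DState}

theorem DTr.nil {P : DState → Prop} (h : P s) : DTr F M s [] P := ⟨trivial, h⟩

theorem DTr.append {a b : List DStep} {P Q : DState → Prop} (h : DTr F M s a P)
    (h' : ∀ s', P s' → DTr F M s' b Q) : DTr F M s (a ++ b) Q := by
  induction a generalizing s with
  | nil => exact h' _ h.2
  | cons x a ih =>
    have := ih (s := x.apply s) ⟨h.1.2, h.2⟩
    exact ⟨⟨h.1.1, this.1⟩, this.2⟩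

theorem DTr.cons {x : DStep} {b : List DStep} {Q : DState → Prop} (hx : x.Ok F M s)
    (h' : DTr F M (x.apply s) b Q) : DTr F M s (x :: b) Q :=
  ⟨⟨hx, h'.1⟩, h'.2⟩

theorem DTr.mono {a : List DStep} {P Q : DState → Prop} (h : DTr F M s a P)
    (h' : ∀ s', P s' → Q s') : DTr F M s a Q :=
  ⟨h.1, h' _ h.2⟩

/-- `s'` has the prefix of `s`, its lines, and the lines in `G`. -/
def Grow (s : DState) (G : Set Fm) (s' : DState) : Prop :=
  s'.pre = s.pre ∧ s.lines ⊆ s'.lines ∧ ∀ A ∈ G, A ∈ s'.lines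

theorem Grow.refl (s : DState) : Grow s ∅ s := ⟨rfl, fun _ h => h, by simp⟩

theorem Grow.trans {s₁ s₂ s₃ : DState} {G H : Set Fm} (h : Grow s₁ G s₂) (h' : Grow s₂ H s₃) :
    Grow s₁ (G ∪ H) s₃ :=
  ⟨h'.1.trans h.1, fun _ hx => h'.2.1 (h.2.1 hx), fun A hA =>
    hA.elim (fun hA => h'.2.1 (h.2.2 A hA)) (h'.2.2 A)⟩

theorem Grow.sub {s₁ s₂ : DState} {G H : Set Fm} (h : Grow s₁ G s₂) (hs : H ⊆ G) :
    Grow s₁ H s₂ :=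
  ⟨h.1, h.2.1, fun A hA => h.2.2 A (hs hA)⟩

theorem DTr.grow_append {a b : List DStep} {G H : Set Fm} (h : DTr F M s a (Grow s G))
    (h' : ∀ s', Grow s G s' → DTr F M s' b (Grow s' H)) :
    DTr F M s (a ++ b) (Grow s (G ∪ H)) :=
  h.append fun s' hs' => (h' s' hs').mono fun _ hs'' => hs'.trans hs''

theorem DTr.grow_append_right {a b : List DStep} {G H : Set Fm} (h : DTr F M s a (Grow s G))
    (h' : ∀ s', Grow s G s' → DTr F M s' b (Grow s' H)) :
    DTr F M s (a ++ b) (Grow s H) :=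
  (h.grow_append h').mono fun _ hs => hs.sub Set.subset_union_right

theorem DTr.grow_flatMap {α : Type} {f : α → List DStep} {G : α → Set Fm} (l : List α)
    (h : ∀ x ∈ l, ∀ s', Grow s ∅ s' → DTr F M s' (f x) (Grow s' (G x))) :
    DTr F M s (l.flatMap f) (Grow s {A | ∃ x ∈ l, A ∈ G x}) := by
  induction l generalizing s with
  | nil => exact DTr.nil ((Grow.refl s).sub (by simp))
  | cons x l ih =>
    rw [List.flatMap_cons]
    refine ((h x List.mem_cons_self s (Grow.refl s)).grow_append fun s' hs' =>
      ih fun y hy s'' hs'' => h y (List.mem_cons_of_mem _ hy) s'' ?_).mono fun s' hs' => hs'.sub ?_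
    · exact (hs'.trans hs'').sub (by simp)
    · rintro A ⟨y, hy, hA⟩
      rcases List.mem_cons.1 hy with rfl | hy
      · exact Or.inl hA
      · exact Or.inr ⟨y, hy, hA⟩

/-- All variables of the formula are in the prefix. -/
def VarsIn (P : DPrefix) (A : Fm) : Prop := ∀ x ∈ A.vars, x ∈ P.names

/-- Rules are schematic, so applying one substitution to all lines of the fixed derivation keeps
every inference correct; the two substitutions compose. -/
theorem inst_derives {r : FregeRule} (hr : Entails r.prems r.concl) {args : List Fm}
    (hv : ∀ A ∈ args, VarsIn s.pre A)
    (hp : ∀ P ∈ r.prems, P.subst (argSubst args) ∈ s.lines) :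
    DTr F M s (inst F r args) (Grow s {r.concl.subst (argSubst args)}) := by
  obtain ⟨h1, h2⟩ := schemaSeq_spec F hr
  have key : ∀ (ds Γ : List Fm) (s' : DState), s'.pre = s.pre → FregeSeq F.rules Γ ds →
      (∀ P ∈ Γ, P.subst (argSubst args) ∈ s'.lines) →
      DTr F M s' (ds.map fun A => .frege (A.subst (argSubst args)))
        (Grow s' {L | ∃ A ∈ ds, L = A.subst (argSubst args)}) := by
    intro ds
    induction ds with
    | nil => intro Γ s' _ _ _; exact DTr.nil ((Grow.refl _).sub (by simp))
    | cons L ds ih =>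
      intro Γ s' hs' hseq hΓ
      have h3 := ih (L :: Γ) (DStep.apply s' (.frege (L.subst (argSubst args)))) hs' hseq.2 (by
        intro P hP
        rcases List.mem_cons.1 hP with rfl | hP
        · exact List.mem_cons_self
        · exact List.mem_cons_of_mem _ (hΓ P hP))
      refine DTr.cons ⟨?_, ?_⟩ (h3.mono fun s'' hs'' => ?_)
      · intro x hx
        obtain ⟨n, hn⟩ := Fm.mem_vars_subst hx
        rw [hs']
        -- Schema variables beyond `args` are replaced by `.top`, which brings in no variables
        -- outside the prefix.
        by_cases hlt : n < args.length
        · refine hv _ (List.getElem_mem hlt) x ?_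
          simpa [argSubst, List.getD, hlt] using hn
        · simp [argSubst, List.getD, hlt, Fm.vars] at hn
      · obtain ⟨r', hr', σ, hσ, e⟩ := hseq.1
        refine ⟨r', hr', fun n => (σ n).subst (argSubst args), fun P hP => ?_, ?_⟩
        · rw [← Fm.subst_subst]; exact hΓ _ (hσ P hP)
        · rw [e, Fm.subst_subst]
      · refine ⟨hs''.1, fun x hx => hs''.2.1 (List.mem_cons_of_mem _ hx), ?_⟩
        rintro A ⟨B, hB, rfl⟩
        rcases List.mem_cons.1 hB with rfl | hB
        · exact hs''.2.1 List.mem_cons_self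
        · exact hs''.2.2 _ ⟨B, hB, rfl⟩
  refine (key _ _ s rfl h1 hp).mono fun s' hs' => ⟨hs'.1, hs'.2.1, ?_⟩
  rintro A rfl
  rcases List.mem_append.1 h2 with h2 | h2
  · exact hs'.2.2 _ ⟨_, h2, rfl⟩
  · exact hs'.2.1 (hp _ h2)

end QBFSim
namespace QBFSim
variable {F : FregeSystem} {M : List Fm} {s : DState}

/-! ### Clausal derivations -/

theorem Lit.neg_neg (l : Lit) : l.neg.neg = l := by
  cases l; simp [Lit.neg]

theorem Lit.neg_var (l : Lit) : l.neg.var = l.var := rfl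

/-- The scheme of a literal in the first variable. -/
def litPat (b : Bool) : Fm := if b then .var 0 else .neg (.var 0)

theorem litPat_subst (l : Lit) (args : List Fm) :
    (litPat l.pos).subst (argSubst (.var l.var :: args)) = l.toFm := by
  unfold litPat Lit.toFm
  cases l.pos <;> rfl

theorem litPat_not_subst (l : Lit) (args : List Fm) :
    (litPat (!l.pos)).subst (argSubst (.var l.var :: args)) = l.neg.toFm :=
  litPat_subst l.neg args

/-- All variables of the clause are in the prefix. -/
def ClauseIn (P : DPrefix) (C : Clause) : Prop := ∀ k ∈ C, k.var ∈ P.names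

theorem Lit.vars_toFm (l : Lit) : l.toFm.vars = [l.var] := by
  unfold Lit.toFm; split <;> rfl

theorem Clause.toFm_cons (l : Lit) (C : Clause) : Clause.toFm (l :: C) = .or l.toFm C.toFm := rfl

theorem Clause.mem_vars_toFm {C : Clause} {x : ℕ} : x ∈ C.toFm.vars ↔ ∃ k ∈ C, k.var = x := by
  induction C with
  | nil => simp [Clause.toFm, bigOr, Fm.vars]
  | cons l C ih =>
    rw [Clause.toFm_cons]
    simp [Fm.vars, Lit.vars_toFm, ih, eq_comm]

theorem ClauseIn.varsIn {P : DPrefix} {C : Clause} (h : ClauseIn P C) : VarsIn P C.toFm := by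
  intro x hx
  obtain ⟨k, hk, rfl⟩ := Clause.mem_vars_toFm.1 hx
  exact h k hk

theorem varsIn_var {P : DPrefix} {x : ℕ} (h : x ∈ P.names) : VarsIn P (.var x) := by
  intro y hy; rw [List.mem_singleton.1 hy]; exact h

theorem varsIn_lit {P : DPrefix} {l : Lit} (h : l.var ∈ P.names) : VarsIn P l.toFm := by
  intro y hy; rw [Lit.vars_toFm] at hy; rw [List.mem_singleton.1 hy]; exact h

theorem ClauseIn.cons {P : DPrefix} {C : Clause} {l : Lit} (hl : l.var ∈ P.names)
    (h : ClauseIn P C) : ClauseIn P (l :: C) := by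
  intro k hk
  rcases List.mem_cons.1 hk with rfl | hk
  · exact hl
  · exact h k hk

theorem ClauseIn.of_cons {P : DPrefix} {C : Clause} {l : Lit} (h : ClauseIn P (l :: C)) :
    l.var ∈ P.names ∧ ClauseIn P C :=
  ⟨h l List.mem_cons_self, fun k hk => h k (List.mem_cons_of_mem _ hk)⟩

/-- The instance of a rule that depends on a polarity. -/
noncomputable def instPol (F : FregeSystem) (r : Bool → FregeRule) (b : Bool)
    (args : List Fm) : List DStep :=
  bif b then inst F (r true) args else inst F (r false) args

@[fun_prop]
theorem PT.instPol {A : Type} [Enc A] (F : FregeSystem) (r : Bool → FregeRule) {b : A → Bool}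
    {args : A → List Fm} (hb : PT b) (h : PT args) : PT fun a => instPol F r (b a) (args a) := by
  unfold QBFSim.instPol
  fun_prop

theorem instPol_eq (F : FregeSystem) (r : Bool → FregeRule) (b : Bool) (args : List Fm) :
    instPol F r b args = inst F (r b) args := by
  cases b <;> rfl

def tautRule (b : Bool) : FregeRule := ⟨[], .or (litPat !b) (.or (litPat b) (.var 1))⟩

def weakenRule : FregeRule := ⟨[.or (.var 0) (.var 1)], .or (.var 0) (.or (.var 2) (.var 1))⟩

theorem tautRule_sound (b : Bool) : Entails (tautRule b).prems (tautRule b).concl := by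
  intro v _
  cases b <;> cases h : v 0 <;> simp [tautRule, Fm.eval, litPat, h]

theorem weakenRule_sound : Entails weakenRule.prems weakenRule.concl := by
  intro v h
  simp [weakenRule, Fm.eval] at h ⊢
  tauto

/-- `l̄ ∨ (l ∨ R)`. -/
noncomputable def excludedMiddle (F : FregeSystem) (l : Lit) (R : Fm) : List DStep :=
  instPol F tautRule l.pos [.var l.var, R]

/-- From `A ∨ R` to `A ∨ (B ∨ R)`. -/
noncomputable def weaken (F : FregeSystem) (A B R : Fm) : List DStep :=
  inst F weakenRule [A, R, B]

theorem excludedMiddle_derives {l : Lit} {R : Fm} (hl : l.var ∈ s.pre.names)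
    (hR : VarsIn s.pre R) :
    DTr F M s (excludedMiddle F l R) (Grow s {.or l.neg.toFm (.or l.toFm R)}) := by
  unfold excludedMiddle
  rw [instPol_eq]
  refine (inst_derives (tautRule_sound _) ?_ (by simp [tautRule])).mono fun s' hs' => ?_
  · simp [varsIn_var hl, hR]
  · simp only [tautRule, Fm.subst, litPat_subst, litPat_not_subst] at hs'
    exact hs'

theorem weaken_derives {A B R : Fm} (hA : VarsIn s.pre A) (hB : VarsIn s.pre B)
    (hR : VarsIn s.pre R) (h : Fm.or A R ∈ s.lines) :
    DTr F M s (weaken F A B R) (Grow s {.or A (.or B R)}) := by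
  refine inst_derives weakenRule_sound ?_ ?_
  · simp [hA, hB, hR]
  · simpa [weakenRule, Fm.subst, argSubst] using h

/-- A derivation of `l̄ ∨ C`, for a literal `l` of the clause `C`. -/
noncomputable def tautology (F : FregeSystem) (C : Clause) (l : Lit) : List DStep :=
  (suffixes C).reverse.flatMap fun p =>
    bif decide (p.1 = l) then excludedMiddle F l (Clause.toFm p.2)
    else bif decide (l ∈ p.2) then weaken F l.neg.toFm p.1.toFm (Clause.toFm p.2) else []

/-- Starting at the occurrence of `l`, the line `l̄ ∨ (l ∨ R)` is an excluded middle, and each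
literal further left is inserted behind `l̄` by weakening. If `l` is repeated, the derivation
restarts at the next occurrence. -/
theorem tautology_derives {C : Clause} {l : Lit} (hC : ClauseIn s.pre C) (hl : l ∈ C) :
    DTr F M s (tautology F C l) (Grow s {Clause.toFm (l.neg :: C)}) := by
  -- The claim is made conditional for the induction: suffixes without `l` contribute no line.
  suffices H : DTr F M s (tautology F C l)
      (Grow s {A | l ∈ C ∧ A = Clause.toFm (l.neg :: C)}) from
    H.mono fun s' hs' => hs'.sub (by simp [hl])
  have hlv := hC l hl
  clear hl
  induction C with
  | nil => exact DTr.nil ((Grow.refl s).sub (by simp))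
  | cons k C ih =>
    obtain ⟨hk, hC⟩ := hC.of_cons
    unfold tautology
    simp only [suffixes, List.reverse_cons, List.flatMap_append, List.flatMap_cons,
      List.flatMap_nil, List.append_nil]
    refine (ih hC).grow_append_right fun s' hs' => ?_
    rw [← hs'.1] at hC hk hlv
    by_cases hkl : k = l
    · subst hkl
      simp only [decide_true, cond_true]
      exact (excludedMiddle_derives hk hC.varsIn).mono fun s'' h => h.sub (by
        rintro A ⟨_, rfl⟩; rfl)
    · by_cases hlC : l ∈ C
      · simp only [hkl, hlC, decide_true, decide_false, cond_true, cond_false]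
        exact (weaken_derives (varsIn_lit (l := l.neg) hlv) (varsIn_lit hk) hC.varsIn
          (hs'.2.2 _ ⟨hlC, rfl⟩)).mono fun s'' h => h.sub (by rintro A ⟨_, rfl⟩; rfl)
      · simp only [hkl, hlC, decide_false, cond_false]
        refine DTr.nil ((Grow.refl s').sub ?_)
        rintro A ⟨h, -⟩
        rcases List.mem_cons.1 h with h | h
        · exact (hkl h.symm).elim
        · exact (hlC h).elim

def addRule : FregeRule := ⟨[.var 0], .or (.var 1) (.var 0)⟩

def resolveRule (b : Bool) : FregeRule :=
  ⟨[.or (.var 2) (.or (litPat b) (.var 1)), .or (litPat !b) (.var 2)], .or (.var 2) (.var 1)⟩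

def orBotRule : FregeRule := ⟨[.or (.var 0) .bot], .var 0⟩

theorem addRule_sound : Entails addRule.prems addRule.concl := by
  intro v h
  simp [addRule, Fm.eval] at h ⊢
  tauto

theorem resolveRule_sound (b : Bool) : Entails (resolveRule b).prems (resolveRule b).concl := by
  intro v h
  cases b <;> cases h0 : v 0 <;> simp [resolveRule, Fm.eval, litPat, h0] at h ⊢ <;> tauto

theorem orBotRule_sound : Entails orBotRule.prems orBotRule.concl := by
  intro v h
  simpa [orBotRule, Fm.eval] using h

/-- From the clause `E` and `k̄ ∨ H` for all literals `k` of `E` to `H`. -/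
noncomputable def hyperResolve (F : FregeSystem) (E : Clause) (H : Fm) : List DStep :=
  inst F addRule [E.toFm, H] ++
    ((suffixes E).flatMap fun p =>
      instPol F resolveRule p.1.pos [.var p.1.var, Clause.toFm p.2, H]) ++
    inst F orBotRule [H]

/-- `E` is weakened to `H ∨ E`, and its literals are cut away one at a time from the left with the
lines `k̄ ∨ H`. What remains is `H ∨ 0`. -/
theorem hyperResolve_derives {E : Clause} {H : Fm} (hE : ClauseIn s.pre E)
    (hH : VarsIn s.pre H) (hl : E.toFm ∈ s.lines) (hk : ∀ k ∈ E, .or k.neg.toFm H ∈ s.lines) :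
    DTr F M s (hyperResolve F E H) (Grow s {H}) := by
  unfold hyperResolve
  have h1 : DTr F M s (inst F addRule [E.toFm, H]) (Grow s {.or H E.toFm}) :=
    inst_derives addRule_sound (by simp [hE.varsIn, hH]) (by
      simpa [addRule, Fm.subst, argSubst] using hl)
  have h2 : ∀ (E : Clause) (s' : DState), s'.pre = s.pre → ClauseIn s.pre E →
      (∀ k ∈ E, .or k.neg.toFm H ∈ s'.lines) → .or H E.toFm ∈ s'.lines →
      DTr F M s' ((suffixes E).flatMap fun p =>
        instPol F resolveRule p.1.pos [.var p.1.var, Clause.toFm p.2, H])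
        (Grow s' {.or H .bot}) := by
    intro E
    induction E with
    | nil =>
      intro s' _ _ _ h
      exact DTr.nil ⟨rfl, fun _ h => h, by rintro A rfl; exact h⟩
    | cons k E ih =>
      intro s' hs' hE hk h
      simp only [suffixes, List.flatMap_cons]
      obtain ⟨hkv, hE⟩ := hE.of_cons
      have h3 : DTr F M s' (instPol F resolveRule k.pos [.var k.var, Clause.toFm E, H])
          (Grow s' {.or H (Clause.toFm E)}) := by
        rw [instPol_eq]
        refine (inst_derives (resolveRule_sound _) ?_ ?_).mono fun s'' h => ?_
        · rw [hs']; simp [varsIn_var hkv, hE.varsIn, hH]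
        · simp only [resolveRule, List.mem_cons, List.not_mem_nil, or_false, forall_eq_or_imp,
            forall_eq, Fm.subst, litPat_subst, litPat_not_subst]
          exact ⟨h, hk k List.mem_cons_self⟩
        · exact h
      refine h3.grow_append_right fun s'' hs'' => ih s'' (hs''.1.trans hs') hE
        (fun k hk' => hs''.2.1 (hk k (List.mem_cons_of_mem _ hk'))) (hs''.2.2 _ rfl)
  refine (h1.grow_append_right fun s' hs' => h2 E s' hs'.1 hE
    (fun k hk' => hs'.2.1 (hk k hk')) (hs'.2.2 _ rfl)).grow_append_right fun s' hs' => ?_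
  refine inst_derives orBotRule_sound (by rw [hs'.1]; simp [hH]) ?_
  simpa [orBotRule, Fm.subst, argSubst] using hs'.2.2 _ rfl

/-! #### Forward chaining -/

/-- A Horn rule for literals: premises, conclusion, and a clause as a label. -/
abbrev HornRule := List Lit × (Lit × Clause)

def hornStep (T : List (Lit × Clause)) (r : HornRule) : List (Lit × Clause) :=
  bif r.1.all fun k => decide (k ∈ T.map Prod.fst) then r.2 :: T else T

/-- Forward chaining with the rules `R`, started from `T`. -/
def hornClosure (R : List HornRule) (T : List (Lit × Clause)) : List (Lit × Clause) :=
  (R.flatMap fun _ => R).foldl hornStep T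

/-- The results of applications of the rules `R`, one after the other. -/
inductive HornTrail (R : List HornRule) (T : List (Lit × Clause)) : List (Lit × Clause) → Prop
  | start : HornTrail R T T
  | step (r : HornRule) (T' : List (Lit × Clause)) (hr : r ∈ R)
      (h : ∀ k ∈ r.1, k ∈ T'.map Prod.fst) (hT : HornTrail R T T') : HornTrail R T (r.2 :: T')

theorem foldl_hornStep_trail {R : List HornRule} {T : List (Lit × Clause)} (L : List HornRule)
    (hL : L ⊆ R) (T' : List (Lit × Clause)) (h : HornTrail R T T') :
    HornTrail R T (L.foldl hornStep T') := by
  induction L generalizing T' with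
  | nil => exact h
  | cons r L ih =>
    refine ih (fun x hx => hL (List.mem_cons_of_mem _ hx)) _ ?_
    unfold hornStep
    cases hr : r.1.all fun k => decide (k ∈ T'.map Prod.fst)
    · exact h
    · exact .step r T' (hL List.mem_cons_self) (by simpa using hr) h

theorem hornClosure_trail (R : List HornRule) (T : List (Lit × Clause)) :
    HornTrail R T (hornClosure R T) :=
  foldl_hornStep_trail _ (by intro x hx; simp at hx; exact hx.2) _ .start

/-- `T` is closed under the rules. -/
def HornClosed (R : List HornRule) (T : List (Lit × Clause)) : Prop :=
  ∀ r ∈ R, (∀ k ∈ r.1, k ∈ T.map Prod.fst) → r.2.1 ∈ T.map Prod.fst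

theorem subset_hornStep (T : List (Lit × Clause)) (r : HornRule) : T ⊆ hornStep T r := by
  unfold hornStep
  cases r.1.all fun k => decide (k ∈ T.map Prod.fst)
  · exact fun _ h => h
  · exact List.subset_cons_self _ _

theorem subset_foldl_hornStep (L : List HornRule) (T : List (Lit × Clause)) :
    T ⊆ L.foldl hornStep T := by
  induction L generalizing T with
  | nil => exact fun _ h => h
  | cons r L ih => exact fun x hx => ih _ (subset_hornStep T r hx)

theorem hornStep_mem {T : List (Lit × Clause)} {r : HornRule}
    (h : ∀ k ∈ r.1, k ∈ T.map Prod.fst) : r.2 ∈ hornStep T r := by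
  unfold hornStep
  have : (r.1.all fun k => decide (k ∈ T.map Prod.fst)) = true := by simpa using h
  rw [this]
  exact List.mem_cons_self

theorem foldl_hornStep_mem {L : List HornRule} {T : List (Lit × Clause)} {r : HornRule}
    (hr : r ∈ L) (h : ∀ k ∈ r.1, k ∈ T.map Prod.fst) : r.2 ∈ L.foldl hornStep T := by
  induction L generalizing T with
  | nil => simp at hr
  | cons r' L ih =>
    rcases List.mem_cons.1 hr with rfl | hr
    · exact subset_foldl_hornStep L _ (hornStep_mem h)
    · exact ih hr fun k hk => List.map_subset _ (subset_hornStep T r') (h k hk)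

theorem HornClosed.foldl {R L : List HornRule} {T : List (Lit × Clause)} (h : HornClosed R T)
    (hL : L ⊆ R) : (L.foldl hornStep T).map Prod.fst ⊆ T.map Prod.fst := by
  have h2 := foldl_hornStep_trail (R := R) (T := T) L hL T .start
  generalize L.foldl hornStep T = T' at h2
  induction h2 with
  | start => exact fun _ h => h
  | step r T' hr hk _ ih =>
    rw [List.map_cons]
    exact List.cons_subset.2 ⟨h r hr fun k hk' => ih (hk k hk'), ih⟩

theorem HornClosed.of_map_eq {R : List HornRule} {T T' : List (Lit × Clause)}
    (h : HornClosed R T) (h1 : T ⊆ T') (h2 : T'.map Prod.fst ⊆ T.map Prod.fst) :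
    HornClosed R T' :=
  fun r hr hk => List.map_subset _ h1 (h r hr fun k hk' => h2 (hk k hk'))

/-- As many passes as there are rules suffice: a pass that starts from a set that is not closed adds
the conclusion of a rule whose conclusion was absent before. So the number of rules with present
conclusion grows until the set is closed or all conclusions are present. -/
theorem hornClosed_hornClosure (R : List HornRule) (T : List (Lit × Clause)) :
    HornClosed R (hornClosure R T) := by
  have key : ∀ (N : List HornRule) (T : List (Lit × Clause)),
      HornClosed R ((N.flatMap fun _ => R).foldl hornStep T) ∨
      N.length + R.countP (fun r => decide (r.2.1 ∈ T.map Prod.fst)) ≤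
        R.countP (fun r => decide
          (r.2.1 ∈ ((N.flatMap fun _ => R).foldl hornStep T).map Prod.fst)) := by
    intro N
    induction N with
    | nil => intro T; right; exact (Nat.zero_add _).le
    | cons _ N ih =>
      intro T
      rw [List.flatMap_cons, List.foldl_append]
      set T₁ := R.foldl hornStep T with hT₁
      have hsub : T ⊆ T₁ := subset_foldl_hornStep R T
      by_cases hc : HornClosed R T
      · left
        have h1 := hc.of_map_eq hsub (hc.foldl fun _ h => h)
        exact h1.of_map_eq (subset_foldl_hornStep _ _)
          (h1.foldl (by intro x hx; simp at hx; exact hx.2))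
      · rcases ih T₁ with h | h
        · exact Or.inl h
        · right
          refine le_trans ?_ h
          unfold HornClosed at hc
          push Not at hc
          obtain ⟨r, hr, hk, hn⟩ := hc
          have hlt : R.countP (fun r => decide (r.2.1 ∈ T.map Prod.fst)) <
              R.countP (fun r => decide (r.2.1 ∈ T₁.map Prod.fst)) := by
            have hmem : r.2.1 ∈ T₁.map Prod.fst :=
              List.mem_map_of_mem (foldl_hornStep_mem hr hk)
            obtain ⟨R₁, R₂, rfl⟩ := List.append_of_mem hr
            simp only [List.countP_append, List.countP_cons, hmem, hn, decide_true, decide_false,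
              if_true]
            have hm : ∀ L : List HornRule,
                L.countP (fun r => decide (r.2.1 ∈ T.map Prod.fst)) ≤
                L.countP (fun r => decide (r.2.1 ∈ T₁.map Prod.fst)) := fun L =>
              List.countP_mono_left fun x _ hx => by
                simp only [decide_eq_true_eq] at hx ⊢
                exact List.map_subset _ hsub hx
            have := hm R₁
            have := hm R₂
            simp only [Bool.false_eq_true, if_false]
            omega
          simp only [List.length_cons]
          omega
  -- In the second case the count has reached the number of rules, so all conclusions are present
  -- and the set is closed trivially.
  rcases key R T with h | h
  · exact h
  · intro r hr _
    have h1 : R.countP (fun r => decide (r.2.1 ∈ (hornClosure R T).map Prod.fst)) = R.length :=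
      le_antisymm List.countP_le_length (le_trans (Nat.le_add_right _ _) h)
    simpa using List.countP_eq_length.1 h1 r hr

theorem HornTrail.subset {R : List HornRule} {T T' : List (Lit × Clause)}
    (h : HornTrail R T T') : T ⊆ T' := by
  induction h with
  | start => exact fun _ h => h
  | step r T' _ _ _ ih => exact fun x hx => List.mem_cons_of_mem _ (ih hx)

/-! #### Derivations from unit propagation -/

/-- Unit propagation as forward chaining. -/
def upRules (Γ : CNF) : List HornRule :=
  Γ.flatMap fun E => E.map fun l => ((E.filter fun k => decide (k ≠ l)).map Lit.neg, (l, E))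

/-- The literals that unit propagation assigns under the assumption `C̄`, with the clauses that
force them (`[]` for the assumptions). -/
def upTrail (Γ : CNF) (C : Clause) : List (Lit × Clause) :=
  hornClosure (upRules Γ) (C.map fun k => (k.neg, []))

theorem unitProp_mem_upTrail {Γ : CNF} {C : Clause} {l : Lit}
    (h : UnitProp (Γ ++ C.negUnits) l) : l ∈ (upTrail Γ C).map Prod.fst := by
  induction h with
  | unit E l hE hl _ ih =>
    rcases List.mem_append.1 hE with hE | hE
    · refine hornClosed_hornClosure (upRules Γ) _
        ((E.filter fun k => decide (k ≠ l)).map Lit.neg, (l, E)) ?_ ?_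
      · simp only [upRules, List.mem_flatMap, List.mem_map]
        exact ⟨E, hE, l, hl, rfl⟩
      · intro k hk
        simp only [List.mem_map, List.mem_filter, decide_eq_true_eq] at hk
        obtain ⟨k, ⟨h1, h2⟩, rfl⟩ := hk
        exact ih k h1 h2
    · simp only [Clause.negUnits, List.mem_map] at hE
      obtain ⟨k, hk, rfl⟩ := hE
      obtain rfl := List.mem_singleton.1 hl
      have := (hornClosure_trail (upRules Γ) (C.map fun k => (k.neg, []))).subset
        (List.mem_map_of_mem (f := fun k : Lit => (k.neg, ([] : Clause))) hk)
      exact List.mem_map_of_mem (f := Prod.fst) this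

def caseRule : FregeRule :=
  ⟨[.or (.var 0) (.var 1), .or (.neg (.var 0)) (.var 1)], .var 1⟩

theorem caseRule_sound : Entails caseRule.prems caseRule.concl := by
  intro v h
  cases h0 : v 0 <;> simp [caseRule, Fm.eval, h0] at h ⊢ <;> tauto

/-- The line `l ∨ C` for an element of the trail. -/
noncomputable def trailSteps (F : FregeSystem) (C : Clause) (e : Lit × Clause) : List DStep :=
  bif e.2.isEmpty then tautology F C e.1.neg
  else (e.2.flatMap fun k =>
      bif decide (k = e.1) then excludedMiddle F k C.toFm
      else weaken F k.neg.toFm e.1.toFm C.toFm) ++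
    hyperResolve F e.2 (Clause.toFm (e.1 :: C))

/-- A derivation of `C` from the clauses `Γ`, if `Γ ∧ C̄ ⊢₁ ⊥`. -/
noncomputable def rupSteps (F : FregeSystem) (Γ : CNF) (C : Clause) : List DStep :=
  (C.flatMap fun k => tautology F C k) ++
  (upTrail Γ C).reverse.flatMap (trailSteps F C) ++
  (Γ.flatMap fun E =>
    bif E.all fun k => decide (k.neg ∈ (upTrail Γ C).map Prod.fst) then hyperResolve F E C.toFm
    else []) ++
  (C.flatMap fun k =>
    bif decide (k ∈ (upTrail Γ C).map Prod.fst) then inst F caseRule [.var k.var, C.toFm] else [])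

/-- Under the assumption `C̄`, an assigned literal `l` is represented by the line `l ∨ C`.
Assumptions give tautologies. If a clause `E` forces `l`, hyperresolution of `E` with the lines `k̄
∨ (l ∨ C)` for `k ∈ E` gives `l ∨ C`. A conflict gives `C` itself. -/
theorem rupSteps_derives {Γ : CNF} {C : Clause} (hΓ : ∀ E ∈ Γ, ClauseIn s.pre E)
    (hC : ClauseIn s.pre C) (hl : ∀ E ∈ Γ, E.toFm ∈ s.lines)
    (h : UPRefutes (Γ ++ C.negUnits)) :
    DTr F M s (rupSteps F Γ C) (Grow s {C.toFm}) := by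
  unfold rupSteps
  have h1 : DTr F M s (C.flatMap fun k => tautology F C k)
      (Grow s {A | ∃ k ∈ C, A ∈ ({Clause.toFm (k.neg :: C)} : Set Fm)}) :=
    DTr.grow_flatMap C fun k hk s' hs' => tautology_derives (by rwa [hs'.1]) hk
  have h2 : ∀ s', Grow s {A | ∃ k ∈ C, A ∈ ({Clause.toFm (k.neg :: C)} : Set Fm)} s' →
      DTr F M s' ((upTrail Γ C).reverse.flatMap (trailSteps F C))
        (Grow s' {A | ∃ l ∈ (upTrail Γ C).map Prod.fst, A = Clause.toFm (l :: C)}) := by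
    intro s' hs'
    have hT := hornClosure_trail (upRules Γ) (C.map fun k => (k.neg, []))
    change HornTrail _ _ (upTrail Γ C) at hT
    generalize upTrail Γ C = T at hT
    -- The induction on the trail also carries that its literals belong to the prefix; this is
    -- needed for the lines in which they occur.
    suffices H : (∀ l ∈ T.map Prod.fst, l.var ∈ s.pre.names) ∧
        DTr F M s' (T.reverse.flatMap (trailSteps F C))
        (Grow s' {A | ∃ l ∈ T.map Prod.fst, A = Clause.toFm (l :: C)}) from H.2
    induction hT with
    | start =>
      refine ⟨?_, ?_⟩
      · intro l hl
        simp only [List.map_map, List.mem_map, Function.comp] at hl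
        obtain ⟨k, hk, rfl⟩ := hl
        exact hC k hk
      · refine (DTr.grow_flatMap (G := fun e => {Clause.toFm (e.1 :: C)}) _ ?_).mono
          fun s'' h => h.sub ?_
        · intro e he s'' hs''
          simp only [List.mem_reverse, List.mem_map] at he
          obtain ⟨k, hk, rfl⟩ := he
          simp only [trailSteps, List.isEmpty_nil, cond_true, Lit.neg_neg]
          exact tautology_derives (by rwa [hs''.1, hs'.1]) hk
        · rintro A ⟨l, hl, rfl⟩
          obtain ⟨e, he, rfl⟩ := List.mem_map.1 hl
          exact ⟨e, List.mem_reverse.2 he, rfl⟩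
    | step r T hr hk _ ih =>
      obtain ⟨ih1, ih2⟩ := ih
      simp only [upRules, List.mem_flatMap, List.mem_map] at hr
      obtain ⟨E, hE, l, hlE, rfl⟩ := hr
      have hlv := hΓ E hE l hlE
      refine ⟨?_, ?_⟩
      · simp only [List.map_cons, List.mem_cons, forall_eq_or_imp]
        exact ⟨hlv, ih1⟩
      · simp only [List.reverse_cons, List.flatMap_append, List.flatMap_cons, List.flatMap_nil,
          List.append_nil]
        refine (ih2.grow_append (H := {Clause.toFm (l :: C)}) fun s'' hs'' => ?_).mono
          fun s'' h => h.sub ?_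
        · have hpre : s''.pre = s.pre := hs''.1.trans hs'.1
          -- A forcing clause contains the forced literal, so the label `[]` is free to mark
          -- assumptions, even if `Γ` contains the empty clause.
          have hne : E.isEmpty = false := by
            cases E with
            | nil => simp at hlE
            | cons => rfl
          simp only [trailSteps, hne, cond_false]
          refine DTr.grow_append_right (G := {A | ∃ k ∈ E, A ∈
            ({.or k.neg.toFm (.or l.toFm C.toFm)} : Set Fm)})
            (DTr.grow_flatMap E fun k hkE s3 hs3 => ?_) fun s3 hs3 => ?_
          · have hkv := hΓ E hE k hkE
            have hpre3 : s3.pre = s.pre := hs3.1.trans hpre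
            rw [← hpre3] at hkv hlv
            by_cases hkl : k = l
            · subst hkl
              simp only [decide_true, cond_true]
              exact excludedMiddle_derives hkv (by rw [hpre3]; exact hC.varsIn)
            · simp only [hkl, decide_false, cond_false]
              refine weaken_derives (varsIn_lit (l := k.neg) hkv) (varsIn_lit hlv)
                (by rw [hpre3]; exact hC.varsIn) (hs3.2.1 (hs''.2.2 _ ⟨k.neg, ?_, rfl⟩))
              refine hk k.neg (List.mem_map.2 ⟨k, ?_, rfl⟩)
              simp [hkE, hkl]
          · have hpre3 : s3.pre = s.pre := hs3.1.trans hpre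
            refine hyperResolve_derives (by rw [hpre3]; exact hΓ E hE)
              (by rw [hpre3]; exact (hC.cons hlv).varsIn)
              (hs3.2.1 (hs''.2.1 (hs'.2.1 (hl E hE)))) fun k hk => hs3.2.2 _ ⟨k, hk, rfl⟩
        · rintro A ⟨k, hk, rfl⟩
          rcases List.mem_cons.1 hk with rfl | hk
          · exact Or.inr rfl
          · exact Or.inl ⟨k, hk, rfl⟩
  have h12 := h1.grow_append h2
  have hall : ∀ s', Grow s ({A | ∃ k ∈ C, A ∈ ({Clause.toFm (k.neg :: C)} : Set Fm)} ∪
        {A | ∃ l ∈ (upTrail Γ C).map Prod.fst, A = Clause.toFm (l :: C)}) s' →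
      DTr F M s' ((Γ.flatMap fun E =>
          bif E.all fun k => decide (k.neg ∈ (upTrail Γ C).map Prod.fst)
          then hyperResolve F E C.toFm else []) ++
        (C.flatMap fun k => bif decide (k ∈ (upTrail Γ C).map Prod.fst)
          then inst F caseRule [.var k.var, C.toFm] else [])) (Grow s' {C.toFm}) := by
    intro s' hs'
    have h3 := DTr.grow_flatMap (F := F) (M := M) (s := s')
      (f := fun E => bif E.all fun k => decide (k.neg ∈ (upTrail Γ C).map Prod.fst)
          then hyperResolve F E C.toFm else [])
      (G := fun E => {A | (∀ k ∈ E, k.neg ∈ (upTrail Γ C).map Prod.fst) ∧ A = C.toFm}) Γ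
      (by
        intro E hE s'' hs''
        have hpre : s''.pre = s.pre := hs''.1.trans hs'.1
        by_cases hc : ∀ k ∈ E, k.neg ∈ (upTrail Γ C).map Prod.fst
        · have : (E.all fun k => decide (k.neg ∈ (upTrail Γ C).map Prod.fst)) = true := by
            simpa using hc
          simp only [this, cond_true]
          refine (hyperResolve_derives (by rw [hpre]; exact hΓ E hE)
            (by rw [hpre]; exact hC.varsIn) (hs''.2.1 (hs'.2.1 (hl E hE)))
            fun k hk => hs''.2.1 (hs'.2.2 _ (Or.inr ⟨k.neg, hc k hk, rfl⟩))).mono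
            fun s3 h => h.sub ?_
          rintro A ⟨_, rfl⟩; rfl
        · have : (E.all fun k => decide (k.neg ∈ (upTrail Γ C).map Prod.fst)) = false := by
            rw [← Bool.not_eq_true]; simpa using hc
          simp only [this, cond_false]
          exact DTr.nil ((Grow.refl _).sub (by rintro A ⟨h, _⟩; exact (hc h).elim)))
    refine (h3.grow_append (H := {A | (∃ k ∈ C, k ∈ (upTrail Γ C).map Prod.fst) ∧ A = C.toFm})
      fun s3 hs3 => ?_).mono fun s4 h4 => h4.sub ?_
    · refine (DTr.grow_flatMap
        (G := fun k => {A | k ∈ (upTrail Γ C).map Prod.fst ∧ A = C.toFm}) C ?_).mono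
        fun s4 h4 => h4.sub (by rintro A ⟨⟨k, hk, hk'⟩, e⟩; exact ⟨k, hk, hk', e⟩)
      intro k hk s4 hs4
      have hpre : s4.pre = s.pre := hs4.1.trans (hs3.1.trans hs'.1)
      by_cases hc : k ∈ (upTrail Γ C).map Prod.fst
      · simp only [hc, decide_true, cond_true]
        have e1 : Fm.or k.toFm C.toFm ∈ s4.lines :=
          hs4.2.1 (hs3.2.1 (hs'.2.2 _ (Or.inr ⟨k, hc, rfl⟩)))
        have e2 : Fm.or k.neg.toFm C.toFm ∈ s4.lines :=
          hs4.2.1 (hs3.2.1 (hs'.2.2 _ (Or.inl ⟨k, hk, rfl⟩)))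
        refine (inst_derives caseRule_sound (by
          rw [hpre]; simp [varsIn_var (hC k hk), hC.varsIn]) ?_).mono fun s5 h => h.sub ?_
        · simp only [caseRule, List.mem_cons, List.not_mem_nil, or_false, forall_eq_or_imp,
            forall_eq, Fm.subst]
          unfold Lit.toFm at e1 e2
          unfold Lit.neg at e2
          cases hp : k.pos <;> simp only [hp, if_true, Bool.false_eq_true, if_false, Bool.not_true,
            Bool.not_false] at e1 e2
          · exact ⟨e2, e1⟩
          · exact ⟨e1, e2⟩
        · rintro A ⟨_, rfl⟩; rfl
      · simp only [hc, decide_false, cond_false]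
        exact DTr.nil ((Grow.refl _).sub (by rintro A ⟨h, _⟩; exact h.elim))
    · rintro A rfl
      -- The conflict clause belongs to `Γ`, or it is a unit clause `k̄` with `k ∈ C`. In the latter
      -- case `k` is on the trail, and `k ∨ C` is cut with the tautology `k̄ ∨ C`.
      obtain ⟨E, hE, hk⟩ := h
      rcases List.mem_append.1 hE with hE | hE
      · exact Or.inl ⟨E, hE, fun k hk' => unitProp_mem_upTrail (hk k hk'), rfl⟩
      · simp only [Clause.negUnits, List.mem_map] at hE
        obtain ⟨k, hkC, rfl⟩ := hE
        refine Or.inr ⟨⟨k, hkC, ?_⟩, rfl⟩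
        have := unitProp_mem_upTrail (hk k.neg (by simp))
        rwa [Lit.neg_neg] at this
  rw [List.append_assoc]
  exact h12.grow_append_right hall

/-! ### Running time of the clausal derivations -/

section
variable {A : Type} [Enc A]

@[fun_prop]
theorem PT.excludedMiddle {l : A → Lit} {R : A → Fm} (hl : PT l) (hR : PT R) :
    PT fun a => excludedMiddle F (l a) (R a) := by
  unfold QBFSim.excludedMiddle
  fun_prop

@[fun_prop]
theorem PT.weaken {f g h : A → Fm} (hf : PT f) (hg : PT g) (hh : PT h) :
    PT fun a => weaken F (f a) (g a) (h a) := by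
  unfold QBFSim.weaken
  fun_prop

@[fun_prop]
theorem PT.tautology {C : A → List Lit} {l : A → Lit} (hC : PT C) (hl : PT l) :
    PT fun a => tautology F (C a) (l a) := by
  unfold QBFSim.tautology
  fun_prop

@[fun_prop]
theorem PT.hyperResolve {E : A → List Lit} {H : A → Fm} (hE : PT E) (hH : PT H) :
    PT fun a => hyperResolve F (E a) (H a) := by
  unfold QBFSim.hyperResolve
  fun_prop

@[fun_prop]
theorem PT.hornClosure {R : A → List HornRule} {T : A → List (Lit × Clause)} (hR : PT R)
    (hT : PT T) : PT fun a => hornClosure (R a) (T a) := by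
  unfold QBFSim.hornClosure
  refine PT.foldl_additive (f := fun _ => hornStep) ?_ hT (by fun_prop) ?_
  · unfold hornStep
    fun_prop
  · refine ⟨Polynomial.X + 1, fun x b r => ?_⟩
    have : esize r = esize r.1 + esize r.2 + 1 := rfl
    simp only [hornStep, Polynomial.eval_add, Polynomial.eval_X, Polynomial.eval_one]
    cases r.1.all fun k => decide (k ∈ b.map Prod.fst) <;>
      simp only [cond_true, cond_false, esize_cons] <;> omega

@[fun_prop]
theorem PT.upTrail {Γ : A → List (List Lit)} {C : A → List Lit} (hΓ : PT Γ) (hC : PT C) :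
    PT fun a => upTrail (Γ a) (C a) := by
  unfold QBFSim.upTrail upRules
  fun_prop

@[fun_prop]
theorem PT.rupSteps {Γ : A → List (List Lit)} {C : A → List Lit} (hΓ : PT Γ) (hC : PT C) :
    PT fun a => rupSteps F (Γ a) (C a) := by
  unfold QBFSim.rupSteps trailSteps
  fun_prop

end

end QBFSim
namespace QBFSim
variable {F : FregeSystem} {M : List Fm} {s : DState}

/-! ### Clausal scripts -/

/-- Instructions of clausal scripts. -/
inductive Item where
  /-- A new universal variable. -/
  | newAll (u : ℕ)
  /-- A new existential variable with empty dependency set. -/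
  | newEx (x : ℕ)
  /-- A clause of the matrix. -/
  | ax (C : Clause)
  /-- The clause `⋁ c̄`, if the matrix is the negation of `⋀ D` and the clauses `c̄ ∨ D` are
  present, for the pairs `(c, D)` of the list. -/
  | axNeg (ps : List (ℕ × Clause))
  /-- The clauses of `v ↔ ⋁ Y`, for a new variable `v`. -/
  | defOr (v : ℕ) (Y : Clause)
  /-- The clauses of `a → (v ↔ x)`, for a new variable `v`. -/
  | defIf (v : ℕ) (a : Lit) (x : ℕ)
  /-- A clause that follows by unit propagation. -/
  | rup (C : Clause)
  /-- Reduction of the clause `l ∨ R` to `R`. -/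
  | red (l : Lit) (R : Clause)

/-- The fields of an instruction, with default values for the missing ones. -/
def Item.view : Item → ℕ × (ℕ × (Lit × (Clause × List (ℕ × Clause))))
  | .newAll u => (0, (u, (⟨0, false⟩, ([], []))))
  | .newEx x => (1, (x, (⟨0, false⟩, ([], []))))
  | .ax C => (2, (0, (⟨0, false⟩, (C, []))))
  | .axNeg ps => (3, (0, (⟨0, false⟩, ([], ps))))
  | .defOr v Y => (4, (v, (⟨0, false⟩, (Y, []))))
  | .defIf v a x => (5, (v, (a, ([⟨x, true⟩], []))))
  | .rup C => (6, (0, (⟨0, false⟩, (C, []))))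
  | .red l R => (7, (0, (l, (R, []))))

/-- The clauses that an instruction produces. -/
def Item.clauses : Item → CNF
  | .newAll _ => []
  | .newEx _ => []
  | .ax C => [C]
  | .axNeg ps => [ps.map fun p => ⟨p.1, false⟩]
  | .defOr v Y => (⟨v, false⟩ :: Y) :: Y.map fun y => [⟨v, true⟩, y.neg]
  | .defIf v a x => [[a.neg, ⟨v, false⟩, ⟨x, true⟩], [a.neg, ⟨v, true⟩, ⟨x, false⟩]]
  | .rup C => [C]
  | .red _ R => [R]

/-- The prefix and the clauses derived so far. -/
structure SState where
  pre : DPrefix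
  Γ : CNF

def Item.apply (S : SState) (i : Item) : SState where
  pre := match i with
    | .newAll u => ⟨u :: S.pre.univ, S.pre.exs⟩
    | .newEx x => ⟨S.pre.univ, (x, []) :: S.pre.exs⟩
    | .defOr v Y => ⟨S.pre.univ, (v, S.pre.extDep [] Y) :: S.pre.exs⟩
    | .defIf v a x => ⟨S.pre.univ, (v, S.pre.extDep [a] [⟨x, true⟩]) :: S.pre.exs⟩
    | _ => S.pre
  Γ := i.clauses ++ S.Γ

/-- The side conditions of the instructions. -/
def Item.Ok (M : List Fm) (S : SState) : Item → Prop
  | .newAll u => u ∉ S.pre.names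
  | .newEx x => x ∉ S.pre.names
  | .ax C => C.toFm ∈ M ∧ ClauseIn S.pre C
  | .axNeg ps => .neg (bigAnd (ps.map fun p => Clause.toFm p.2)) ∈ M ∧
      ∀ p ∈ ps, (⟨p.1, false⟩ :: p.2) ∈ S.Γ
  | .defOr v Y => v ∉ S.pre.names ∧ ClauseIn S.pre Y
  | .defIf v a x => v ∉ S.pre.names ∧ a.var ∈ S.pre.univ ∧ x ∈ S.pre.names
  | .rup C => ClauseIn S.pre C ∧ UPRefutes (S.Γ ++ C.negUnits)
  | .red l R => (l :: R) ∈ S.Γ ∧ l.var ∈ S.pre.univ ∧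
      ∀ k ∈ R, k.var ≠ l.var ∧ (k.var ∈ S.pre.exNames → l.var ∉ S.pre.dep k.var)

/-- The clauses are over the prefix, and no variable is both universal and existential. -/
def SState.Inv (S : SState) : Prop :=
  (∀ C ∈ S.Γ, ClauseIn S.pre C) ∧ ∀ u ∈ S.pre.univ, u ∉ S.pre.exNames

/-! #### Translation into the DQBF system -/

/-- The shape of the premises of this rule and of the next three is that of an extension line: an
empty `α` becomes `.top`, a single literal in `α` carries a trailing `∧ 1`, and a single literal in
`Y` carries a trailing `∨ 0`. -/
def defPosRule : FregeRule :=
  ⟨[.imp .top (.iff (.var 0) (.var 1))], .or (.neg (.var 0)) (.var 1)⟩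

def defNegRule : FregeRule :=
  ⟨[.imp .top (.iff (.var 0) (.var 1)), .or (.var 2) (.var 1)], .or (.var 0) (.or (.var 2) .bot)⟩

def ifPosRule (b : Bool) : FregeRule :=
  ⟨[.imp (.and (litPat b) .top) (.iff (.var 1) (.or (.var 2) .bot))],
    .or (litPat !b) (.or (.neg (.var 1)) (.or (.var 2) .bot))⟩

def ifNegRule (b : Bool) : FregeRule :=
  ⟨[.imp (.and (litPat b) .top) (.iff (.var 1) (.or (.var 2) .bot))],
    .or (litPat !b) (.or (.var 1) (.or (.neg (.var 2)) .bot))⟩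

/-- The premise starts with what is left of the reduced literal: reduction substitutes the value
that falsifies it, which turns a positive literal into `0` and a negative one into `¬ 1`. -/
def reduceRule (b : Bool) : FregeRule :=
  ⟨[.or (if b then .bot else .neg .top) (.var 0)], .var 0⟩

def cutRule : FregeRule :=
  ⟨[.or (.var 0) (.var 2), .or (.neg (.var 0)) (.var 1)], .or (.var 2) (.var 1)⟩

def orTopRule : FregeRule := ⟨[], .or (.var 0) .top⟩

def orAndRule : FregeRule :=
  ⟨[.or (.var 0) (.var 1), .or (.var 0) (.var 2)], .or (.var 0) (.and (.var 1) (.var 2))⟩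

def orNegRule : FregeRule := ⟨[.or (.var 0) (.var 1), .neg (.var 1)], .var 0⟩

theorem defPosRule_sound : Entails defPosRule.prems defPosRule.concl := by
  intro v h
  cases h0 : v 0 <;> cases h1 : v 1 <;> simp_all [defPosRule, Fm.eval, Fm.iff]

theorem defNegRule_sound : Entails defNegRule.prems defNegRule.concl := by
  intro v h
  cases h0 : v 0 <;> cases h1 : v 1 <;> simp_all [defNegRule, Fm.eval, Fm.iff]

theorem ifPosRule_sound (b : Bool) : Entails (ifPosRule b).prems (ifPosRule b).concl := by
  intro v h
  cases b <;> cases h0 : v 0 <;> cases h1 : v 1 <;> cases h2 : v 2 <;>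
    simp_all [ifPosRule, Fm.eval, Fm.iff, litPat]

theorem ifNegRule_sound (b : Bool) : Entails (ifNegRule b).prems (ifNegRule b).concl := by
  intro v h
  cases b <;> cases h0 : v 0 <;> cases h1 : v 1 <;> cases h2 : v 2 <;>
    simp_all [ifNegRule, Fm.eval, Fm.iff, litPat]

theorem reduceRule_sound (b : Bool) : Entails (reduceRule b).prems (reduceRule b).concl := by
  intro v h
  cases b <;> simpa [reduceRule, Fm.eval] using h

theorem cutRule_sound : Entails cutRule.prems cutRule.concl := by
  intro v h
  cases h0 : v 0 <;> cases h1 : v 1 <;> simp_all [cutRule, Fm.eval]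

theorem orTopRule_sound : Entails orTopRule.prems orTopRule.concl := by
  intro v h
  simp [orTopRule, Fm.eval]

theorem orAndRule_sound : Entails orAndRule.prems orAndRule.concl := by
  intro v h
  cases h0 : v 0 <;> simp_all [orAndRule, Fm.eval]

theorem orNegRule_sound : Entails orNegRule.prems orNegRule.concl := by
  intro v h
  cases h0 : v 0 <;> simp_all [orNegRule, Fm.eval]

/-- With `Z` for the clause of all `c̄`, cutting `c̄ ∨ D` against the tautology `c ∨ Z` gives `Z ∨
D`. These lines are collected into `Z ∨ ⋀ D`, and the matrix `¬ ⋀ D` leaves `Z`. -/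
noncomputable def negMatrixSteps (F : FregeSystem) (ps : List (ℕ × Clause)) : List DStep :=
  let Z : Clause := ps.map fun p => ⟨p.1, false⟩
  let D : List Fm := ps.map fun p => Clause.toFm p.2
  [.ax (.neg (bigAnd D))] ++
  (ps.flatMap fun p => tautology F Z ⟨p.1, false⟩ ++
    inst F cutRule [.var p.1, Clause.toFm p.2, Z.toFm]) ++
  inst F orTopRule [Z.toFm] ++
  ((suffixes D).reverse.flatMap fun q => inst F orAndRule [Z.toFm, q.1, bigAnd q.2]) ++
  inst F orNegRule [Z.toFm, bigAnd D]

/-- The translation of an instruction; `Γ` are the clauses derived before. -/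
noncomputable def Item.compile (F : FregeSystem) (Γ : CNF) : Item → List DStep
  | .newAll u => [.newAll u]
  | .newEx x => [.newEx x []]
  | .ax C => [.ax C.toFm]
  | .axNeg ps => negMatrixSteps F ps
  | .defOr v Y => [.extOr v [] Y] ++ inst F defPosRule [.var v, Y.toFm] ++
      Y.flatMap fun y => tautology F Y y ++ inst F defNegRule [.var v, Y.toFm, y.neg.toFm]
  | .defIf v a x => [.extOr v [a] [⟨x, true⟩]] ++
      instPol F ifPosRule a.pos [.var a.var, .var v, .var x] ++
      instPol F ifNegRule a.pos [.var a.var, .var v, .var x]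
  | .rup C => rupSteps F Γ C
  | .red l R => [.red (Clause.toFm (l :: R)) l.var (!l.pos)] ++
      instPol F reduceRule l.pos [R.toFm]

/-- The lines contain the clauses of the state. -/
def Sim (S : SState) (s : DState) : Prop :=
  s.pre = S.pre ∧ ∀ C ∈ S.Γ, C.toFm ∈ s.lines

theorem dep_cons {P : DPrefix} {v y : ℕ} {D : List ℕ} (h : y ≠ v) :
    DPrefix.dep ⟨P.univ, (v, D) :: P.exs⟩ y = P.dep y := by
  unfold DPrefix.dep
  have : (y == v) = false := by simpa using h
  simp [List.lookup_cons, this]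

theorem names_cons_ex {P : DPrefix} {v y : ℕ} {D : List ℕ} :
    y ∈ DPrefix.names ⟨P.univ, (v, D) :: P.exs⟩ ↔ y = v ∨ y ∈ P.names := by
  simp [DPrefix.names, DPrefix.exNames]
  tauto

theorem names_cons_univ {P : DPrefix} {u y : ℕ} :
    y ∈ DPrefix.names ⟨u :: P.univ, P.exs⟩ ↔ y = u ∨ y ∈ P.names := by
  simp [DPrefix.names, DPrefix.exNames]

theorem mem_names_apply {S : SState} {i : Item} {y : ℕ} (h : y ∈ S.pre.names) :
    y ∈ (i.apply S).pre.names := by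
  cases i <;> simp only [Item.apply, names_cons_ex, names_cons_univ] <;> tauto

theorem clauseIn_clauses {S : SState} {i : Item} (hS : S.Inv) (h : i.Ok M S) :
    ∀ C ∈ i.clauses, ClauseIn (i.apply S).pre C := by
  have hmono : ∀ C, ClauseIn S.pre C → ClauseIn (i.apply S).pre C :=
    fun C h k hk => mem_names_apply (h k hk)
  intro C hC
  cases i with
  | newAll u => simp [Item.clauses] at hC
  | newEx x => simp [Item.clauses] at hC
  | ax C => obtain rfl := List.mem_singleton.1 hC; exact hmono _ h.2
  | axNeg ps =>
    obtain rfl := List.mem_singleton.1 hC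
    intro k hk
    obtain ⟨p, hp, rfl⟩ := List.mem_map.1 hk
    exact mem_names_apply ((hS.1 _ (h.2 p hp)).of_cons.1)
  | defOr v Y =>
    rcases List.mem_cons.1 hC with rfl | hC
    · exact (hmono _ h.2).cons (by simp [Item.apply, names_cons_ex])
    · obtain ⟨y, hy, rfl⟩ := List.mem_map.1 hC
      intro k hk
      simp only [List.mem_cons, List.not_mem_nil, or_false] at hk
      rcases hk with rfl | rfl
      · simp [Item.apply, names_cons_ex]
      · exact mem_names_apply (h.2 y hy)
  | defIf v a x =>
    have hv : v ∈ (Item.apply S (.defIf v a x)).pre.names := by simp [Item.apply, names_cons_ex]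
    have ha : a.var ∈ (Item.apply S (.defIf v a x)).pre.names :=
      mem_names_apply (List.mem_append_left _ h.2.1)
    have hx : x ∈ (Item.apply S (.defIf v a x)).pre.names := mem_names_apply h.2.2
    simp only [Item.clauses, List.mem_cons, List.not_mem_nil, or_false] at hC
    intro k hk
    rcases hC with rfl | rfl <;> simp only [List.mem_cons, List.not_mem_nil, or_false] at hk <;>
      rcases hk with rfl | rfl | rfl <;> assumption
  | rup C => obtain rfl := List.mem_singleton.1 hC; exact hmono _ h.1
  | red l R => obtain rfl := List.mem_singleton.1 hC; exact hmono _ (hS.1 _ h.1).of_cons.2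

theorem inv_apply {S : SState} {i : Item} (hS : S.Inv) (h : i.Ok M S) : (i.apply S).Inv := by
  refine ⟨fun C hC => ?_, ?_⟩
  · rcases List.mem_append.1 hC with hC | hC
    · exact clauseIn_clauses hS h C hC
    · exact fun k hk => mem_names_apply (hS.1 C hC k hk)
  · have h2 := hS.2
    have key : ∀ v, v ∉ S.pre.names → v ∉ S.pre.univ ∧ v ∉ S.pre.exNames := by
      intro v hv
      simpa [DPrefix.names] using hv
    cases i with
    | newAll u =>
      intro u' hu'
      rcases List.mem_cons.1 hu' with rfl | hu'
      · exact (key _ h).2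
      · exact h2 u' hu'
    | newEx x =>
      intro u hu hx
      rcases List.mem_cons.1 hx with rfl | hx
      · exact (key _ h).1 hu
      · exact h2 u hu hx
    | defOr v Y =>
      intro u hu hx
      rcases List.mem_cons.1 hx with rfl | hx
      · exact (key _ h.1).1 hu
      · exact h2 u hu hx
    | defIf v a x =>
      intro u hu hx
      rcases List.mem_cons.1 hx with rfl | hx
      · exact (key _ h.1).1 hu
      · exact h2 u hu hx
    | _ => exact h2

theorem setVar_of_not_mem {A : Fm} {u : ℕ} {b : Bool} (h : u ∉ A.vars) : A.setVar u b = A := by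
  unfold Fm.setVar
  induction A with
  | bot => rfl
  | top => rfl
  | var x =>
    have : x ≠ u := fun e => h (by simp [Fm.vars, e])
    simp [Fm.subst, this]
  | neg A ih => simp only [Fm.subst]; rw [ih h]
  | and A B ih1 ih2 =>
    simp only [Fm.vars, List.mem_append, not_or] at h
    simp only [Fm.subst]; rw [ih1 h.1, ih2 h.2]
  | or A B ih1 ih2 =>
    simp only [Fm.vars, List.mem_append, not_or] at h
    simp only [Fm.subst]; rw [ih1 h.1, ih2 h.2]
  | imp A B ih1 ih2 =>
    simp only [Fm.vars, List.mem_append, not_or] at h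
    simp only [Fm.subst]; rw [ih1 h.1, ih2 h.2]

theorem setVar_lit (l : Lit) :
    l.toFm.setVar l.var (!l.pos) = if l.pos then .bot else .neg .top := by
  unfold Lit.toFm
  cases l.pos <;> simp [Fm.setVar, Fm.subst, Fm.const]

theorem varsIn_bigAnd {P : DPrefix} {L : List Fm} (h : ∀ A ∈ L, VarsIn P A) :
    VarsIn P (bigAnd L) := by
  induction L with
  | nil => intro x hx; simp [bigAnd, Fm.vars] at hx
  | cons A L ih =>
    intro x hx
    simp only [bigAnd, Fm.vars, List.mem_append] at hx
    rcases hx with hx | hx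
    · exact h A List.mem_cons_self x hx
    · exact ih (fun B hB => h B (List.mem_cons_of_mem _ hB)) x hx

theorem orBigAnd_derives {Z : Fm} (hZ : VarsIn s.pre Z) (D : List Fm)
    (hD : ∀ A ∈ D, VarsIn s.pre A) (h : ∀ A ∈ D, .or Z A ∈ s.lines) (h' : .or Z .top ∈ s.lines) :
    DTr F M s ((suffixes D).reverse.flatMap fun q => inst F orAndRule [Z, q.1, bigAnd q.2])
      (Grow s {.or Z (bigAnd D)}) := by
  induction D with
  | nil => exact DTr.nil ⟨rfl, fun _ h => h, by rintro A rfl; exact h'⟩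
  | cons A D ih =>
    simp only [suffixes, List.reverse_cons, List.flatMap_append, List.flatMap_cons,
      List.flatMap_nil, List.append_nil]
    refine (ih (fun B hB => hD B (List.mem_cons_of_mem _ hB))
      fun B hB => h B (List.mem_cons_of_mem _ hB)).grow_append_right fun s' hs' => ?_
    refine inst_derives orAndRule_sound ?_ ?_
    · rw [hs'.1]
      simp only [List.mem_cons, List.not_mem_nil, or_false, forall_eq_or_imp, forall_eq]
      exact ⟨hZ, hD A List.mem_cons_self,
        varsIn_bigAnd fun B hB => hD B (List.mem_cons_of_mem _ hB)⟩
    · simp only [orAndRule, List.mem_cons, List.not_mem_nil, or_false, forall_eq_or_imp, forall_eq]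
      exact ⟨hs'.2.1 (h A List.mem_cons_self), hs'.2.2 _ rfl⟩

theorem negMatrixSteps_derives {ps : List (ℕ × Clause)}
    (hM : .neg (bigAnd (ps.map fun p => Clause.toFm p.2)) ∈ M)
    (hv : ∀ p ∈ ps, ClauseIn s.pre (⟨p.1, false⟩ :: p.2))
    (h : ∀ p ∈ ps, Clause.toFm (⟨p.1, false⟩ :: p.2) ∈ s.lines) :
    DTr F M s (negMatrixSteps F ps)
      (Grow s {Clause.toFm (ps.map fun p => ⟨p.1, false⟩)}) := by
  unfold negMatrixSteps
  simp only
  set Z : Clause := ps.map fun p => ⟨p.1, false⟩ with hZdef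
  have hZ : ClauseIn s.pre Z := by
    intro k hk
    obtain ⟨p, hp, rfl⟩ := List.mem_map.1 hk
    exact (hv p hp).of_cons.1
  have hD : ∀ A ∈ ps.map (fun p => Clause.toFm p.2), VarsIn s.pre A := by
    intro A hA
    obtain ⟨p, hp, rfl⟩ := List.mem_map.1 hA
    exact (hv p hp).of_cons.2.varsIn
  have h0 : DTr F M s [.ax (.neg (bigAnd (ps.map fun p => Clause.toFm p.2)))]
      (Grow s {.neg (bigAnd (ps.map fun p => Clause.toFm p.2))}) :=
    DTr.cons hM (DTr.nil ⟨rfl, List.subset_cons_self _ _, by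
      rintro A rfl; exact List.mem_cons_self⟩)
  have h1 := h0.grow_append fun s1 hs1 => DTr.grow_flatMap (F := F) (M := M) (s := s1)
    (f := fun p => tautology F Z ⟨p.1, false⟩ ++
      inst F cutRule [.var p.1, Clause.toFm p.2, Z.toFm])
    (G := fun p => {.or Z.toFm (Clause.toFm p.2)}) ps (by
      intro p hp s2 hs2
      have hpre2 := hs2.1.trans hs1.1
      refine (tautology_derives (by rwa [hpre2]) (List.mem_map_of_mem hp)).grow_append_right
        fun s3 hs3 => ?_
      have hpre3 := hs3.1.trans hpre2
      refine inst_derives cutRule_sound ?_ ?_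
      · rw [hpre3]
        simp only [List.mem_cons, List.not_mem_nil, or_false, forall_eq_or_imp, forall_eq]
        exact ⟨varsIn_var (hv p hp).of_cons.1, (hv p hp).of_cons.2.varsIn, hZ.varsIn⟩
      · simp only [cutRule, List.mem_cons, List.not_mem_nil, or_false, forall_eq_or_imp,
          forall_eq]
        exact ⟨hs3.2.2 _ rfl, hs3.2.1 (hs2.2.1 (hs1.2.1 (h p hp)))⟩)
  have h2 := h1.grow_append fun s2 hs2 => (inst_derives (F := F) (M := M) (s := s2)
    orTopRule_sound (args := [Z.toFm]) (by rw [hs2.1]; simp [hZ.varsIn]) (by simp [orTopRule]))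
  have h3 := h2.grow_append fun s3 hs3 => orBigAnd_derives (F := F) (M := M) (s := s3)
    (Z := Z.toFm) (by rw [hs3.1]; exact hZ.varsIn) _ (by rwa [hs3.1]) (by
      intro A hA
      obtain ⟨p, hp, rfl⟩ := List.mem_map.1 hA
      exact hs3.2.2 _ (Or.inl (Or.inr ⟨p, hp, rfl⟩))) (hs3.2.2 _ (Or.inr rfl))
  refine h3.grow_append_right fun s4 hs4 => inst_derives orNegRule_sound ?_ ?_
  · rw [hs4.1]
    simp only [List.mem_cons, List.not_mem_nil, or_false, forall_eq_or_imp, forall_eq]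
    exact ⟨hZ.varsIn, varsIn_bigAnd hD⟩
  · simp only [orNegRule, List.mem_cons, List.not_mem_nil, or_false, forall_eq_or_imp, forall_eq]
    exact ⟨hs4.2.2 _ (Or.inr rfl), hs4.2.2 _ (Or.inl (Or.inl (Or.inl rfl)))⟩

theorem Sim.of_grow {S : SState} {i : Item} {s' : DState} {G : Set Fm} (h : Sim S s)
    (hg : Grow s G s') (hp : (i.apply S).pre = S.pre) (hc : ∀ C ∈ i.clauses, C.toFm ∈ G) :
    Sim (i.apply S) s' := by
  refine ⟨by rw [hp, hg.1, h.1], fun C hC => ?_⟩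
  rcases List.mem_append.1 hC with hC | hC
  · exact hg.2.2 _ (hc C hC)
  · exact hg.2.1 (h.2 C hC)

/-- The induction step of the translation: a script state is matched by a state of the DQBF system
with the same prefix whose lines include all clauses of the script. Additional lines are harmless,
as lines are never removed. -/
theorem compile_correct {S : SState} {i : Item} (h : Sim S s) (hS : S.Inv) (hi : i.Ok M S) :
    DTr F M s (i.compile F S.Γ) (Sim (i.apply S)) := by
  have hpre := h.1
  cases i with
  | newAll u =>
    refine DTr.cons (by simpa [DStep.Ok, Item.Ok, hpre] using hi) (DTr.nil ⟨?_, ?_⟩)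
    · simp [DStep.apply, Item.apply, hpre]
    · simpa [Item.apply, Item.clauses, DStep.apply] using h.2
  | newEx x =>
    refine DTr.cons (by simpa [DStep.Ok, Item.Ok, hpre] using hi) (DTr.nil ⟨?_, ?_⟩)
    · simp [DStep.apply, Item.apply, hpre]
    · simpa [Item.apply, Item.clauses, DStep.apply] using h.2
  | ax C =>
    refine DTr.cons hi.1 (DTr.nil ⟨hpre, ?_⟩)
    intro C' hC'
    rcases List.mem_cons.1 hC' with rfl | hC'
    · exact List.mem_cons_self
    · exact List.mem_cons_of_mem _ (h.2 C' hC')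
  | axNeg ps =>
    refine (negMatrixSteps_derives hi.1 (fun p hp => ?_) fun p hp => h.2 _ (hi.2 p hp)).mono
      fun s' hs' => h.of_grow hs' rfl ?_
    · rw [hpre]; exact hS.1 _ (hi.2 p hp)
    · intro C hC
      obtain rfl := List.mem_singleton.1 hC
      rfl
  | rup C =>
    refine (rupSteps_derives (by rw [hpre]; exact hS.1) (by rw [hpre]; exact hi.1) h.2 hi.2).mono
      fun s' hs' => h.of_grow hs' rfl ?_
    intro C' hC'
    obtain rfl := List.mem_singleton.1 hC'
    rfl
  | red l R =>
    have hR := (hS.1 _ hi.1).of_cons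
    have hnot : l.var ∉ R.toFm.vars := by
      rw [Clause.mem_vars_toFm]
      rintro ⟨k, hk, e⟩
      exact (hi.2.2 k hk).1 e
    have h1 : DTr F M s [.red (Clause.toFm (l :: R)) l.var (!l.pos)]
        (Grow s {.or (if l.pos then .bot else .neg .top) R.toFm}) := by
      refine DTr.cons ⟨h.2 _ hi.1, by rw [hpre]; exact hi.2.1, ?_⟩
        (DTr.nil ⟨rfl, List.subset_cons_self _ _, ?_⟩)
      · rw [hpre]
        intro x hx hx'
        obtain ⟨k, hk, rfl⟩ := Clause.mem_vars_toFm.1 hx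
        rcases List.mem_cons.1 hk with rfl | hk
        · exact (hS.2 _ hi.2.1 hx').elim
        · exact (hi.2.2 k hk).2 hx'
      · rintro A rfl
        refine List.mem_cons.2 (Or.inl ?_)
        rw [← setVar_lit l]
        conv_lhs => rw [← setVar_of_not_mem (b := !l.pos) hnot]
        rfl
    refine (h1.grow_append (H := {R.toFm}) fun s' hs' => ?_).mono
      fun s' hs' => h.of_grow hs' rfl ?_
    · rw [instPol_eq]
      refine inst_derives (reduceRule_sound _) ?_ ?_
      · rw [hs'.1, hpre]; simp [hR.2.varsIn]
      · simp only [reduceRule, List.mem_cons, List.not_mem_nil, or_false, forall_eq]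
        have := hs'.2.2 _ rfl
        cases hp : l.pos <;> rw [hp] at this <;> exact this
    · intro C hC
      obtain rfl := List.mem_singleton.1 hC
      exact Or.inr rfl
  | defOr v Y =>
    have h1 : DTr F M s [.extOr v [] Y] (fun s' => s'.pre = (Item.apply S (.defOr v Y)).pre ∧
        Fm.imp .top (.iff (.var v) Y.toFm) ∈ s'.lines ∧ s.lines ⊆ s'.lines) := by
      refine DTr.cons ⟨by rw [hpre]; exact hi.1, by simp, by rw [hpre]; exact hi.2⟩
        (DTr.nil ⟨?_, List.mem_cons_self, List.subset_cons_self _ _⟩)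
      simp [DStep.apply, Item.apply, hpre]
    have hcl := clauseIn_clauses hS hi
    have hvn := ((hcl _ List.mem_cons_self).of_cons).1
    have hYn := ((hcl _ List.mem_cons_self).of_cons).2
    simp only [Item.compile, List.append_assoc]
    refine h1.append fun s1 ⟨hp1, hl1, hsub⟩ => ?_
    have h2 : DTr F M s1 (inst F defPosRule [.var v, Y.toFm])
        (Grow s1 {Clause.toFm (⟨v, false⟩ :: Y)}) := by
      refine inst_derives defPosRule_sound ?_ ?_
      · rw [hp1]; simp [varsIn_var hvn, hYn.varsIn]
      · simpa [defPosRule, Fm.subst, argSubst, Fm.iff] using hl1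
    have h3 := h2.grow_append fun s2 hs2 => DTr.grow_flatMap (F := F) (M := M) (s := s2)
      (f := fun y => tautology F Y y ++ inst F defNegRule [.var v, Y.toFm, y.neg.toFm])
      (G := fun y => {Clause.toFm [⟨v, true⟩, y.neg]}) Y (by
        intro y hy s3 hs3
        have hp3 := hs3.1.trans (hs2.1.trans hp1)
        refine (tautology_derives (by rwa [hp3]) hy).grow_append_right fun s4 hs4 => ?_
        refine inst_derives defNegRule_sound ?_ ?_
        · rw [hs4.1, hp3]
          simp only [List.mem_cons, List.not_mem_nil, or_false, forall_eq_or_imp, forall_eq]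
          exact ⟨varsIn_var hvn, hYn.varsIn, varsIn_lit (l := y.neg) (hYn y hy)⟩
        · simp only [defNegRule, List.mem_cons, List.not_mem_nil, or_false, forall_eq_or_imp,
            forall_eq]
          exact ⟨hs4.2.1 (hs3.2.1 (hs2.2.1 hl1)), hs4.2.2 _ rfl⟩)
    refine h3.mono fun s4 hs4 => ⟨hs4.1.trans hp1, fun C hC => ?_⟩
    rcases List.mem_append.1 hC with hC | hC
    · rcases List.mem_cons.1 hC with rfl | hC
      · exact hs4.2.2 _ (Or.inl rfl)
      · obtain ⟨y, hy, rfl⟩ := List.mem_map.1 hC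
        exact hs4.2.2 _ (Or.inr ⟨y, hy, rfl⟩)
    · exact hs4.2.1 (hsub (h.2 C hC))
  | defIf v a x =>
    have h1 : DTr F M s [.extOr v [a] [⟨x, true⟩]]
        (fun s' => s'.pre = (Item.apply S (.defIf v a x)).pre ∧
        Fm.imp (.and a.toFm .top) (.iff (.var v) (.or (.var x) .bot)) ∈ s'.lines ∧
        s.lines ⊆ s'.lines) := by
      refine DTr.cons ⟨by rw [hpre]; exact hi.1, by rw [hpre]; simpa using hi.2.1,
        by rw [hpre]; simpa using hi.2.2⟩
        (DTr.nil ⟨?_, List.mem_cons_self, List.subset_cons_self _ _⟩)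
      simp [DStep.apply, Item.apply, hpre]
    have hcl := clauseIn_clauses hS hi
    have hc := (hcl _ List.mem_cons_self)
    have ha : a.var ∈ (Item.apply S (.defIf v a x)).pre.names := hc a.neg (by simp)
    have hv : v ∈ (Item.apply S (.defIf v a x)).pre.names := hc ⟨v, false⟩ (by simp)
    have hx : x ∈ (Item.apply S (.defIf v a x)).pre.names := hc ⟨x, true⟩ (by simp)
    simp only [Item.compile, List.append_assoc, instPol_eq]
    refine h1.append fun s1 ⟨hp1, hl1, hsub⟩ => ?_
    have hargs : ∀ A ∈ [Fm.var a.var, .var v, .var x],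
        VarsIn (Item.apply S (.defIf v a x)).pre A := by
      simp [varsIn_var ha, varsIn_var hv, varsIn_var hx]
    have h2 : DTr F M s1 (inst F (ifPosRule a.pos) [.var a.var, .var v, .var x])
        (Grow s1 {Clause.toFm [a.neg, ⟨v, false⟩, ⟨x, true⟩]}) := by
      refine (inst_derives (ifPosRule_sound _) (by rwa [hp1]) ?_).mono fun s2 hs2 => ?_
      · simp only [ifPosRule, List.mem_cons, List.not_mem_nil, or_false, forall_eq, Fm.subst,
          litPat_subst, Fm.iff]
        exact hl1
      · simp only [ifPosRule, Fm.subst, litPat_not_subst] at hs2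
        exact hs2
    have h3 := h2.grow_append fun s2 hs2 =>
        (show DTr F M s2 (inst F (ifNegRule a.pos) [.var a.var, .var v, .var x])
        (Grow s2 {Clause.toFm [a.neg, ⟨v, true⟩, ⟨x, false⟩]}) by
      refine (inst_derives (ifNegRule_sound _) (by rwa [hs2.1, hp1]) ?_).mono fun s3 hs3 => ?_
      · simp only [ifNegRule, List.mem_cons, List.not_mem_nil, or_false, forall_eq, Fm.subst,
          litPat_subst, Fm.iff]
        exact hs2.2.1 hl1
      · simp only [ifNegRule, Fm.subst, litPat_not_subst] at hs3
        exact hs3)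
    refine h3.mono fun s4 hs4 => ⟨hs4.1.trans hp1, fun C hC => ?_⟩
    rcases List.mem_append.1 hC with hC | hC
    · simp only [Item.clauses, List.mem_cons, List.not_mem_nil, or_false] at hC
      rcases hC with rfl | rfl
      · exact hs4.2.2 _ (Or.inl rfl)
      · exact hs4.2.2 _ (Or.inr rfl)
    · exact hs4.2.1 (hsub (h.2 C hC))

/-! #### Scripts -/

/-- The script is correct from the state `S`, and its result has the property `P`. -/
def STr (M : List Fm) : SState → List Item → (SState → Prop) → Prop
  | S, [], P => P S
  | S, i :: is, P => i.Ok M S ∧ STr M (i.apply S) is P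

/-- The translation of a script. -/
noncomputable def compileScript (F : FregeSystem) (is : List Item) : List DStep :=
  (suffixes is.reverse).reverse.flatMap fun p => p.1.compile F (p.2.flatMap Item.clauses)

/-- A propagation step needs all earlier clauses, so each instruction is compiled together with the
instructions before it, which form a suffix of the reversed script. The induction generalizes over
this history. -/
theorem compileScript_correct {is : List Item} {P : DPrefix} {Q : SState → Prop}
    (hinv : SState.Inv ⟨P, []⟩) (h : STr M ⟨P, []⟩ is Q) :
    DTr F M ⟨P, []⟩ (compileScript F is) (fun s => ∃ S, Sim S s ∧ S.Inv ∧ Q S) := by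
  have key : ∀ (is hist : List Item) (S : SState) (s : DState), S.Γ = hist.flatMap Item.clauses →
      S.Inv → Sim S s → STr M S is Q →
      DTr F M s ((suffixes is.reverse).reverse.flatMap fun p =>
        p.1.compile F ((p.2 ++ hist).flatMap Item.clauses))
        (fun s => ∃ S, Sim S s ∧ S.Inv ∧ Q S) := by
    intro is
    induction is with
    | nil => intro hist S s _ hinv hsim h; exact DTr.nil ⟨S, hsim, hinv, h⟩
    | cons i is ih =>
      intro hist S s hΓ hinv hsim h
      rw [List.reverse_cons, suffixes_append, List.reverse_append, List.flatMap_append]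
      have h1 := compile_correct (F := F) hsim hinv h.1
      simp only [suffixes, List.reverse_cons, List.reverse_nil, List.nil_append,
        List.flatMap_cons, List.flatMap_nil, List.append_nil]
      rw [← hΓ]
      refine h1.append fun s' hs' => ?_
      have := ih (i :: hist) (i.apply S) s' (by simp [Item.apply, hΓ]) (inv_apply hinv h.1) hs' h.2
      rw [← List.map_reverse, List.flatMap_map]
      simpa using this
  simpa [compileScript] using key is [] ⟨P, []⟩ ⟨P, []⟩ rfl hinv ⟨rfl, by simp⟩ h

/-! ### Running time of the translation of scripts -/

section
variable {A : Type} [Enc A]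

instance : Enc Item := ⟨fun i => Enc.enc i.view⟩

@[fun_prop]
theorem PT.view {f : A → Item} (hf : PT f) : PT fun a => (f a).view :=
  PT.of_enc hf fun _ => rfl

@[fun_prop]
theorem PT.item_newAll {f : A → ℕ} (hf : PT f) : PT fun a => Item.newAll (f a) :=
  PT.of_enc (g := fun a => (Item.newAll (f a)).view) (by simp only [Item.view]; fun_prop)
    fun _ => rfl

@[fun_prop]
theorem PT.item_newEx {f : A → ℕ} (hf : PT f) : PT fun a => Item.newEx (f a) :=
  PT.of_enc (g := fun a => (Item.newEx (f a)).view) (by simp only [Item.view]; fun_prop)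
    fun _ => rfl

@[fun_prop]
theorem PT.item_ax {f : A → List Lit} (hf : PT f) : PT fun a => Item.ax (f a) :=
  PT.of_enc (g := fun a => (Item.ax (f a)).view) (by simp only [Item.view]; fun_prop)
    fun _ => rfl

@[fun_prop]
theorem PT.item_axNeg {f : A → List (ℕ × List Lit)} (hf : PT f) :
    PT fun a => Item.axNeg (f a) :=
  PT.of_enc (g := fun a => (Item.axNeg (f a)).view) (by simp only [Item.view]; fun_prop)
    fun _ => rfl

@[fun_prop]
theorem PT.item_defOr {v : A → ℕ} {f : A → List Lit} (hv : PT v) (hf : PT f) :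
    PT fun a => Item.defOr (v a) (f a) :=
  PT.of_enc (g := fun a => (Item.defOr (v a) (f a)).view) (by simp only [Item.view]; fun_prop)
    fun _ => rfl

@[fun_prop]
theorem PT.item_defIf {v x : A → ℕ} {l : A → Lit} (hv : PT v) (hl : PT l) (hx : PT x) :
    PT fun a => Item.defIf (v a) (l a) (x a) :=
  PT.of_enc (g := fun a => (Item.defIf (v a) (l a) (x a)).view)
    (by simp only [Item.view]; fun_prop) fun _ => rfl

@[fun_prop]
theorem PT.item_rup {f : A → List Lit} (hf : PT f) : PT fun a => Item.rup (f a) :=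
  PT.of_enc (g := fun a => (Item.rup (f a)).view) (by simp only [Item.view]; fun_prop)
    fun _ => rfl

@[fun_prop]
theorem PT.item_red {f : A → List Lit} {l : A → Lit} (hl : PT l) (hf : PT f) :
    PT fun a => Item.red (l a) (f a) :=
  PT.of_enc (g := fun a => (Item.red (l a) (f a)).view) (by simp only [Item.view]; fun_prop)
    fun _ => rfl

@[fun_prop]
theorem PT.clauses {f : A → Item} (hf : PT f) : PT fun a => (f a).clauses := by
  have h : PT fun w : ℕ × (ℕ × (Lit × (List Lit × List (ℕ × List Lit)))) =>
      bif decide (w.1 = 0) || decide (w.1 = 1) then ([] : List (List Lit))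
      else bif decide (w.1 = 3) then [w.2.2.2.2.map fun p => (⟨p.1, false⟩ : Lit)]
      else bif decide (w.1 = 4) then (⟨w.2.1, false⟩ :: w.2.2.2.1) ::
        w.2.2.2.1.map fun y => [(⟨w.2.1, true⟩ : Lit), y.neg]
      else bif decide (w.1 = 5) then
        [w.2.2.1.neg :: (⟨w.2.1, false⟩ : Lit) :: w.2.2.2.1,
          w.2.2.1.neg :: (⟨w.2.1, true⟩ : Lit) :: w.2.2.2.1.map Lit.neg]
      else [w.2.2.2.1] := by fun_prop
  refine PT.of_enc (PT.comp h (PT.view hf)) fun a => ?_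
  congr 1
  cases f a <;> rfl

@[fun_prop]
theorem PT.negMatrixSteps {f : A → List (ℕ × List Lit)} (hf : PT f) :
    PT fun a => negMatrixSteps F (f a) := by
  unfold QBFSim.negMatrixSteps
  fun_prop

-- The case distinction on instructions becomes a chain of tests on the numerical tag in
-- `Item.view`.
@[fun_prop]
theorem PT.compile {f : A → Item} {Γ : A → List (List Lit)} (hΓ : PT Γ) (hf : PT f) :
    PT fun a => (f a).compile F (Γ a) := by
  have h : PT fun p : List (List Lit) × (ℕ × (ℕ × (Lit × (List Lit × List (ℕ × List Lit))))) =>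
      bif decide (p.2.1 = 0) then [DStep.newAll p.2.2.1]
      else bif decide (p.2.1 = 1) then [DStep.newEx p.2.2.1 []]
      else bif decide (p.2.1 = 2) then [DStep.ax (Clause.toFm p.2.2.2.2.1)]
      else bif decide (p.2.1 = 3) then QBFSim.negMatrixSteps F p.2.2.2.2.2
      else bif decide (p.2.1 = 4) then [DStep.extOr p.2.2.1 [] p.2.2.2.2.1] ++
        QBFSim.inst F defPosRule [.var p.2.2.1, Clause.toFm p.2.2.2.2.1] ++
        p.2.2.2.2.1.flatMap fun y => QBFSim.tautology F p.2.2.2.2.1 y ++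
          QBFSim.inst F defNegRule [.var p.2.2.1, Clause.toFm p.2.2.2.2.1, y.neg.toFm]
      else bif decide (p.2.1 = 5) then
        -- For `defIf` the view stores the copied variable as a one-element clause, and `flatMap`
        -- reads it out.
        p.2.2.2.2.1.flatMap fun x => [DStep.extOr p.2.2.1 [p.2.2.2.1] [⟨x.var, true⟩]] ++
        QBFSim.instPol F ifPosRule p.2.2.2.1.pos [.var p.2.2.2.1.var, .var p.2.2.1, .var x.var] ++
        QBFSim.instPol F ifNegRule p.2.2.2.1.pos [.var p.2.2.2.1.var, .var p.2.2.1, .var x.var]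
      else bif decide (p.2.1 = 6) then QBFSim.rupSteps F p.1 p.2.2.2.2.1
      else [DStep.red (Clause.toFm (p.2.2.2.1 :: p.2.2.2.2.1)) p.2.2.2.1.var (!p.2.2.2.1.pos)] ++
        QBFSim.instPol F reduceRule p.2.2.2.1.pos [Clause.toFm p.2.2.2.2.1] := by fun_prop
  refine PT.of_enc (PT.comp h (PT.pair hΓ (PT.view hf))) fun a => ?_
  congr 1
  cases f a <;> simp [Item.view, Item.compile]

@[fun_prop]
theorem PT.compileScript {f : A → List Item} (hf : PT f) : PT fun a => compileScript F (f a) := by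
  unfold QBFSim.compileScript
  fun_prop

end

end QBFSim
namespace QBFSim

/-! ### Prefixes -/

theorem names_nodup_snd {Q : Prefix} (h : Q.names.Nodup) {q q' : Quant} {x : ℕ}
    (h1 : (q, x) ∈ Q) (h2 : (q', x) ∈ Q) : q = q' := by
  have := List.inj_on_of_nodup_map h h1 h2 rfl
  exact (Prod.ext_iff.1 this).1

theorem mem_names {Q : Prefix} {x : ℕ} : x ∈ Q.names ↔ (Quant.all, x) ∈ Q ∨ (Quant.ex, x) ∈ Q := by
  constructor
  · intro h
    obtain ⟨⟨q, y⟩, h', rfl⟩ := List.mem_map.1 h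
    cases q
    · exact Or.inl ‹_›
    · exact Or.inr ‹_›
  · rintro (h | h)
    · exact List.mem_map.2 ⟨_, h, rfl⟩
    · exact List.mem_map.2 ⟨_, h, rfl⟩

/-- `x` is an existential variable to the right of the universal variable `u`. -/
def Prefix.LeftAll (Q : Prefix) (u x : ℕ) : Prop :=
  ∃ Q₁ Q₂ : Prefix, Q = Q₁ ++ (Quant.all, u) :: Q₂ ∧ (Quant.ex, x) ∈ Q₂

theorem leftAll_cons {Q : Prefix} {q : Quant} {y u x : ℕ} :
    Prefix.LeftAll ((q, y) :: Q) u x ↔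
      (q = Quant.all ∧ y = u ∧ (Quant.ex, x) ∈ Q) ∨ Q.LeftAll u x := by
  constructor
  · rintro ⟨Q₁, Q₂, h, hx⟩
    cases Q₁ with
    | nil =>
      simp only [List.nil_append, List.cons.injEq, Prod.mk.injEq] at h
      obtain ⟨⟨rfl, rfl⟩, rfl⟩ := h
      exact Or.inl ⟨rfl, rfl, hx⟩
    | cons e Q₁ =>
      simp only [List.cons_append, List.cons.injEq] at h
      exact Or.inr ⟨Q₁, Q₂, h.2, hx⟩
  · rintro (⟨rfl, rfl, hx⟩ | ⟨Q₁, Q₂, rfl, hx⟩)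
    · exact ⟨[], Q, rfl, hx⟩
    · exact ⟨(q, y) :: Q₁, Q₂, rfl, hx⟩

theorem Prefix.LeftAll.mem {Q : Prefix} {u x : ℕ} (h : Q.LeftAll u x) :
    (Quant.all, u) ∈ Q ∧ (Quant.ex, x) ∈ Q := by
  obtain ⟨Q₁, Q₂, rfl, hx⟩ := h
  simp [hx]

theorem Prefix.LeftAll.sublist {Q Q' : Prefix} {u x : ℕ} (h : Q.LeftAll u x)
    (hs : Q.Sublist Q') : Q'.LeftAll u x := by
  induction hs with
  | slnil => exact h
  | cons e _ ih => exact leftAll_cons.2 (Or.inr (ih h))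
  | cons_cons e hs ih =>
    rcases leftAll_cons.1 h with ⟨h1, h2, h3⟩ | h
    · exact leftAll_cons.2 (Or.inl ⟨h1, h2, hs.subset h3⟩)
    · exact leftAll_cons.2 (Or.inr (ih h))

/-- The dependency set of a variable of a linear prefix. -/
def depOf (Q : Prefix) (x : ℕ) : List ℕ :=
  bif decide ((Quant.all, x) ∈ Q) then [x]
  else (suffixes Q).flatMap fun p =>
    bif decide (p.1.1 = Quant.all) && decide ((Quant.ex, x) ∈ p.2) then [p.1.2] else []

theorem mem_depOf {Q : Prefix} {u x : ℕ} (hx : (Quant.all, x) ∉ Q) :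
    u ∈ depOf Q x ↔ Q.LeftAll u x := by
  simp only [depOf, hx, decide_false, cond_false, List.mem_flatMap, mem_suffixes]
  constructor
  · rintro ⟨⟨⟨q, y⟩, R⟩, ⟨Q₁, hQ⟩, h⟩
    simp only [Bool.cond_eq_ite, Bool.and_eq_true, decide_eq_true_eq] at h
    split at h
    · rename_i h'
      obtain ⟨rfl, h3⟩ := h'
      obtain rfl := List.mem_singleton.1 h
      exact ⟨Q₁, R, hQ, h3⟩
    · simp at h
  · rintro ⟨Q₁, Q₂, hQ, h⟩
    exact ⟨((Quant.all, u), Q₂), ⟨Q₁, hQ⟩, by simp [h]⟩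

theorem depOf_all {Q : Prefix} {u : ℕ} (h : (Quant.all, u) ∈ Q) : depOf Q u = [u] := by
  simp [depOf, h]

theorem mem_univ_toD {Q : Prefix} {u : ℕ} : u ∈ Q.toD.univ ↔ (Quant.all, u) ∈ Q := by
  simp only [Prefix.toD, List.mem_map, List.mem_filter, decide_eq_true_eq]
  constructor
  · rintro ⟨⟨q, y⟩, ⟨h, h'⟩, rfl⟩
    simp only at h'
    exact h' ▸ h
  · intro h
    exact ⟨_, ⟨h, rfl⟩, rfl⟩

theorem mem_exDeps {Q : Prefix} : ∀ {U : List ℕ} {x : ℕ},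
    x ∈ (Q.exDeps U).map Prod.fst ↔ (Quant.ex, x) ∈ Q := by
  induction Q with
  | nil => simp [Prefix.exDeps]
  | cons e Q ih =>
    intro U x
    obtain ⟨q, y⟩ := e
    cases q
    · simp [Prefix.exDeps, ← ih (U := U ++ [y])]
    · simp [Prefix.exDeps, ← ih (U := U), eq_comm]

theorem mem_exNames_toD {Q : Prefix} {x : ℕ} : x ∈ Q.toD.exNames ↔ (Quant.ex, x) ∈ Q :=
  mem_exDeps

theorem mem_names_toD {Q : Prefix} {x : ℕ} : x ∈ Q.toD.names ↔ x ∈ Q.names := by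
  rw [DPrefix.names, List.mem_append, mem_univ_toD, mem_exNames_toD, mem_names]

theorem exDeps_lookup {Q : Prefix} (hQ : Q.names.Nodup) : ∀ {U : List ℕ} {x : ℕ},
    (Quant.ex, x) ∈ Q → ∃ D, (Q.exDeps U).lookup x = some D ∧
      ∀ u, u ∈ D ↔ u ∈ U ∨ Q.LeftAll u x := by
  induction Q with
  | nil => intro U x h; simp at h
  | cons e Q ih =>
    intro U x h
    obtain ⟨q, y⟩ := e
    have hQ' : y ∉ Prefix.names Q ∧ (Prefix.names Q).Nodup := List.nodup_cons.1 hQ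
    cases q
    · have hx : (Quant.ex, x) ∈ Q := by simpa using h
      obtain ⟨D, h1, h2⟩ := ih hQ'.2 (U := U ++ [y]) hx
      refine ⟨D, h1, fun u => ?_⟩
      rw [h2, leftAll_cons]
      simp [hx, eq_comm, or_assoc]
    · by_cases hxy : x = y
      · subst hxy
        refine ⟨U, by simp [Prefix.exDeps], fun u => ?_⟩
        have : ¬ Prefix.LeftAll ((Quant.ex, x) :: Q) u x := by
          intro h
          rcases leftAll_cons.1 h with ⟨h, _⟩ | h
          · cases h
          · exact hQ'.1 (mem_names.2 (Or.inr h.mem.2))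
        simp [this]
      · have hx : (Quant.ex, x) ∈ Q := by simpa [hxy] using h
        obtain ⟨D, h1, h2⟩ := ih hQ'.2 (U := U) hx
        refine ⟨D, ?_, fun u => ?_⟩
        · have : (x == y) = false := by simpa using hxy
          simp [Prefix.exDeps, List.lookup_cons, this, h1]
        · rw [h2, leftAll_cons]
          simp

theorem mem_dep_toD {Q : Prefix} (hQ : Q.names.Nodup) {u x : ℕ} :
    u ∈ Q.toD.dep x ↔ u ∈ depOf Q x := by
  unfold DPrefix.dep
  by_cases hx : (Quant.all, x) ∈ Q
  · simp [hx, depOf, mem_univ_toD]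
  · rw [if_neg (mem_univ_toD.not.2 hx), mem_depOf hx]
    by_cases hx' : (Quant.ex, x) ∈ Q
    · obtain ⟨D, h1, h2⟩ := exDeps_lookup hQ (U := []) hx'
      simp [Prefix.toD, h1, h2]
    · have h1 : (Q.exDeps []).lookup x = none := by
        rw [List.lookup_eq_none_iff]
        intro p hp
        have : p.1 ≠ x := fun e => hx' (mem_exDeps.1 (List.mem_map.2 ⟨p, hp, e⟩))
        simpa using fun e => this e.symm
      simp only [Prefix.toD, h1, Option.getD_none, List.not_mem_nil, false_iff]
      exact fun h => hx' h.mem.2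

/-- A prefix extension only enlarges dependency sets, so dependency bounds for existing copies
survive it. -/
theorem depOf_sublist {Q Q' : Prefix} (hs : Q.Sublist Q') (hQ : Q'.names.Nodup) {x : ℕ} :
    depOf Q x ⊆ depOf Q' x := by
  intro u hu
  by_cases hx : (Quant.all, x) ∈ Q
  · rw [depOf_all hx] at hu
    rwa [depOf_all (hs.subset hx)]
  · rw [mem_depOf hx] at hu
    have h := hu.sublist hs
    have hx' : (Quant.all, x) ∉ Q' := fun h' => by
      have := names_nodup_snd hQ h' h.mem.2
      cases this
    rwa [mem_depOf hx']

/-- The existential variables to the right of `u`. -/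
def exRight (Q : Prefix) (u : ℕ) : List ℕ :=
  (suffixes Q).flatMap fun p => bif decide (p.1.2 = u) then
    (p.2.filter fun e => decide (e.1 = Quant.ex)).map Prod.snd else []

theorem mem_exRight {Q : Prefix} {u x : ℕ} : x ∈ exRight Q u ↔ Q.ExRightOf u x := by
  simp only [exRight, List.mem_flatMap, mem_suffixes, Prefix.ExRightOf]
  constructor
  · rintro ⟨⟨⟨q, y⟩, R⟩, ⟨Q₁, hQ⟩, h⟩
    by_cases hy : y = u
    · simp only [hy, decide_true, cond_true, List.mem_map, List.mem_filter,
        decide_eq_true_eq] at h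
      obtain ⟨⟨q', z⟩, ⟨h1, h2⟩, rfl⟩ := h
      simp only at h2
      exact ⟨Q₁, R, q, hy ▸ hQ, h2 ▸ h1⟩
    · simp [hy] at h
  · rintro ⟨Q₁, Q₂, q, hQ, h⟩
    exact ⟨((q, u), Q₂), ⟨Q₁, hQ⟩, by simpa using h⟩

theorem exRight_mem {Q : Prefix} {u x : ℕ} (h : x ∈ exRight Q u) : (Quant.ex, x) ∈ Q := by
  obtain ⟨Q₁, Q₂, q, rfl, h'⟩ := mem_exRight.1 h
  simp [h']

theorem leftAll_iff_exRight {Q : Prefix} (hQ : Q.names.Nodup) {u x : ℕ}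
    (hu : (Quant.all, u) ∈ Q) : Q.LeftAll u x ↔ x ∈ exRight Q u := by
  rw [mem_exRight]
  constructor
  · rintro ⟨Q₁, Q₂, h, hx⟩
    exact ⟨Q₁, Q₂, _, h, hx⟩
  · rintro ⟨Q₁, Q₂, q, h, hx⟩
    have : q = Quant.all := names_nodup_snd hQ (x := u) (by rw [h]; simp) hu
    exact ⟨Q₁, Q₂, this ▸ h, hx⟩

/-! #### Quantifier levels -/

theorem le_levelFrom {Q : Prefix} : ∀ {q : Quant} {n x : ℕ}, n ≤ Q.levelFrom q n x := by
  induction Q with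
  | nil => intro q n x; exact le_rfl
  | cons e Q ih =>
    intro q n x
    obtain ⟨q', y⟩ := e
    simp only [Prefix.levelFrom]
    have := ih (q := q') (n := if q' = q then n else n + 1) (x := x)
    split_ifs at this ⊢ <;> omega

/-- A variable whose quantifier differs from that of the current block lies in a later block. -/
theorem lt_levelFrom {Q : Prefix} (hQ : Q.names.Nodup) : ∀ {q q' : Quant} {n x : ℕ},
    (q', x) ∈ Q → q' ≠ q → n < Q.levelFrom q n x := by
  induction Q with
  | nil => intro q q' n x h; simp at h
  | cons e Q ih =>
    intro q q' n x h hq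
    obtain ⟨q₁, y⟩ := e
    have hQ' : y ∉ Prefix.names Q ∧ (Prefix.names Q).Nodup := List.nodup_cons.1 hQ
    simp only [Prefix.levelFrom]
    rcases List.mem_cons.1 h with h | hm
    · obtain ⟨rfl, rfl⟩ := Prod.mk.inj h
      simp [hq]
    · have hxy : x ≠ y := by
        rintro rfl
        exact hQ'.1 (List.mem_map_of_mem (f := Prod.snd) hm)
      rw [if_neg hxy]
      by_cases h1 : q₁ = q
      · rw [if_pos h1]
        exact ih hQ'.2 hm (h1 ▸ hq)
      · rw [if_neg h1]
        have := le_levelFrom (Q := Q) (q := q₁) (n := n + 1) (x := x)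
        omega

theorem levelFrom_order {Q : Prefix} (hQ : Q.names.Nodup) : ∀ {Q₁ Q₂ : Prefix} {q q₁ q' : Quant}
    {n a b : ℕ}, Q = Q₁ ++ (q₁, a) :: Q₂ → (q', b) ∈ Q₂ →
    Q.levelFrom q n a ≤ Q.levelFrom q n b ∧
      (q₁ ≠ q' → Q.levelFrom q n a < Q.levelFrom q n b) := by
  induction Q with
  | nil => intro Q₁ Q₂ q q₁ q' n a b h; simp at h
  | cons e Q ih =>
    intro Q₁ Q₂ q q₁ q' n a b h hb
    obtain ⟨q₂, y⟩ := e
    have hQ' : y ∉ Prefix.names Q ∧ (Prefix.names Q).Nodup := List.nodup_cons.1 hQ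
    cases Q₁ with
    | nil =>
      simp only [List.nil_append, List.cons.injEq, Prod.mk.injEq] at h
      obtain ⟨⟨rfl, rfl⟩, rfl⟩ := h
      have hby : b ≠ y := by
        rintro rfl
        exact hQ'.1 (List.mem_map.2 ⟨_, hb, rfl⟩)
      simp only [Prefix.levelFrom, if_true, if_neg hby]
      exact ⟨le_levelFrom, fun h => lt_levelFrom hQ'.2 hb h.symm⟩
    | cons e Q₁ =>
      simp only [List.cons_append, List.cons.injEq] at h
      obtain ⟨rfl, rfl⟩ := h
      have hay : a ≠ y := by
        rintro rfl
        exact hQ'.1 (by simp [Prefix.names])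
      have hby : b ≠ y := by
        rintro rfl
        exact hQ'.1 (List.mem_map.2 ⟨(q', b), by simp [hb], rfl⟩)
      simp only [Prefix.levelFrom, if_neg hay, if_neg hby]
      exact ih hQ'.2 rfl hb

theorem level_order {Q : Prefix} (hQ : Q.names.Nodup) {Q₁ Q₂ : Prefix} {q₁ q' : Quant}
    {a b : ℕ} (h : Q = Q₁ ++ (q₁, a) :: Q₂) (hb : (q', b) ∈ Q₂) :
    Q.level a ≤ Q.level b ∧ (q₁ ≠ q' → Q.level a < Q.level b) := by
  cases Q with
  | nil => simp at h
  | cons e Q => exact levelFrom_order hQ h hb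

theorem mem_split {Q : Prefix} {q₁ q₂ : Quant} {a b : ℕ} (ha : (q₁, a) ∈ Q) (hb : (q₂, b) ∈ Q)
    (hab : a ≠ b) : (∃ Q₁ Q₂, Q = Q₁ ++ (q₁, a) :: Q₂ ∧ (q₂, b) ∈ Q₂) ∨
      ∃ Q₁ Q₂, Q = Q₁ ++ (q₂, b) :: Q₂ ∧ (q₁, a) ∈ Q₂ := by
  obtain ⟨Q₁, Q₂, rfl⟩ := List.append_of_mem ha
  have hne : (q₂, b) ≠ (q₁, a) := fun e => hab (Prod.mk.inj e).2.symm
  simp only [List.mem_append, List.mem_cons, hne, false_or] at hb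
  rcases hb with hb | hb
  · obtain ⟨R₁, R₂, rfl⟩ := List.append_of_mem hb
    exact Or.inr ⟨R₁, R₂ ++ (q₁, a) :: Q₂, by simp, by simp⟩
  · exact Or.inl ⟨Q₁, Q₂, rfl, hb⟩

/-- Variables with different quantifiers never share a block, so for them even the weak comparison
of levels decides the order in the prefix. -/
theorem leftAll_of_level {Q : Prefix} (hQ : Q.names.Nodup) {u x : ℕ}
    (hu : (Quant.all, u) ∈ Q) (hx : (Quant.ex, x) ∈ Q) (h : Q.level u ≤ Q.level x) :
    Q.LeftAll u x := by
  have hux : u ≠ x := by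
    rintro rfl
    cases names_nodup_snd hQ hu hx
  rcases mem_split hu hx hux with h' | ⟨Q₁, Q₂, h1, h2⟩
  · exact h'
  · have := (level_order hQ h1 h2).2 (by simp)
    omega

theorem level_of_leftAll {Q : Prefix} (hQ : Q.names.Nodup) {u x : ℕ} (h : Q.LeftAll u x) :
    Q.level u < Q.level x := by
  obtain ⟨Q₁, Q₂, h1, h2⟩ := h
  exact (level_order hQ h1 h2).2 (by simp)

/-- Why outer clauses are harmless for QRATA: a variable defined from outer literals depends only on
what `x` itself may depend on, so it may be used to redefine `x`. -/
theorem depOf_level {Q : Prefix} (hQ : Q.names.Nodup) {k x : ℕ} (hk : k ∈ Q.names)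
    (hx : (Quant.ex, x) ∈ Q) (h : Q.level k ≤ Q.level x) : depOf Q k ⊆ depOf Q x := by
  have hx' : (Quant.all, x) ∉ Q := fun h' => by cases names_nodup_snd hQ h' hx
  intro u hu
  rw [mem_depOf hx']
  rcases mem_names.1 hk with hk | hk
  · rw [depOf_all hk] at hu
    obtain rfl := List.mem_singleton.1 hu
    exact leftAll_of_level hQ hk hx h
  · have hk' : (Quant.all, k) ∉ Q := fun h' => by cases names_nodup_snd hQ h' hk
    rw [mem_depOf hk'] at hu
    have := level_of_leftAll hQ hu
    exact leftAll_of_level hQ hu.mem.1 hx (by omega)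

/-- The counterpart for a universal `l`. Outer literals are not among the variables that get
redefined, and whatever is defined from them may be used for each redefined variable. -/
theorem depOf_level_right {Q : Prefix} (hQ : Q.names.Nodup) {k l : ℕ} (hk : k ∈ Q.names)
    (hl : (Quant.all, l) ∈ Q) (h : Q.level k ≤ Q.level l) :
    k ∉ exRight Q l ∧ ∀ x ∈ exRight Q l, depOf Q k ⊆ depOf Q x := by
  refine ⟨fun h' => ?_, fun x hx => ?_⟩
  · have := level_of_leftAll hQ ((leftAll_iff_exRight hQ hl).2 h')
    omega
  · have := level_of_leftAll hQ ((leftAll_iff_exRight hQ hl).2 hx)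
    exact depOf_level hQ hk (exRight_mem hx) (by omega)

/-! ### Fresh names -/

/-- The kinds of fresh variables. -/
abbrev Kind := Bool × Bool × Bool

/-- The fresh variable of the kind `k` with the index `bs`, introduced at time `t`. -/
def name (t : List Unit) (k : Kind) (bs : List Bool) : ℕ :=
  ofBitList ((k.1 :: k.2.1 :: k.2.2 :: bs ++ true :: t.map fun _ => false) ++ [true])

theorem bits_name (t : List Unit) (k : Kind) (bs : List Bool) : (name t k bs).bits =
    (k.1 :: k.2.1 :: k.2.2 :: bs ++ true :: t.map fun _ => false) ++ [true] :=
  (bits_ofBitList _).1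

/-- Read from the end, the run of `false` stops at the marker `true`, whatever precedes it. So the
time and the index can be recovered from a name. -/
theorem marker_inj {bs bs' : List Bool} {n n' : ℕ}
    (h : bs ++ true :: List.replicate n false = bs' ++ true :: List.replicate n' false) :
    bs = bs' ∧ n = n' := by
  have h' := congrArg List.reverse h
  simp only [List.reverse_append, List.reverse_cons, List.reverse_replicate,
    List.append_assoc, List.cons_append, List.nil_append] at h'
  have hn : n = n' := by
    have := congrArg (List.takeWhile fun b => !b) h'
    have key : ∀ (m : ℕ) (l : List Bool),
        (List.replicate m false ++ true :: l).takeWhile (fun b => !b) = List.replicate m false := by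
      intro m l
      induction m with
      | zero => simp
      | succ m ih => simp [List.replicate_succ, ih]
    rw [key, key] at this
    simpa using congrArg List.length this
  subst hn
  have h2 := List.append_cancel_left h'
  simp only [List.cons.injEq, true_and, List.reverse_inj] at h2
  exact ⟨h2, rfl⟩

theorem name_inj {t t' : List Unit} {k k' : Kind} {bs bs' : List Bool}
    (h : name t k bs = name t' k' bs') : t.length = t'.length ∧ k = k' ∧ bs = bs' := by
  have h' := congrArg Nat.bits h
  rw [bits_name, bits_name] at h'
  have h2 := List.append_cancel_right h'
  simp only [List.map_const'] at h2
  obtain ⟨h3, h4⟩ := marker_inj h2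
  simp only [List.cons.injEq] at h3
  obtain ⟨h5, h6, h7, h8⟩ := h3
  exact ⟨h4, Prod.ext h5 (Prod.ext h6 h7), h8⟩

/-- The expansion of a name is longer than its time, so names of sufficiently late times differ from
all given variables. -/
theorem name_ne_of_length {t : List Unit} {k : Kind} {bs : List Bool} {x : ℕ}
    (h : x.bits.length ≤ t.length) : name t k bs ≠ x := by
  rintro rfl
  rw [bits_name] at h
  simp at h
  omega

/-- The elements of a list, labelled by their positions. -/
def labels {A : Type} (l : List A) : List (A × List Bool) :=
  (suffixes l).map fun p => (p.1, p.2.map fun _ => true)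

theorem labels_cons {A : Type} (a : A) (l : List A) :
    labels (a :: l) = (a, l.map fun _ => true) :: labels l := rfl

theorem mem_labels_length {A : Type} {l : List A} {d : A × List Bool} (h : d ∈ labels l) :
    d.2.length < l.length := by
  induction l with
  | nil => simp [labels, suffixes] at h
  | cons a l ih =>
    rw [labels_cons] at h
    rcases List.mem_cons.1 h with rfl | h
    · simp
    · have := ih h; simp only [List.length_cons]; omega

/-- A label is the length of the remaining list in unary, so labels strictly decrease. In
particular, repeated clauses get different names. -/
theorem labels_nodup {A : Type} (l : List A) : ((labels l).map Prod.snd).Nodup := by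
  induction l with
  | nil => exact List.nodup_nil
  | cons a l ih =>
    rw [labels_cons, List.map_cons, List.nodup_cons]
    refine ⟨fun h => ?_, ih⟩
    obtain ⟨d, hd, e⟩ := List.mem_map.1 h
    have := mem_labels_length hd
    rw [e] at this
    simp at this

theorem mem_labels_fst {A : Type} {l : List A} {d : A × List Bool} (h : d ∈ labels l) :
    d.1 ∈ l := by
  induction l with
  | nil => simp [labels, suffixes] at h
  | cons a l ih =>
    rw [labels_cons] at h
    rcases List.mem_cons.1 h with rfl | h
    · exact List.mem_cons_self
    · exact List.mem_cons_of_mem _ (ih h)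

theorem exists_label {A : Type} {l : List A} {a : A} (h : a ∈ l) : ∃ b, (a, b) ∈ labels l := by
  induction l with
  | nil => simp at h
  | cons c l ih =>
    rw [labels_cons]
    rcases List.mem_cons.1 h with rfl | h
    · exact ⟨_, List.mem_cons_self⟩
    · obtain ⟨b, hb⟩ := ih h
      exact ⟨b, List.mem_cons_of_mem _ hb⟩

/-! ### Running time of the computations with prefixes and names -/

section
variable {A B : Type} [Enc A] [Enc B]

@[fun_prop]
theorem PT.depOf {Q : A → List (Quant × ℕ)} {x : A → ℕ} (hQ : PT Q) (hx : PT x) :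
    PT fun a => depOf (Q a) (x a) := by
  unfold QBFSim.depOf
  fun_prop

@[fun_prop]
theorem PT.exRight {Q : A → List (Quant × ℕ)} {x : A → ℕ} (hQ : PT Q) (hx : PT x) :
    PT fun a => exRight (Q a) (x a) := by
  unfold QBFSim.exRight
  fun_prop

@[fun_prop]
theorem PT.name {t : A → List Unit} (k : Kind) {bs : A → List Bool} (ht : PT t) (hb : PT bs) :
    PT fun a => name (t a) k (bs a) := by
  refine PT.of_bits ?_
  simp only [bits_name]
  fun_prop

@[fun_prop]
theorem PT.labels {l : A → List B} (hl : PT l) : PT fun a => labels (l a) := by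
  unfold QBFSim.labels
  fun_prop

end

end QBFSim
namespace QBFSim

/-! ### Models of unit propagation -/

/-- The literals in `U` are closed under unit propagation in the clause `E`, without a conflict. -/
def VC (U : Lit → Prop) (E : Clause) : Prop :=
  (∀ l ∈ E, (∀ k ∈ E, k ≠ l → U k.neg) → U l) ∧ ¬ ∀ k ∈ E, U k.neg

/-- The literals in `U` are closed under unit propagation in `Γ`, without a conflict. -/
structure UPM (Γ : CNF) (U : Lit → Prop) : Prop where
  cons : ∀ l, U l → U l.neg → False
  clause : ∀ E ∈ Γ, VC U E

/-- Unit propagation only assigns literals that belong to every closed set, so a conflict-free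
closed set rules out refutation. -/
theorem UPRefutes.false_of_model {Γ : CNF} {U : Lit → Prop} (h : UPRefutes Γ) (hU : UPM Γ U) :
    False := by
  have key : ∀ l, UnitProp Γ l → U l := by
    intro l hl
    induction hl with
    | unit C l hC hl _ ih => exact (hU.clause C hC).1 l hl ih
  obtain ⟨C, hC, hk⟩ := h
  exact (hU.clause C hC).2 fun k hk' => key _ (hk k hk')

theorem UPM.mono {Γ Δ : CNF} {U : Lit → Prop} (h : UPM Γ U) (hs : Δ ⊆ Γ) : UPM Δ U :=
  ⟨h.cons, fun E hE => h.clause E (hs hE)⟩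

/-- The converse, and the method by which all propagation claims below are proved: instead of
exhibiting a trace, one derives a contradiction from a consistent closed set that falsifies `C`. The
literals assigned by propagation form such a set unless propagation refutes. -/
theorem upRefutes_of {Γ : CNF} {C : Clause}
    (h : ∀ U, UPM Γ U → (∀ k ∈ C, U k.neg) → False) : UPRefutes (Γ ++ C.negUnits) := by
  by_contra hn
  refine h (UnitProp (Γ ++ C.negUnits)) ⟨fun l h1 h2 => hn ?_, fun E hE => ⟨?_, ?_⟩⟩ ?_
  -- If both `l` and its complement are assigned, the clause that forced `l` is falsified, which is
  -- a conflict.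
  · cases h1 with
    | unit D l hD hl h1 =>
      refine ⟨D, hD, fun k hk => ?_⟩
      by_cases hkl : k = l
      · exact hkl ▸ h2
      · exact h1 k hk hkl
  · exact fun l hl hk => .unit E l (List.mem_append_left _ hE) hl hk
  · exact fun hk => hn ⟨E, List.mem_append_left _ hE, hk⟩
  · intro k hk
    refine .unit [k.neg] k.neg (List.mem_append_right _ (List.mem_map.2 ⟨k, hk, rfl⟩))
      List.mem_cons_self ?_
    intro k' hk' hne
    exact (hne (List.mem_singleton.1 hk')).elim

theorem UPRefutes.mono {Γ Δ : CNF} (h : UPRefutes Γ) (hs : Γ ⊆ Δ) : UPRefutes Δ := by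
  have key : ∀ l, UnitProp Γ l → UnitProp Δ l := by
    intro l hl
    induction hl with
    | unit C l hC hl _ ih => exact .unit C l (hs hC) hl ih
  obtain ⟨C, hC, hk⟩ := h
  exact ⟨C, hs hC, fun k hk' => key _ (hk k hk')⟩

theorem VC.of_cons {U : Lit → Prop} {k : Lit} {E : Clause} (h : VC U (k :: E)) (hk : U k.neg) :
    VC U E := by
  refine ⟨fun l hl h' => h.1 l (List.mem_cons_of_mem _ hl) fun k' hk' hne => ?_, fun h' => h.2 ?_⟩
  · rcases List.mem_cons.1 hk' with rfl | hk'
    · exact hk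
    · exact h' k' hk' hne
  · intro k' hk'
    rcases List.mem_cons.1 hk' with rfl | hk'
    · exact hk
    · exact h' k' hk'

theorem UPM.vc_unit {Γ : CNF} {U : Lit → Prop} (hU : UPM Γ U) {l : Lit} (h : U l) : VC U [l] := by
  refine ⟨fun k hk _ => ?_, fun h' => hU.cons l h (h' l List.mem_cons_self)⟩
  rwa [List.mem_singleton.1 hk]

/-- A renamed literal. -/
def rl (f : ℕ → ℕ) (l : Lit) : Lit := ⟨f l.var, l.pos⟩

/-- A renamed clause. -/
def ren (f : ℕ → ℕ) (C : Clause) : Clause := C.map (rl f)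

theorem rl_neg (f : ℕ → ℕ) (l : Lit) : (rl f l).neg = rl f l.neg := rfl

theorem mem_ren {f : ℕ → ℕ} {C : Clause} {k : Lit} (h : k ∈ C) : rl f k ∈ ren f C :=
  List.mem_map_of_mem h

theorem forall_ren {f : ℕ → ℕ} {C : Clause} {P : Lit → Prop} :
    (∀ k ∈ ren f C, P k) ↔ ∀ k ∈ C, P (rl f k) := by
  simp [ren]

/-- The renaming need not be injective: literals with different images are different, and this is
the only direction used. -/
theorem VC.of_ren {U : Lit → Prop} {f : ℕ → ℕ} {E : Clause} (h : VC U (ren f E)) :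
    VC (fun l => U (rl f l)) E := by
  refine ⟨fun l hl h' => h.1 _ (mem_ren hl) ?_, fun h' => h.2 (forall_ren.2 h')⟩
  rw [forall_ren]
  intro k hk hne
  exact h' k hk fun e => hne (e ▸ rfl)

/-- The clauses of `v ↔ ⋁ Y`. -/
def HasDef (Γ : CNF) (v : ℕ) (Y : Clause) : Prop :=
  (⟨v, false⟩ :: Y) ∈ Γ ∧ ∀ y ∈ Y, [⟨v, true⟩, y.neg] ∈ Γ

/-- The clauses of `a → (v ↔ x)`. -/
def HasIf (Γ : CNF) (v : ℕ) (a : Lit) (x : ℕ) : Prop :=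
  [a.neg, ⟨v, false⟩, ⟨x, true⟩] ∈ Γ ∧ [a.neg, ⟨v, true⟩, ⟨x, false⟩] ∈ Γ

theorem HasDef.mono {Γ Δ : CNF} {v : ℕ} {Y : Clause} (h : HasDef Γ v Y) (hs : Γ ⊆ Δ) :
    HasDef Δ v Y :=
  ⟨hs h.1, fun y hy => hs (h.2 y hy)⟩

theorem HasIf.mono {Γ Δ : CNF} {v x : ℕ} {a : Lit} (h : HasIf Γ v a x) (hs : Γ ⊆ Δ) :
    HasIf Δ v a x :=
  ⟨hs h.1, hs h.2⟩

namespace UPM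
variable {Γ : CNF} {U : Lit → Prop} (hU : UPM Γ U)
include hU

theorem conflict {E : Clause} (hE : E ∈ Γ) (h : ∀ k ∈ E, U k.neg) : False :=
  (hU.clause E hE).2 h

theorem two {a b : Lit} (h : [a, b] ∈ Γ) (ha : U a.neg) : U b := by
  refine (hU.clause _ h).1 b (by simp) ?_
  intro k hk hne
  simp only [List.mem_cons, List.not_mem_nil, or_false] at hk
  rcases hk with rfl | rfl
  · exact ha
  · exact (hne rfl).elim

theorem three {a b c : Lit} (h : [a, b, c] ∈ Γ) (ha : U a.neg) (hb : U b.neg) : U c := by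
  refine (hU.clause _ h).1 c (by simp) ?_
  intro k hk hne
  simp only [List.mem_cons, List.not_mem_nil, or_false] at hk
  rcases hk with rfl | rfl | rfl
  · exact ha
  · exact hb
  · exact (hne rfl).elim

theorem three' {a b c : Lit} (h : [a, b, c] ∈ Γ) (ha : U a.neg) (hc : U c.neg) : U b := by
  refine (hU.clause _ h).1 b (by simp) ?_
  intro k hk hne
  simp only [List.mem_cons, List.not_mem_nil, or_false] at hk
  rcases hk with rfl | rfl | rfl
  · exact ha
  · exact (hne rfl).elim
  · exact hc

theorem def_pos {v : ℕ} {Y : Clause} (h : HasDef Γ v Y) {y : Lit} (hy : y ∈ Y) (h' : U y) :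
    U ⟨v, true⟩ := by
  have := h.2 y hy
  refine (hU.clause _ this).1 _ (by simp) ?_
  intro k hk hne
  simp only [List.mem_cons, List.not_mem_nil, or_false] at hk
  rcases hk with rfl | rfl
  · exact (hne rfl).elim
  · rwa [Lit.neg_neg]

theorem def_neg {v : ℕ} {Y : Clause} (h : HasDef Γ v Y) (h' : U ⟨v, false⟩) :
    ∀ y ∈ Y, U y.neg :=
  fun y hy => hU.two (h.2 y hy) h'

theorem def_false {v : ℕ} {Y : Clause} (h : HasDef Γ v Y) (h' : ∀ y ∈ Y, U y.neg) :
    U ⟨v, false⟩ := by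
  refine (hU.clause _ h.1).1 _ List.mem_cons_self ?_
  intro k hk hne
  rcases List.mem_cons.1 hk with rfl | hk
  · exact (hne rfl).elim
  · exact h' k hk

theorem def_true {v : ℕ} {Y : Clause} (h : HasDef Γ v Y) (hv : U ⟨v, true⟩) {y : Lit}
    (hy : y ∈ Y) (h' : ∀ k ∈ Y, k ≠ y → U k.neg) : U y := by
  refine (hU.clause _ h.1).1 _ (List.mem_cons_of_mem _ hy) ?_
  intro k hk hne
  rcases List.mem_cons.1 hk with rfl | hk
  · exact hv
  · exact h' k hk hne

theorem def_conflict {v : ℕ} {Y : Clause} (h : HasDef Γ v Y) (hv : U ⟨v, true⟩)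
    (h' : ∀ y ∈ Y, U y.neg) : False :=
  hU.cons _ hv (hU.def_false h h')

theorem def_vc {v : ℕ} {Y : Clause} (h : HasDef Γ v Y) (hv : U ⟨v, true⟩) : VC U Y :=
  (hU.clause _ h.1).of_cons hv

/-- Propagation through the definition of a copy. -/
theorem copy {v : ℕ} {l : Lit} (h : HasDef Γ v [l]) {b : Bool} (hv : U ⟨v, b⟩) :
    U (if b then l else l.neg) := by
  cases b
  · exact hU.def_neg h hv l List.mem_cons_self
  · refine hU.def_true h hv List.mem_cons_self ?_
    intro k hk hne
    exact (hne (List.mem_singleton.1 hk)).elim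

theorem copy_var {v x : ℕ} (h : HasDef Γ v [⟨x, true⟩]) {b : Bool} (hv : U ⟨v, b⟩) :
    U ⟨x, b⟩ := by
  have := hU.copy h hv
  cases b <;> exact this

theorem of_if {v x : ℕ} {a : Lit} (h : HasIf Γ v a x) (ha : U a) {b : Bool} (hv : U ⟨v, b⟩) :
    U ⟨x, b⟩ := by
  rw [← Lit.neg_neg a] at ha
  cases b
  · exact hU.three h.2 ha hv
  · exact hU.three h.1 ha hv

theorem to_if {v x : ℕ} {a : Lit} (h : HasIf Γ v a x) (ha : U a) {b : Bool} (hx : U ⟨x, b⟩) :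
    U ⟨v, b⟩ := by
  rw [← Lit.neg_neg a] at ha
  cases b
  · exact hU.three' h.1 ha hx
  · exact hU.three' h.2 ha hx

end UPM

/-! ### Blocks of instructions -/

variable {M : List Fm}

theorem STr.append {S : SState} {a b : List Item} {P Q : SState → Prop} (h : STr M S a P)
    (h' : ∀ S', P S' → STr M S' b Q) : STr M S (a ++ b) Q := by
  induction a generalizing S with
  | nil => exact h' S h
  | cons i a ih => exact ⟨h.1, ih h.2⟩

theorem STr.mono {S : SState} {a : List Item} {P Q : SState → Prop} (h : STr M S a P)
    (h' : ∀ S', P S' → Q S') : STr M S a Q := by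
  induction a generalizing S with
  | nil => exact h' S h
  | cons i a ih => exact ⟨h.1, ih h.2⟩

theorem STr.inv {S : SState} {a : List Item} {P : SState → Prop} (hS : S.Inv) (h : STr M S a P) :
    STr M S a (fun S' => P S' ∧ S'.Inv) := by
  induction a generalizing S with
  | nil => exact ⟨h, hS⟩
  | cons i a ih => exact ⟨h.1, ih (inv_apply hS h.1) h.2⟩

/-- `S'` extends `S`. -/
structure Ext (S S' : SState) : Prop where
  univ : S.pre.univ ⊆ S'.pre.univ
  exs : S.pre.exNames ⊆ S'.pre.exNames
  dep : ∀ y ∈ S.pre.names, S'.pre.dep y = S.pre.dep y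
  cls : S.Γ ⊆ S'.Γ

theorem Ext.refl (S : SState) : Ext S S :=
  ⟨fun _ h => h, fun _ h => h, fun _ _ => rfl, fun _ h => h⟩

theorem Ext.names {S S' : SState} (h : Ext S S') : S.pre.names ⊆ S'.pre.names := by
  intro y hy
  rcases List.mem_append.1 hy with hy | hy
  · exact List.mem_append_left _ (h.univ hy)
  · exact List.mem_append_right _ (h.exs hy)

theorem Ext.trans {S₁ S₂ S₃ : SState} (h : Ext S₁ S₂) (h' : Ext S₂ S₃) : Ext S₁ S₃ :=
  ⟨fun _ hx => h'.univ (h.univ hx), fun _ hx => h'.exs (h.exs hx),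
    fun y hy => (h'.dep y (h.names hy)).trans (h.dep y hy), fun _ hx => h'.cls (h.cls hx)⟩

theorem Ext.clauseIn {S S' : SState} (h : Ext S S') {C : Clause} (hC : ClauseIn S.pre C) :
    ClauseIn S'.pre C :=
  fun k hk => h.names (hC k hk)

theorem ext_ex {S : SState} {v : ℕ} {D : List ℕ} {Γ : CNF} (hv : v ∉ S.pre.names)
    (hΓ : S.Γ ⊆ Γ) : Ext S ⟨⟨S.pre.univ, (v, D) :: S.pre.exs⟩, Γ⟩ :=
  ⟨fun _ h => h, List.subset_cons_self _ _, fun _ hy => dep_cons (ne_of_mem_of_not_mem hy hv), hΓ⟩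

theorem dep_head {P : DPrefix} {v : ℕ} {D : List ℕ} (hv : v ∉ P.names) :
    DPrefix.dep ⟨P.univ, (v, D) :: P.exs⟩ v = D := by
  have : v ∉ P.univ := fun h => hv (List.mem_append_left _ h)
  simp [DPrefix.dep, this]

theorem ext_newAll {S : SState} {u : ℕ} (hu : u ∉ S.pre.names) :
    Ext S (Item.apply S (.newAll u)) := by
  refine ⟨List.subset_cons_self _ _, fun _ h => h, fun y hy => ?_, fun _ h => h⟩
  have : y ≠ u := ne_of_mem_of_not_mem hy hu
  simp [Item.apply, DPrefix.dep, this]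

theorem ext_apply {S : SState} {i : Item} (h : i.Ok M S) : Ext S (i.apply S) := by
  have hΓ : S.Γ ⊆ i.clauses ++ S.Γ := List.subset_append_right _ _
  cases i with
  | newAll u => exact ext_newAll h
  | newEx x => exact ext_ex h hΓ
  | defOr v Y => exact ext_ex h.1 hΓ
  | defIf v a x => exact ext_ex h.1 hΓ
  | ax C => exact ⟨fun _ h => h, fun _ h => h, fun _ _ => rfl, hΓ⟩
  | axNeg ps => exact ⟨fun _ h => h, fun _ h => h, fun _ _ => rfl, hΓ⟩
  | rup C => exact ⟨fun _ h => h, fun _ h => h, fun _ _ => rfl, hΓ⟩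
  | red l R => exact ⟨fun _ h => h, fun _ h => h, fun _ _ => rfl, hΓ⟩

/-- `S'` extends `S` by variables that are introduced at time `t` and have kinds in `used`. -/
structure Within (S : SState) (t : List Unit) (used : List Kind) (S' : SState) : Prop where
  inv : S'.Inv
  ext : Ext S S'
  names : ∀ y ∈ S'.pre.names, y ∈ S.pre.names ∨ ∃ k ∈ used, ∃ bs, y = name t k bs

theorem Within.refl {S : SState} (h : S.Inv) (t : List Unit) : Within S t [] S :=
  ⟨h, Ext.refl S, fun _ hy => Or.inl hy⟩

theorem Within.fresh {S S' : SState} {t : List Unit} {used : List Kind} (h : Within S t used S')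
    (hf : ∀ k bs, name t k bs ∉ S.pre.names) {k : Kind} (hk : k ∉ used) (bs : List Bool) :
    name t k bs ∉ S'.pre.names := by
  intro hn
  rcases h.names _ hn with hn | ⟨k', hk', bs', e⟩
  · exact hf k bs hn
  · obtain ⟨_, rfl, _⟩ := name_inj e
    exact hk hk'

/-- A block of definitions, whose variables get the names `name t k (idx a)`. -/
theorem def_block {S S₁ : SState} {t : List Unit} {used : List Kind} (hw : Within S t used S₁)
    (hf : ∀ k bs, name t k bs ∉ S.pre.names) {k : Kind} (hk : k ∉ used) {α : Type}
    (L : List α) (idx : α → List Bool) (hL : (L.map idx).Nodup) (Y : α → Clause)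
    (hY : ∀ a ∈ L, ClauseIn S₁.pre (Y a)) :
    STr M S₁ (L.map fun a => .defOr (name t k (idx a)) (Y a)) (fun S₂ =>
      Within S t (k :: used) S₂ ∧ Ext S₁ S₂ ∧ ∀ a ∈ L, HasDef S₂.Γ (name t k (idx a)) (Y a) ∧
        name t k (idx a) ∈ S₂.pre.exNames ∧
        ∀ u ∈ S₂.pre.dep (name t k (idx a)), ∃ y ∈ Y a, u ∈ S₁.pre.dep y.var) := by
  have key : ∀ (L : List α) (S₁ : SState), (L.map idx).Nodup →
      (∀ a ∈ L, ClauseIn S₁.pre (Y a)) → (∀ a ∈ L, name t k (idx a) ∉ S₁.pre.names) →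
      STr M S₁ (L.map fun a => .defOr (name t k (idx a)) (Y a)) (fun S₂ =>
        (∀ y ∈ S₂.pre.names, y ∈ S₁.pre.names ∨ ∃ bs, y = name t k bs) ∧
        Ext S₁ S₂ ∧ ∀ a ∈ L, HasDef S₂.Γ (name t k (idx a)) (Y a) ∧
          name t k (idx a) ∈ S₂.pre.exNames ∧
          ∀ u ∈ S₂.pre.dep (name t k (idx a)), ∃ y ∈ Y a, u ∈ S₁.pre.dep y.var) := by
    intro L
    induction L with
    | nil => intro S₁ _ _ _; exact ⟨fun y hy => Or.inl hy, Ext.refl _, by simp⟩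
    | cons a L ih =>
      intro S₁ hL hY hfr
      have hok : Item.Ok M S₁ (.defOr (name t k (idx a)) (Y a)) :=
        ⟨hfr a List.mem_cons_self, hY a List.mem_cons_self⟩
      have hx := ext_apply hok
      rw [List.map_cons, List.nodup_cons] at hL
      refine ⟨hok, (ih _ hL.2 (fun b hb => hx.clauseIn (hY b (List.mem_cons_of_mem _ hb)))
        fun b hb hn => ?_).mono ?_⟩
      · simp only [Item.apply, names_cons_ex] at hn
        rcases hn with hn | hn
        · obtain ⟨_, _, e⟩ := name_inj hn
          exact hL.1 (List.mem_map.2 ⟨b, hb, e⟩)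
        · exact hfr b (List.mem_cons_of_mem _ hb) hn
      · rintro S₂ ⟨h1, h2, h3⟩
        refine ⟨fun y hy => ?_, hx.trans h2, fun b hb => ?_⟩
        · rcases h1 y hy with hy | hy
          · simp only [Item.apply, names_cons_ex] at hy
            exact hy.elim (fun h => Or.inr ⟨_, h⟩) Or.inl
          · exact Or.inr hy
        · rcases List.mem_cons.1 hb with rfl | hb'
          · refine ⟨⟨h2.cls (by simp [Item.apply, Item.clauses]), fun y hy => h2.cls ?_⟩,
              h2.exs (by simp [Item.apply, DPrefix.exNames]), fun u hu => ?_⟩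
            · simp only [Item.apply, Item.clauses, List.mem_append, List.mem_cons, List.mem_map]
              exact Or.inl (Or.inr ⟨y, hy, rfl⟩)
            · rw [h2.dep _ (by simp [Item.apply, names_cons_ex])] at hu
              simp only [Item.apply] at hu
              rw [dep_head hok.1] at hu
              simpa [DPrefix.extDep] using hu
          · obtain ⟨h4, h5, h6⟩ := h3 b hb'
            refine ⟨h4, h5, fun u hu => ?_⟩
            obtain ⟨y, hy, hu⟩ := h6 u hu
            rw [hx.dep _ (hY b hb y hy)] at hu
            exact ⟨y, hy, hu⟩
  refine ((key L S₁ hL hY fun a _ => hw.fresh hf hk _).inv hw.inv).mono ?_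
  rintro S₂ ⟨⟨h1, h2, h3⟩, h4⟩
  refine ⟨⟨h4, hw.ext.trans h2, fun y hy => ?_⟩, h2, h3⟩
  rcases h1 y hy with hy | ⟨bs, e⟩
  · rcases hw.names y hy with hy | ⟨k', hk', h⟩
    · exact Or.inl hy
    · exact Or.inr ⟨k', List.mem_cons_of_mem _ hk', h⟩
  · exact Or.inr ⟨k, List.mem_cons_self, bs, e⟩

/-- A block of conditional copies. -/
theorem if_block {S S₁ : SState} {t : List Unit} {used : List Kind} (hw : Within S t used S₁)
    (hf : ∀ k bs, name t k bs ∉ S.pre.names) {k : Kind} (hk : k ∉ used)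
    (L : List ℕ) (hL : L.Nodup) (f : ℕ → ℕ) (a : Lit) (ha : a.var ∈ S₁.pre.univ)
    (hY : ∀ x ∈ L, f x ∈ S₁.pre.names) :
    STr M S₁ (L.map fun x => .defIf (name t k x.bits) a (f x)) (fun S₂ =>
      Within S t (k :: used) S₂ ∧ Ext S₁ S₂ ∧ ∀ x ∈ L, HasIf S₂.Γ (name t k x.bits) a (f x) ∧
        name t k x.bits ∈ S₂.pre.exNames ∧
        ∀ u ∈ S₂.pre.dep (name t k x.bits), u ∈ S₁.pre.dep (f x) ∧ u ≠ a.var) := by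
  have key : ∀ (L : List ℕ) (S₁ : SState), L.Nodup → a.var ∈ S₁.pre.univ →
      (∀ x ∈ L, f x ∈ S₁.pre.names) → (∀ x ∈ L, name t k x.bits ∉ S₁.pre.names) →
      STr M S₁ (L.map fun x => .defIf (name t k x.bits) a (f x)) (fun S₂ =>
        (∀ y ∈ S₂.pre.names, y ∈ S₁.pre.names ∨ ∃ bs, y = name t k bs) ∧
        Ext S₁ S₂ ∧ ∀ x ∈ L, HasIf S₂.Γ (name t k x.bits) a (f x) ∧
          name t k x.bits ∈ S₂.pre.exNames ∧
          ∀ u ∈ S₂.pre.dep (name t k x.bits), u ∈ S₁.pre.dep (f x) ∧ u ≠ a.var) := by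
    intro L
    induction L with
    | nil => intro S₁ _ _ _ _; exact ⟨fun y hy => Or.inl hy, Ext.refl _, by simp⟩
    | cons x L ih =>
      intro S₁ hL ha hY hfr
      have hok : Item.Ok M S₁ (.defIf (name t k x.bits) a (f x)) :=
        ⟨hfr x List.mem_cons_self, ha, hY x List.mem_cons_self⟩
      have hx := ext_apply hok
      rw [List.nodup_cons] at hL
      refine ⟨hok, (ih _ hL.2 (hx.univ ha)
        (fun b hb => hx.names (hY b (List.mem_cons_of_mem _ hb))) fun b hb hn => ?_).mono ?_⟩
      · simp only [Item.apply, names_cons_ex] at hn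
        rcases hn with hn | hn
        · obtain ⟨_, _, e⟩ := name_inj hn
          exact hL.1 (bits_injective e ▸ hb)
        · exact hfr b (List.mem_cons_of_mem _ hb) hn
      · rintro S₂ ⟨h1, h2, h3⟩
        refine ⟨fun y hy => ?_, hx.trans h2, fun b hb => ?_⟩
        · rcases h1 y hy with hy | hy
          · simp only [Item.apply, names_cons_ex] at hy
            exact hy.elim (fun h => Or.inr ⟨_, h⟩) Or.inl
          · exact Or.inr hy
        · rcases List.mem_cons.1 hb with rfl | hb'
          · refine ⟨⟨h2.cls (by simp [Item.apply, Item.clauses]),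
              h2.cls (by simp [Item.apply, Item.clauses])⟩,
              h2.exs (by simp [Item.apply, DPrefix.exNames]), fun u hu => ?_⟩
            rw [h2.dep _ (by simp [Item.apply, names_cons_ex])] at hu
            simp only [Item.apply] at hu
            rw [dep_head hok.1] at hu
            simpa [DPrefix.extDep] using hu
          · obtain ⟨h4, h5, h6⟩ := h3 b hb'
            refine ⟨h4, h5, fun u hu => ?_⟩
            have := h6 u hu
            rwa [hx.dep _ (hY b hb)] at this
  refine ((key L S₁ hL ha hY fun a _ => hw.fresh hf hk _).inv hw.inv).mono ?_
  rintro S₂ ⟨⟨h1, h2, h3⟩, h4⟩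
  refine ⟨⟨h4, hw.ext.trans h2, fun y hy => ?_⟩, h2, h3⟩
  rcases h1 y hy with hy | ⟨bs, e⟩
  · rcases hw.names y hy with hy | ⟨k', hk', h⟩
    · exact Or.inl hy
    · exact Or.inr ⟨k', List.mem_cons_of_mem _ hk', h⟩
  · exact Or.inr ⟨k, List.mem_cons_self, bs, e⟩

/-- A block of clauses that follow by unit propagation. -/
theorem rup_block {S S₁ : SState} {t : List Unit} {used : List Kind} (hw : Within S t used S₁)
    {α : Type} (L : List α) (C : α → Clause) (hC : ∀ a ∈ L, ClauseIn S₁.pre (C a))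
    (h : ∀ a ∈ L, ∀ U, UPM S₁.Γ U → (∀ k ∈ C a, U k.neg) → False) :
    STr M S₁ (L.map fun a => .rup (C a)) (fun S₂ =>
      Within S t used S₂ ∧ Ext S₁ S₂ ∧ S₂.pre = S₁.pre ∧ ∀ a ∈ L, C a ∈ S₂.Γ) := by
  induction L generalizing S₁ with
  | nil => exact ⟨hw, Ext.refl _, rfl, by simp⟩
  | cons a L ih =>
    have hok : Item.Ok M S₁ (.rup (C a)) :=
      ⟨hC a List.mem_cons_self, upRefutes_of (h a List.mem_cons_self)⟩
    have hx := ext_apply hok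
    refine ⟨hok, (ih (S₁ := Item.apply S₁ (.rup (C a)))
      ⟨inv_apply hw.inv hok, hw.ext.trans hx, hw.names⟩
      (fun b hb => hC b (List.mem_cons_of_mem _ hb)) fun b hb U hU =>
        h b (List.mem_cons_of_mem _ hb) U (hU.mono hx.cls)).mono ?_⟩
    rintro S₂ ⟨h1, h2, h3, h4⟩
    refine ⟨h1, hx.trans h2, h3, fun b hb => ?_⟩
    rcases List.mem_cons.1 hb with rfl | hb
    · exact h2.cls (by simp [Item.apply, Item.clauses])
    · exact h4 b hb

theorem rup_one {S S₁ : SState} {t : List Unit} {used : List Kind} (hw : Within S t used S₁)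
    (C : Clause) (hC : ClauseIn S₁.pre C)
    (h : ∀ U, UPM S₁.Γ U → (∀ k ∈ C, U k.neg) → False) :
    STr M S₁ [.rup C] (fun S₂ =>
      Within S t used S₂ ∧ Ext S₁ S₂ ∧ S₂.pre = S₁.pre ∧ C ∈ S₂.Γ) :=
  (rup_block hw [C] (fun C => C) (by simpa using hC) (by simpa using h)).mono fun S₂ h => by
    simpa using h

/-- A block of reductions. -/
theorem red_block {S S₁ : SState} {t : List Unit} {used : List Kind} (hw : Within S t used S₁)
    {α : Type} (L : List α) (C : α → Clause) (l : Lit) (hl : l.var ∈ S₁.pre.univ)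
    (hC : ∀ a ∈ L, (l :: C a) ∈ S₁.Γ)
    (h : ∀ a ∈ L, ∀ k ∈ C a, k.var ≠ l.var ∧ (k.var ∈ S₁.pre.exNames → l.var ∉ S₁.pre.dep k.var)) :
    STr M S₁ (L.map fun a => .red l (C a)) (fun S₂ =>
      Within S t used S₂ ∧ Ext S₁ S₂ ∧ S₂.pre = S₁.pre ∧ ∀ a ∈ L, C a ∈ S₂.Γ) := by
  induction L generalizing S₁ with
  | nil => exact ⟨hw, Ext.refl _, rfl, by simp⟩
  | cons a L ih =>
    have hok : Item.Ok M S₁ (.red l (C a)) :=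
      ⟨hC a List.mem_cons_self, hl, h a List.mem_cons_self⟩
    have hx := ext_apply hok
    refine ⟨hok, (ih (S₁ := Item.apply S₁ (.red l (C a)))
      ⟨inv_apply hw.inv hok, hw.ext.trans hx, hw.names⟩ hl
      (fun b hb => hx.cls (hC b (List.mem_cons_of_mem _ hb))) fun b hb =>
        h b (List.mem_cons_of_mem _ hb)).mono ?_⟩
    rintro S₂ ⟨h1, h2, h3, h4⟩
    refine ⟨h1, hx.trans h2, h3, fun b hb => ?_⟩
    rcases List.mem_cons.1 hb with rfl | hb
    · exact h2.cls (by simp [Item.apply, Item.clauses])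
    · exact h4 b hb

end QBFSim
namespace QBFSim
variable {M : List Fm}

theorem Lit.eq_neg_of_var {k l : Lit} (h : k.var = l.var) (h' : k ≠ l) : k = l.neg := by
  obtain ⟨v, p⟩ := k
  obtain ⟨v', p'⟩ := l
  simp only [ne_eq, Lit.mk.injEq, Lit.neg] at *
  subst h
  cases p <;> cases p' <;> simp_all

/-! ### Stages of the simulation -/

abbrev kCopy : Kind := (false, false, false)
abbrev kOuter : Kind := (true, false, false)
abbrev kGate : Kind := (false, true, false)
abbrev kCond : Kind := (true, true, false)
abbrev kLeft : Kind := (false, false, true)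
abbrev kRight : Kind := (true, false, true)
abbrev kClause : Kind := (false, true, true)
abbrev kReduced : Kind := (true, true, true)

/-- The renaming of the variables `xs` at time `t`. -/
def newMap (t : List Unit) (xs : List ℕ) (x : ℕ) : ℕ :=
  bif decide (x ∈ xs) then name t kCopy x.bits else x

/-- The renaming `f` sends the existential variables `xs` to variables with suitable dependency
sets; the universal variables are `us`, and names of times later than `cur` are fresh. -/
structure Stage (xs us : List ℕ) (cur : ℕ) (Q : Prefix) (f : ℕ → ℕ) (S : SState) : Prop where
  inv : S.Inv
  univ : ∀ u ∈ us, u ∈ S.pre.univ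
  ex : ∀ x ∈ xs, f x ∈ S.pre.exNames
  dep : ∀ x ∈ xs, S.pre.dep (f x) ⊆ depOf Q x
  id : ∀ x, x ∉ xs → f x = x
  inj : ∀ x ∈ us ++ xs, ∀ y ∈ us ++ xs, f x = f y → x = y
  fresh : ∀ t k bs, cur < t.length → name t k bs ∉ S.pre.names
  nodup : Q.names.Nodup
  allMem : ∀ u, (Quant.all, u) ∈ Q → u ∈ us
  exMem : ∀ x, (Quant.ex, x) ∈ Q → x ∈ xs
  disj : ∀ u ∈ us, u ∉ xs
  xs_nodup : xs.Nodup

namespace Stage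
variable {xs us : List ℕ} {cur : ℕ} {Q : Prefix} {f : ℕ → ℕ} {S : SState}

/-- A prefix extension costs no lines: the variables of the whole derivation are present from the
start, and only the dependency bounds are relaxed. -/
theorem extend (h : Stage xs us cur Q f S) {Q' : Prefix} (hs : Q.Sublist Q')
    (hn : Q'.names.Nodup) (ha : ∀ u, (Quant.all, u) ∈ Q' → u ∈ us)
    (he : ∀ x, (Quant.ex, x) ∈ Q' → x ∈ xs) : Stage xs us cur Q' f S :=
  { h with
    dep := fun x hx => List.Subset.trans (h.dep x hx) (depOf_sublist hs hn)
    nodup := hn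
    allMem := ha
    exMem := he }

theorem of_pre (h : Stage xs us cur Q f S) {S' : SState} (hi : S'.Inv) (hp : S'.pre = S.pre) :
    Stage xs us cur Q f S' :=
  { h with
    inv := hi
    univ := fun u hu => hp ▸ h.univ u hu
    ex := fun x hx => hp ▸ h.ex x hx
    dep := fun x hx => hp ▸ h.dep x hx
    fresh := fun t k bs ht => hp ▸ h.fresh t k bs ht }

theorem fresh_at (h : Stage xs us cur Q f S) {t : List Unit} (ht : t.length = cur + 1)
    (k : Kind) (bs : List Bool) : name t k bs ∉ S.pre.names :=
  h.fresh t k bs (by omega)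

theorem map_univ (h : Stage xs us cur Q f S) {u : ℕ} (hu : u ∈ us) : f u = u :=
  h.id u (h.disj u hu)

theorem map_all (h : Stage xs us cur Q f S) {u : ℕ} (hu : (Quant.all, u) ∈ Q) : f u = u :=
  h.map_univ (h.allMem u hu)

theorem all_univ (h : Stage xs us cur Q f S) {u : ℕ} (hu : (Quant.all, u) ∈ Q) :
    u ∈ S.pre.univ :=
  h.univ u (h.allMem u hu)

theorem map_mem (h : Stage xs us cur Q f S) {y : ℕ} (hy : y ∈ Q.names) : f y ∈ S.pre.names := by
  rcases mem_names.1 hy with hy | hy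
  · rw [h.map_all hy]
    exact List.mem_append_left _ (h.all_univ hy)
  · exact List.mem_append_right _ (h.ex y (h.exMem y hy))

theorem map_dep (h : Stage xs us cur Q f S) {y : ℕ} (hy : y ∈ Q.names) :
    S.pre.dep (f y) ⊆ depOf Q y := by
  rcases mem_names.1 hy with hy | hy
  · rw [h.map_all hy, depOf_all hy]
    simp [DPrefix.dep, h.all_univ hy]
  · exact h.dep y (h.exMem y hy)

theorem clauseIn (h : Stage xs us cur Q f S) {C : Clause} (hC : ∀ k ∈ C, k.var ∈ Q.names) :
    ClauseIn S.pre (ren f C) :=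
  forall_ren.2 fun k hk => h.map_mem (hC k hk)

end Stage

theorem UPM.vc_negUnits {Γ : CNF} {U : Lit → Prop} (hU : UPM Γ U) {f : ℕ → ℕ} {C : Clause}
    (h : ∀ k ∈ C, U (rl f k).neg) : ∀ E ∈ C.negUnits, VC U (ren f E) := by
  intro E hE
  obtain ⟨k, hk, rfl⟩ := List.mem_map.1 hE
  exact hU.vc_unit (h k hk)

/-- The side condition of a QRAT step speaks about original clauses, the state about renamed ones. A
closed set of the state is pulled back along the renaming, where the side condition contradicts it.
-/
theorem UPRefutes.false_of_ren {Γ Δ : CNF} {U : Lit → Prop} {f : ℕ → ℕ} (h : UPRefutes Δ)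
    (hU : UPM Γ U) (hΔ : ∀ E ∈ Δ, VC U (ren f E)) : False :=
  h.false_of_model (U := fun l => U (rl f l))
    ⟨fun _ h1 h2 => hU.cons _ h1 h2, fun E hE => (hΔ E hE).of_ren⟩

theorem def_one {S S₁ : SState} {t : List Unit} {used : List Kind} (hw : Within S t used S₁)
    (hf : ∀ k bs, name t k bs ∉ S.pre.names) {k : Kind} (hk : k ∉ used) (Y : Clause)
    (hY : ClauseIn S₁.pre Y) :
    STr M S₁ [.defOr (name t k []) Y] (fun S₂ =>
      Within S t (k :: used) S₂ ∧ Ext S₁ S₂ ∧ HasDef S₂.Γ (name t k []) Y ∧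
        name t k [] ∈ S₂.pre.exNames ∧
        ∀ u ∈ S₂.pre.dep (name t k []), ∃ y ∈ Y, u ∈ S₁.pre.dep y.var) :=
  (def_block hw hf hk [()] (fun _ => []) (by simp) (fun _ => Y) (by simpa using hY)).mono
    fun S₂ h => by simpa using h

/-- The definitions of the variables of the next stage. -/
def newDefs (t : List Unit) (xs : List ℕ) (Y : ℕ → Clause) : List Item :=
  xs.map fun x => .defOr (name t kCopy x.bits) (Y x)

section Blocks
variable {xs us : List ℕ} {cur : ℕ} {Q : Prefix} {f : ℕ → ℕ} {S S₁ : SState} {t : List Unit}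
  {used : List Kind}

theorem newMap_of_mem {x : ℕ} (h : x ∈ xs) : newMap t xs x = name t kCopy x.bits := by
  simp [newMap, h]

theorem newMap_of_not_mem {x : ℕ} (h : x ∉ xs) : newMap t xs x = x := by
  simp [newMap, h]

/-- The passage to the next stage. Any definitions `Y` are allowed as long as the variables in `Y x`
depend only on what `x` may depend on. The new renaming is injective since names remember the bits
of `x` and are fresh with respect to the universal variables. -/
theorem new_block (hS : Stage xs us cur Q f S) (ht : t.length = cur + 1)
    (hw : Within S t used S₁) (hk : kCopy ∉ used) {Y : ℕ → Clause}
    (hY : ∀ x ∈ xs, ClauseIn S₁.pre (Y x))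
    (hd : ∀ x ∈ xs, ∀ y ∈ Y x, S₁.pre.dep y.var ⊆ depOf Q x) :
    STr M S₁ (newDefs t xs Y) (fun S₂ =>
      Stage xs us (cur + 1) Q (newMap t xs) S₂ ∧ Within S t (kCopy :: used) S₂ ∧ Ext S₁ S₂ ∧
        ∀ x ∈ xs, HasDef S₂.Γ (newMap t xs x) (Y x)) := by
  refine (def_block hw (hS.fresh_at ht) hk xs Nat.bits
    (hS.xs_nodup.map bits_injective) Y hY).mono ?_
  rintro S₂ ⟨h1, h2, h3⟩
  refine ⟨{ hS with
    inv := h1.inv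
    univ := fun u hu => h1.ext.univ (hS.univ u hu)
    ex := fun x hx => ?_
    dep := fun x hx => ?_
    id := fun x hx => newMap_of_not_mem hx
    inj := ?_
    fresh := ?_ }, h1, h2, fun x hx => ?_⟩
  · rw [newMap_of_mem hx]
    exact (h3 x hx).2.1
  · rw [newMap_of_mem hx]
    intro u hu
    obtain ⟨y, hy, hu⟩ := (h3 x hx).2.2 u hu
    exact hd x hx y hy hu
  · have key : ∀ x ∈ xs, ∀ y ∈ us, newMap t xs x ≠ newMap t xs y := by
      intro x hx y hy e
      rw [newMap_of_mem hx, newMap_of_not_mem (hS.disj y hy)] at e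
      exact hS.fresh_at ht kCopy x.bits
        (e ▸ List.mem_append_left _ (hS.univ y hy))
    intro x hx y hy e
    rcases List.mem_append.1 hx with hx | hx <;> rcases List.mem_append.1 hy with hy | hy
    · rwa [newMap_of_not_mem (hS.disj x hx), newMap_of_not_mem (hS.disj y hy)] at e
    · exact (key y hy x hx e.symm).elim
    · exact (key x hx y hy e).elim
    · rw [newMap_of_mem hx, newMap_of_mem hy] at e
      exact bits_injective (name_inj e).2.2
  · intro t' k bs ht' hn
    rcases h1.names _ hn with hn | ⟨k', _, bs', e⟩
    · exact hS.fresh t' k bs (by omega) hn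
    · have := (name_inj e).1
      omega
  · rw [newMap_of_mem hx]
    exact (h3 x hx).1

/-- The state contains the renamed clauses. -/
def Has (S : SState) (f : ℕ → ℕ) (N : CNF) : Prop := ∀ C ∈ N, ren f C ∈ S.Γ

theorem Has.ext {N : CNF} (h : Has S f N) (he : Ext S S₁) : Has S₁ f N :=
  fun C hC => he.cls (h C hC)

theorem Has.vc {N : CNF} (h : Has S f N) {U : Lit → Prop} (hU : UPM S.Γ U) :
    ∀ E ∈ N, VC U (ren f E) :=
  fun E hE => hU.clause _ (h E hE)

/-- The clauses that define the gate `n ↔ ⋁ ō`, with `o ↔ ⋁ O` for the subclause `O` of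
outer literals of each of the labelled clauses. -/
def gates (t : List Unit) (f : ℕ → ℕ) (sel : Lit → Bool) (Ds : List (Clause × List Bool)) :
    List Item :=
  (Ds.map fun d => .defOr (name t kOuter d.2) (ren f (d.1.filter sel))) ++
    [.defOr (name t kGate []) (Ds.map fun d => ⟨name t kOuter d.2, false⟩)]

/-- The gate is false when all outer clauses hold and true when one of them fails. It depends only
on the dependencies of the selected literals. -/
structure HasGates (Γ : CNF) (t : List Unit) (f : ℕ → ℕ) (sel : Lit → Bool)
    (Ds : List (Clause × List Bool)) : Prop where
  outer : ∀ d ∈ Ds, HasDef Γ (name t kOuter d.2) (ren f (d.1.filter sel))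
  gate : HasDef Γ (name t kGate []) (Ds.map fun d => ⟨name t kOuter d.2, false⟩)

theorem HasGates.mono {Γ Δ : CNF} {sel : Lit → Bool} {Ds : List (Clause × List Bool)}
    (h : HasGates Γ t f sel Ds) (hs : Γ ⊆ Δ) : HasGates Δ t f sel Ds :=
  ⟨fun d hd => (h.outer d hd).mono hs, h.gate.mono hs⟩

theorem HasGates.outer_vc {Γ : CNF} {sel : Lit → Bool} {Ds : List (Clause × List Bool)}
    (h : HasGates Γ t f sel Ds) {U : Lit → Prop} (hU : UPM Γ U)
    (hn : U ⟨name t kGate [], false⟩) {d : Clause × List Bool} (hd : d ∈ Ds) :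
    U ⟨name t kOuter d.2, true⟩ ∧ VC U (ren f (d.1.filter sel)) := by
  have : U ⟨name t kOuter d.2, true⟩ :=
    hU.def_neg h.gate hn _ (List.mem_map.2 ⟨d, hd, rfl⟩)
  exact ⟨this, hU.def_vc (h.outer d hd) this⟩

theorem HasGates.gate_false {Γ : CNF} {sel : Lit → Bool} {Ds : List (Clause × List Bool)}
    (h : HasGates Γ t f sel Ds) {U : Lit → Prop} (hU : UPM Γ U)
    (ho : ∀ d ∈ Ds, U ⟨name t kOuter d.2, true⟩) : U ⟨name t kGate [], false⟩ := by
  refine hU.def_false h.gate fun y hy => ?_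
  obtain ⟨d, hd, rfl⟩ := List.mem_map.1 hy
  exact ho d hd

theorem gates_block (hS : Stage xs us cur Q f S) (ht : t.length = cur + 1)
    (hw : Within S t used S₁) (hk : kOuter ∉ used) (hk' : kGate ∉ used) {sel : Lit → Bool}
    {Ds : List (Clause × List Bool)} (hD : (Ds.map Prod.snd).Nodup)
    (hQ : ∀ d ∈ Ds, ∀ k ∈ d.1, k.var ∈ Q.names) :
    STr M S₁ (gates t f sel Ds) (fun S₂ =>
      Within S t (kGate :: kOuter :: used) S₂ ∧ Ext S₁ S₂ ∧ HasGates S₂.Γ t f sel Ds ∧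
        (∀ d ∈ Ds, name t kOuter d.2 ∈ S₂.pre.exNames) ∧ name t kGate [] ∈ S₂.pre.exNames ∧
        ∀ u ∈ S₂.pre.dep (name t kGate []), ∃ d ∈ Ds, ∃ k ∈ d.1, sel k = true ∧
          u ∈ depOf Q k.var) := by
  have hin : ∀ d ∈ Ds, ∀ k ∈ d.1.filter sel, k.var ∈ Q.names := fun d hd k hk =>
    hQ d hd k (List.mem_filter.1 hk).1
  refine (def_block hw (hS.fresh_at ht) hk Ds Prod.snd hD
    (fun d => ren f (d.1.filter sel))
    fun d hd => hw.ext.clauseIn (hS.clauseIn (hin d hd))).append ?_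
  rintro S₂ ⟨h1, h2, h3⟩
  refine (def_one h1 (hS.fresh_at ht) (k := kGate) (by simp [hk']) _ ?_).mono ?_
  · intro y hy
    obtain ⟨d, hd, rfl⟩ := List.mem_map.1 hy
    exact List.mem_append_right _ (h3 d hd).2.1
  · rintro S₃ ⟨h4, h5, h6, h7, h8⟩
    refine ⟨h4, h2.trans h5, ⟨fun d hd => (h3 d hd).1.mono h5.cls, h6⟩,
      fun d hd => h5.exs (h3 d hd).2.1, h7, fun u hu => ?_⟩
    obtain ⟨y, hy, hu⟩ := h8 u hu
    obtain ⟨d, hd, rfl⟩ := List.mem_map.1 hy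
    obtain ⟨y, hy, hu⟩ := (h3 d hd).2.2 u hu
    obtain ⟨k, hk, rfl⟩ := List.mem_map.1 hy
    have hkQ := hin d hd k hk
    refine ⟨d, hd, k, (List.mem_filter.1 hk).1, (List.mem_filter.1 hk).2, ?_⟩
    change u ∈ S₁.pre.dep (f k.var) at hu
    rw [hw.ext.dep _ (hS.map_mem hkQ)] at hu
    exact hS.map_dep hkQ hu

end Blocks

/-- The literals, not in the variable `v` or in `Sx`, whose dependencies are below those of the
variables `T`. -/
def outerSel (Q : Prefix) (v : ℕ) (Sx T : List ℕ) (k : Lit) : Bool :=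
  decide (k.var ≠ v) && (decide (k.var ∉ Sx) &&
    T.all fun x => (depOf Q k.var).all fun u => decide (u ∈ depOf Q x))

theorem outerSel_iff {Q : Prefix} {v : ℕ} {Sx T : List ℕ} {k : Lit} :
    outerSel Q v Sx T k = true ↔
      k.var ≠ v ∧ k.var ∉ Sx ∧ ∀ x ∈ T, depOf Q k.var ⊆ depOf Q x := by
  simp [outerSel, List.subset_def]

/-! ### Steps without a change of the assignment -/

/-- First the clauses `pre`, then copies of all variables, then the clauses `N`. -/
def copyScript (t : List Unit) (xs : List ℕ) (f : ℕ → ℕ) (pre N : CNF) : List Item :=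
  (pre.map fun C => .rup (ren f C)) ++
  ((newDefs t xs fun x => [⟨f x, true⟩]) ++
  (N.map fun C => .rup (ren (newMap t xs) C)))

section Steps
variable {xs us : List ℕ} {cur : ℕ} {Q : Prefix} {f : ℕ → ℕ} {S S₁ : SState} {t : List Unit}

/-- A literal of a copied variable propagates to the original one. -/
theorem UPM.to_old {Γ : CNF} {U : Lit → Prop} (hU : UPM Γ U) (hS : Stage xs us cur Q f S)
    {l : Lit} (h : l.var ∈ xs → HasDef Γ (newMap t xs l.var) [⟨f l.var, true⟩])
    (hl : U (rl (newMap t xs) l)) : U (rl f l) := by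
  by_cases hx : l.var ∈ xs
  · exact hU.copy_var (h hx) hl
  · have : rl f l = rl (newMap t xs) l := by
      rw [rl, rl, newMap_of_not_mem hx, hS.id _ hx]
    rwa [this]

theorem UPM.to_new {Γ : CNF} {U : Lit → Prop} (hU : UPM Γ U) (hS : Stage xs us cur Q f S)
    {l : Lit} (h : l.var ∈ xs → HasDef Γ (newMap t xs l.var) [⟨f l.var, true⟩])
    (hl : U (rl f l)) : U (rl (newMap t xs) l) := by
  by_cases hx : l.var ∈ xs
  · obtain ⟨x, b⟩ := l
    cases b
    · exact hU.def_false (h hx) fun y hy => by rw [List.mem_singleton.1 hy]; exact hl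
    · exact hU.def_pos (h hx) List.mem_cons_self hl
  · have : rl f l = rl (newMap t xs) l := by
      rw [rl, rl, newMap_of_not_mem hx, hS.id _ hx]
    rwa [← this]

theorem Stage.copy_clauseIn (hS : Stage xs us cur Q f S) {x : ℕ} (hx : x ∈ xs) :
    ClauseIn S.pre [⟨f x, true⟩] := by
  intro k hk
  rw [List.mem_singleton.1 hk]
  exact List.mem_append_right _ (hS.ex x hx)

/-- Here the strategy stays the same. Fresh copies are made nevertheless, so that the renaming of a
stage is determined by its time alone; the old clauses propagate through the copies. -/
theorem copy_step (hS : Stage xs us cur Q f S) (ht : t.length = cur + 1) {pre N₀ N : CNF}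
    (hN₀ : Has S f N₀) (hpre : ∀ C ∈ pre, (∀ k ∈ C, k.var ∈ Q.names) ∧
      UPRefutes (N₀ ++ C.negUnits)) (hN : ∀ C ∈ N, C ∈ pre ∨ C ∈ N₀)
    (hv : ∀ C ∈ N₀, ∀ k ∈ C, k.var ∈ Q.names) :
    STr M S (copyScript t xs f pre N) (fun S' =>
      Stage xs us (cur + 1) Q (newMap t xs) S' ∧ Has S' (newMap t xs) N ∧ Ext S S') := by
  refine (rup_block (Within.refl hS.inv t) pre (ren f)
    (fun C hC => hS.clauseIn (hpre C hC).1) ?_).append ?_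
  · intro C hC U hU hk
    refine (hpre C hC).2.false_of_ren (f := f) hU fun E hE => ?_
    rcases List.mem_append.1 hE with hE | hE
    · exact hN₀.vc hU E hE
    · exact hU.vc_negUnits (forall_ren.1 hk) E hE
  rintro S₂ ⟨h1, h2, h3, h4⟩
  refine (new_block hS ht h1 (by simp) (fun x hx => h2.clauseIn (hS.copy_clauseIn hx))
    fun x hx y hy => ?_).append ?_
  · rw [List.mem_singleton.1 hy, h3]
    exact hS.dep x hx
  rintro S₃ ⟨h5, h6, h7, h8⟩
  refine (rup_block h6 N (ren (newMap t xs)) (fun C hC => h5.clauseIn ?_) ?_).mono ?_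
  · rcases hN C hC with hC | hC
    · exact (hpre C hC).1
    · exact hv C hC
  · intro C hC U hU hk
    have hold : ren f C ∈ S₃.Γ := by
      rcases hN C hC with hC | hC
      · exact h7.cls (h4 C hC)
      · exact h6.ext.cls (hN₀ C hC)
    refine hU.conflict hold (forall_ren.2 fun k hk' => ?_)
    exact hU.to_old hS (l := k.neg) (fun hx => h8 _ hx) (forall_ren.1 hk k hk')
  · rintro S₄ ⟨h9, _, h10, h11⟩
    exact ⟨h5.of_pre h9.inv h10, h11, h9.ext⟩

/-! ### Resolution asymmetric tautologies for an existential literal -/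

/-- The script for the addition of `l ∨ C`, where `Ds` are the labelled clauses with `l̄`. -/
def qrataScript (t : List Unit) (xs : List ℕ) (f : ℕ → ℕ) (sel : Lit → Bool) (N : CNF) (C : Clause)
    (l : Lit) : List Item :=
  let Ds := (labels N).filter fun d => decide (l.neg ∈ d.1)
  gates t f sel Ds ++
  ((Ds.map fun d => .rup (⟨name t kOuter d.2, true⟩ :: ren f (l :: C))) ++
  ([.defOr (name t kLeft []) [rl f l, ⟨name t kGate [], false⟩]] ++
  ((newDefs t xs fun x =>
    bif decide (x = l.var) then [⟨name t kLeft [], l.pos⟩] else [⟨f x, true⟩]) ++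
  ((Ds.map fun d => .rup (⟨name t kGate [], true⟩ :: ren (newMap t xs) d.1)) ++
  (((l :: C) :: N).map fun D => .rup (ren (newMap t xs) D))))))

/-- The new value of `l` is `l ∨ n̄`, where `n` says that one of the outer clauses of the clauses
with `l̄` is false; all other variables are copied. Clauses without `l̄` can only gain from this. A
clause `D` with `l̄` is true by `D` itself if the old `l` is true, and by its outer clause if `l`
was switched on. -/
theorem qrata_step (hS : Stage xs us cur Q f S) (ht : t.length = cur + 1) {sel : Lit → Bool}
    {N : CNF} {C : Clause} {l : Lit}
    (hN : Has S f N) (hv : ∀ D ∈ N, ∀ k ∈ D, k.var ∈ Q.names) (hC : ∀ k ∈ C, k.var ∈ Q.names)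
    (hl : (Quant.ex, l.var) ∈ Q)
    (hsel : ∀ k, sel k = true → k.var ≠ l.var ∧ depOf Q k.var ⊆ depOf Q l.var)
    (hup : ∀ D ∈ N, l.neg ∈ D →
      UPRefutes (N ++ C.negUnits ++ [[l.neg]] ++ Clause.negUnits (D.filter sel))) :
    STr M S (qrataScript t xs f sel N C l) (fun S' =>
      Stage xs us (cur + 1) Q (newMap t xs) S' ∧ Has S' (newMap t xs) ((l :: C) :: N) ∧
        Ext S S') := by
  have hlx : l.var ∈ xs := hS.exMem _ hl
  have hlQ : l.var ∈ Q.names := mem_names.2 (Or.inr hl)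
  have hlC : ∀ k ∈ l :: C, k.var ∈ Q.names := by
    intro k hk
    rcases List.mem_cons.1 hk with rfl | hk
    · exact hlQ
    · exact hC k hk
  unfold qrataScript
  set Ds := (labels N).filter fun d => decide (l.neg ∈ d.1) with hDs
  have hD1 : ∀ d ∈ Ds, d.1 ∈ N ∧ l.neg ∈ d.1 := by
    intro d hd
    rw [hDs, List.mem_filter] at hd
    exact ⟨mem_labels_fst hd.1, by simpa using hd.2⟩
  have hD2 : (Ds.map Prod.snd).Nodup :=
    (labels_nodup N).sublist (List.filter_sublist.map _)
  have hD3 : ∀ D ∈ N, l.neg ∈ D → ∃ b, (D, b) ∈ Ds := by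
    intro D hD hl
    obtain ⟨b, hb⟩ := exists_label hD
    exact ⟨b, List.mem_filter.2 ⟨hb, by simpa using hl⟩⟩
  refine (gates_block hS ht (Within.refl hS.inv t) (by simp) (by simp) hD2
    fun d hd => hv d.1 (hD1 d hd).1).append ?_
  rintro S₁ ⟨w1, e1, g1, o1, n1, d1⟩
  -- The clauses `o_D ∨ l ∨ C`. Falsifying one of them assigns `C̄`, `l̄` and the negated outer
  -- literals, which is the situation of `hup`.
  refine (rup_block w1 Ds _ (fun d hd => ?_) ?_).append ?_
  · exact ClauseIn.cons (List.mem_append_right _ (o1 d hd)) (e1.clauseIn (hS.clauseIn hlC))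
  · intro d hd U hU hk
    rw [List.forall_mem_cons] at hk
    have h2 := forall_ren.1 hk.2
    have h3 := forall_ren.1 (hU.def_neg (g1.outer d hd) hk.1)
    refine (hup d.1 (hD1 d hd).1 (hD1 d hd).2).false_of_ren (f := f) hU fun E hE => ?_
    simp only [List.mem_append, List.mem_singleton] at hE
    rcases hE with ((hE | hE) | rfl) | hE
    · exact (hN.ext e1).vc hU E hE
    · exact hU.vc_negUnits (fun k hk => h2 k (List.mem_cons_of_mem _ hk)) E hE
    · exact hU.vc_unit (h2 l List.mem_cons_self)
    · exact hU.vc_negUnits h3 E hE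
  rintro S₂ ⟨w2, e2, p2, c2⟩
  refine (def_one w2 (hS.fresh_at ht) (by decide) _ ?_).append ?_
  · intro y hy
    simp only [List.mem_cons, List.not_mem_nil, or_false] at hy
    rcases hy with rfl | rfl
    · exact w2.ext.names (hS.map_mem hlQ)
    · exact List.mem_append_right _ (e2.exs n1)
  rintro S₃ ⟨w3, e3, y3, n3, d3⟩
  have hdepy : S₃.pre.dep (name t kLeft []) ⊆ depOf Q l.var := by
    intro u hu
    obtain ⟨y, hy, hu⟩ := d3 u hu
    simp only [List.mem_cons, List.not_mem_nil, or_false] at hy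
    rcases hy with rfl | rfl
    · change u ∈ S₂.pre.dep (f l.var) at hu
      rw [w2.ext.dep _ (hS.map_mem hlQ)] at hu
      exact hS.map_dep hlQ hu
    · rw [p2] at hu
      obtain ⟨d, _, k, _, hk, hu⟩ := d1 u hu
      exact (hsel k hk).2 hu
  refine (new_block hS ht w3 (by decide) (fun x hx => ?_) fun x hx y hy => ?_).append ?_
  · by_cases hxl : x = l.var
    · simp only [hxl, decide_true, cond_true]
      intro k hk
      rw [List.mem_singleton.1 hk]
      exact List.mem_append_right _ n3
    · simp only [hxl, decide_false, cond_false]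
      exact w3.ext.clauseIn (hS.copy_clauseIn hx)
  · by_cases hxl : x = l.var
    · simp only [hxl, decide_true, cond_true, List.mem_singleton] at hy
      rw [hy, hxl]
      exact hdepy
    · simp only [hxl, decide_false, cond_false, List.mem_singleton] at hy
      rw [hy, w3.ext.dep _ (List.mem_append_right _ (hS.ex x hx))]
      exact hS.dep x hx
  rintro S₄ ⟨st4, w4, e4, c4⟩
  have e14 : Ext S₁ S₄ := e2.trans (e3.trans e4)
  have g4 := g1.mono e14.cls
  have y4 := y3.mono e4.cls
  have hold : ∀ {Γ : CNF}, S₄.Γ ⊆ Γ → ∀ {U}, UPM Γ U → ∀ {k : Lit}, k.var ≠ l.var →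
      U (rl (newMap t xs) k) → U (rl f k) := by
    intro Γ hΓ U hU k hk h
    refine hU.to_old hS (fun hx => ?_) h
    have := c4 _ hx
    simp only [hk, decide_false, cond_false] at this
    exact this.mono hΓ
  -- The sign `l.pos` makes the new literal `l`, and not the new variable, agree with the variable
  -- of kind `kLeft`.
  have hlit : HasDef S₄.Γ (newMap t xs l.var) [⟨name t kLeft [], l.pos⟩] := by
    simpa using c4 _ hlx
  have hneg : ∀ {Γ : CNF}, S₄.Γ ⊆ Γ → ∀ {U}, UPM Γ U → U (rl (newMap t xs) l.neg) →
      U (rl f l.neg) ∧ U ⟨name t kGate [], true⟩ := by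
    intro Γ hΓ U hU h
    have h1 : U ⟨name t kLeft [], false⟩ := by
      have := hU.copy (hlit.mono hΓ) h
      cases hp : l.pos <;> simpa [hp, Lit.neg] using this
    have h2 := hU.def_neg (y4.mono hΓ) h1
    exact ⟨h2 (rl f l) (by simp), h2 ⟨name t kGate [], false⟩ (by simp)⟩
  have hpos : ∀ {Γ : CNF}, S₄.Γ ⊆ Γ → ∀ {U}, UPM Γ U → U (rl (newMap t xs) l) →
      U ⟨name t kGate [], true⟩ → U (rl f l) := by
    intro Γ hΓ U hU h hn
    have h1 : U ⟨name t kLeft [], true⟩ := by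
      have := hU.copy (hlit.mono hΓ) h
      cases hp : l.pos <;> simpa [hp, Lit.neg] using this
    refine hU.def_true (y4.mono hΓ) h1 (by simp) fun k hk hne => ?_
    simp only [List.mem_cons, List.not_mem_nil, or_false] at hk
    rcases hk with rfl | rfl
    · exact (hne rfl).elim
    · exact hn
  -- The clauses `n ∨ D'` for the copied `D`: if `n` is false, the outer clause of `D` holds, and
  -- its literals are unchanged by the step. In the last round they let a falsified `D'` propagate
  -- to `n`.
  refine (rup_block w4 Ds (fun d => ⟨name t kGate [], true⟩ :: ren (newMap t xs) d.1)
    (fun d hd => ?_) ?_).append ?_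
  · exact ClauseIn.cons (List.mem_append_right _ (e14.exs n1))
      (st4.clauseIn (hv d.1 (hD1 d hd).1))
  · intro d hd U hU hk
    rw [List.forall_mem_cons] at hk
    have h2 := forall_ren.1 hk.2
    refine (g4.outer_vc hU hk.1 hd).2.2 (forall_ren.2 fun k hk' => ?_)
    obtain ⟨hk1, hk2⟩ := List.mem_filter.1 hk'
    exact hold (k := k.neg) (fun _ h => h) hU (hsel k hk2).1 (h2 k hk1)
  rintro S₅ ⟨w5, e5, p5, c5⟩
  refine (rup_block w5 ((l :: C) :: N) (ren (newMap t xs)) (fun D hD => ?_) ?_).mono ?_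
  · refine e5.clauseIn (st4.clauseIn ?_)
    rcases List.mem_cons.1 hD with rfl | hD
    · exact hlC
    · exact hv D hD
  · intro D hD U hU hk
    have hk := forall_ren.1 hk
    rcases List.mem_cons.1 hD with rfl | hD
    · obtain ⟨h1, h2⟩ := hneg e5.cls hU (hk l List.mem_cons_self)
      -- If the new `l` is false, then `l` is false and `n` is true. But the clauses `o_D ∨ l ∨ C`
      -- now force every `o_D`, and with them `n̄`.
      refine hU.cons _ h2 ((g4.mono e5.cls).gate_false hU fun d hd => ?_)
      refine (hU.clause _ (e5.cls (e4.cls (e3.cls (c2 d hd))))).1 _ (by simp) fun k hk' hne => ?_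
      rcases List.mem_cons.1 hk' with rfl | hk'
      · exact (hne rfl).elim
      · obtain ⟨k, hk'', rfl⟩ := List.mem_map.1 hk'
        by_cases hkl : k.var = l.var
        · by_cases hkl' : k = l
          · exact hkl' ▸ h1
          · obtain rfl := Lit.eq_neg_of_var hkl hkl'
            exact (hU.cons _ (hk l List.mem_cons_self) (hk _ hk'')).elim
        · exact hold (k := k.neg) e5.cls hU hkl (hk k hk'')
    · have hbase : ∀ k ∈ D, k.var ≠ l.var → U (rl f k.neg) := fun k hk' hne =>
        hold (k := k.neg) e5.cls hU hne (hk k hk')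
      refine hU.conflict (w5.ext.cls (hN D hD)) (forall_ren.2 fun k hk' => ?_)
      by_cases hkl : k.var = l.var
      · by_cases hkl' : k = l
        · subst hkl'
          exact (hneg e5.cls hU (hk k hk')).1
        · obtain rfl := Lit.eq_neg_of_var hkl hkl'
          obtain ⟨b, hb⟩ := hD3 D hD hk'
          have h1 := hk _ hk'
          rw [rl_neg, Lit.neg_neg] at h1 ⊢
          -- The new `l` is true because its complement is falsified in `D`. With `n` obtained from
          -- `n ∨ D'`, the old `l` must be true as well.
          refine hpos e5.cls hU h1 ?_
          refine (hU.clause _ (c5 _ hb)).1 _ (by simp) fun j hj hne => ?_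
          rcases List.mem_cons.1 hj with rfl | hj
          · exact (hne rfl).elim
          · obtain ⟨j, hj', rfl⟩ := List.mem_map.1 hj
            exact hk j hj'
      · exact hbase k hk' hkl
  · rintro S₆ ⟨w6, e6, p6, c6⟩
    exact ⟨st4.of_pre w6.inv (p6.trans p5), c6, w6.ext⟩

end Steps

end QBFSim
namespace QBFSim
variable {M : List Fm}

/-! ### Reduction of universal literals -/

/-- Literals that are true after the renaming `g` are true after the renaming `h`, when unit
propagation has assigned `c`. -/
def Leads (Γ : CNF) (c : Lit) (g h : ℕ → ℕ) : Prop :=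
  ∀ Δ, Γ ⊆ Δ → ∀ U, UPM Δ U → U c → ∀ k, U (rl g k) → U (rl h k)

/-- The renaming that replaces the variables `Sx` by their conditional copies. -/
def condMap (t : List Unit) (Sx : List ℕ) (f : ℕ → ℕ) (x : ℕ) : ℕ :=
  bif decide (x ∈ Sx) then name t kCond x.bits else f x

def condItems (t : List Unit) (Sx : List ℕ) (f : ℕ → ℕ) (a : Lit) : List Item :=
  Sx.map fun x => .defIf (name t kCond x.bits) a (f x)

/-- The variables `v x` depend on at most what `x` depends on, except `u`. -/
def Indep (S : SState) (xs : List ℕ) (Q : Prefix) (u : ℕ) (v : ℕ → ℕ) : Prop :=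
  ∀ x ∈ xs, v x ∈ S.pre.exNames ∧ S.pre.dep (v x) ⊆ depOf Q x ∧ u ∉ S.pre.dep (v x)

def reduceItems {A : Type} (v : ℕ → ℕ) (a : Lit) (L : List A) (R : A → Clause) : List Item :=
  (L.map fun i => .rup (a.neg :: ren v (R i))) ++ L.map fun i => .red a.neg (ren v (R i))

/-- The definitions of `x' ↔ (n ∧ x) ∨ (n̄ ∧ v)` for the variables `x` in `Sx`, where `n` is the
gate, and of copies of the other variables. -/
def iteItems (t : List Unit) (xs Sx : List ℕ) (f v : ℕ → ℕ) : List Item :=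
  (Sx.map fun x => .defOr (name t kLeft x.bits) [⟨name t kGate [], true⟩, ⟨v x, false⟩]) ++
  ((Sx.map fun x => .defOr (name t kRight x.bits) [⟨name t kGate [], false⟩, ⟨f x, false⟩]) ++
  (newDefs t xs fun x => bif decide (x ∈ Sx) then
    [⟨name t kLeft x.bits, false⟩, ⟨name t kRight x.bits, false⟩] else [⟨f x, true⟩]))

section
variable {xs us Sx : List ℕ} {cur : ℕ} {Q : Prefix} {f v : ℕ → ℕ} {S S₁ : SState}
  {t : List Unit} {used : List Kind}

theorem condMap_of_mem {x : ℕ} (h : x ∈ Sx) : condMap t Sx f x = name t kCond x.bits := by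
  simp [condMap, h]

theorem condMap_of_not_mem {x : ℕ} (h : x ∉ Sx) : condMap t Sx f x = f x := by
  simp [condMap, h]

theorem rl_condMap {k : Lit} (h : k.var ∉ Sx) : rl (condMap t Sx f) k = rl f k := by
  rw [rl, rl, condMap_of_not_mem h]

/-- Independent extension with the condition `a` removes `a.var` from the dependency set of the
conditional copy. The variables outside `Sx` do not depend on `a.var` in the first place, so they
may stay as they are. -/
theorem cond_block (hS : Stage xs us cur Q f S) (ht : t.length = cur + 1)
    (hw : Within S t used S₁) (hk : kCond ∉ used) {a : Lit} (ha : (Quant.all, a.var) ∈ Q)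
    (hsub : Sx ⊆ xs) (hnd : Sx.Nodup) (hSx : ∀ x ∈ xs, a.var ∈ depOf Q x → x ∈ Sx) :
    STr M S₁ (condItems t Sx f a) (fun S₂ =>
      Within S t (kCond :: used) S₂ ∧ Ext S₁ S₂ ∧ Indep S₂ xs Q a.var (condMap t Sx f) ∧
        Leads S₂.Γ a (condMap t Sx f) f ∧ Leads S₂.Γ a f (condMap t Sx f)) := by
  refine (if_block hw (hS.fresh_at ht) hk Sx hnd f a (hw.ext.univ (hS.all_univ ha))
    fun x hx => hw.ext.names (List.mem_append_right _ (hS.ex x (hsub hx)))).mono ?_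
  rintro S₂ ⟨h1, h2, h3⟩
  have hold : ∀ x ∈ xs, S₁.pre.dep (f x) = S.pre.dep (f x) := fun x hx =>
    hw.ext.dep _ (List.mem_append_right _ (hS.ex x hx))
  refine ⟨h1, h2, fun x hx => ?_, ?_, ?_⟩
  · by_cases hxS : x ∈ Sx
    · rw [condMap_of_mem hxS]
      obtain ⟨_, h5, h6⟩ := h3 x hxS
      refine ⟨h5, fun u hu => ?_, fun hu => (h6 _ hu).2 rfl⟩
      have := (h6 u hu).1
      rw [hold x hx] at this
      exact hS.dep x hx this
    · rw [condMap_of_not_mem hxS, h1.ext.dep _ (List.mem_append_right _ (hS.ex x hx))]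
      exact ⟨h1.ext.exs (hS.ex x hx), hS.dep x hx, fun hu => hxS (hSx x hx (hS.dep x hx hu))⟩
  · intro Δ hΔ U hU hUa k hk
    by_cases hxS : k.var ∈ Sx
    · rw [rl, condMap_of_mem hxS] at hk
      exact hU.of_if ((h3 _ hxS).1.mono hΔ) hUa hk
    · rwa [rl_condMap hxS] at hk
  · intro Δ hΔ U hU hUa k hk
    by_cases hxS : k.var ∈ Sx
    · rw [rl, condMap_of_mem hxS]
      exact hU.to_if ((h3 _ hxS).1.mono hΔ) hUa hk
    · rwa [rl_condMap hxS]

theorem Indep.ext (h : Indep S xs Q cur v) (he : Ext S S₁) : Indep S₁ xs Q cur v := by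
  intro x hx
  obtain ⟨h1, h2, h3⟩ := h x hx
  rw [he.dep _ (List.mem_append_right _ h1)]
  exact ⟨he.exs h1, h2, h3⟩

/-- Nothing in the clause `ā ∨ R` except `ā` depends on `a.var` after the renaming `v`, so `ā` can
be reduced and `R` holds for `v` unconditionally. -/
theorem reduce_block (hS : Stage xs us cur Q f S) (hw : Within S t used S₁) {a : Lit}
    (ha : (Quant.all, a.var) ∈ Q) (hv : Indep S₁ xs Q a.var v) (hid : ∀ x, x ∉ xs → v x = x)
    {A : Type} (L : List A) (R : A → Clause)
    (hR : ∀ i ∈ L, ∀ k ∈ R i, k.var ∈ Q.names ∧ k.var ≠ a.var)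
    (hup : ∀ i ∈ L, ∀ U, UPM S₁.Γ U → U a → (∀ k ∈ R i, U (rl v k).neg) → False) :
    STr M S₁ (reduceItems v a L R) (fun S₂ =>
      Within S t used S₂ ∧ Ext S₁ S₂ ∧ ∀ i ∈ L, ren v (R i) ∈ S₂.Γ) := by
  have hau : a.var ∈ S₁.pre.univ := hw.ext.univ (hS.all_univ ha)
  have hin : ∀ i ∈ L, ∀ k ∈ R i, (rl v k).var ∈ S₁.pre.names := by
    intro i hi k hk
    change v k.var ∈ _
    by_cases hx : k.var ∈ xs
    · exact List.mem_append_right _ (hv _ hx).1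
    · rw [hid _ hx]
      rcases mem_names.1 (hR i hi k hk).1 with h | h
      · exact List.mem_append_left _ (hw.ext.univ (hS.all_univ h))
      · exact (hx (hS.exMem _ h)).elim
  refine (rup_block hw L (fun i => a.neg :: ren v (R i)) ?_ ?_).append ?_
  · intro i hi
    exact ClauseIn.cons (List.mem_append_left _ hau) (forall_ren.2 (hin i hi))
  · intro i hi U hU hk
    rw [List.forall_mem_cons, Lit.neg_neg] at hk
    exact hup i hi U hU hk.1 (forall_ren.1 hk.2)
  rintro S₂ ⟨h1, h2, h3, h4⟩
  refine (red_block h1 L (fun i => ren v (R i)) a.neg (h2.univ hau) h4 ?_).mono ?_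
  · intro i hi
    rw [forall_ren]
    intro k hk
    rw [Lit.neg_var, h3]
    change v k.var ≠ _ ∧ (v k.var ∈ _ → _)
    by_cases hx : k.var ∈ xs
    · obtain ⟨h5, _, h7⟩ := hv _ hx
      refine ⟨fun e => hw.inv.2 _ hau (e ▸ h5), fun _ => h7⟩
    · rw [hid _ hx]
      refine ⟨(hR i hi k hk).2, fun h => ?_⟩
      rcases mem_names.1 (hR i hi k hk).1 with h' | h'
      · exact (hw.inv.2 _ (hw.ext.univ (hS.all_univ h')) h).elim
      · exact (hx (hS.exMem _ h')).elim
  · rintro S₃ ⟨h5, h6, _, h7⟩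
    exact ⟨h5, h2.trans h6, h7⟩

/-- Propagation through `g ↔ (n̄ ∧ v) ∨ (n ∧ w̄)`, defined with `a ↔ n ∨ v̄` and `b ↔ n̄ ∨ w`. -/
theorem UPM.mux {Γ : CNF} {U : Lit → Prop} (hU : UPM Γ U) {g a b v : ℕ} {n w : Lit} {Y : Clause}
    (hY : HasDef Γ g Y) (hm : ∀ y, y ∈ Y ↔ y = ⟨a, false⟩ ∨ y = ⟨b, false⟩)
    (hA : HasDef Γ a [n, ⟨v, false⟩]) (hB : HasDef Γ b [n.neg, w]) (hn : U n.neg) (c : Bool) :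
    U ⟨g, c⟩ ↔ U ⟨v, c⟩ := by
  have hb : U ⟨b, true⟩ := hU.def_pos hB (y := n.neg) (by simp) hn
  constructor
  · intro h
    cases c
    · have h1 := hU.def_neg hY h ⟨a, false⟩ ((hm _).2 (Or.inl rfl))
      refine hU.def_true hA h1 (by simp) fun k hk hne => ?_
      simp only [List.mem_cons, List.not_mem_nil, or_false] at hk
      rcases hk with rfl | rfl
      · exact hn
      · exact (hne rfl).elim
    · have h1 : U ⟨a, false⟩ := by
        refine hU.def_true hY h ((hm _).2 (Or.inl rfl)) fun k hk hne => ?_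
        rcases (hm k).1 hk with rfl | rfl
        · exact (hne rfl).elim
        · exact hb
      exact hU.def_neg hA h1 ⟨v, false⟩ (by simp)
  · intro h
    cases c
    · have h1 : U ⟨a, true⟩ := hU.def_pos hA (y := ⟨v, false⟩) (by simp) h
      refine hU.def_false hY fun y hy => ?_
      rcases (hm y).1 hy with rfl | rfl
      · exact h1
      · exact hb
    · have h1 : U ⟨a, false⟩ := by
        refine hU.def_false hA fun k hk => ?_
        simp only [List.mem_cons, List.not_mem_nil, or_false] at hk
        rcases hk with rfl | rfl
        · exact hn
        · exact h
      exact hU.def_pos hY ((hm _).2 (Or.inl rfl)) h1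

/-- Once the gate is assigned, propagation identifies the new copies with one of the two strategies.
The direction from the new copies to the old variables serves derivations; the proofs of true
formulas, where falsity of clauses is transferred, also use the other one. -/
theorem ite_block {u : ℕ} (hS : Stage xs us cur Q f S) (ht : t.length = cur + 1)
    (hw : Within S t used S₁) (hk : ∀ k ∈ [kCopy, kLeft, kRight], k ∉ used)
    (hsub : Sx ⊆ xs) (hnd : Sx.Nodup) (hv : Indep S₁ xs Q u v) (hvf : ∀ x, x ∉ Sx → v x = f x)
    (hn : name t kGate [] ∈ S₁.pre.exNames)
    (hd : ∀ x ∈ Sx, S₁.pre.dep (name t kGate []) ⊆ depOf Q x) :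
    STr M S₁ (iteItems t xs Sx f v) (fun S₂ =>
      Stage xs us (cur + 1) Q (newMap t xs) S₂ ∧
      Within S t (kCopy :: kRight :: kLeft :: used) S₂ ∧ Ext S₁ S₂ ∧
      Leads S₂.Γ ⟨name t kGate [], false⟩ (newMap t xs) v ∧
      Leads S₂.Γ ⟨name t kGate [], true⟩ (newMap t xs) f ∧
      Leads S₂.Γ ⟨name t kGate [], false⟩ v (newMap t xs) ∧
      Leads S₂.Γ ⟨name t kGate [], true⟩ f (newMap t xs)) := by
  have hfx : ∀ x ∈ xs, f x ∈ S₁.pre.names := fun x hx =>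
    hw.ext.names (List.mem_append_right _ (hS.ex x hx))
  have hfd : ∀ x ∈ xs, S₁.pre.dep (f x) ⊆ depOf Q x := fun x hx => by
    rw [hw.ext.dep _ (List.mem_append_right _ (hS.ex x hx))]
    exact hS.dep x hx
  have hndb : (Sx.map Nat.bits).Nodup := hnd.map bits_injective
  refine (def_block hw (hS.fresh_at ht) (hk kLeft (by simp)) Sx Nat.bits hndb
    (fun x => [⟨name t kGate [], true⟩, ⟨v x, false⟩]) ?_).append ?_
  · intro x hx y hy
    simp only [List.mem_cons, List.not_mem_nil, or_false] at hy
    rcases hy with rfl | rfl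
    · exact List.mem_append_right _ hn
    · exact List.mem_append_right _ (hv x (hsub hx)).1
  rintro S₂ ⟨w2, e2, c2⟩
  refine (def_block w2 (hS.fresh_at ht) (k := kRight)
    (by simpa using hk kRight (by simp)) Sx Nat.bits hndb
    (fun x => [⟨name t kGate [], false⟩, ⟨f x, false⟩]) ?_).append ?_
  · intro x hx y hy
    simp only [List.mem_cons, List.not_mem_nil, or_false] at hy
    rcases hy with rfl | rfl
    · exact List.mem_append_right _ (e2.exs hn)
    · exact e2.names (hfx x (hsub hx))
  rintro S₃ ⟨w3, e3, c3⟩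
  have dL : ∀ x ∈ Sx, S₃.pre.dep (name t kLeft x.bits) ⊆ depOf Q x := by
    intro x hx u hu
    rw [e3.dep _ (List.mem_append_right _ (c2 x hx).2.1)] at hu
    obtain ⟨y, hy, hu⟩ := (c2 x hx).2.2 u hu
    simp only [List.mem_cons, List.not_mem_nil, or_false] at hy
    rcases hy with rfl | rfl
    · exact hd x hx hu
    · exact (hv x (hsub hx)).2.1 hu
  have dR : ∀ x ∈ Sx, S₃.pre.dep (name t kRight x.bits) ⊆ depOf Q x := by
    intro x hx u hu
    obtain ⟨y, hy, hu⟩ := (c3 x hx).2.2 u hu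
    simp only [List.mem_cons, List.not_mem_nil, or_false] at hy
    rcases hy with rfl | rfl
    · rw [e2.dep _ (List.mem_append_right _ hn)] at hu
      exact hd x hx hu
    · rw [e2.dep _ (hfx x (hsub hx))] at hu
      exact hfd x (hsub hx) hu
  refine (new_block hS ht w3 (by simpa using hk kCopy (by simp)) (fun x hx => ?_)
    fun x hx y hy => ?_).mono ?_
  · by_cases hxS : x ∈ Sx
    · simp only [hxS, decide_true, cond_true]
      intro y hy
      simp only [List.mem_cons, List.not_mem_nil, or_false] at hy
      rcases hy with rfl | rfl
      · exact List.mem_append_right _ (e3.exs (c2 x hxS).2.1)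
      · exact List.mem_append_right _ (c3 x hxS).2.1
    · simp only [hxS, decide_false, cond_false]
      exact w3.ext.clauseIn (hS.copy_clauseIn hx)
  · by_cases hxS : x ∈ Sx
    · simp only [hxS, decide_true, cond_true, List.mem_cons, List.not_mem_nil, or_false] at hy
      rcases hy with rfl | rfl
      · exact dL x hxS
      · exact dR x hxS
    · simp only [hxS, decide_false, cond_false, List.mem_singleton] at hy
      rw [hy, (e2.trans e3).dep _ (hfx x hx)]
      exact hfd x hx
  rintro S₄ ⟨h4, w4, e4, c4⟩
  have defs : ∀ {Δ : CNF}, S₄.Γ ⊆ Δ → ∀ x ∈ Sx,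
      HasDef Δ (newMap t xs x)
        [⟨name t kLeft x.bits, false⟩, ⟨name t kRight x.bits, false⟩] ∧
      HasDef Δ (name t kLeft x.bits) [⟨name t kGate [], true⟩, ⟨v x, false⟩] ∧
      HasDef Δ (name t kRight x.bits) [⟨name t kGate [], false⟩, ⟨f x, false⟩] := by
    intro Δ hΔ x hx
    have hY := (c4 x (hsub hx)).mono hΔ
    simp only [hx, decide_true, cond_true] at hY
    exact ⟨hY, (c2 x hx).1.mono (List.Subset.trans (e3.trans e4).cls hΔ),
      (c3 x hx).1.mono (List.Subset.trans e4.cls hΔ)⟩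
  have copies : ∀ {Δ : CNF}, S₄.Γ ⊆ Δ → ∀ x ∈ xs, x ∉ Sx →
      HasDef Δ (newMap t xs x) [⟨f x, true⟩] := by
    intro Δ hΔ x hx hxS
    have := (c4 x hx).mono hΔ
    simpa only [hxS, decide_false, cond_false] using this
  refine ⟨h4, w4, e2.trans (e3.trans e4), ?_, ?_, ?_, ?_⟩
  · rintro Δ hΔ U hU hg ⟨x, b⟩ hk
    by_cases hxS : x ∈ Sx
    · obtain ⟨hY, hL, hR⟩ := defs hΔ x hxS
      exact (hU.mux hY (by simp) hL hR hg b).1 hk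
    · have := hU.to_old hS (fun hx => copies hΔ x hx hxS) hk
      rwa [rl, ← hvf x hxS] at this
  · rintro Δ hΔ U hU hg ⟨x, b⟩ hk
    by_cases hxS : x ∈ Sx
    · obtain ⟨hY, hL, hR⟩ := defs hΔ x hxS
      -- The same lemma with the roles of the two halves of the definition exchanged.
      exact (hU.mux hY (by simp [or_comm]) hR hL hg b).1 hk
    · exact hU.to_old hS (fun hx => copies hΔ x hx hxS) hk
  · rintro Δ hΔ U hU hg ⟨x, b⟩ hk
    by_cases hxS : x ∈ Sx
    · obtain ⟨hY, hL, hR⟩ := defs hΔ x hxS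
      exact (hU.mux hY (by simp) hL hR hg b).2 hk
    · rw [rl, hvf x hxS] at hk
      exact hU.to_new hS (fun hx => copies hΔ x hx hxS) hk
  · rintro Δ hΔ U hU hg ⟨x, b⟩ hk
    by_cases hxS : x ∈ Sx
    · obtain ⟨hY, hL, hR⟩ := defs hΔ x hxS
      exact (hU.mux hY (by simp [or_comm]) hR hL hg b).2 hk
    · exact hU.to_new hS (fun hx => copies hΔ x hx hxS) hk

end

theorem mem_without {K : Clause} {k l : Lit} : k ∈ K.without l ↔ k ∈ K ∧ k ≠ l := by
  simp [Clause.without]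

theorem var_ne_of_mem_without {K : Clause} {k l : Lit} (hl : l.neg ∉ K) (hk : k ∈ K.without l) :
    k.var ≠ l.var := by
  obtain ⟨h1, h2⟩ := mem_without.1 hk
  intro h
  rw [Lit.eq_neg_of_var h h2] at h1
  exact hl h1

/-- Reduced clauses: the clauses `D` of `N` without `l̄`, with `l` removed. -/
theorem without_block {xs us Sx : List ℕ} {cur : ℕ} {Q : Prefix} {f : ℕ → ℕ} {S S₁ : SState}
    {t : List Unit} {used : List Kind} {N : CNF} {l : Lit} (hS : Stage xs us cur Q f S)
    (hw : Within S t used S₁)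
    (hl : (Quant.all, l.var) ∈ Q) (hsub : Sx ⊆ xs)
    (hv : Indep S₁ xs Q l.var (condMap t Sx f)) (hL : Leads S₁.Γ l.neg f (condMap t Sx f))
    (hL' : Leads S₁.Γ l.neg (condMap t Sx f) f)
    (hN : Has S f N) (hNv : ∀ D ∈ N, ∀ k ∈ D, k.var ∈ Q.names) :
    STr M S₁ (reduceItems (condMap t Sx f) l.neg (N.filter fun D => decide (l.neg ∉ D))
        fun D => Clause.without D l) (fun S₂ =>
      Within S t used S₂ ∧ Ext S₁ S₂ ∧
        ∀ D ∈ N, l.neg ∉ D → ren (condMap t Sx f) (Clause.without D l) ∈ S₂.Γ) := by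
  refine (reduce_block (a := l.neg) hS hw hl hv (fun x hx => ?_) (N.filter fun D =>
    decide (l.neg ∉ D)) (fun D => Clause.without D l) ?_ ?_).mono ?_
  · rw [condMap_of_not_mem fun h => hx (hsub h), hS.id x hx]
  · intro D hD k hk
    rw [List.mem_filter, decide_eq_true_eq] at hD
    exact ⟨hNv D hD.1 k (mem_without.1 hk).1, var_ne_of_mem_without (l := l) hD.2 hk⟩
  · intro D hD U hU ha hk
    refine hU.conflict (hw.ext.cls (hN D (List.mem_filter.1 hD).1)) (forall_ren.2 fun k hk' => ?_)
    by_cases hkl : k = l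
    · subst hkl
      have : rl f k = k := by
        rw [rl, hS.map_all hl]
      rwa [this]
    · exact hL' _ (fun _ h => h) U hU ha k.neg (hk k (mem_without.2 ⟨hk', hkl⟩))
  · rintro S₂ ⟨h1, h2, h3⟩
    exact ⟨h1, h2, fun D hD hl => h3 D (List.mem_filter.2 ⟨hD, by simpa using hl⟩)⟩

/-- The script for the removal of the universal literal `l` from `K` by resolution asymmetric
tautology. -/
def qratuScript (t : List Unit) (xs Sx : List ℕ) (f : ℕ → ℕ) (sel : Lit → Bool) (N : CNF)
    (K : Clause) (l : Lit) : List Item :=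
  let v := condMap t Sx f
  let Ds := (labels (N.erase K)).filter fun d => decide (l.neg ∈ d.1)
  gates t f sel Ds ++
  (condItems t Sx f l.neg ++
  (reduceItems v l.neg (N.filter fun D => decide (l.neg ∉ D)) (fun D => Clause.without D l) ++
  (iteItems t xs Sx f v ++
  ((Ds.map fun d => .rup (⟨name t kOuter d.2, true⟩ :: ren f (Clause.without K l))) ++
  (((Clause.without K l :: N.erase K).map fun D =>
    .rup (⟨name t kGate [], false⟩ :: ren (newMap t xs) D)) ++
  ((Clause.without K l :: N.erase K).map fun D => .rup (ren (newMap t xs) D)))))))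

section
variable {xs us Sx : List ℕ} {cur : ℕ} {Q : Prefix} {f : ℕ → ℕ} {S : SState} {t : List Unit}

/-- The new strategy follows the old one if some outer clause `O_D` is false, and otherwise the
strategy `v` that plays as if `l` were false. In the first case `C` holds, since otherwise `hup`
makes all outer clauses true. In the second case clauses with `l̄` hold by their outer clauses,
which `v` leaves unchanged; all others, including `C`, hold for `v` by reduction. -/
theorem qratu_step (hS : Stage xs us cur Q f S) (ht : t.length = cur + 1) {sel : Lit → Bool}
    {N : CNF} {K : Clause} {l : Lit} (hsub : Sx ⊆ xs) (hnd : Sx.Nodup)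
    (hSx : ∀ x ∈ xs, l.var ∈ depOf Q x → x ∈ Sx)
    (hN : Has S f N) (hNv : ∀ D ∈ N, ∀ k ∈ D, k.var ∈ Q.names)
    (hK : K ∈ N) (hlK : l.neg ∉ K) (hl : (Quant.all, l.var) ∈ Q)
    (hsel : ∀ k, sel k = true → k.var ∉ Sx ∧ ∀ x ∈ Sx, depOf Q k.var ⊆ depOf Q x)
    (hup : ∀ D ∈ N.erase K, l.neg ∈ D →
      UPRefutes (N.erase K ++ (K.without l).negUnits ++ Clause.negUnits (D.filter sel))) :
    STr M S (qratuScript t xs Sx f sel N K l) (fun S' =>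
      Stage xs us (cur + 1) Q (newMap t xs) S' ∧
        Has S' (newMap t xs) (K.without l :: N.erase K) ∧ Ext S S') := by
  have hN' : ∀ D ∈ N.erase K, D ∈ N := fun D hD => List.mem_of_mem_erase hD
  have hCv : ∀ k ∈ K.without l, k.var ∈ Q.names := fun k hk => hNv K hK k (mem_without.1 hk).1
  have hCNv : ∀ D ∈ K.without l :: N.erase K, ∀ k ∈ D, k.var ∈ Q.names := by
    intro D hD
    rcases List.mem_cons.1 hD with rfl | hD
    · exact hCv
    · exact hNv D (hN' D hD)
  unfold qratuScript
  simp only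
  set Ds := (labels (N.erase K)).filter fun d => decide (l.neg ∈ d.1) with hDs
  have hD1 : ∀ d ∈ Ds, d.1 ∈ N.erase K ∧ l.neg ∈ d.1 := by
    intro d hd
    rw [hDs, List.mem_filter] at hd
    exact ⟨mem_labels_fst hd.1, by simpa using hd.2⟩
  have hD2 : (Ds.map Prod.snd).Nodup :=
    (labels_nodup (N.erase K)).sublist (List.filter_sublist.map _)
  have hD3 : ∀ D ∈ N.erase K, l.neg ∈ D → ∃ b, (D, b) ∈ Ds := by
    intro D hD hl
    obtain ⟨b, hb⟩ := exists_label hD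
    exact ⟨b, List.mem_filter.2 ⟨hb, by simpa using hl⟩⟩
  refine (gates_block hS ht (Within.refl hS.inv t) (by simp) (by simp) hD2
    fun d hd => hNv d.1 (hN' _ (hD1 d hd).1)).append ?_
  rintro S₁ ⟨w1, e1, g1, o1, n1, d1⟩
  -- The condition is `l̄`: under it, `l` contributes nothing to a clause and can be dropped.
  refine (cond_block (a := l.neg) hS ht w1 (by decide) hl hsub hnd hSx).append ?_
  rintro S₂ ⟨w2, e2, i2, l2, l2'⟩
  refine (without_block hS w2 hl hsub i2 l2' l2 hN hNv).append ?_
  rintro S₃ ⟨w3, e3, c3⟩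
  have e13 := e2.trans e3
  refine (ite_block (v := condMap t Sx f) hS ht w3 (by decide) hsub hnd (i2.ext e3)
    (fun x hx => condMap_of_not_mem hx) (e13.exs n1) ?_).append ?_
  · intro x hx u hu
    rw [e13.dep _ (List.mem_append_right _ n1)] at hu
    obtain ⟨d, _, k, _, hk, hu⟩ := d1 u hu
    exact (hsel k hk).2 x hx hu
  rintro S₄ ⟨st4, w4, e4, v4, f4, _, _⟩
  have e14 := e13.trans e4
  have g4 := g1.mono e14.cls
  refine (rup_block w4 Ds (fun d => ⟨name t kOuter d.2, true⟩ :: ren f (K.without l))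
    (fun d hd => ?_) ?_).append ?_
  · exact ClauseIn.cons (List.mem_append_right _ (e14.exs (o1 d hd)))
      (w4.ext.clauseIn (hS.clauseIn hCv))
  · intro d hd U hU hk
    rw [List.forall_mem_cons] at hk
    have h3 := forall_ren.1 (hU.def_neg (g4.outer d hd) hk.1)
    refine (hup d.1 (hD1 d hd).1 (hD1 d hd).2).false_of_ren (f := f) hU fun E hE => ?_
    simp only [List.mem_append] at hE
    rcases hE with (hE | hE) | hE
    · exact (hN.ext w4.ext).vc hU E (hN' E hE)
    · exact hU.vc_negUnits (forall_ren.1 hk.2) E hE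
    · exact hU.vc_negUnits h3 E hE
  rintro S₅ ⟨w5, e5, p5, c5⟩
  -- Unit propagation cannot split on the gate. So the case of a true gate is derived as a separate
  -- round of clauses `n̄ ∨ D'`; the next round then propagates `n̄` and treats the other case.
  refine (rup_block w5 (K.without l :: N.erase K)
    (fun D => ⟨name t kGate [], false⟩ :: ren (newMap t xs) D) (fun D hD => ?_) ?_).append ?_
  · exact ClauseIn.cons (List.mem_append_right _ (e5.exs (e14.exs n1)))
      (e5.clauseIn (st4.clauseIn (hCNv D hD)))
  · intro D hD U hU hk
    rw [List.forall_mem_cons] at hk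
    have h2 : ∀ k ∈ D, U (rl f k).neg := fun k hk' =>
      f4 _ e5.cls U hU hk.1 k.neg (forall_ren.1 hk.2 k hk')
    rcases List.mem_cons.1 hD with rfl | hD
    · refine hU.cons _ hk.1 ((g4.mono e5.cls).gate_false hU fun d hd => ?_)
      refine (hU.clause _ (c5 d hd)).1 _ (by simp) fun j hj hne => ?_
      rcases List.mem_cons.1 hj with rfl | hj
      · exact (hne rfl).elim
      · exact (forall_ren (P := fun k => U k.neg)).2 h2 j hj
    · exact hU.conflict (w5.ext.cls (hN D (hN' D hD))) (forall_ren.2 h2)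
  rintro S₆ ⟨w6, e6, p6, c6⟩
  have e46 := e5.trans e6
  refine (rup_block w6 (K.without l :: N.erase K) (ren (newMap t xs))
    (fun D hD => e46.clauseIn (st4.clauseIn (hCNv D hD))) ?_).mono ?_
  · intro D hD U hU hk
    have hn : U ⟨name t kGate [], false⟩ := by
      refine (hU.clause _ (c6 D hD)).1 _ (by simp) fun j hj hne => ?_
      rcases List.mem_cons.1 hj with rfl | hj
      · exact (hne rfl).elim
      · exact hk j hj
    have h2 : ∀ k ∈ D, U (rl (condMap t Sx f) k).neg := fun k hk' =>
      v4 _ e46.cls U hU hn k.neg (forall_ren.1 hk k hk')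
    rcases List.mem_cons.1 hD with rfl | hD
    · exact hU.conflict (e46.cls (e4.cls (c3 K hK hlK))) (forall_ren.2 h2)
    · by_cases hlD : l.neg ∈ D
      · obtain ⟨b, hb⟩ := hD3 D hD hlD
        refine ((g4.mono e46.cls).outer_vc hU hn hb).2.2 (forall_ren.2 fun k hk' => ?_)
        obtain ⟨hk1, hk2⟩ := List.mem_filter.1 hk'
        have := h2 k hk1
        rwa [rl_condMap (hsel k hk2).1] at this
      · exact hU.conflict (e46.cls (e4.cls (c3 D (hN' D hD) hlD)))
          (forall_ren.2 fun k hk' => h2 k (mem_without.1 hk').1)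
  · rintro S₇ ⟨w7, e7, p7, c7⟩
    exact ⟨st4.of_pre w7.inv (p7.trans (p6.trans p5)), c7, w7.ext⟩

end

end QBFSim
namespace QBFSim
variable {M : List Fm}

/-! ### Extended universal reduction -/

def pathRules (φ : CNF) (Sx : List ℕ) : List HornRule :=
  φ.flatMap fun D => D.flatMap fun k =>
    (D.filter fun q => decide (q ≠ k) && decide (q.var ∈ Sx)).map fun q => ([k.neg], (q, []))

/-- The `Sx`-literals on the resolution paths of `φ` from `C`. -/
def pathLits (φ : CNF) (C : Clause) (Sx : List ℕ) : List Lit :=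
  (hornClosure (pathRules φ Sx)
    ((C.filter fun q => decide (q.var ∈ Sx)).map fun q => (q, []))).map Prod.fst

theorem mem_pathRules {φ : CNF} {Sx : List ℕ} {r : HornRule} :
    r ∈ pathRules φ Sx ↔ ∃ D ∈ φ, ∃ k ∈ D, ∃ q ∈ D, q ≠ k ∧ q.var ∈ Sx ∧ r = ([k.neg], (q, [])) := by
  simp only [pathRules, List.mem_flatMap, List.mem_map, List.mem_filter, Bool.and_eq_true,
    decide_eq_true_eq]
  constructor
  · rintro ⟨D, hD, k, hk, q, ⟨hq, h1, h2⟩, rfl⟩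
    exact ⟨D, hD, k, hk, q, hq, h1, h2, rfl⟩
  · rintro ⟨D, hD, k, hk, q, hq, h1, h2, rfl⟩
    exact ⟨D, hD, k, hk, q, ⟨hq, h1, h2⟩, rfl⟩

theorem pathLits_init {φ : CNF} {C : Clause} {Sx : List ℕ} {q : Lit} (hq : q ∈ C)
    (hS : q.var ∈ Sx) : q ∈ pathLits φ C Sx := by
  refine List.map_subset _ (hornClosure_trail _ _).subset ?_
  simp only [List.map_map, List.mem_map, List.mem_filter, decide_eq_true_eq]
  exact ⟨q, ⟨hq, hS⟩, rfl⟩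

theorem pathLits_step {φ : CNF} {C D : Clause} {Sx : List ℕ} {k q : Lit} (hD : D ∈ φ) (hk : k ∈ D)
    (hp : k.neg ∈ pathLits φ C Sx) (hq : q ∈ D) (hne : q ≠ k) (hS : q.var ∈ Sx) :
    q ∈ pathLits φ C Sx :=
  hornClosed_hornClosure (pathRules φ Sx) _ ([k.neg], (q, []))
    (mem_pathRules.2 ⟨D, hD, k, hk, q, hq, hne, hS, rfl⟩)
    fun _ hk' => (List.mem_singleton.1 hk').symm ▸ hp

theorem pathLits_sound {φ : CNF} {C : Clause} {Sx : List ℕ} {S : ℕ → Prop}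
    (hS : ∀ x ∈ Sx, S x) {q : Lit} (hq : q ∈ pathLits φ C Sx) :
    PathLit φ [C] S q ∧ q.var ∈ Sx := by
  unfold pathLits at hq
  have h := hornClosure_trail (pathRules φ Sx)
    ((C.filter fun q => decide (q.var ∈ Sx)).map fun q => (q, []))
  generalize hornClosure (pathRules φ Sx) _ = T at h hq
  induction h generalizing q with
  | start =>
    simp only [List.map_map, List.mem_map, List.mem_filter, decide_eq_true_eq] at hq
    obtain ⟨q, ⟨h1, h2⟩, rfl⟩ := hq
    exact ⟨.init C q List.mem_cons_self h1 (hS _ h2), h2⟩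
  | step r T' hr hk _ ih =>
    rw [List.map_cons, List.mem_cons] at hq
    rcases hq with rfl | hq
    · obtain ⟨D, hD, k, hk', q, hq, hne, hqS, rfl⟩ := mem_pathRules.1 hr
      refine ⟨.step k.neg q D (ih (hk k.neg (by simp))).1 hD ?_ hq ?_ (hS _ hqS), hqS⟩
      · rwa [Lit.neg_neg]
      · rwa [Lit.neg_neg]
    · exact ih hq

/-- The definition of the new copy of a variable, where `A` are the literals on the paths. -/
def eurDef (t : List Unit) (A : List Lit) (f v : ℕ → ℕ) (x : ℕ) : Clause :=
  bif decide (⟨x, true⟩ ∈ A) then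
    (bif decide (⟨x, false⟩ ∈ A) then [⟨v x, true⟩] else [⟨f x, true⟩, ⟨v x, true⟩])
  else (bif decide (⟨x, false⟩ ∈ A) then [⟨name t kLeft x.bits, false⟩] else [⟨f x, true⟩])

/-- The script for the removal of the universal literal `l` from `K` by extended universal
reduction. -/
def eurScript (t : List Unit) (xs Sx : List ℕ) (f : ℕ → ℕ) (N : CNF) (K : Clause) (l : Lit) :
    List Item :=
  let v := condMap t Sx f
  let A := pathLits (Clause.without K l :: N.erase K) (Clause.without K l) Sx
  condItems t Sx f l.neg ++
  (reduceItems v l.neg (N.filter fun D => decide (l.neg ∉ D)) (fun D => Clause.without D l) ++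
  ((Sx.map fun x => .defOr (name t kLeft x.bits) [⟨f x, false⟩, ⟨v x, false⟩]) ++
  (newDefs t xs (eurDef t A f v) ++
  ((Clause.without K l :: N.erase K).map fun D => .rup (ren (newMap t xs) D)))))

/-- Let `A` be the set of path literals. The definition of the new copies has three effects. A
literal in `A` becomes true whenever it is true for `v`. A literal whose complement is not in `A`
becomes true whenever it is true for the old copies. A literal outside `A` with complement in `A`
becomes true if it is true for both. Hence the reduced clause is inherited from `v`, and a clause
that contains no complement of a literal in `A` is inherited from the old copies. A clause `D` on a
path does not contain `l̄`, so it holds for both strategies, the one for `v` even without `l`, and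
is treated with the literal `k` by which the path enters it. -/
theorem eur_step {xs us Sx : List ℕ} {cur : ℕ} {Q : Prefix} {f : ℕ → ℕ} {S : SState}
    {t : List Unit} (hS : Stage xs us cur Q f S) (ht : t.length = cur + 1)
    {N : CNF} {K : Clause} {l : Lit} (hsub : Sx ⊆ xs) (hnd : Sx.Nodup)
    (hSx : ∀ x ∈ xs, l.var ∈ depOf Q x → x ∈ Sx) (hSx' : ∀ x ∈ Sx, Q.ExRightOf l.var x)
    (hN : Has S f N) (hNv : ∀ D ∈ N, ∀ k ∈ D, k.var ∈ Q.names)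
    (hK : K ∈ N) (hl : (Quant.all, l.var) ∈ Q)
    (hpath : ∀ D, PathClause (K.without l :: N.erase K) [K.without l] (Q.ExRightOf l.var) D →
      l.neg ∉ D) :
    STr M S (eurScript t xs Sx f N K l) (fun S' =>
      Stage xs us (cur + 1) Q (newMap t xs) S' ∧
        Has S' (newMap t xs) (K.without l :: N.erase K) ∧ Ext S S') := by
  have hN' : ∀ D ∈ N.erase K, D ∈ N := fun D hD => List.mem_of_mem_erase hD
  -- The reduced clause itself lies on the paths, so it does not contain `l̄`; hence neither does
  -- `K`.
  have hlK : l.neg ∉ K := by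
    intro h
    refine hpath (K.without l) (Or.inl List.mem_cons_self) (mem_without.2 ⟨h, fun e => ?_⟩)
    have := congrArg Lit.pos e
    simp [Lit.neg] at this
  have hCNv : ∀ D ∈ K.without l :: N.erase K, ∀ k ∈ D, k.var ∈ Q.names := by
    intro D hD
    rcases List.mem_cons.1 hD with rfl | hD
    · exact fun k hk => hNv K hK k (mem_without.1 hk).1
    · exact hNv D (hN' D hD)
  unfold eurScript
  simp only
  set A := pathLits (K.without l :: N.erase K) (K.without l) Sx with hA
  set v := condMap t Sx f with hv
  have hAS : ∀ k ∈ A, k.var ∈ Sx := fun k hk => (pathLits_sound hSx' hk).2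
  have hfx : ∀ x ∈ xs, f x ∈ S.pre.names := fun x hx => List.mem_append_right _ (hS.ex x hx)
  refine (cond_block (a := l.neg) hS ht (Within.refl hS.inv t) (by decide) hl hsub hnd
    hSx).append ?_
  rintro S₁ ⟨w1, e1, i1, l1, l1'⟩
  refine (without_block hS w1 hl hsub i1 l1' l1 hN hNv).append ?_
  rintro S₂ ⟨w2, e2, c2⟩
  have i2 := i1.ext e2
  refine (def_block w2 (hS.fresh_at ht) (by decide) Sx Nat.bits (hnd.map bits_injective)
    (fun x => [⟨f x, false⟩, ⟨v x, false⟩]) ?_).append ?_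
  · intro x hx y hy
    simp only [List.mem_cons, List.not_mem_nil, or_false] at hy
    rcases hy with rfl | rfl
    · exact w2.ext.names (hfx x (hsub hx))
    · exact List.mem_append_right _ (i2 x (hsub hx)).1
  rintro S₃ ⟨w3, e3, c3⟩
  have i3 := i2.ext e3
  have dfx : ∀ x ∈ xs, S₃.pre.dep (f x) ⊆ depOf Q x := by
    intro x hx
    rw [w3.ext.dep _ (hfx x hx)]
    exact hS.dep x hx
  have dyx : ∀ x ∈ Sx, S₃.pre.dep (name t kLeft x.bits) ⊆ depOf Q x := by
    intro x hx u hu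
    obtain ⟨y, hy, hu⟩ := (c3 x hx).2.2 u hu
    simp only [List.mem_cons, List.not_mem_nil, or_false] at hy
    rcases hy with rfl | rfl
    · rw [w2.ext.dep _ (hfx x (hsub hx))] at hu
      exact hS.dep x (hsub hx) hu
    · exact (i2 x (hsub hx)).2.1 hu
  have hY : ∀ x ∈ xs, ∀ y ∈ eurDef t A f v x,
      y.var ∈ S₃.pre.names ∧ S₃.pre.dep y.var ⊆ depOf Q x := by
    intro x hx y hy
    have h1 : f x ∈ S₃.pre.names ∧ S₃.pre.dep (f x) ⊆ depOf Q x :=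
      ⟨w3.ext.names (hfx x hx), dfx x hx⟩
    have h2 : v x ∈ S₃.pre.names ∧ S₃.pre.dep (v x) ⊆ depOf Q x :=
      ⟨List.mem_append_right _ (i3 x hx).1, (i3 x hx).2.1⟩
    by_cases ht : (⟨x, true⟩ : Lit) ∈ A <;> by_cases hf : (⟨x, false⟩ : Lit) ∈ A <;>
      simp only [eurDef, ht, hf, decide_true, decide_false, cond_true, cond_false,
        List.mem_cons, List.not_mem_nil, or_false] at hy
    · rw [hy]
      exact h2
    · rcases hy with rfl | rfl
      · exact h1
      · exact h2
    · rw [hy]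
      exact ⟨List.mem_append_right _ (c3 x (hAS _ hf)).2.1, dyx x (hAS _ hf)⟩
    · rw [hy]
      exact h1
  refine (new_block hS ht w3 (by decide) (fun x hx y hy => (hY x hx y hy).1)
    fun x hx y hy => (hY x hx y hy).2).append ?_
  rintro S₄ ⟨st4, w4, e4, c4⟩
  refine (rup_block w4 (K.without l :: N.erase K) (ren (newMap t xs))
    (fun D hD => st4.clauseIn (hCNv D hD)) ?_).mono ?_
  swap
  · rintro S₅ ⟨w5, e5, p5, c5⟩
    exact ⟨st4.of_pre w5.inv p5, c5, w5.ext⟩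
  intro D hD U hU hk
  have hk := forall_ren.1 hk
  have hy : ∀ x ∈ Sx, HasDef S₄.Γ (name t kLeft x.bits) [⟨f x, false⟩, ⟨v x, false⟩] :=
    fun x hx => (c3 x hx).1.mono e4.cls
  have notIn : ∀ k : Lit, k ∉ A → k.neg ∉ A → U (rl (newMap t xs) k).neg → U (rl f k).neg := by
    intro k h1 h2 h
    refine hU.to_old hS (l := k.neg) (fun hx => ?_) h
    have := c4 _ hx
    obtain ⟨x, b⟩ := k
    cases b <;> simp only [Lit.neg, Bool.not_false, Bool.not_true] at h1 h2 this ⊢ <;>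
      simpa only [eurDef, h1, h2, decide_false, cond_false] using this
  -- Both definitions that `v` enters with a path literal `k`, namely `v` alone and the disjunction
  -- (for that literal), are implied by the value of `k` under `v`; this is the contrapositive.
  have inA : ∀ k ∈ A, U (rl (newMap t xs) k).neg → U (rl v k).neg := by
    intro k h1 h
    have hxS := hAS k h1
    have hd := c4 _ (hsub hxS)
    have hy := hy _ hxS
    obtain ⟨x, b⟩ := k
    by_cases h2 : (⟨x, !b⟩ : Lit) ∈ A
    · have hd' : HasDef S₄.Γ (newMap t xs x) [⟨v x, true⟩] := by
        cases b <;> simp only [Bool.not_false, Bool.not_true] at h2 <;>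
          simpa only [eurDef, h1, h2, decide_true, cond_true] using hd
      exact hU.copy_var hd' h
    · cases b
      · simp only [Bool.not_false] at h2
        have hd' : HasDef S₄.Γ (newMap t xs x) [⟨name t kLeft x.bits, false⟩] := by
          simpa only [eurDef, h1, h2, decide_true, decide_false, cond_true, cond_false] using hd
        exact hU.def_neg hy (hU.copy hd' h) ⟨v x, false⟩ (by simp)
      · simp only [Bool.not_true] at h2
        have hd' : HasDef S₄.Γ (newMap t xs x) [⟨f x, true⟩, ⟨v x, true⟩] := by
          simpa only [eurDef, h1, h2, decide_true, decide_false, cond_true, cond_false] using hd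
        exact hU.def_neg hd' h ⟨v x, true⟩ (by simp)
  have toF : ∀ k : Lit, k.neg ∉ A → U (rl (newMap t xs) k).neg → U (rl f k).neg := by
    intro k h2 h
    by_cases h1 : k ∈ A
    · have hxS := hAS k h1
      have hd := c4 _ (hsub hxS)
      have hy := hy _ hxS
      obtain ⟨x, b⟩ := k
      cases b
      · simp only [Lit.neg, Bool.not_false] at h2
        have hd' : HasDef S₄.Γ (newMap t xs x) [⟨name t kLeft x.bits, false⟩] := by
          simpa only [eurDef, h1, h2, decide_true, decide_false, cond_true, cond_false] using hd
        exact hU.def_neg hy (hU.copy hd' h) ⟨f x, false⟩ (by simp)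
      · simp only [Lit.neg, Bool.not_true] at h2
        have hd' : HasDef S₄.Γ (newMap t xs x) [⟨f x, true⟩, ⟨v x, true⟩] := by
          simpa only [eurDef, h1, h2, decide_true, decide_false, cond_true, cond_false] using hd
        exact hU.def_neg hd' h ⟨f x, true⟩ (by simp)
    · exact notIn k h1 h2 h
  -- If only the complement of `k` is on the paths, the new `k` is the conjunction of its two
  -- values, and so cannot be false when both are true.
  have clash : ∀ k : Lit, k ∉ A → k.neg ∈ A → U (rl (newMap t xs) k).neg → U (rl f k) →
      U (rl v k) → False := by
    intro k h1 h2 h hf hv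
    have hxS : k.var ∈ Sx := hAS k.neg h2
    have hd := c4 _ (hsub hxS)
    have hy := hy _ hxS
    obtain ⟨x, b⟩ := k
    cases b
    · simp only [Lit.neg, Bool.not_false] at h2
      have hd' : HasDef S₄.Γ (newMap t xs x) [⟨f x, true⟩, ⟨v x, true⟩] := by
        simpa only [eurDef, h1, h2, decide_true, decide_false, cond_true, cond_false] using hd
      refine hU.def_conflict hd' h fun y hy => ?_
      simp only [List.mem_cons, List.not_mem_nil, or_false] at hy
      rcases hy with rfl | rfl
      · exact hf
      · exact hv
    · simp only [Lit.neg, Bool.not_true] at h2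
      have hd' : HasDef S₄.Γ (newMap t xs x) [⟨name t kLeft x.bits, false⟩] := by
        simpa only [eurDef, h1, h2, decide_true, decide_false, cond_true, cond_false] using hd
      refine hU.def_conflict hy (hU.copy hd' h) fun y hy => ?_
      simp only [List.mem_cons, List.not_mem_nil, or_false] at hy
      rcases hy with rfl | rfl
      · exact hf
      · exact hv
  have toV : ∀ k : Lit, (k.var ∈ Sx → k ∈ A) → U (rl (newMap t xs) k).neg → U (rl v k).neg := by
    intro k h1 h
    by_cases hxS : k.var ∈ Sx
    · exact inA k (h1 hxS) h
    · rw [hv, rl_condMap hxS]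
      exact notIn k (fun h => hxS (hAS k h)) (fun h => hxS (hAS k.neg h)) h
  have vc : ∀ D ∈ N, l.neg ∉ D → ren v (Clause.without D l) ∈ S₄.Γ := fun D hD hlD =>
    e4.cls (e3.cls (c2 D hD hlD))
  rcases List.mem_cons.1 hD with rfl | hD
  · exact hU.conflict (vc K hK hlK) (forall_ren.2 fun k hk' =>
      toV k (fun hxS => pathLits_init hk' hxS) (hk k hk'))
  -- If no literal of `D` has its complement in `A`, all literals pass over from the old copies.
  -- Otherwise a path enters `D` at `k`, and every other literal of `D` over `Sx` is in `A`.
  by_cases hp : ∃ k ∈ D, k.neg ∈ A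
  · obtain ⟨k, hkD, hkA⟩ := hp
    have hlD : l.neg ∉ D := by
      refine hpath D (Or.inr ⟨List.mem_cons_of_mem _ hD, k.neg, (pathLits_sound hSx' hkA).1, ?_⟩)
      rwa [Lit.neg_neg]
    have hq : ∀ q ∈ D, q ≠ k → q.var ∈ Sx → q ∈ A := fun q hq hne hqS =>
      pathLits_step (List.mem_cons_of_mem _ hD) hkD hkA hq hne hqS
    by_cases hkA' : k ∈ A
    · refine hU.conflict (vc D (hN' D hD) hlD) (forall_ren.2 fun q hqD => ?_)
      have hqD := (mem_without.1 hqD).1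
      refine toV q (fun hqS => ?_) (hk q hqD)
      by_cases hne : q = k
      · exact hne ▸ hkA'
      · exact hq q hqD hne hqS
    · have hkl : k ≠ l := by
        rintro rfl
        cases names_nodup_snd hS.nodup (exRight_mem (mem_exRight.2 (hSx' _ (hAS _ hkA)))) hl
      -- All other literals of `D` are false for both strategies, so `D` forces `k` in both. For the
      -- old copies this uses that no other literal `q` has its complement in `A`: a path entering
      -- `D` at `q` would put `k` into `A`.
      refine clash k hkA' hkA (hk k hkD) ?_ ?_
      · refine (hU.clause _ (w4.ext.cls (hN D (hN' D hD)))).1 _ (mem_ren hkD) ?_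
        rw [forall_ren]
        intro q hqD hne
        have hne : q ≠ k := fun e => hne (e ▸ rfl)
        refine toF q (fun hqA => hkA' ?_) (hk q hqD)
        exact pathLits_step (List.mem_cons_of_mem _ hD) hqD hqA hkD hne.symm (hAS k.neg hkA)
      · refine (hU.clause _ (vc D (hN' D hD) hlD)).1 _ (mem_ren (mem_without.2 ⟨hkD, hkl⟩)) ?_
        rw [forall_ren]
        intro q hqD hne
        have hne : q ≠ k := fun e => hne (e ▸ rfl)
        have hqD := (mem_without.1 hqD).1
        exact toV q (fun hqS => hq q hqD hne hqS) (hk q hqD)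
  · push Not at hp
    exact hU.conflict (w4.ext.cls (hN D (hN' D hD))) (forall_ren.2 fun k hkD =>
      toF k (hp k hkD) (hk k hkD))

end QBFSim
namespace QBFSim
variable {M : List Fm}

/-! ### The simulation of derivations -/

def rightVars (xs : List ℕ) (Q : Prefix) (u : ℕ) : List ℕ :=
  xs.filter fun x => decide (x ∈ exRight Q u)

theorem mem_rightVars {xs : List ℕ} {Q : Prefix} {u x : ℕ} :
    x ∈ rightVars xs Q u ↔ x ∈ xs ∧ x ∈ exRight Q u := by
  simp [rightVars]

theorem rightVars_subset {xs : List ℕ} {Q : Prefix} {u : ℕ} : rightVars xs Q u ⊆ xs :=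
  List.filter_sublist.subset

theorem mem_rightVars_of_depOf {xs : List ℕ} {Q : Prefix} (hQ : Q.names.Nodup) {u x : ℕ}
    (hu : (Quant.all, u) ∈ Q) (hx : x ∈ xs) (hx' : (Quant.all, x) ∉ Q) (h : u ∈ depOf Q x) :
    x ∈ rightVars xs Q u :=
  mem_rightVars.2 ⟨hx, (leftAll_iff_exRight hQ hu).1 ((mem_depOf hx').1 h)⟩

/-- The script that simulates a step. -/
def QRATStep.script (t : List Unit) (xs : List ℕ) (f : ℕ → ℕ) (Φ : PCNF) : QRATStep → List Item
  | .ata _ C => copyScript t xs f [C] (C :: Φ.matrix)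
  | .qrata Q' C l => qrataScript t xs f (outerSel Q' l.var [] [l.var]) Φ.matrix C l
  | .qratu K l =>
      qratuScript t xs (rightVars xs Φ.pre l.var) f
        (outerSel Φ.pre l.var (rightVars xs Φ.pre l.var) (rightVars xs Φ.pre l.var)) Φ.matrix K l
  | .eur K l => eurScript t xs (rightVars xs Φ.pre l.var) f Φ.matrix K l
  | .del K => copyScript t xs f [] (Φ.matrix.erase K)
  | .newVars _ => copyScript t xs f [] Φ.matrix

theorem QRATStep.Ok.sublist {Φ : PCNF} {s : QRATStep} (h : s.Ok Φ) :
    Φ.pre.Sublist (s.apply Φ).pre := by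
  cases s with
  | ata Q' C => exact h.1.1
  | qrata Q' C l => exact h.1.1
  | newVars Q' => exact h.1
  | qratu K l => exact List.Sublist.refl _
  | eur K l => exact List.Sublist.refl _
  | del K => exact List.Sublist.refl _

theorem PCNF.Closed.extend {Φ : PCNF} (hΦ : Φ.Closed) {Q' : Prefix} (h : Q'.Extends Φ.pre) :
    PCNF.Closed ⟨Q', Φ.matrix⟩ :=
  ⟨h.2, fun C hC l hl => (h.1.map Prod.snd).subset (hΦ.2 C hC l hl)⟩

theorem PCNF.Closed.cons {Φ : PCNF} (hΦ : Φ.Closed) {C : Clause}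
    (h : ∀ k ∈ C, k.var ∈ Φ.pre.names) : PCNF.Closed ⟨Φ.pre, C :: Φ.matrix⟩ :=
  ⟨hΦ.1, fun D hD => (List.mem_cons.1 hD).elim (fun e => e ▸ h) (hΦ.2 D)⟩

theorem PCNF.Closed.erase {Φ : PCNF} (hΦ : Φ.Closed) (K : Clause) :
    PCNF.Closed ⟨Φ.pre, Φ.matrix.erase K⟩ :=
  ⟨hΦ.1, fun D hD => hΦ.2 D (List.mem_of_mem_erase hD)⟩

theorem PCNF.Closed.without {Φ : PCNF} (hΦ : Φ.Closed) {K : Clause} (hK : K ∈ Φ.matrix)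
    (l : Lit) : PCNF.Closed ⟨Φ.pre, K.without l :: Φ.matrix.erase K⟩ :=
  (hΦ.erase K).cons fun k hk => hΦ.2 K hK k (mem_without.1 hk).1

theorem QRATStep.Ok.closed {Φ : PCNF} {s : QRATStep} (h : s.Ok Φ) (hΦ : Φ.Closed) :
    (s.apply Φ).Closed := by
  cases s with
  | ata Q' C => exact (hΦ.extend h.1).cons h.2.1
  | qrata Q' C l =>
    refine (hΦ.extend h.1).cons fun k hk => ?_
    rcases List.mem_cons.1 hk with rfl | hk
    · exact mem_names.2 (Or.inr h.2.2.1)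
    · exact h.2.1 k hk
  | newVars Q' => exact hΦ.extend h
  | qratu K l => exact hΦ.without h.1 l
  | eur K l => exact hΦ.without h.1 l
  | del K => exact hΦ.erase K

theorem negUnits_subset {C D : Clause} (h : C ⊆ D) : C.negUnits ⊆ D.negUnits :=
  List.map_subset _ h

/-- The scripts select outer literals by their dependencies, not by their levels. This gives at
least the outer clause, and more unit clauses can only help propagation. -/
theorem outerClause_subset_ex {Q : Prefix} (hQ : Q.names.Nodup) {l : Lit}
    (hl : (Quant.ex, l.var) ∈ Q) {D : Clause} (hD : ∀ k ∈ D, k.var ∈ Q.names) :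
    outerClause Q l D ⊆ D.filter (outerSel Q l.var [] [l.var]) := by
  intro k hk
  simp only [outerClause, List.mem_filter, decide_eq_true_eq] at hk
  refine List.mem_filter.2 ⟨hk.1, outerSel_iff.2 ⟨hk.2.2, by simp, fun x hx => ?_⟩⟩
  rw [List.mem_singleton.1 hx]
  exact depOf_level hQ (hD k hk.1) hl hk.2.1

theorem outerClause_subset_all {Q : Prefix} (hQ : Q.names.Nodup) {l : Lit} {xs : List ℕ}
    (hl : (Quant.all, l.var) ∈ Q) {D : Clause} (hD : ∀ k ∈ D, k.var ∈ Q.names) :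
    outerClause Q l D ⊆
      D.filter (outerSel Q l.var (rightVars xs Q l.var) (rightVars xs Q l.var)) := by
  intro k hk
  simp only [outerClause, List.mem_filter, decide_eq_true_eq] at hk
  obtain ⟨h1, h2⟩ := depOf_level_right hQ (hD k hk.1) hl hk.2.1
  exact List.mem_filter.2 ⟨hk.1, outerSel_iff.2 ⟨hk.2.2, fun h => h1 (mem_rightVars.1 h).2,
    fun x hx => h2 x (mem_rightVars.1 hx).2⟩⟩

section
variable {xs us : List ℕ} {cur : ℕ} {f : ℕ → ℕ} {S : SState} {t : List Unit}

theorem Stage.not_all {Q : Prefix} (hS : Stage xs us cur Q f S) {x : ℕ} (hx : x ∈ xs) :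
    (Quant.all, x) ∉ Q :=
  fun h => hS.disj x (hS.allMem x h) hx

theorem step_script {Φ : PCNF} {s : QRATStep} (hS : Stage xs us cur Φ.pre f S)
    (ht : t.length = cur + 1) (hN : Has S f Φ.matrix) (hΦ : Φ.Closed) (hs : s.Ok Φ)
    (ha : ∀ u, (Quant.all, u) ∈ (s.apply Φ).pre → u ∈ us)
    (he : ∀ x, (Quant.ex, x) ∈ (s.apply Φ).pre → x ∈ xs) :
    STr M S (s.script t xs f Φ) (fun S' =>
      Stage xs us (cur + 1) (s.apply Φ).pre (newMap t xs) S' ∧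
        Has S' (newMap t xs) (s.apply Φ).matrix ∧ Ext S S') := by
  have hcl := hs.closed hΦ
  have hS' := hS.extend hs.sublist hcl.1 ha he
  cases s with
  | ata Q' C =>
    refine copy_step hS' ht hN (fun D hD => ?_) (fun D hD => ?_)
      (hΦ.extend hs.1).2
    · rw [List.mem_singleton.1 hD]
      exact ⟨hs.2.1, hs.2.2⟩
    · simpa using hD
  | qrata Q' C l =>
    have hv := (hΦ.extend hs.1).2
    refine qrata_step hS' ht hN hv hs.2.1 hs.2.2.1 (fun k hk => ?_) fun D hD hlD => ?_
    · have := outerSel_iff.1 hk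
      exact ⟨this.1, this.2.2 _ (by simp)⟩
    · refine (hs.2.2.2 D hD hlD).mono ?_
      exact List.append_subset.2 ⟨List.subset_append_left _ _,
        List.Subset.trans (negUnits_subset (outerClause_subset_ex hcl.1 hs.2.2.1 (hv D hD)))
          (List.subset_append_right _ _)⟩
  | qratu K l =>
    obtain ⟨hK, hlK, hlK', hl, hup⟩ := hs
    refine qratu_step hS ht rightVars_subset (hS.xs_nodup.filter _)
      (fun x hx h => mem_rightVars_of_depOf hΦ.1 hl hx (hS.not_all hx) h) hN hΦ.2 hK hlK' hl
      (fun k hk => (outerSel_iff.1 hk).2) fun D hD hlD => ?_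
    refine (hup D hD hlD).mono ?_
    exact List.append_subset.2 ⟨List.subset_append_left _ _,
      List.Subset.trans (negUnits_subset (outerClause_subset_all hΦ.1 hl
        (hΦ.2 D (List.mem_of_mem_erase hD)))) (List.subset_append_right _ _)⟩
  | eur K l =>
    obtain ⟨hK, hlK, hl, hpath⟩ := hs
    exact eur_step hS ht rightVars_subset (hS.xs_nodup.filter _)
      (fun x hx h => mem_rightVars_of_depOf hΦ.1 hl hx (hS.not_all hx) h)
      (fun x hx => mem_exRight.1 (mem_rightVars.1 hx).2) hN hΦ.2 hK hl hpath
  | del K =>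
    exact copy_step hS' ht hN (by simp) (fun D hD => Or.inr (List.mem_of_mem_erase hD)) hΦ.2
  | newVars Q' =>
    exact copy_step hS' ht hN (by simp) (fun D hD => Or.inr hD) (hΦ.extend hs).2

end

/-! #### The whole derivation -/

/-- The formula after the given steps, of which the last one comes first. -/
def QRATStep.history (Φ : PCNF) (R : List QRATStep) : PCNF := R.foldr (fun s Φ => s.apply Φ) Φ

theorem QRATStep.allOk_append {Φ : PCNF} {a b : List QRATStep} :
    QRATStep.AllOk Φ (a ++ b) ↔ QRATStep.AllOk Φ a ∧
      QRATStep.AllOk (a.foldl QRATStep.apply Φ) b := by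
  induction a generalizing Φ with
  | nil => simp [QRATStep.AllOk]
  | cons s a ih => simp [QRATStep.AllOk, ih, and_assoc]

theorem QRATStep.history_eq {Φ : PCNF} {R : List QRATStep} :
    R.reverse.foldl QRATStep.apply Φ = QRATStep.history Φ R := by
  rw [List.foldl_reverse]
  rfl

/-- Steps are kept in reverse order, so that the steps before a given one form a suffix, and both
the current formula and the script of a step can be read from `suffixes`. -/
theorem QRATStep.allOk_cons {Φ : PCNF} {s : QRATStep} {R : List QRATStep} :
    QRATStep.AllOk Φ (s :: R).reverse ↔ QRATStep.AllOk Φ R.reverse ∧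
      s.Ok (QRATStep.history Φ R) := by
  rw [List.reverse_cons, QRATStep.allOk_append, QRATStep.history_eq]
  simp [QRATStep.AllOk]

/-- The renaming after as many steps as `n` has elements; `B` is the initial time. -/
def stageMap (n B : List Unit) (xs : List ℕ) (x : ℕ) : ℕ :=
  bif n.isEmpty then x else newMap (n ++ B) xs x

def units {A : Type} (l : List A) : List Unit := l.map fun _ => ()

def QRATStep.scripts (B : List Unit) (xs : List ℕ) (Φ : PCNF) (R : List QRATStep) : List Item :=
  (suffixes R).reverse.flatMap fun p =>
    p.1.script (() :: units p.2 ++ B) xs (stageMap (units p.2) B xs) (QRATStep.history Φ p.2)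

theorem QRATStep.scripts_cons (B : List Unit) (xs : List ℕ) (Φ : PCNF) (s : QRATStep)
    (R : List QRATStep) : QRATStep.scripts B xs Φ (s :: R) = QRATStep.scripts B xs Φ R ++
      s.script (() :: units R ++ B) xs (stageMap (units R) B xs) (QRATStep.history Φ R) := by
  simp [QRATStep.scripts, suffixes]

/-- The variables of the prefix `Q` that are not in the prefix `Q₀`, with a given quantifier. -/
def newOf (q : Quant) (Q Q₀ : List (Quant × ℕ)) : List ℕ :=
  (Q.filter fun e => decide (e.1 = q) && decide (e ∉ Q₀)).map Prod.snd

def quantified (q : Quant) (Q : List (Quant × ℕ)) : List ℕ :=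
  (Q.filter fun e => decide (e.1 = q)).map Prod.snd

theorem mem_quantified {q : Quant} {Q : Prefix} {x : ℕ} : x ∈ quantified q Q ↔ (q, x) ∈ Q := by
  simp only [quantified, List.mem_map, List.mem_filter, decide_eq_true_eq]
  constructor
  · rintro ⟨⟨q, x⟩, ⟨h, rfl⟩, rfl⟩
    exact h
  · exact fun h => ⟨(q, x), ⟨h, rfl⟩, rfl⟩

theorem quantified_nodup {q : Quant} {Q : Prefix} (h : Q.names.Nodup) : (quantified q Q).Nodup :=
  h.sublist (List.filter_sublist.map _)

theorem mem_newOf {q : Quant} {Q Q₀ : Prefix} {x : ℕ} :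
    x ∈ newOf q Q Q₀ ↔ (q, x) ∈ Q ∧ (q, x) ∉ Q₀ := by
  simp only [newOf, List.mem_map, List.mem_filter, decide_eq_true_eq, Bool.and_eq_true]
  constructor
  · rintro ⟨⟨q, x⟩, ⟨h, rfl, h'⟩, rfl⟩
    exact ⟨h, h'⟩
  · exact fun h => ⟨(q, x), ⟨h.1, rfl, h.2⟩, rfl⟩

theorem newOf_nodup {q : Quant} {Q Q₀ : Prefix} (h : Q.names.Nodup) : (newOf q Q Q₀).Nodup :=
  h.sublist (List.filter_sublist.map _)

/-- The introduction of the variables of `Q` that are not in `Q₀`. -/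
def introItems (Q Q₀ : Prefix) : List Item :=
  ((newOf .all Q Q₀).map fun u => .newAll u) ++ (newOf .ex Q Q₀).map fun x => .newEx x

theorem newAll_block (L : List ℕ) : ∀ {S : SState}, S.Inv → L.Nodup →
    (∀ u ∈ L, u ∉ S.pre.names) → STr M S (L.map fun u => .newAll u) (fun S' =>
      S'.Inv ∧ Ext S S' ∧ (∀ u ∈ L, u ∈ S'.pre.univ) ∧
        ∀ y ∈ S'.pre.names, y ∈ S.pre.names ∨ y ∈ L) := by
  induction L with
  | nil => exact fun h _ _ => ⟨h, Ext.refl _, by simp, fun y hy => Or.inl hy⟩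
  | cons u L ih =>
    intro S hS hL hf
    rw [List.nodup_cons] at hL
    have hok : Item.Ok M S (.newAll u) := hf u List.mem_cons_self
    have hx := ext_apply hok
    refine ⟨hok, (ih (inv_apply hS hok) hL.2 fun y hy hn => ?_).mono ?_⟩
    · rcases names_cons_univ.1 hn with rfl | hn
      · exact hL.1 hy
      · exact hf y (List.mem_cons_of_mem _ hy) hn
    · rintro S' ⟨h1, h2, h3, h4⟩
      refine ⟨h1, hx.trans h2, fun y hy => ?_, fun y hy => ?_⟩
      · rcases List.mem_cons.1 hy with rfl | hy
        · exact h2.univ List.mem_cons_self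
        · exact h3 y hy
      · rcases h4 y hy with hy | hy
        · rcases names_cons_univ.1 hy with rfl | hy
          · exact Or.inr List.mem_cons_self
          · exact Or.inl hy
        · exact Or.inr (List.mem_cons_of_mem _ hy)

theorem newEx_block (L : List ℕ) : ∀ {S : SState}, S.Inv → L.Nodup →
    (∀ x ∈ L, x ∉ S.pre.names) → STr M S (L.map fun x => .newEx x) (fun S' =>
      S'.Inv ∧ Ext S S' ∧ (∀ x ∈ L, x ∈ S'.pre.exNames ∧ S'.pre.dep x = []) ∧
        ∀ y ∈ S'.pre.names, y ∈ S.pre.names ∨ y ∈ L) := by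
  induction L with
  | nil => exact fun h _ _ => ⟨h, Ext.refl _, by simp, fun y hy => Or.inl hy⟩
  | cons x L ih =>
    intro S hS hL hf
    rw [List.nodup_cons] at hL
    have hok : Item.Ok M S (.newEx x) := hf x List.mem_cons_self
    have hx := ext_apply hok
    refine ⟨hok, (ih (inv_apply hS hok) hL.2 fun y hy hn => ?_).mono ?_⟩
    · rcases names_cons_ex.1 hn with rfl | hn
      · exact hL.1 hy
      · exact hf y (List.mem_cons_of_mem _ hy) hn
    · rintro S' ⟨h1, h2, h3, h4⟩
      refine ⟨h1, hx.trans h2, fun y hy => ?_, fun y hy => ?_⟩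
      · rcases List.mem_cons.1 hy with rfl | hy
        · refine ⟨h2.exs List.mem_cons_self, ?_⟩
          rw [h2.dep _ (names_cons_ex.2 (Or.inl rfl))]
          exact dep_head hok
        · exact h3 y hy
      · rcases h4 y hy with hy | hy
        · rcases names_cons_ex.1 hy with rfl | hy
          · exact Or.inr List.mem_cons_self
          · exact Or.inl hy
        · exact Or.inr (List.mem_cons_of_mem _ hy)

theorem ax_block (L : CNF) : ∀ {S : SState}, S.Inv →
    (∀ C ∈ L, C.toFm ∈ M ∧ ClauseIn S.pre C) → STr M S (L.map fun C => .ax C) (fun S' =>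
      S'.Inv ∧ S'.pre = S.pre ∧ ∀ C ∈ L, C ∈ S'.Γ) := by
  intro S hS h
  suffices H : STr M S (L.map fun C => .ax C) (fun S' =>
      (S'.Inv ∧ S'.pre = S.pre ∧ ∀ C ∈ L, C ∈ S'.Γ) ∧ Ext S S') from H.mono fun _ h => h.1
  induction L generalizing S with
  | nil => exact ⟨⟨hS, rfl, by simp⟩, Ext.refl _⟩
  | cons C L ih =>
    have hok : Item.Ok M S (.ax C) := h C List.mem_cons_self
    refine ⟨hok, (ih (S := Item.apply S (.ax C)) (inv_apply hS hok)
      fun D hD => h D (List.mem_cons_of_mem _ hD)).mono ?_⟩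
    rintro S' ⟨⟨h1, h2, h3⟩, h4⟩
    refine ⟨⟨h1, h2, fun D hD => ?_⟩, (ext_apply hok).trans h4⟩
    rcases List.mem_cons.1 hD with rfl | hD
    · exact h4.cls (by simp [Item.apply, Item.clauses])
    · exact h3 D hD

theorem toD_inv {Q : Prefix} (hQ : Q.names.Nodup) : SState.Inv ⟨Q.toD, []⟩ := by
  refine ⟨by simp, fun u hu hx => ?_⟩
  cases names_nodup_snd hQ (mem_univ_toD.1 hu) (mem_exNames_toD.1 hx)

/-- A time that makes the names of this and later times new with respect to `Q`. -/
def baseTime (Q : Prefix) : List Unit := units (Q.flatMap fun e => e.2.bits)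

theorem name_not_mem {Q : Prefix} {t : List Unit} (ht : (baseTime Q).length < t.length) {k : Kind}
    {bs : List Bool} : name t k bs ∉ Q.names := by
  intro h
  obtain ⟨e, he, h⟩ := List.mem_map.1 h
  refine name_ne_of_length (x := e.2) ?_ h.symm
  refine le_trans ?_ ht.le
  simp only [baseTime, units, List.length_map, List.length_flatMap]
  exact List.single_le_sum (by simp) _ (List.mem_map.2 ⟨e, he, rfl⟩)

/-- All variables that the derivation will ever use are introduced at the beginning. The new
existential variables get empty dependency sets, so their dependency bounds hold for every later
prefix, and the sets of variables to be copied never change. -/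
theorem intro_block {Q Q₀ : Prefix} (hQ : Q.names.Nodup) (hs : Q₀.Sublist Q) :
    STr M ⟨Q₀.toD, []⟩ (introItems Q Q₀) (fun S =>
      Stage (quantified .ex Q) (quantified .all Q) (baseTime Q).length Q₀ (fun x => x) S ∧
        ∀ y ∈ S.pre.names, y ∈ Q.names) := by
  have hQ₀ : Q₀.names.Nodup := hQ.sublist (hs.map _)
  have hnew : ∀ {q x}, (q, x) ∈ Q → (q, x) ∉ Q₀ → x ∉ Q₀.names := by
    intro q x h h' hx
    rcases mem_names.1 hx with hx | hx
    · exact h' (names_nodup_snd hQ h (hs.subset hx) ▸ hx)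
    · exact h' (names_nodup_snd hQ h (hs.subset hx) ▸ hx)
  refine (newAll_block (newOf .all Q Q₀) (toD_inv hQ₀) (newOf_nodup hQ) ?_).append ?_
  · intro u hu
    obtain ⟨h1, h2⟩ := mem_newOf.1 hu
    rw [mem_names_toD]
    exact hnew h1 h2
  rintro S₁ ⟨i1, e1, u1, n1⟩
  refine (newEx_block (newOf .ex Q Q₀) i1 (newOf_nodup hQ) ?_).mono ?_
  · intro x hx hn
    obtain ⟨h1, h2⟩ := mem_newOf.1 hx
    rcases n1 x hn with hn | hn
    · rw [mem_names_toD] at hn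
      exact hnew h1 h2 hn
    · cases names_nodup_snd hQ h1 (mem_newOf.1 hn).1
  rintro S₂ ⟨i2, e2, x2, n2⟩
  have e := e1.trans e2
  have hnames : ∀ y ∈ S₂.pre.names, y ∈ Q.names := by
    intro y hy
    rcases n2 y hy with hy | hy
    · rcases n1 y hy with hy | hy
      · rw [mem_names_toD] at hy
        exact (hs.map _).subset hy
      · exact mem_names.2 (Or.inl (mem_newOf.1 hy).1)
    · exact mem_names.2 (Or.inr (mem_newOf.1 hy).1)
  refine ⟨{
    inv := i2
    univ := fun u hu => ?_
    ex := fun x hx => ?_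
    dep := fun x hx => ?_
    id := fun _ _ => rfl
    inj := fun _ _ _ _ h => h
    fresh := fun t k bs ht hn => name_not_mem ht (hnames _ hn)
    nodup := hQ₀
    allMem := fun u hu => mem_quantified.2 (hs.subset hu)
    exMem := fun x hx => mem_quantified.2 (hs.subset hx)
    disj := fun u hu hx => ?_
    xs_nodup := quantified_nodup hQ }, hnames⟩
  · by_cases h : (Quant.all, u) ∈ Q₀
    · exact e.univ (mem_univ_toD.2 h)
    · exact e2.univ (u1 u (mem_newOf.2 ⟨mem_quantified.1 hu, h⟩))
  · by_cases h : (Quant.ex, x) ∈ Q₀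
    · exact e.exs (mem_exNames_toD.2 h)
    · exact (x2 x (mem_newOf.2 ⟨mem_quantified.1 hx, h⟩)).1
  · by_cases h : (Quant.ex, x) ∈ Q₀
    · rw [e.dep _ (List.mem_append_right _ (mem_exNames_toD.2 h))]
      exact fun u hu => (mem_dep_toD hQ₀).1 hu
    · rw [(x2 x (mem_newOf.2 ⟨mem_quantified.1 hx, h⟩)).2]
      exact List.nil_subset _
  · cases names_nodup_snd hQ (mem_quantified.1 hu) (mem_quantified.1 hx)

/-- The script of a derivation with the steps `R.reverse`. -/
def derivationScript (Φ : PCNF) (R : List QRATStep) : List Item :=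
  let Q := (QRATStep.history Φ R).pre
  introItems Q Φ.pre ++ ((Φ.matrix.map fun C => .ax C) ++
    QRATStep.scripts (baseTime Q) (quantified .ex Q) Φ R)

theorem QRATStep.history_closed {Φ : PCNF} (hΦ : Φ.Closed) {R : List QRATStep}
    (h : QRATStep.AllOk Φ R.reverse) : (QRATStep.history Φ R).Closed ∧
      Φ.pre.Sublist (QRATStep.history Φ R).pre := by
  induction R with
  | nil => exact ⟨hΦ, List.Sublist.refl _⟩
  | cons s R ih =>
    obtain ⟨h1, h2⟩ := QRATStep.allOk_cons.1 h
    exact ⟨h2.closed (ih h1).1, (ih h1).2.trans h2.sublist⟩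

theorem ren_id (C : Clause) : ren (fun x => x) C = C := by
  exact List.map_id' C

/-- The state contains the copy of stage `R`. -/
def AtStage (xs us : List ℕ) (B : List Unit) (Φ : PCNF) (R : List QRATStep) (S : SState) : Prop :=
  Stage xs us (R.length + B.length) (QRATStep.history Φ R).pre (stageMap (units R) B xs) S ∧
    Has S (stageMap (units R) B xs) (QRATStep.history Φ R).matrix

/-- The conclusion speaks of every suffix, that is, of every earlier stage: each had a state with
its copy, and the final state extends all of them. So the copies of all stages are still available
at the end. -/
theorem scripts_correct {xs us : List ℕ} {B : List Unit} {Φ : PCNF} {S : SState} (hΦ : Φ.Closed)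
    (hS : AtStage xs us B Φ [] S) (R : List QRATStep) (hR : QRATStep.AllOk Φ R.reverse)
    (ha : ∀ u, (Quant.all, u) ∈ (QRATStep.history Φ R).pre → u ∈ us)
    (he : ∀ x, (Quant.ex, x) ∈ (QRATStep.history Φ R).pre → x ∈ xs) :
    STr M S (QRATStep.scripts B xs Φ R) (fun S' => AtStage xs us B Φ R S' ∧
      ∀ R', R' <:+ R → ∃ S₁, AtStage xs us B Φ R' S₁ ∧ Ext S₁ S') := by
  induction R with
  | nil =>
    refine ⟨hS, fun R' hR' => ⟨S, ?_, Ext.refl _⟩⟩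
    rw [List.suffix_nil.1 hR']
    exact hS
  | cons s R ih =>
    obtain ⟨h1, h2⟩ := QRATStep.allOk_cons.1 hR
    rw [QRATStep.scripts_cons]
    refine (ih h1 (fun u hu => ha u (h2.sublist.subset hu))
      fun x hx => he x (h2.sublist.subset hx)).append ?_
    rintro S₁ ⟨⟨h3, h4⟩, h5⟩
    refine (step_script (t := () :: units R ++ B) h3 (by simp [units]) h4
      (QRATStep.history_closed hΦ h1).1 h2 ha he).mono ?_
    rintro S₂ ⟨h6, h7, h8⟩
    have h9 : AtStage xs us B Φ (s :: R) S₂ := by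
      refine ⟨?_, h7⟩
      rw [List.length_cons, Nat.add_right_comm]
      exact h6
    refine ⟨h9, fun R' hR' => ?_⟩
    rcases List.suffix_cons_iff.1 hR' with rfl | hR'
    · exact ⟨S₂, h9, Ext.refl _⟩
    · obtain ⟨S₃, h10, h11⟩ := h5 R' hR'
      exact ⟨S₃, h10, h11.trans h8⟩

theorem derivationScript_correct {Φ : PCNF} (hΦ : Φ.Closed) {R : List QRATStep}
    (hR : QRATStep.AllOk Φ R.reverse) :
    STr (Φ.matrix.map Clause.toFm) ⟨Φ.pre.toD, []⟩ (derivationScript Φ R) (fun S' =>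
      ∀ R', R' <:+ R → ∃ S₁ f us xs cur, Stage xs us cur (QRATStep.history Φ R').pre f S₁ ∧
        Has S₁ f (QRATStep.history Φ R').matrix ∧ Ext S₁ S') := by
  obtain ⟨hcl, hsub⟩ := QRATStep.history_closed hΦ hR
  refine (intro_block hcl.1 hsub).append ?_
  rintro S₁ ⟨h1, h2⟩
  refine (ax_block Φ.matrix h1.inv fun C hC => ⟨List.mem_map_of_mem hC, ?_⟩).append ?_
  · have := h1.clauseIn (C := C) (hΦ.2 C hC)
    rwa [ren_id] at this
  rintro S₂ ⟨h3, h4, h5⟩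
  refine (scripts_correct hΦ (us := quantified .all (QRATStep.history Φ R).pre) ⟨?_, ?_⟩ R hR
    (fun u hu => mem_quantified.2 hu) fun x hx => mem_quantified.2 hx).mono ?_
  · rw [List.length_nil, Nat.zero_add]
    exact h1.of_pre h3 h4
  · intro C hC
    have := h5 C hC
    rwa [← ren_id C] at this
  · rintro S₃ ⟨_, h6⟩ R' hR'
    obtain ⟨S₄, ⟨h7, h8⟩, h9⟩ := h6 R' hR'
    exact ⟨S₄, _, _, _, _, h7, h8, h9⟩

theorem Stage.containsCopy {xs us : List ℕ} {cur : ℕ} {f : ℕ → ℕ} {S S' : SState} {s : DState}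
    {Φ : PCNF} (hS : Stage xs us cur Φ.pre f S) (hN : Has S f Φ.matrix) (he : Ext S S')
    (hs : Sim S' s) : s.ContainsCopy Φ := by
  have hmem : ∀ {x}, x ∈ Φ.pre.names → x ∈ us ++ xs := by
    intro x hx
    rcases mem_names.1 hx with hx | hx
    · exact List.mem_append_left _ (hS.allMem x hx)
    · exact List.mem_append_right _ (hS.exMem x hx)
  refine ⟨f, fun x hx y hy e => hS.inj x (hmem hx) y (hmem hy) e, fun u hu => ?_, fun x hx => ?_,
    fun C hC => hs.2 _ (he.cls (hN C hC))⟩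
  · rw [hs.1]
    exact ⟨hS.map_all hu, he.univ (hS.all_univ hu)⟩
  · have hx' := hS.exMem x hx
    rw [hs.1]
    refine ⟨he.exs (hS.ex x hx'), ?_⟩
    rw [he.dep _ (List.mem_append_right _ (hS.ex x hx'))]
    exact fun u hu => (mem_dep_toD hS.nodup).2 (hS.dep x hx' hu)

end QBFSim
namespace QBFSim

/-! ### Running time of the simulation of derivations -/

section
variable {A : Type} [Enc A] {t n B : A → List Unit} {xs Sx : A → List ℕ}

/-- Renamings and selections are parameters that are functions, not data. Their running time is
expressed by the uncurried function, and this lemma applies such hypotheses. -/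
theorem PT.comp₂ {D E C : Type} [Enc D] [Enc E] [Enc C] {f : D → E → C}
    (hf : PT fun p : D × E => f p.1 p.2) {x : A → D} {y : A → E} (hx : PT x) (hy : PT y) :
    PT fun a => f (x a) (y a) :=
  PT.comp (g := fun p : D × E => f p.1 p.2) (f := fun a => (x a, y a)) hf (by fun_prop)

@[fun_prop]
theorem PT.ren {f : A → ℕ → ℕ} {C : A → List Lit} (hf : PT fun p : A × ℕ => f p.1 p.2)
    (hC : PT C) : PT fun a => ren (f a) (C a) := by
  unfold QBFSim.ren rl
  have : PT fun p : A × Lit => f p.1 p.2.var := PT.comp₂ hf PT.fst (PT.lit_var PT.snd)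
  fun_prop

@[fun_prop]
theorem PT.rl {f : A → ℕ → ℕ} {l : A → Lit} (hf : PT fun p : A × ℕ => f p.1 p.2)
    (hl : PT l) : PT fun a => rl (f a) (l a) := by
  unfold QBFSim.rl
  have : PT fun a => f a (l a).var := PT.comp₂ hf PT.id (PT.lit_var hl)
  fun_prop

@[fun_prop]
theorem PT.newMap {x : A → ℕ} (ht : PT t) (hxs : PT xs) (hx : PT x) :
    PT fun a => newMap (t a) (xs a) (x a) := by
  unfold QBFSim.newMap
  fun_prop

@[fun_prop]
theorem PT.stageMap {x : A → ℕ} (hn : PT n) (hB : PT B) (hxs : PT xs) (hx : PT x) :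
    PT fun a => stageMap (n a) (B a) (xs a) (x a) := by
  unfold QBFSim.stageMap
  fun_prop

@[fun_prop]
theorem PT.condMap {f : A → ℕ → ℕ} {x : A → ℕ} (hf : PT fun p : A × ℕ => f p.1 p.2) (ht : PT t)
    (hS : PT Sx) (hx : PT x) : PT fun a => condMap (t a) (Sx a) (f a) (x a) := by
  unfold QBFSim.condMap
  have : PT fun a => f a (x a) := PT.comp₂ hf PT.id hx
  fun_prop

@[fun_prop]
theorem PT.outerSel {Q : A → List (Quant × ℕ)} {v : A → ℕ} {T : A → List ℕ} {k : A → Lit}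
    (hQ : PT Q) (hv : PT v) (hS : PT Sx) (hT : PT T) (hk : PT k) :
    PT fun a => outerSel (Q a) (v a) (Sx a) (T a) (k a) := by
  unfold QBFSim.outerSel
  fun_prop

@[fun_prop]
theorem PT.newDefs {Y : A → ℕ → List Lit} (ht : PT t) (hxs : PT xs)
    (hY : PT fun p : A × ℕ => Y p.1 p.2) : PT fun a => newDefs (t a) (xs a) (Y a) := by
  unfold QBFSim.newDefs
  fun_prop

@[fun_prop]
theorem PT.gates {f : A → ℕ → ℕ} {sel : A → Lit → Bool} {Ds : A → List (List Lit × List Bool)}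
    (hf : PT fun p : A × ℕ => f p.1 p.2) (hs : PT fun p : A × Lit => sel p.1 p.2) (ht : PT t)
    (hD : PT Ds) : PT fun a => gates (t a) (f a) (sel a) (Ds a) := by
  have h : PT fun p : A × List Lit => QBFSim.ren (f p.1) (p.2.filter (sel p.1)) := by
    refine PT.ren (f := fun p : A × List Lit => f p.1)
      (PT.comp₂ hf (PT.comp PT.fst PT.fst) PT.snd) (PT.filter (f := fun p : A × List Lit => sel p.1)
      (PT.comp₂ hs (PT.comp PT.fst PT.fst) PT.snd) PT.snd)
  have h' : PT fun p : A × (List Lit × List Bool) =>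
      QBFSim.ren (f p.1) (p.2.1.filter (sel p.1)) :=
    PT.comp₂ (f := fun a (C : List Lit) => QBFSim.ren (f a) (C.filter (sel a))) h PT.fst
      (PT.comp PT.fst PT.snd)
  unfold QBFSim.gates
  fun_prop

@[fun_prop]
theorem PT.rupMap {f : A → ℕ → ℕ} {N : A → List (List Lit)} (hf : PT fun p : A × ℕ => f p.1 p.2)
    (hN : PT N) : PT fun a => (N a).map fun C => Item.rup (QBFSim.ren (f a) C) := by
  have : PT fun p : A × List Lit => QBFSim.ren (f p.1) p.2 :=
    PT.ren (f := fun p : A × List Lit => f p.1)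
      (PT.comp₂ hf (PT.comp PT.fst PT.fst) PT.snd) PT.snd
  fun_prop

theorem PT.rupMapCons {f : A → ℕ → ℕ} {B : Type} [Enc B] {N : A → List B} {g : A → B → Lit}
    {C : A → B → List Lit} (hf : PT fun p : A × ℕ => f p.1 p.2) (hN : PT N)
    (hg : PT fun p : A × B => g p.1 p.2) (hC : PT fun p : A × B => C p.1 p.2) :
    PT fun a => (N a).map fun b => Item.rup (g a b :: QBFSim.ren (f a) (C a b)) := by
  have : PT fun p : A × B => QBFSim.ren (f p.1) (C p.1 p.2) :=
    PT.ren (f := fun p : A × B => f p.1) (PT.comp₂ hf (PT.comp PT.fst PT.fst) PT.snd) hC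
  fun_prop

@[fun_prop]
theorem PT.copyScript {f : A → ℕ → ℕ} {pre N : A → List (List Lit)}
    (hf : PT fun p : A × ℕ => f p.1 p.2) (ht : PT t) (hxs : PT xs) (hp : PT pre) (hN : PT N) :
    PT fun a => copyScript (t a) (xs a) (f a) (pre a) (N a) := by
  unfold QBFSim.copyScript
  have h1 := PT.rupMap hf hp
  have h2 : PT fun a => (N a).map fun C => Item.rup (QBFSim.ren (QBFSim.newMap (t a) (xs a)) C) :=
    PT.rupMap (by fun_prop) hN
  fun_prop

@[fun_prop]
theorem PT.qrataScript {f : A → ℕ → ℕ} {sel : A → Lit → Bool} {N : A → List (List Lit)}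
    {C : A → List Lit} {l : A → Lit} (hf : PT fun p : A × ℕ => f p.1 p.2)
    (hs : PT fun p : A × Lit => sel p.1 p.2) (ht : PT t) (hxs : PT xs) (hN : PT N) (hC : PT C)
    (hl : PT l) :
    PT fun a => qrataScript (t a) (xs a) (f a) (sel a) (N a) (C a) (l a) := by
  unfold QBFSim.qrataScript
  simp only
  have hD : PT fun a => (QBFSim.labels (N a)).filter fun d => decide ((l a).neg ∈ d.1) := by
    fun_prop
  have h1 := PT.gates hf hs ht hD
  have h2 := PT.rupMapCons (g := fun a d => (⟨QBFSim.name (t a) kOuter d.2, true⟩ : Lit))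
    (C := fun a _ => l a :: C a) hf hD (by fun_prop) (by fun_prop)
  have h3 := PT.rl hf hl
  have h4 := PT.rupMapCons (f := fun a => QBFSim.newMap (t a) (xs a))
    (g := fun a (d : List Lit × List Bool) => (⟨QBFSim.name (t a) kGate [], true⟩ : Lit))
    (C := fun a d => d.1) (by fun_prop) hD (by fun_prop) (by fun_prop)
  have h5 := PT.rupMap (f := fun a => QBFSim.newMap (t a) (xs a))
    (N := fun a => (l a :: C a) :: N a) (by fun_prop) (by fun_prop)
  fun_prop

@[fun_prop]
theorem PT.condItems {f : A → ℕ → ℕ} {l : A → Lit} (hf : PT fun p : A × ℕ => f p.1 p.2)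
    (ht : PT t) (hS : PT Sx) (hl : PT l) :
    PT fun a => condItems (t a) (Sx a) (f a) (l a) := by
  unfold QBFSim.condItems
  fun_prop

@[fun_prop]
theorem PT.reduceItems {f : A → ℕ → ℕ} {B : Type} [Enc B] {N : A → List B} {l : A → Lit}
    {C : A → B → List Lit} (hf : PT fun p : A × ℕ => f p.1 p.2) (hN : PT N)
    (hl : PT l) (hC : PT fun p : A × B => C p.1 p.2) :
    PT fun a => reduceItems (f a) (l a) (N a) (C a) := by
  unfold QBFSim.reduceItems
  have h1 := PT.rupMapCons (g := fun a _ => (l a).neg) hf hN (by fun_prop) hC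
  have : PT fun p : A × B => QBFSim.ren (f p.1) (C p.1 p.2) :=
    PT.ren (f := fun p : A × B => f p.1) (PT.comp₂ hf (PT.comp PT.fst PT.fst) PT.snd) hC
  fun_prop

@[fun_prop]
theorem PT.iteItems {f v : A → ℕ → ℕ} (hf : PT fun p : A × ℕ => f p.1 p.2)
    (hv : PT fun p : A × ℕ => v p.1 p.2) (ht : PT t) (hxs : PT xs) (hS : PT Sx) :
    PT fun a => iteItems (t a) (xs a) (Sx a) (f a) (v a) := by
  unfold QBFSim.iteItems
  fun_prop

@[fun_prop]
theorem PT.rightVars {Q : A → List (Quant × ℕ)} {u : A → ℕ} (hQ : PT Q) (hu : PT u)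
    (hxs : PT xs) : PT fun a => rightVars (xs a) (Q a) (u a) := by
  unfold QBFSim.rightVars
  fun_prop

@[fun_prop]
theorem PT.qratuScript {f : A → ℕ → ℕ} {sel : A → Lit → Bool} {N : A → List (List Lit)}
    {K : A → List Lit} {l : A → Lit} (hf : PT fun p : A × ℕ => f p.1 p.2)
    (hs : PT fun p : A × Lit => sel p.1 p.2) (ht : PT t) (hxs : PT xs) (hS : PT Sx) (hN : PT N)
    (hK : PT K) (hl : PT l) :
    PT fun a => qratuScript (t a) (xs a) (Sx a) (f a) (sel a) (N a) (K a) (l a) := by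
  unfold QBFSim.qratuScript
  simp only
  have hv : PT fun p : A × ℕ => QBFSim.condMap (t p.1) (Sx p.1) (f p.1) p.2 :=
    PT.condMap (f := fun p : A × ℕ => f p.1) (PT.comp₂ hf (PT.comp PT.fst PT.fst) PT.snd)
      (by fun_prop) (by fun_prop) PT.snd
  have hD : PT fun a => (QBFSim.labels ((N a).erase (K a))).filter fun d =>
    decide ((l a).neg ∈ d.1) := by fun_prop
  have h1 := PT.gates hf hs ht hD
  have h2 := PT.condItems hf ht hS (PT.lit_neg hl)
  have h3 := PT.reduceItems (f := fun a => QBFSim.condMap (t a) (Sx a) (f a)) (l := fun a => (l a).neg)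
    (N := fun a => (N a).filter fun D => decide ((l a).neg ∉ D))
    (C := fun a D => Clause.without D (l a)) hv (by fun_prop) (by fun_prop) (by fun_prop)
  have h4 := PT.iteItems (v := fun a => QBFSim.condMap (t a) (Sx a) (f a)) hf hv ht hxs hS
  have h5 := PT.rupMapCons (g := fun a d => (⟨QBFSim.name (t a) kOuter d.2, true⟩ : Lit))
    (C := fun a _ => Clause.without (K a) (l a)) hf hD (by fun_prop) (by fun_prop)
  have h6 := PT.rupMapCons (f := fun a => QBFSim.newMap (t a) (xs a))
    (g := fun a (_ : List Lit) => (⟨QBFSim.name (t a) kGate [], false⟩ : Lit))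
    (C := fun a D => D) (N := fun a => Clause.without (K a) (l a) :: (N a).erase (K a))
    (by fun_prop) (by fun_prop) (by fun_prop) (by fun_prop)
  have h7 := PT.rupMap (f := fun a => QBFSim.newMap (t a) (xs a))
    (N := fun a => Clause.without (K a) (l a) :: (N a).erase (K a)) (by fun_prop) (by fun_prop)
  fun_prop

@[fun_prop]
theorem PT.pathRules {φ : A → List (List Lit)} (hφ : PT φ) (hS : PT Sx) :
    PT fun a => pathRules (φ a) (Sx a) := by
  unfold QBFSim.pathRules
  fun_prop

@[fun_prop]
theorem PT.pathLits {φ : A → List (List Lit)} {C : A → List Lit} (hφ : PT φ) (hC : PT C)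
    (hS : PT Sx) : PT fun a => pathLits (φ a) (C a) (Sx a) := by
  unfold QBFSim.pathLits
  fun_prop

@[fun_prop]
theorem PT.eurDef {f v : A → ℕ → ℕ} {L : A → List Lit} {x : A → ℕ}
    (hf : PT fun p : A × ℕ => f p.1 p.2) (hv : PT fun p : A × ℕ => v p.1 p.2) (ht : PT t)
    (hL : PT L) (hx : PT x) : PT fun a => eurDef (t a) (L a) (f a) (v a) (x a) := by
  unfold QBFSim.eurDef
  have h1 := PT.comp₂ hf PT.id hx
  have h2 := PT.comp₂ hv PT.id hx
  fun_prop

@[fun_prop]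
theorem PT.eurScript {f : A → ℕ → ℕ} {N : A → List (List Lit)}
    {K : A → List Lit} {l : A → Lit} (hf : PT fun p : A × ℕ => f p.1 p.2)
    (ht : PT t) (hxs : PT xs) (hS : PT Sx) (hN : PT N) (hK : PT K) (hl : PT l) :
    PT fun a => eurScript (t a) (xs a) (Sx a) (f a) (N a) (K a) (l a) := by
  unfold QBFSim.eurScript
  simp only
  have hv : PT fun p : A × ℕ => QBFSim.condMap (t p.1) (Sx p.1) (f p.1) p.2 :=
    PT.condMap (f := fun p : A × ℕ => f p.1) (PT.comp₂ hf (PT.comp PT.fst PT.fst) PT.snd)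
      (by fun_prop) (by fun_prop) PT.snd
  have h2 := PT.condItems hf ht hS (PT.lit_neg hl)
  have h3 := PT.reduceItems (f := fun a => QBFSim.condMap (t a) (Sx a) (f a)) (l := fun a => (l a).neg)
    (N := fun a => (N a).filter fun D => decide ((l a).neg ∉ D))
    (C := fun a D => Clause.without D (l a)) hv (by fun_prop) (by fun_prop) (by fun_prop)
  have h4 : PT fun p : A × ℕ => QBFSim.eurDef (t p.1)
      (QBFSim.pathLits (Clause.without (K p.1) (l p.1) :: (N p.1).erase (K p.1))
        (Clause.without (K p.1) (l p.1)) (Sx p.1)) (f p.1)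
      (QBFSim.condMap (t p.1) (Sx p.1) (f p.1)) p.2 :=
    PT.eurDef (f := fun p : A × ℕ => f p.1)
      (v := fun p : A × ℕ => QBFSim.condMap (t p.1) (Sx p.1) (f p.1))
      (PT.comp₂ hf (PT.comp PT.fst PT.fst) PT.snd)
      (PT.comp₂ (f := fun a x => QBFSim.condMap (t a) (Sx a) (f a) x) hv
        (PT.comp PT.fst PT.fst) PT.snd)
      (by fun_prop) (by fun_prop) PT.snd
  have h7 := PT.rupMap (f := fun a => QBFSim.newMap (t a) (xs a))
    (N := fun a => Clause.without (K a) (l a) :: (N a).erase (K a)) (by fun_prop) (by fun_prop)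
  fun_prop

end

end QBFSim
namespace QBFSim

/-! ### Decoding of steps, recomputation of formulas, assembly of the simulation -/

section
variable {A : Type} [Enc A]

theorem PT.dataCons {f g : A → Data} (hf : PT f) (hg : PT g) :
    PT fun a => Data.cons (f a) (g a) :=
  PT.of_enc (PT.pair hf hg) fun _ => rfl

/-- The constructor number in unary and the fields, with default values for the missing ones. -/
def QRATStep.view : QRATStep → List Bool × (List (Quant × ℕ) × (List Lit × Lit))
  | .ata Q C => ([], (Q, (C, ⟨0, false⟩)))
  | .qrata Q C l => ([true], (Q, (C, l)))
  | .qratu K l => ([true, true], ([], (K, l)))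
  | .eur K l => ([true, true, true], ([], (K, l)))
  | .del K => ([true, true, true, true], ([], (K, ⟨0, false⟩)))
  | .newVars Q => ([true, true, true, true, true], (Q, ([], ⟨0, false⟩)))

def QRATSatStep.view : QRATSatStep → List Bool × (List (Quant × ℕ) × (List Lit × Lit))
  | .ate K => ([], ([], (K, ⟨0, false⟩)))
  | .qrate K l => ([true], ([], (K, l)))
  | .add Q C => ([true, true], (Q, (C, ⟨0, false⟩)))
  | .red K l => ([true, true, true], ([], (K, l)))
  | .newVars Q => ([true, true, true, true], (Q, ([], ⟨0, false⟩)))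

-- The position of a field depends on the constructor, which is found by testing how long the unary
-- tag is.
@[fun_prop]
theorem PT.qratStep_view {f : A → QRATStep} (hf : PT f) : PT fun a => (f a).view := by
  refine PT.comp (g := QRATStep.view) (PT.of_raw (fun d =>
    Data.cons d.hd (Data.cons
      (bif d.hd.tl.isCons then (bif d.hd.tl.tl.tl.tl.isCons then d.tl.hd else .nil) else d.tl.hd)
      (Data.cons
        (bif d.hd.tl.isCons then (bif d.hd.tl.tl.tl.tl.isCons then .nil else d.tl.hd)
          else d.tl.tl.hd)
        -- `Data.cons .nil .nil` is the code of the default literal `⟨0, false⟩`.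
        (bif d.hd.isCons then (bif d.hd.tl.tl.tl.isCons then Data.cons .nil .nil
          else (bif d.hd.tl.isCons then d.tl.tl.hd else d.tl.tl.tl.hd))
          else Data.cons .nil .nil)))) ?_ ?_) hf
  · exact PT.dataCons (by fun_prop) (PT.dataCons (by fun_prop)
      (PT.dataCons (by fun_prop) (by fun_prop)))
  · intro s
    cases s <;> rfl

@[fun_prop]
theorem PT.qratSatStep_view {f : A → QRATSatStep} (hf : PT f) : PT fun a => (f a).view := by
  refine PT.comp (g := QRATSatStep.view) (PT.of_raw (fun d =>
    Data.cons d.hd (Data.cons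
      (bif d.hd.tl.isCons then (bif d.hd.tl.tl.isCons then
        (bif d.hd.tl.tl.tl.isCons then d.tl.hd else .nil) else d.tl.hd) else .nil)
      (Data.cons
        (bif d.hd.tl.isCons then (bif d.hd.tl.tl.isCons then
          (bif d.hd.tl.tl.tl.isCons then .nil else d.tl.hd) else d.tl.tl.hd) else d.tl.hd)
        (bif d.hd.isCons then (bif d.hd.tl.isCons then (bif d.hd.tl.tl.isCons then
          (bif d.hd.tl.tl.tl.isCons then Data.cons .nil .nil else d.tl.tl.hd)
          else Data.cons .nil .nil) else d.tl.tl.hd) else Data.cons .nil .nil)))) ?_ ?_) hf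
  · exact PT.dataCons (by fun_prop) (PT.dataCons (by fun_prop)
      (PT.dataCons (by fun_prop) (by fun_prop)))
  · intro s
    cases s <;> rfl

theorem esize_erase_le (l : List (List Lit)) (k : List Lit) : esize (l.erase k) ≤ esize l := by
  induction l with
  | nil => exact le_rfl
  | cons b l ih =>
    rw [List.erase_cons]
    split <;> simp only [esize_cons] <;> omega

/-- Formulas after steps that change the prefix, remove a clause, and add clauses. -/
theorem PT.formulas {T : Type} [Enc T] {ap : PCNF → T → PCNF} {c e : T → Bool}
    {Q : T → List (Quant × ℕ)} {N : T → List (List Lit)} {K : T → List Lit} (hc : PT c) (he : PT e)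
    (hQ : PT Q) (hN : PT N) (hK : PT K)
    (h : ∀ Φ s, ap Φ s = ⟨bif c s then Q s else Φ.pre,
      N s ++ (bif e s then Φ.matrix.erase (K s) else Φ.matrix)⟩)
    {Φ : A → PCNF} {R : A → List T} (hΦ : PT Φ) (hR : PT R) :
    PT fun a => (R a).foldr (fun s Φ => ap Φ s) (Φ a) := by
  refine PT.foldr_additive (f := fun _ s Φ => ap Φ s) ?_ hΦ hR ?_
  · simp only [h]
    have h1 : PT fun p : A × (T × PCNF) => p.2.1 := by fun_prop
    have h2 := PT.comp hc h1
    have h3 := PT.comp he h1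
    have h4 := PT.comp hQ h1
    have h5 := PT.comp hN h1
    have h6 := PT.comp hK h1
    refine PT.pcnf_mk (f := fun p : A × (T × PCNF) => bif c p.2.1 then Q p.2.1 else p.2.2.pre)
      (g := fun p : A × (T × PCNF) => N p.2.1 ++
        (bif e p.2.1 then p.2.2.matrix.erase (K p.2.1) else p.2.2.matrix)) ?_ ?_
    · exact PT.cond h2 h4 (by fun_prop)
    · exact PT.append h5 (PT.cond h3 (PT.erase h6 (by fun_prop)) (by fun_prop))
  · obtain ⟨P₁, h1⟩ := hQ.size_bound
    obtain ⟨P₂, h2⟩ := hN.size_bound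
    -- A step adds at most its own prefix and its own clauses, whatever the current formula is, so
    -- the growth is additive.
    refine ⟨P₁ + P₂, fun x s Φ => ?_⟩
    have h3 := (h1 s).trans (poly_eval_mono P₁ (Nat.le_add_left (esize s) (esize x)))
    have h4 := (h2 s).trans (poly_eval_mono P₂ (Nat.le_add_left (esize s) (esize x)))
    have h5 := esize_append (N s) (bif e s then Φ.matrix.erase (K s) else Φ.matrix)
    have h6 : esize (bif e s then Φ.matrix.erase (K s) else Φ.matrix) ≤ esize Φ.matrix := by
      cases e s
      · exact le_rfl
      · exact esize_erase_le _ _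
    have h7 : esize (bif c s then Q s else Φ.pre) ≤ esize Φ.pre + esize (Q s) := by
      cases c s
      · exact Nat.le_add_right _ _
      · exact Nat.le_add_left _ _
    have h8 : ∀ Φ : PCNF, esize Φ = esize Φ.pre + esize Φ.matrix + 1 := fun _ => rfl
    rw [h, h8, h8, Polynomial.eval_add]
    dsimp only at *
    omega

@[fun_prop]
theorem PT.qrat_history {Φ : A → PCNF} {R : A → List QRATStep} (hΦ : PT Φ) (hR : PT R) :
    PT fun a => QRATStep.history (Φ a) (R a) := by
  have h1 : PT fun s : QRATStep => s.view := by fun_prop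
  refine PT.formulas (ap := fun Φ s => QRATStep.apply Φ s)
    (c := fun s => decide (s.view.1 = []) || (decide (s.view.1 = [true]) ||
      decide (s.view.1 = [true, true, true, true, true])))
    (e := fun s => decide (s.view.1 = [true, true]) || (decide (s.view.1 = [true, true, true]) ||
      decide (s.view.1 = [true, true, true, true])))
    (Q := fun s => s.view.2.1)
    (N := fun s => bif decide (s.view.1 = []) then [s.view.2.2.1] else
      bif decide (s.view.1 = [true]) then [s.view.2.2.2 :: s.view.2.2.1] else
      bif decide (s.view.1 = [true, true]) || decide (s.view.1 = [true, true, true]) then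
        [Clause.without s.view.2.2.1 s.view.2.2.2] else [])
    (K := fun s => s.view.2.2.1)
    (by fun_prop) (by fun_prop) (by fun_prop) (by fun_prop) (by fun_prop) ?_ hΦ hR
  intro Φ s
  cases s <;> rfl

theorem PT.qrat_script {t n B : A → List Unit} {xs : A → List ℕ} {Φ : A → PCNF}
    {s : A → QRATStep} (ht : PT t) (hn : PT n) (hB : PT B) (hxs : PT xs) (hΦ : PT Φ) (hs : PT s) :
    PT fun a => (s a).script (t a) (xs a) (QBFSim.stageMap (n a) (B a) (xs a)) (Φ a) := by
  have hv : PT fun a => (s a).view := by fun_prop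
  have hN : PT fun a => (Φ a).matrix := by fun_prop
  have hp : PT fun a => (Φ a).pre := by fun_prop
  have hC : PT fun a => (s a).view.2.2.1 := by fun_prop
  have hl : PT fun a => (s a).view.2.2.2 := by fun_prop
  have hr := PT.rightVars hp (PT.lit_var hl) hxs
  have h0 := PT.copyScript (f := fun a => QBFSim.stageMap (n a) (B a) (xs a))
    (pre := fun a => [(s a).view.2.2.1]) (N := fun a => (s a).view.2.2.1 :: (Φ a).matrix)
    (by fun_prop) ht hxs (by fun_prop) (by fun_prop)
  have h1 := PT.qrataScript (f := fun a => QBFSim.stageMap (n a) (B a) (xs a))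
    (sel := fun a => QBFSim.outerSel (s a).view.2.1 (s a).view.2.2.2.var [] [(s a).view.2.2.2.var])
    (by fun_prop) (by fun_prop) ht hxs hN hC hl
  have h2 := PT.qratuScript (f := fun a => QBFSim.stageMap (n a) (B a) (xs a))
    (sel := fun a => QBFSim.outerSel (Φ a).pre (s a).view.2.2.2.var
      (QBFSim.rightVars (xs a) (Φ a).pre (s a).view.2.2.2.var)
      (QBFSim.rightVars (xs a) (Φ a).pre (s a).view.2.2.2.var))
    (by fun_prop) (by fun_prop) ht hxs hr hN hC hl
  have h3 := PT.eurScript (f := fun a => QBFSim.stageMap (n a) (B a) (xs a))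
    (by fun_prop) ht hxs hr hN hC hl
  have h4 := PT.copyScript (f := fun a => QBFSim.stageMap (n a) (B a) (xs a))
    (pre := fun _ => []) (N := fun a => (Φ a).matrix.erase (s a).view.2.2.1)
    (by fun_prop) ht hxs (by fun_prop) (by fun_prop)
  have h5 := PT.copyScript (f := fun a => QBFSim.stageMap (n a) (B a) (xs a))
    (pre := fun _ => []) (N := fun a => (Φ a).matrix)
    (by fun_prop) ht hxs (by fun_prop) (by fun_prop)
  have htag : ∀ m : List Bool, PT fun a => decide ((s a).view.1 = m) := fun m => by fun_prop
  refine PT.of_enc (PT.cond (htag []) h0 (PT.cond (htag [true]) h1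
    (PT.cond (htag [true, true]) h2 (PT.cond (htag [true, true, true]) h3
      (PT.cond (htag [true, true, true, true]) h4 h5))))) fun a => ?_
  congr 1
  cases s a <;> rfl

@[fun_prop]
theorem PT.units {B : Type} [Enc B] {l : A → List B} (hl : PT l) : PT fun a => units (l a) := by
  unfold QBFSim.units
  fun_prop

@[fun_prop]
theorem PT.quantified (q : Quant) {Q : A → List (Quant × ℕ)} (hQ : PT Q) :
    PT fun a => quantified q (Q a) := by
  unfold QBFSim.quantified
  fun_prop

@[fun_prop]
theorem PT.introItems {Q Q₀ : A → List (Quant × ℕ)} (hQ : PT Q) (hQ₀ : PT Q₀) :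
    PT fun a => introItems (Q a) (Q₀ a) := by
  unfold QBFSim.introItems newOf
  fun_prop

@[fun_prop]
theorem PT.baseTime {Q : A → List (Quant × ℕ)} (hQ : PT Q) : PT fun a => baseTime (Q a) := by
  unfold QBFSim.baseTime
  fun_prop

theorem PT.qrat_scripts {B : A → List Unit} {xs : A → List ℕ} {Φ : A → PCNF}
    {R : A → List QRATStep} (hB : PT B) (hxs : PT xs) (hΦ : PT Φ) (hR : PT R) :
    PT fun a => QRATStep.scripts (B a) (xs a) (Φ a) (R a) := by
  unfold QRATStep.scripts
  refine PT.flatMap ?_ (by fun_prop)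
  exact PT.qrat_script (t := fun q : A × (QRATStep × List QRATStep) =>
      () :: QBFSim.units q.2.2 ++ B q.1) (n := fun q => QBFSim.units q.2.2)
    (Φ := fun q => QRATStep.history (Φ q.1) q.2.2) (s := fun q => q.2.1)
    (by fun_prop) (by fun_prop) (by fun_prop) (by fun_prop) (by fun_prop) (by fun_prop)

theorem PT.derivationScript {Φ : A → PCNF} {R : A → List QRATStep} (hΦ : PT Φ) (hR : PT R) :
    PT fun a => derivationScript (Φ a) (R a) := by
  unfold QBFSim.derivationScript
  have hp : PT fun a => (QRATStep.history (Φ a) (R a)).pre := by fun_prop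
  have h1 : PT fun a => QBFSim.introItems (QRATStep.history (Φ a) (R a)).pre (Φ a).pre :=
    PT.introItems hp (PT.pcnf_pre hΦ)
  have h2 : PT fun a => (Φ a).matrix.map fun C => Item.ax C :=
    PT.map (f := fun _ C => Item.ax C) (by fun_prop) (PT.pcnf_matrix hΦ)
  have h3 := PT.qrat_scripts (PT.baseTime hp) (PT.quantified Quant.ex hp) hΦ hR
  exact PT.append h1 (PT.append h2 h3)

theorem exDeps_append (U : List ℕ) (Q Q' : Prefix) :
    (Q ++ Q').exDeps U = Q.exDeps U ++ Q'.exDeps (U ++ quantified .all Q) := by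
  induction Q generalizing U with
  | nil => simp [Prefix.exDeps, quantified]
  | cons e Q ih =>
    obtain ⟨q, x⟩ := e
    cases q <;> simp [Prefix.exDeps, quantified, ih]

/-- The recursion with an accumulator is replaced by an iteration: the universal variables left of
an existential one are those of a suffix of the reversed prefix. -/
theorem exDeps_eq (Q : List (Quant × ℕ)) : Prefix.exDeps [] Q =
    (suffixes Q.reverse).reverse.flatMap fun p =>
      bif decide (p.1.1 = Quant.ex) then [(p.1.2, quantified .all p.2.reverse)] else [] := by
  induction Q using List.reverseRecOn with
  | nil => rfl
  | append_singleton Q e ih =>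
    rw [exDeps_append, ih]
    obtain ⟨q, x⟩ := e
    cases q <;> simp [Prefix.exDeps, suffixes]

@[fun_prop]
theorem PT.toD {Q : A → List (Quant × ℕ)} (hQ : PT Q) : PT fun a => Prefix.toD (Q a) := by
  refine PT.dprefix_mk (f := fun a => QBFSim.quantified .all (Q a))
    (g := fun a => Prefix.exDeps [] (Q a)) (by fun_prop) ?_
  simp only [exDeps_eq]
  fun_prop

@[fun_prop]
theorem PT.toDQBF {Φ : A → PCNF} (hΦ : PT Φ) : PT fun a => (Φ a).toDQBF :=
  PT.dqbf_mk (f := fun a => Prefix.toD (Φ a).pre) (g := fun a => (Φ a).matrix.map Clause.toFm)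
    (by fun_prop) (by fun_prop)

@[fun_prop]
theorem PT.dual {Q : A → List (Quant × ℕ)} (hQ : PT Q) : PT fun a => Prefix.dual (Q a) := by
  unfold Prefix.dual
  fun_prop

@[fun_prop]
theorem PT.negDQBF {Φ : A → PCNF} (hΦ : PT Φ) : PT fun a => (Φ a).negDQBF :=
  PT.dqbf_mk (f := fun a => Prefix.toD (Prefix.dual (Φ a).pre))
    (g := fun a => [Fm.neg (QBFSim.bigAnd ((Φ a).matrix.map Clause.toFm))])
    (by fun_prop) (by fun_prop)

end

/-- The simulation of a derivation. -/
noncomputable def simulate (F : FregeSystem) (π : QRATProof) : DProof :=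
  ⟨π.formula.toDQBF, compileScript F (derivationScript π.formula π.steps.reverse)⟩

theorem PT.simulate (F : FregeSystem) : PT (simulate F) := by
  have h := PT.derivationScript (Φ := fun π : QRATProof => π.formula)
    (R := fun π => π.steps.reverse) (by fun_prop) (by fun_prop)
  exact PT.dproof_mk (PT.toDQBF (by fun_prop)) (PT.compileScript h)

theorem QRATProof.stage_eq (π : QRATProof) (i : ℕ) :
    π.stage i = QRATStep.history π.formula (π.steps.take i).reverse := by
  rw [← QRATStep.history_eq, List.reverse_reverse]
  rfl

theorem simulate_correct (F : FregeSystem) (π : QRATProof) (h : π.IsDerivation) :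
    (simulate F π).IsDerivation F ∧
      (∀ i ≤ π.steps.length, (simulate F π).final.ContainsCopy (π.stage i)) ∧
      (π.IsRefutation → (simulate F π).IsRefutation F) := by
  have h1 := compileScript_correct (F := F) (toD_inv h.1.1)
    (derivationScript_correct h.1 (R := π.steps.reverse) (by simpa using h.2))
  obtain ⟨h2, S, h3, _, h4⟩ := h1
  have h5 : ∀ i ≤ π.steps.length, (simulate F π).final.ContainsCopy (π.stage i) := by
    intro i _
    obtain ⟨S₁, f, us, xs, cur, h5, h6, h7⟩ := h4 (π.steps.take i).reverse
      (List.reverse_suffix.2 (List.take_prefix _ _))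
    rw [QRATProof.stage_eq]
    exact h5.containsCopy h6 h7 h3
  refine ⟨h2, h5, fun hr => ⟨h2, ?_⟩⟩
  obtain ⟨ρ, _, _, _, h6⟩ := h5 _ le_rfl
  -- The copy of the empty clause is the formula `0`, whatever the renaming.
  exact h6 [] hr.2

end QBFSim
namespace QBFSim
variable {M : List Fm}

/-! ### Steps of proofs of true formulas -/

/-- The clause that says that one of the labelled clauses is false. -/
def negClause (s : List Unit) (k : Kind) (L : List (Clause × List Bool)) : Clause :=
  L.map fun d => ⟨name s k d.2, false⟩

/-- Definitions of variables for the labelled clauses, modified by `R`. -/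
def clauseDefs (t : List Unit) (k : Kind) (R : Clause → Clause) (L : List (Clause × List Bool)) :
    List Item :=
  L.map fun d => .defOr (name t k d.2) (R d.1)

def HasClauses (S : SState) (s : List Unit) (k : Kind) (R : Clause → Clause)
    (L : List (Clause × List Bool)) : Prop :=
  ∀ d ∈ L, HasDef S.Γ (name s k d.2) (R d.1) ∧ name s k d.2 ∈ S.pre.exNames

theorem HasClauses.ext {S S₁ : SState} {s : List Unit} {k : Kind} {R : Clause → Clause}
    {L : List (Clause × List Bool)} (h : HasClauses S s k R L) (he : Ext S S₁) :
    HasClauses S₁ s k R L :=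
  fun d hd => ⟨(h d hd).1.mono he.cls, he.exs (h d hd).2⟩

theorem HasClauses.clauseIn {S : SState} {s : List Unit} {k : Kind} {R : Clause → Clause}
    {L : List (Clause × List Bool)} (h : HasClauses S s k R L) :
    ClauseIn S.pre (negClause s k L) := by
  intro y hy
  obtain ⟨d, hd, rfl⟩ := List.mem_map.1 hy
  exact List.mem_append_right _ (h d hd).2

theorem clauses_block {S S₁ : SState} {t : List Unit} {used : List Kind} (hw : Within S t used S₁)
    (hf : ∀ k bs, name t k bs ∉ S.pre.names) {k : Kind} (hk : k ∉ used) (R : Clause → Clause)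
    {L : List (Clause × List Bool)} (hL : (L.map Prod.snd).Nodup)
    (hR : ∀ d ∈ L, ClauseIn S₁.pre (R d.1)) :
    STr M S₁ (clauseDefs t k R L) (fun S₂ =>
      Within S t (k :: used) S₂ ∧ Ext S₁ S₂ ∧ HasClauses S₂ t k R L ∧
        ∀ d ∈ L, ∀ u ∈ S₂.pre.dep (name t k d.2), ∃ y ∈ R d.1, u ∈ S₁.pre.dep y.var) := by
  refine (def_block hw hf hk L Prod.snd hL (fun d => R d.1) hR).mono ?_
  rintro S₂ ⟨h1, h2, h3⟩
  exact ⟨h1, h2, fun d hd => ⟨(h3 d hd).1, (h3 d hd).2.1⟩, fun d hd => (h3 d hd).2.2⟩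

/-- The pairs of labelled clauses of which the second is contained in the first. -/
def subPairs (L L' : List (Clause × List Bool)) :
    List ((Clause × List Bool) × (Clause × List Bool)) :=
  L.flatMap fun d => (L'.filter fun d' => d'.1.all fun x => decide (x ∈ d.1)).map fun d' => (d, d')

theorem mem_subPairs {L L' : List (Clause × List Bool)} {d d' : Clause × List Bool} :
    (d, d') ∈ subPairs L L' ↔ d ∈ L ∧ d' ∈ L' ∧ d'.1 ⊆ d.1 := by
  simp [subPairs, List.subset_def]

/-- If one of the clauses `L` is false, then so is one of the clauses `N`, in the context `E`;
this is so for the clauses `Ks` by assumption, and for the others by inclusion. -/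
def transferItems (E : Clause) (s : List Unit) (k : Kind) (L : List (Clause × List Bool))
    (t : List Unit) (N Ks : CNF) : List Item :=
  ((subPairs L (labels N)).map fun p =>
    .rup (E ++ [⟨name t kClause p.2.2, false⟩, ⟨name s k p.1.2, true⟩])) ++
  (((L.filter fun d => decide (d.1 ∈ Ks)).map fun d =>
    .rup (E ++ ⟨name s k d.2, true⟩ :: negClause t kClause (labels N))) ++
  [.rup (E ++ negClause t kClause (labels N))])

/-- A false clause `D` of `L` yields a false clause of `N`: one contained in `D`, by `hp`, or some
clause, by `hK`, if `D` is among `Ks`. As propagation cannot split on which clause of `L` is false,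
each case is first derived as a clause with context `E`; the last step then assigns all names of `L`
to true and contradicts the old invariant. -/
theorem transfer_block {S S₁ : SState} {t₀ t s : List Unit} {used : List Kind} {k : Kind}
    {R R' : Clause → Clause} {E : Clause} {L : List (Clause × List Bool)} {N Ks : CNF}
    (hw : Within S t₀ used S₁) (hE : ClauseIn S₁.pre E) (hc : HasClauses S₁ s k R L)
    (hc' : HasClauses S₁ t kClause R' (labels N)) (hZ : negClause s k L ∈ S₁.Γ)
    (hL : ∀ d ∈ L, d.1 ∈ Ks ∨ ∃ D ∈ N, D ⊆ d.1)
    (hp : ∀ d ∈ L, ∀ d' ∈ labels N, d'.1 ⊆ d.1 → ∀ U, UPM S₁.Γ U → (∀ k ∈ E, U k.neg) →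
      U ⟨name t kClause d'.2, true⟩ → (∀ k ∈ R d.1, U k.neg) → False)
    (hK : ∀ d ∈ L, d.1 ∈ Ks → ∀ U, UPM S₁.Γ U → (∀ k ∈ E, U k.neg) →
      (∀ d' ∈ labels N, U ⟨name t kClause d'.2, true⟩) → (∀ k ∈ R d.1, U k.neg) → False) :
    STr M S₁ (transferItems E s k L t N Ks) (fun S₂ =>
      Within S t₀ used S₂ ∧ Ext S₁ S₂ ∧ S₂.pre = S₁.pre ∧
        (E ++ negClause t kClause (labels N)) ∈ S₂.Γ) := by
  have hneg : ∀ {U : Lit → Prop}, (∀ y ∈ negClause t kClause (labels N), U y.neg) →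
      ∀ d' ∈ labels N, U ⟨name t kClause d'.2, true⟩ :=
    fun h d' hd' => h _ (List.mem_map.2 ⟨d', hd', rfl⟩)
  have hin : ∀ d ∈ L, ∀ C, ClauseIn S₁.pre C → ClauseIn S₁.pre (⟨name s k d.2, true⟩ :: C) :=
    fun d hd C hC => ClauseIn.cons (List.mem_append_right _ (hc d hd).2) hC
  have happ : ∀ C, ClauseIn S₁.pre C → ClauseIn S₁.pre (E ++ C) := fun C hC y hy =>
    (List.mem_append.1 hy).elim (hE y) (hC y)
  refine (rup_block hw (subPairs L (labels N)) (fun p => E ++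
    [⟨name t kClause p.2.2, false⟩, ⟨name s k p.1.2, true⟩]) ?_ ?_).append ?_
  · rintro ⟨d, d'⟩ hdd
    obtain ⟨hd, hd', hs⟩ := mem_subPairs.1 hdd
    exact happ _ (ClauseIn.cons (List.mem_append_right _ (hc' d' hd').2)
      (hin d hd [] (by simp [ClauseIn])))
  · rintro ⟨d, d'⟩ hdd U hU hk
    obtain ⟨hd, hd', hs⟩ := mem_subPairs.1 hdd
    exact hp d hd d' hd' hs U hU (fun y hy => hk y (List.mem_append_left _ hy))
      (hk ⟨name t kClause d'.2, false⟩ (by simp))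
      (hU.def_neg (hc d hd).1 (hk ⟨name s k d.2, true⟩ (by simp)))
  rintro S₂ ⟨w2, e2, p2, c2⟩
  refine (rup_block w2 (L.filter fun d => decide (d.1 ∈ Ks)) (fun d => E ++
    ⟨name s k d.2, true⟩ :: negClause t kClause (labels N)) ?_ ?_).append ?_
  · intro d hd
    rw [p2]
    exact happ _ (hin d (List.mem_filter.1 hd).1 _ hc'.clauseIn)
  · intro d hd U hU hk
    rw [List.mem_filter, decide_eq_true_eq] at hd
    refine hK d hd.1 hd.2 U (hU.mono e2.cls) (fun y hy => hk y (List.mem_append_left _ hy))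
      (hneg fun y hy => hk y (List.mem_append_right _ (List.mem_cons_of_mem _ hy)))
      (hU.def_neg ((hc d hd.1).1.mono e2.cls) (hk ⟨name s k d.2, true⟩ (by simp)))
  rintro S₃ ⟨w3, e3, p3, c3⟩
  refine (rup_one w3 (E ++ negClause t kClause (labels N)) ?_ ?_).mono ?_
  · rw [p3, p2]
    exact happ _ hc'.clauseIn
  · intro U hU hk
    refine hU.conflict (e3.cls (e2.cls hZ)) fun y hy => ?_
    obtain ⟨d, hd, rfl⟩ := List.mem_map.1 hy
    change U ⟨name s k d.2, true⟩
    rcases hL d hd with h | ⟨D, hD, h⟩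
    · refine (hU.clause _ (c3 d (List.mem_filter.2 ⟨hd, by simpa using h⟩))).1 _ (by simp)
        fun j hj hne => ?_
      rcases List.mem_append.1 hj with hj | hj
      · exact hk j (List.mem_append_left _ hj)
      · rcases List.mem_cons.1 hj with rfl | hj
        · exact (hne rfl).elim
        · exact hk j (List.mem_append_right _ hj)
    · obtain ⟨b, hb⟩ := exists_label hD
      refine (hU.clause _ (e3.cls (c2 (d, (D, b)) (mem_subPairs.2 ⟨hd, hb, h⟩)))).1 _ (by simp)
        fun j hj hne => ?_
      rcases List.mem_append.1 hj with hj | hj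
      · exact hk j (List.mem_append_left _ hj)
      · simp only [List.mem_cons, List.not_mem_nil, or_false] at hj
        rcases hj with rfl | rfl
        · exact hneg (fun y hy => hk y (List.mem_append_right _ hy)) (D, b) hb
        · exact (hne rfl).elim
  · rintro S₄ ⟨w4, e4, p4, c4⟩
    exact ⟨w4, e2.trans (e3.trans e4), p4.trans (p3.trans p2), c4⟩

/-- A state with a name for each clause of `N`, and the information that one of them is false. -/
structure NegStage (xs us : List ℕ) (cur : ℕ) (P : Prefix) (f : ℕ → ℕ) (s : List Unit) (N : CNF)
    (S : SState) : Prop where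
  stage : Stage xs us cur P f S
  defs : HasClauses S s kClause (ren f) (labels N)
  neg : negClause s kClause (labels N) ∈ S.Γ

section
variable {xs us : List ℕ} {cur : ℕ} {P : Prefix} {f g : ℕ → ℕ} {S S₁ : SState}
  {s t : List Unit} {used : List Kind}

theorem Stage.of_ext {n : ℕ} (h : Stage xs us cur P f S) (hi : S₁.Inv) (he : Ext S S₁)
    (hf : ∀ t k bs, n < t.length → name t k bs ∉ S₁.pre.names) : Stage xs us n P f S₁ :=
  { h with
    inv := hi
    univ := fun u hu => he.univ (h.univ u hu)
    ex := fun x hx => he.exs (h.ex x hx)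
    dep := fun x hx => by
      rw [he.dep _ (List.mem_append_right _ (h.ex x hx))]
      exact h.dep x hx
    fresh := hf }

theorem Within.fresh_after (hw : Within S t used S₁) (hS : Stage xs us cur P f S)
    (ht : t.length = cur + 1) :
    ∀ t' k bs, cur + 1 < t'.length → name t' k bs ∉ S₁.pre.names := by
  intro t' k bs h hn
  rcases hw.names _ hn with hn | ⟨k', _, bs', e⟩
  · exact hS.fresh t' k bs (by omega) hn
  · have := (name_inj e).1
    omega

/-- If all names are true, the clauses of `N` themselves act as propagating clauses, through their
definitions. Here they are renamed by `g`, while the other units are renamed by `f`; `hl` identifies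
the two. -/
theorem UPRefutes.false_of_clauses {N Δ : CNF} (h : UPRefutes (N ++ Δ)) {U : Lit → Prop}
    (hU : UPM S.Γ U) (hd : HasClauses S t kClause (ren g) (labels N))
    (hc : ∀ d ∈ labels N, U ⟨name t kClause d.2, true⟩)
    (hl : ∀ k, U (rl g k) ↔ U (rl f k)) (hΔ : ∀ E ∈ Δ, VC U (ren f E)) : False := by
  have he : (fun k => U (rl g k)) = fun k => U (rl f k) := funext fun k => propext (hl k)
  refine h.false_of_model (U := fun l => U (rl f l))
    ⟨fun _ h1 h2 => hU.cons _ h1 h2, fun E hE => ?_⟩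
  rcases List.mem_append.1 hE with hE | hE
  · obtain ⟨b, hb⟩ := exists_label hE
    have := (hU.def_vc (hd _ hb).1 (hc _ hb)).of_ren
    rwa [he] at this
  · exact (hΔ E hE).of_ren

/-- The transition from the clauses `N` to `N'` without a change of the assignment; the clauses
`Ks` are removed by asymmetric tautology elimination. -/
def transferScript (t : List Unit) (xs : List ℕ) (f : ℕ → ℕ) (s : List Unit) (N N' Ks : CNF) :
    List Item :=
  (newDefs t xs fun x => [⟨f x, true⟩]) ++
  (clauseDefs t kClause (ren (newMap t xs)) (labels N') ++
  transferItems [] s kClause (labels N) t N' Ks)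

/-- Adding clauses and shortening clauses keep a false clause false, as every old clause includes a
new one. If an eliminated asymmetric tautology is false, propagation shows that not all remaining
clauses are true. -/
theorem transfer_step {N N' Ks : CNF} (hS : NegStage xs us cur P f s N S)
    (ht : t.length = cur + 1) (hv : ∀ D ∈ N', ∀ k ∈ D, k.var ∈ P.names)
    (hK : ∀ K ∈ Ks, UPRefutes (N' ++ K.negUnits))
    (hN : ∀ D ∈ N, D ∈ Ks ∨ ∃ D' ∈ N', D' ⊆ D) :
    STr M S (transferScript t xs f s N N' Ks)
      (NegStage xs us (cur + 1) P (newMap t xs) t N') := by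
  refine (new_block hS.stage ht (Within.refl hS.stage.inv t) (by simp)
    (fun x hx => hS.stage.copy_clauseIn hx) fun x hx y hy => ?_).append ?_
  · rw [List.mem_singleton.1 hy]
    exact hS.stage.dep x hx
  rintro S₁ ⟨st1, w1, e1, c1⟩
  refine (clauses_block w1 (hS.stage.fresh_at ht) (by decide) (ren (newMap t xs)) (labels_nodup N')
    fun d hd => st1.clauseIn (hv d.1 (mem_labels_fst hd))).append ?_
  rintro S₂ ⟨w2, e2, c2, _⟩
  have e := e1.trans e2
  have hlead : ∀ {U : Lit → Prop}, UPM S₂.Γ U → ∀ k, U (rl (newMap t xs) k) ↔ U (rl f k) :=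
    fun hU k => ⟨hU.to_old hS.stage fun hx => (c1 _ hx).mono e2.cls,
      hU.to_new hS.stage fun hx => (c1 _ hx).mono e2.cls⟩
  refine (transfer_block w2 (by simp [ClauseIn]) (hS.defs.ext e) c2 (e.cls hS.neg)
    (fun d hd => hN d.1 (mem_labels_fst hd)) ?_ ?_).mono ?_
  · intro d hd d' hd' hs U hU _ hc hk
    rw [forall_ren] at hk
    exact hU.def_conflict (c2 d' hd').1 hc (forall_ren.2 fun k hk' =>
      (hlead hU k.neg).2 (hk k (hs hk')))
  · intro d hd hdK U hU _ hc hk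
    exact (hK d.1 hdK).false_of_clauses hU c2 hc (hlead hU) (hU.vc_negUnits (forall_ren.1 hk))
  · rintro S₃ ⟨w3, e3, _, c3⟩
    exact ⟨st1.of_ext w3.inv (e2.trans e3) (w3.fresh_after hS.stage ht), c2.ext e3, c3⟩

/-- The script for the elimination of `K` by resolution asymmetric tautology with respect to the
literal `l`, universal in the dual prefix. -/
def qrateScript (t : List Unit) (xs Sx : List ℕ) (f : ℕ → ℕ) (sel : Lit → Bool) (s : List Unit)
    (N : CNF) (K : Clause) (l : Lit) : List Item :=
  let v := condMap t Sx f
  let N' := N.erase K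
  let Z := negClause t kClause (labels N')
  let Ds := (labels N').filter fun d => decide (l.neg ∈ d.1)
  let Vs := (labels N).filter fun d => decide (l ∉ d.1)
  gates t f sel Ds ++
  (condItems t Sx f l ++
  (clauseDefs t kReduced (fun D => ren v (Clause.without D l.neg)) Vs ++
  ((Vs.map fun d => .rup [l.neg, ⟨name t kReduced d.2, false⟩, ⟨name s kClause d.2, true⟩]) ++
  ([.rup (l.neg :: negClause t kReduced Vs)] ++
  ([.red l.neg (negClause t kReduced Vs)] ++
  (iteItems t xs Sx f v ++
  (clauseDefs t kClause (ren (newMap t xs)) (labels N') ++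
  (transferItems [⟨name t kGate [], true⟩] t kReduced Vs t N' [] ++
  ((Ds.map fun d => .rup (⟨name t kGate [], false⟩ :: ⟨name t kOuter d.2, true⟩ ::
    (ren f K ++ Z))) ++
  (transferItems [⟨name t kGate [], false⟩] s kClause (labels N) t N' [K] ++
  [.rup Z]))))))))))

/-- In the dual prefix `l` is universal. Let `v` be the opponent's strategy that plays as if `l`
were true. A false clause then does not contain `l`, and reduction shows that some `D` without `l`
is false for `v` even when `l̄` is removed. The new strategy is `v` if all outer clauses of clauses
with `l̄` hold, and the old one otherwise. With `v`, the false `D` cannot contain `l̄`, as its outer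
clause holds, and it is not `K`, as `l ∈ K`. With the old strategy, if `K` is false and all other
clauses are true, `hup` makes all outer clauses true, against the case. -/
theorem qrate_step {Sx : List ℕ} {sel : Lit → Bool} {N : CNF} {K : Clause} {l : Lit}
    (hS : NegStage xs us cur P f s N S) (ht : t.length = cur + 1) (hsub : Sx ⊆ xs) (hnd : Sx.Nodup)
    (hSx : ∀ x ∈ xs, l.var ∈ depOf P x → x ∈ Sx)
    (hNv : ∀ D ∈ N, ∀ k ∈ D, k.var ∈ P.names)
    (hK : K ∈ N) (hlK : l ∈ K) (hl : (Quant.all, l.var) ∈ P)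
    (hsel : ∀ k, sel k = true →
      k.var ≠ l.var ∧ k.var ∉ Sx ∧ ∀ x ∈ Sx, depOf P k.var ⊆ depOf P x)
    (hup : ∀ D ∈ N.erase K, l.neg ∈ D →
      UPRefutes (N.erase K ++ K.negUnits ++ Clause.negUnits (D.filter sel))) :
    STr M S (qrateScript t xs Sx f sel s N K l)
      (NegStage xs us (cur + 1) P (newMap t xs) t (N.erase K)) := by
  have hN' : ∀ D ∈ N.erase K, D ∈ N := fun D hD => List.mem_of_mem_erase hD
  have hfl : ∀ b, rl f ⟨l.var, b⟩ = ⟨l.var, b⟩ := fun b => by rw [rl, hS.stage.map_all hl]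
  unfold qrateScript
  simp only
  set Ds := (labels (N.erase K)).filter fun d => decide (l.neg ∈ d.1) with hDs
  set Vs := (labels N).filter fun d => decide (l ∉ d.1) with hVs
  have hD1 : ∀ d ∈ Ds, d.1 ∈ N.erase K ∧ l.neg ∈ d.1 := by
    intro d hd
    rw [hDs, List.mem_filter] at hd
    exact ⟨mem_labels_fst hd.1, by simpa using hd.2⟩
  have hV1 : ∀ d ∈ Vs, d ∈ labels N ∧ d.1 ∈ N ∧ l ∉ d.1 := by
    intro d hd
    rw [hVs, List.mem_filter] at hd
    exact ⟨hd.1, mem_labels_fst hd.1, by simpa using hd.2⟩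
  have hV2 : ∀ d ∈ Vs, ∀ k ∈ Clause.without d.1 l.neg, k.var ≠ l.var := fun d hd k hk =>
    var_ne_of_mem_without (l := l.neg) (by rw [Lit.neg_neg]; exact (hV1 d hd).2.2) hk
  refine (gates_block hS.stage ht (Within.refl hS.stage.inv t) (by simp) (by simp)
    ((labels_nodup (N.erase K)).sublist (List.filter_sublist.map _))
    fun d hd => hNv d.1 (hN' _ (hD1 d hd).1)).append ?_
  rintro S₁ ⟨w1, e1, g1, o1, n1, d1⟩
  refine (cond_block hS.stage ht w1 (by decide) hl hsub hnd hSx).append ?_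
  rintro S₂ ⟨w2, e2, i2, l2, l2'⟩
  have hvx : ∀ x, x ∉ xs → condMap t Sx f x = x := fun x hx => by
    rw [condMap_of_not_mem fun h => hx (hsub h), hS.stage.id x hx]
  refine (clauses_block w2 (hS.stage.fresh_at ht) (by decide)
    (fun D => ren (condMap t Sx f) (Clause.without D l.neg))
    ((labels_nodup N).sublist (List.filter_sublist.map _)) fun d hd => forall_ren.2 fun k hk =>
      ?_).append ?_
  · have hkP := hNv d.1 (hV1 d hd).2.1 k (mem_without.1 hk).1
    change condMap t Sx f k.var ∈ _
    by_cases hx : k.var ∈ xs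
    · exact List.mem_append_right _ (i2 _ hx).1
    · rw [hvx _ hx, ← hS.stage.id _ hx]
      exact w2.ext.names (hS.stage.map_mem hkP)
  rintro S₃ ⟨w3, e3, c3, d3⟩
  have hlu : l.var ∈ S₃.pre.univ := w3.ext.univ (hS.stage.all_univ hl)
  have hind : ∀ d ∈ Vs, l.var ∉ S₃.pre.dep (name t kReduced d.2) := by
    intro d hd hu
    obtain ⟨y, hy, hu⟩ := d3 d hd _ hu
    obtain ⟨k, hk, rfl⟩ := List.mem_map.1 hy
    have hkP := hNv d.1 (hV1 d hd).2.1 k (mem_without.1 hk).1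
    change _ ∈ S₂.pre.dep (condMap t Sx f k.var) at hu
    by_cases hx : k.var ∈ xs
    · exact (i2 _ hx).2.2 hu
    · rw [hvx _ hx] at hu
      rcases mem_names.1 hkP with h | h
      · have := w2.ext.univ (hS.stage.all_univ h)
        simp only [DPrefix.dep, this, if_true, List.mem_singleton] at hu
        exact hV2 d hd k hk hu.symm
      · exact hx (hS.stage.exMem _ h)
  refine (rup_block w3 Vs (fun d =>
    [l.neg, ⟨name t kReduced d.2, false⟩, ⟨name s kClause d.2, true⟩]) (fun d hd => ?_) ?_).append ?_
  · refine ClauseIn.cons (List.mem_append_left _ hlu) (ClauseIn.cons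
      (List.mem_append_right _ (c3 d hd).2) (ClauseIn.cons (List.mem_append_right _
      (w3.ext.exs (hS.defs d (hV1 d hd).1).2)) (by simp [ClauseIn])))
  · intro d hd U hU hk
    have ha : U l := by
      have := hk l.neg (by simp)
      rwa [Lit.neg_neg] at this
    have hk1 := forall_ren.1 (hU.def_neg ((hS.defs d (hV1 d hd).1).1.mono w3.ext.cls)
      (hk ⟨name s kClause d.2, true⟩ (by simp)))
    refine hU.def_conflict (c3 d hd).1 (hk ⟨name t kReduced d.2, false⟩ (by simp))
      (forall_ren.2 fun k hk' => ?_)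
    exact l2' _ e3.cls U hU ha k.neg (hk1 k (mem_without.1 hk').1)
  rintro S₄ ⟨w4, e4, p4, c4⟩
  -- The clause says that if `l` is true, one of the reduced clauses is false for `v`. Clauses that
  -- contain `l` are true in this case and drop out of the invariant.
  refine (rup_one w4 (l.neg :: negClause t kReduced Vs) (ClauseIn.cons
    (List.mem_append_left _ (e4.univ hlu)) (e4.clauseIn c3.clauseIn)) ?_).append ?_
  · intro U hU hk
    rw [List.forall_mem_cons, Lit.neg_neg] at hk
    refine hU.conflict (w4.ext.cls hS.neg) fun y hy => ?_
    obtain ⟨d, hd, rfl⟩ := List.mem_map.1 hy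
    change U ⟨name s kClause d.2, true⟩
    by_cases hld : l ∈ d.1
    · refine hU.def_pos ((hS.defs d hd).1.mono w4.ext.cls) (mem_ren hld) ?_
      obtain ⟨v, b⟩ := l
      rw [hfl]
      exact hk.1
    · have hd' : d ∈ Vs := List.mem_filter.2 ⟨hd, by simpa using hld⟩
      exact hU.three (c4 d hd') (by rw [Lit.neg_neg]; exact hk.1)
        (hk.2 _ (List.mem_map.2 ⟨d, hd', rfl⟩))
  rintro S₅ ⟨w5, e5, p5, c5⟩
  have e35 := e4.trans e5
  have p35 : S₅.pre = S₃.pre := p5.trans p4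
  refine ((red_block w5 [()] (fun _ => negClause t kReduced Vs) l.neg (e35.univ hlu)
    (by simpa using c5) ?_).mono (Q := fun S₆ => Within S t _ S₆ ∧ Ext S₅ S₆ ∧
      negClause t kReduced Vs ∈ S₆.Γ) fun S₆ h => ⟨h.1, h.2.1, h.2.2.2 () (by simp)⟩).append ?_
  -- The names of the reduced clauses are defined from variables independent of `l`, and this is why
  -- the literal `l̄` can be reduced.
  · intro _ _ y hy
    obtain ⟨d, hd, rfl⟩ := List.mem_map.1 hy
    rw [Lit.neg_var, p35]
    exact ⟨fun e => w3.inv.2 _ hlu (e ▸ (c3 d hd).2), fun _ => hind d hd⟩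
  rintro S₆ ⟨w6, e6, c6⟩
  have e36 := e35.trans e6
  have e26 := e3.trans e36
  have e16 := e2.trans e26
  refine (ite_block (v := condMap t Sx f) hS.stage ht w6 (by decide) hsub hnd (i2.ext e26)
    (fun x hx => condMap_of_not_mem hx) (e16.exs n1) ?_).append ?_
  · intro x hx u hu
    rw [e16.dep _ (List.mem_append_right _ n1)] at hu
    obtain ⟨d, _, k, _, hk, hu⟩ := d1 u hu
    exact (hsel k hk).2.2 x hx hu
  rintro S₇ ⟨st7, w7, e7, gv7, gf7, vg7, fg7⟩
  refine (clauses_block w7 (hS.stage.fresh_at ht) (by decide) (ren (newMap t xs))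
    (labels_nodup _) fun d hd => st7.clauseIn (hNv d.1 (hN' _ (mem_labels_fst hd)))).append ?_
  rintro S₈ ⟨w8, e8, c8, _⟩
  have e78 := e7.trans e8
  have hgate : name t kGate [] ∈ S₈.pre.names :=
    List.mem_append_right _ ((e16.trans e78).exs n1)
  have hg1 : ∀ b, ClauseIn S₈.pre [⟨name t kGate [], b⟩] := fun b =>
    ClauseIn.cons hgate (by simp [ClauseIn])
  have g8 := g1.mono (e16.trans e78).cls
  -- The case of a false gate, in which the new copies follow `v`; nothing has to be eliminated by
  -- assumption.
  refine (transfer_block (Ks := []) w8 (hg1 true) (c3.ext (e36.trans e78)) c8 (e78.cls c6)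
    (fun d hd => Or.inr ⟨d.1, ?_, List.Subset.refl _⟩) ?_ (by simp)).append ?_
  · exact (List.mem_erase_of_ne fun e => (hV1 d hd).2.2 (by rw [e]; exact hlK)).2 (hV1 d hd).2.1
  · intro d hd d' hd' hs U hU hn hc hk
    have hn : U ⟨name t kGate [], false⟩ := hn ⟨name t kGate [], true⟩ (by simp)
    rw [forall_ren] at hk
    by_cases hld : l.neg ∈ d'.1
    · have hd'' : d' ∈ Ds := List.mem_filter.2 ⟨hd', by simpa using hld⟩
      refine (g8.outer_vc hU hn hd'').2.2 (forall_ren.2 fun k hk' => ?_)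
      obtain ⟨hk1, hk2⟩ := List.mem_filter.1 hk'
      have := hk k (mem_without.2 ⟨hs hk1, fun e => (hsel k hk2).1 (by rw [e, Lit.neg_var])⟩)
      rw [rl_neg] at this
      rwa [rl_condMap (k := k.neg) (hsel k hk2).2.1] at this
    · exact hU.def_conflict (c8 d' hd').1 hc (forall_ren.2 fun k hk' =>
        vg7 _ e8.cls U hU hn k.neg (hk k (mem_without.2 ⟨hs hk', fun e => hld (e ▸ hk')⟩)))
  rintro S₉ ⟨w9, e9, p9, c9⟩
  have hlead : ∀ {Γ : CNF}, S₈.Γ ⊆ Γ → ∀ {U : Lit → Prop}, UPM Γ U → U ⟨name t kGate [], true⟩ →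
      ∀ k, U (rl (newMap t xs) k) ↔ U (rl f k) := fun hΓ U hU hn k =>
    ⟨gf7 _ (List.Subset.trans e8.cls hΓ) U hU hn k, fg7 _ (List.Subset.trans e8.cls hΓ) U hU hn k⟩
  -- The clauses `n̄ ∨ o_D ∨ K ∨ Z`, where `Z` is the new invariant. Falsifying one makes all
  -- remaining clauses true, so that `hup` applies to the old copies.
  refine (rup_block w9 Ds (fun d => ⟨name t kGate [], false⟩ :: ⟨name t kOuter d.2, true⟩ ::
    (ren f K ++ negClause t kClause (labels (N.erase K)))) (fun d hd => ?_) ?_).append ?_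
  · rw [p9]
    refine ClauseIn.cons hgate (ClauseIn.cons
      (List.mem_append_right _ ((e16.trans e78).exs (o1 d hd))) fun y hy => ?_)
    exact (List.mem_append.1 hy).elim
      (w8.ext.clauseIn (hS.stage.clauseIn (hNv K hK)) y) (c8.clauseIn y)
  · intro d hd U hU hk
    simp only [List.forall_mem_cons, List.forall_mem_append] at hk
    obtain ⟨hn, ho, hkK, hkZ⟩ := hk
    have h := hup d.1 (hD1 d hd).1 (hD1 d hd).2
    rw [List.append_assoc] at h
    refine h.false_of_clauses hU (c8.ext e9) (fun d hd => hkZ _ (List.mem_map.2 ⟨d, hd, rfl⟩))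
      (hlead e9.cls hU hn) fun E hE => ?_
    rcases List.mem_append.1 hE with hE | hE
    · exact hU.vc_negUnits (forall_ren.1 hkK) E hE
    · exact hU.vc_negUnits (forall_ren.1
        (hU.def_neg ((g8.mono e9.cls).outer d hd) ho)) E hE
  rintro S₁₀ ⟨w10, e10, p10, c10⟩
  have e810 := e9.trans e10
  -- The case of a true gate. If `K` is false and no other clause is, the clauses just derived force
  -- every `o_D` and so contradict the gate.
  refine (transfer_block (E := [⟨name t kGate [], false⟩]) (Ks := [K]) w10
    (e810.clauseIn (hg1 false)) (hS.defs.ext w10.ext)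
    (c8.ext e810) (w10.ext.cls hS.neg) (fun d hd => ?_) ?_ ?_).append ?_
  · by_cases h : d.1 = K
    · exact Or.inl (by simp [h])
    · exact Or.inr ⟨d.1, (List.mem_erase_of_ne h).2 (mem_labels_fst hd), List.Subset.refl _⟩
  · intro d hd d' hd' hs U hU hn hc hk
    rw [forall_ren] at hk
    exact hU.def_conflict ((c8.ext e810) d' hd').1 hc (forall_ren.2 fun k hk' =>
      (hlead e810.cls hU (hn ⟨name t kGate [], false⟩ (by simp)) k.neg).2 (hk k (hs hk')))
  · intro d hd hdK U hU hn hc hk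
    rw [List.mem_singleton.1 hdK] at hk
    have hn : U ⟨name t kGate [], true⟩ := hn ⟨name t kGate [], false⟩ (by simp)
    refine hU.cons _ hn ((g8.mono e810.cls).gate_false hU fun d hd => ?_)
    refine (hU.clause _ (c10 d hd)).1 _ (by simp) fun j hj hne => ?_
    simp only [List.mem_cons, List.mem_append] at hj
    rcases hj with rfl | rfl | hj | hj
    · exact hn
    · exact (hne rfl).elim
    · exact hk j hj
    · obtain ⟨d, hd, rfl⟩ := List.mem_map.1 hj
      exact hc d hd
  rintro S₁₁ ⟨w11, e11, p11, c11⟩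
  have e811 := e810.trans e11
  -- The two cases are joined: the second forces `n̄`, and then the first is in conflict.
  refine (rup_one w11 (negClause t kClause (labels (N.erase K))) (c8.ext e811).clauseIn ?_).mono ?_
  · intro U hU hk
    have hn : U ⟨name t kGate [], false⟩ := by
      refine (hU.clause _ c11).1 _ (by simp) fun j hj hne => ?_
      rcases List.mem_append.1 hj with hj | hj
      · exact (hne (List.mem_singleton.1 hj)).elim
      · exact hk j hj
    refine hU.conflict (e11.cls (e10.cls c9)) fun j hj => ?_
    rcases List.mem_append.1 hj with hj | hj
    · rw [List.mem_singleton.1 hj]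
      exact hn
    · exact hk j hj
  · rintro S₁₂ ⟨w12, e12, _, c12⟩
    have e812 := e811.trans e12
    exact ⟨st7.of_ext w12.inv (e8.trans e812) (w12.fresh_after hS.stage ht), c8.ext e812, c12⟩

end

end QBFSim
namespace QBFSim
variable {M : List Fm}

/-! ### Dual prefixes -/

theorem dual_names (Q : Prefix) : Q.dual.names = Q.names := by
  simp [Prefix.dual, Prefix.names]

theorem mem_dual {Q : Prefix} {q : Quant} {x : ℕ} : (q, x) ∈ Q.dual ↔ (q.flip, x) ∈ Q := by
  simp only [Prefix.dual, List.mem_map, Prod.mk.injEq, Prod.exists]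
  constructor
  · rintro ⟨q', y, h, rfl, rfl⟩
    cases q' <;> exact h
  · intro h
    exact ⟨q.flip, x, h, by cases q <;> rfl, rfl⟩

theorem dual_levelFrom (Q : Prefix) (q : Quant) (n x : ℕ) :
    Q.dual.levelFrom q.flip n x = Q.levelFrom q n x := by
  induction Q generalizing q n with
  | nil => rfl
  | cons e Q ih =>
    obtain ⟨q', y⟩ := e
    have h : q'.flip = q.flip ↔ q' = q := by cases q <;> cases q' <;> decide
    simp only [Prefix.dual, List.map_cons, Prefix.levelFrom, h]
    rw [← ih]
    rfl

theorem dual_level (Q : Prefix) (x : ℕ) : Q.dual.level x = Q.level x := by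
  cases Q with
  | nil => rfl
  | cons e Q => exact dual_levelFrom (e :: Q) e.1 0 x

/-- Exchanging the quantifiers preserves the blocks and their order. So the side condition of QRATE,
stated for `Π`, can be read in the dual prefix, in which the refutation lives. -/
theorem dual_outerClause (Q : Prefix) (l : Lit) (D : Clause) :
    outerClause Q.dual l D = outerClause Q l D := by
  simp only [outerClause, dual_level]

/-! ### The refutation of the negated formula -/

/-- The script for a step of a proof that a formula is true; `s` is the time of the names of the
clauses. -/
def QRATSatStep.script (t : List Unit) (xs : List ℕ) (f : ℕ → ℕ) (s : List Unit) (Φ : PCNF) :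
    QRATSatStep → List Item
  | .ate K => transferScript t xs f s Φ.matrix (Φ.matrix.erase K) [K]
  | .qrate K l =>
      qrateScript t xs (rightVars xs Φ.pre.dual l.var) f
        (outerSel Φ.pre.dual l.var (rightVars xs Φ.pre.dual l.var)
          (rightVars xs Φ.pre.dual l.var)) s Φ.matrix K l
  | .add _ C => transferScript t xs f s Φ.matrix (C :: Φ.matrix) []
  | .red K l => transferScript t xs f s Φ.matrix (K.without l :: Φ.matrix.erase K) []
  | .newVars _ => transferScript t xs f s Φ.matrix Φ.matrix []

theorem QRATSatStep.Ok.sublist {Φ : PCNF} {s : QRATSatStep} (h : s.Ok Φ) :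
    Φ.pre.Sublist (s.apply Φ).pre := by
  cases s with
  | add Q' C => exact h.1.1
  | newVars Q' => exact h.1
  | ate K => exact List.Sublist.refl _
  | qrate K l => exact List.Sublist.refl _
  | red K l => exact List.Sublist.refl _

theorem QRATSatStep.Ok.closed {Φ : PCNF} {s : QRATSatStep} (h : s.Ok Φ) (hΦ : Φ.Closed) :
    (s.apply Φ).Closed := by
  cases s with
  | add Q' C => exact (hΦ.extend h.1).cons h.2
  | newVars Q' => exact hΦ.extend h
  | ate K => exact hΦ.erase K
  | qrate K l => exact hΦ.erase K
  | red K l => exact hΦ.without h.1 l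

theorem sat_step_script {xs us : List ℕ} {cur : ℕ} {f : ℕ → ℕ} {S : SState} {s t : List Unit}
    {Φ : PCNF} {st : QRATSatStep} (hS : NegStage xs us cur Φ.pre.dual f s Φ.matrix S)
    (ht : t.length = cur + 1) (hΦ : Φ.Closed) (hs : st.Ok Φ)
    (ha : ∀ u, (Quant.all, u) ∈ (st.apply Φ).pre.dual → u ∈ us)
    (he : ∀ x, (Quant.ex, x) ∈ (st.apply Φ).pre.dual → x ∈ xs) :
    STr M S (st.script t xs f s Φ)
      (NegStage xs us (cur + 1) (st.apply Φ).pre.dual (newMap t xs) t (st.apply Φ).matrix) := by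
  have hcl := hs.closed hΦ
  have hv : ∀ D ∈ (st.apply Φ).matrix, ∀ k ∈ D, k.var ∈ (st.apply Φ).pre.dual.names := by
    rw [dual_names]
    exact hcl.2
  have hS' : NegStage xs us cur (st.apply Φ).pre.dual f s Φ.matrix S :=
    { hS with
      stage := hS.stage.extend (hs.sublist.map _) ((dual_names _).symm ▸ hcl.1) ha he }
  have hsame : ∀ {N' : CNF} {D : Clause}, D ∈ N' → ∃ D' ∈ N', D' ⊆ D := fun h =>
    ⟨_, h, List.Subset.refl _⟩
  cases st with
  | ate K =>
    refine transfer_step hS' ht hv (by simpa using hs.2) fun D hD => ?_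
    by_cases h : D = K
    · exact Or.inl (by simp [h])
    · exact Or.inr (hsame ((List.mem_erase_of_ne h).2 hD))
  | qrate K l =>
    obtain ⟨hK, hlK, hl, hup⟩ := hs
    have hQ : Φ.pre.dual.names.Nodup := (dual_names _).symm ▸ hΦ.1
    have hl' : (Quant.all, l.var) ∈ Φ.pre.dual := mem_dual.2 hl
    have hv' : ∀ D ∈ Φ.matrix, ∀ k ∈ D, k.var ∈ Φ.pre.dual.names := by
      rw [dual_names]
      exact hΦ.2
    refine qrate_step hS ht rightVars_subset (hS.stage.xs_nodup.filter _)
      (fun x hx h => mem_rightVars_of_depOf hQ hl' hx (hS.stage.not_all hx) h) hv' hK hlK hl'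
      (fun k hk => outerSel_iff.1 hk) fun D hD hlD => (hup D hD hlD).mono ?_
    rw [← dual_outerClause]
    exact List.append_subset.2 ⟨List.subset_append_left _ _,
      List.Subset.trans (negUnits_subset (outerClause_subset_all hQ hl'
        (hv' D (List.mem_of_mem_erase hD)))) (List.subset_append_right _ _)⟩
  | add Q' C =>
    exact transfer_step hS' ht hv (by simp) fun D hD => Or.inr (hsame (List.mem_cons_of_mem _ hD))
  | red K l =>
    refine transfer_step hS' ht hv (by simp) fun D hD => Or.inr ?_
    by_cases h : D = K
    · exact ⟨K.without l, List.mem_cons_self, h ▸ fun k hk => (mem_without.1 hk).1⟩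
    · exact hsame (List.mem_cons_of_mem _ ((List.mem_erase_of_ne h).2 hD))
  | newVars Q' => exact transfer_step hS' ht hv (by simp) fun D hD => Or.inr (hsame hD)

/-- The formula after the given steps, of which the last one comes first. -/
def QRATSatStep.history (Φ : PCNF) (R : List QRATSatStep) : PCNF :=
  R.foldr (fun s Φ => s.apply Φ) Φ

theorem QRATSatStep.allOk_append {Φ : PCNF} {a b : List QRATSatStep} :
    QRATSatStep.AllOk Φ (a ++ b) ↔ QRATSatStep.AllOk Φ a ∧
      QRATSatStep.AllOk (a.foldl QRATSatStep.apply Φ) b := by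
  induction a generalizing Φ with
  | nil => simp [QRATSatStep.AllOk]
  | cons s a ih => simp [QRATSatStep.AllOk, ih, and_assoc]

theorem QRATSatStep.history_eq {Φ : PCNF} {R : List QRATSatStep} :
    R.reverse.foldl QRATSatStep.apply Φ = QRATSatStep.history Φ R := by
  rw [List.foldl_reverse]
  rfl

theorem QRATSatStep.allOk_cons {Φ : PCNF} {s : QRATSatStep} {R : List QRATSatStep} :
    QRATSatStep.AllOk Φ (s :: R).reverse ↔ QRATSatStep.AllOk Φ R.reverse ∧
      s.Ok (QRATSatStep.history Φ R) := by
  rw [List.reverse_cons, QRATSatStep.allOk_append, QRATSatStep.history_eq]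
  simp [QRATSatStep.AllOk]

theorem QRATSatStep.history_closed {Φ : PCNF} (hΦ : Φ.Closed) {R : List QRATSatStep}
    (h : QRATSatStep.AllOk Φ R.reverse) : (QRATSatStep.history Φ R).Closed ∧
      Φ.pre.Sublist (QRATSatStep.history Φ R).pre := by
  induction R with
  | nil => exact ⟨hΦ, List.Sublist.refl _⟩
  | cons s R ih =>
    obtain ⟨h1, h2⟩ := QRATSatStep.allOk_cons.1 h
    exact ⟨h2.closed (ih h1).1, (ih h1).2.trans h2.sublist⟩

def QRATSatStep.scripts (B : List Unit) (xs : List ℕ) (Φ : PCNF) (R : List QRATSatStep) :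
    List Item :=
  (suffixes R).reverse.flatMap fun p =>
    p.1.script (() :: units p.2 ++ B) xs (stageMap (units p.2) B xs) (units p.2 ++ B)
      (QRATSatStep.history Φ p.2)

theorem QRATSatStep.scripts_cons (B : List Unit) (xs : List ℕ) (Φ : PCNF) (s : QRATSatStep)
    (R : List QRATSatStep) :
    QRATSatStep.scripts B xs Φ (s :: R) = QRATSatStep.scripts B xs Φ R ++
      s.script (() :: units R ++ B) xs (stageMap (units R) B xs) (units R ++ B)
        (QRATSatStep.history Φ R) := by
  simp [QRATSatStep.scripts, suffixes]

/-- The script of the refutation for the steps `R.reverse`. -/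
def negScript (Φ : PCNF) (R : List QRATSatStep) : List Item :=
  let P := (QRATSatStep.history Φ R).pre.dual
  let B := () :: baseTime P
  introItems P Φ.pre.dual ++ (clauseDefs B kClause (ren fun x => x) (labels Φ.matrix) ++
    ([.axNeg ((labels Φ.matrix).map fun d => (name B kClause d.2, d.1))] ++
    QRATSatStep.scripts B (quantified .ex P) Φ R))

theorem sat_scripts_correct {xs us : List ℕ} {B : List Unit} {Φ : PCNF} {S : SState}
    (hΦ : Φ.Closed)
    (hS : NegStage xs us B.length Φ.pre.dual (fun x => x) B Φ.matrix S) (R : List QRATSatStep)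
    (hR : QRATSatStep.AllOk Φ R.reverse)
    (ha : ∀ u, (Quant.all, u) ∈ (QRATSatStep.history Φ R).pre.dual → u ∈ us)
    (he : ∀ x, (Quant.ex, x) ∈ (QRATSatStep.history Φ R).pre.dual → x ∈ xs) :
    STr M S (QRATSatStep.scripts B xs Φ R)
      (NegStage xs us (R.length + B.length) (QRATSatStep.history Φ R).pre.dual
        (stageMap (units R) B xs) (units R ++ B) (QRATSatStep.history Φ R).matrix) := by
  induction R with
  | nil =>
    rw [List.length_nil, Nat.zero_add]
    exact hS
  | cons s R ih =>
    obtain ⟨h1, h2⟩ := QRATSatStep.allOk_cons.1 hR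
    have hsub := h2.sublist.map fun e => (e.1.flip, e.2)
    rw [QRATSatStep.scripts_cons]
    refine (ih h1 (fun u hu => ha u (hsub.subset hu)) fun x hx => he x (hsub.subset hx)).append ?_
    intro S₁ h3
    rw [List.length_cons, Nat.add_right_comm]
    exact sat_step_script (t := () :: units R ++ B) h3 (by simp [units])
      (QRATSatStep.history_closed hΦ h1).1 h2 ha he

theorem labels_map_fst {A : Type} (l : List A) : (labels l).map Prod.fst = l := by
  induction l with
  | nil => rfl
  | cons a l ih => rw [labels_cons, List.map_cons, ih]

theorem negScript_correct {Φ : PCNF} (hΦ : Φ.Closed) {R : List QRATSatStep}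
    (hR : QRATSatStep.AllOk Φ R.reverse) (hemp : (QRATSatStep.history Φ R).matrix = []) :
    STr [.neg (bigAnd (Φ.matrix.map Clause.toFm))] ⟨Φ.pre.dual.toD, []⟩ (negScript Φ R)
      (fun S' => [] ∈ S'.Γ) := by
  obtain ⟨hcl, hsub⟩ := QRATSatStep.history_closed hΦ hR
  unfold negScript
  simp only
  set P := (QRATSatStep.history Φ R).pre.dual with hP
  have hPn : P.names.Nodup := (dual_names _).symm ▸ hcl.1
  refine (intro_block (Q := P) (Q₀ := Φ.pre.dual) hPn (hsub.map _)).append ?_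
  rintro S₁ ⟨h1, h2⟩
  have ht : (() :: baseTime P).length = (baseTime P).length + 1 := rfl
  refine (clauses_block (Within.refl h1.inv (() :: baseTime P)) (h1.fresh_at ht) (by simp)
    (ren fun x => x) (labels_nodup Φ.matrix) fun d hd => h1.clauseIn ?_).append ?_
  · rw [dual_names]
    exact hΦ.2 d.1 (mem_labels_fst hd)
  rintro S₂ ⟨w2, e2, c2, _⟩
  have hf := w2.fresh_after h1 ht
  have hok : Item.Ok [.neg (bigAnd (Φ.matrix.map Clause.toFm))] S₂ (.axNeg
      ((labels Φ.matrix).map fun d => (name (() :: baseTime P) kClause d.2, d.1))) := by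
    refine ⟨List.mem_singleton.2 ?_, fun p hp => ?_⟩
    · conv_rhs => rw [← labels_map_fst Φ.matrix]
      simp [List.map_map, Function.comp_def]
    · obtain ⟨d, hd, rfl⟩ := List.mem_map.1 hp
      have := (c2 d hd).1.1
      rwa [ren_id] at this
  refine ⟨hok, ?_⟩
  have hx := ext_apply hok
  refine (sat_scripts_correct (us := quantified .all P) (B := () :: baseTime P) hΦ
    ⟨h1.of_ext (inv_apply w2.inv hok) (e2.trans hx) hf, c2.ext hx, ?_⟩ R hR
    (fun u hu => mem_quantified.2 hu) fun x hx => mem_quantified.2 hx).mono ?_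
  · simp [Item.apply, Item.clauses, negClause, List.map_map, Function.comp_def]
  -- For the empty matrix there are no names, and the invariant is the empty clause.
  · intro S₃ h
    have := h.neg
    rw [hemp] at this
    exact this

end QBFSim
namespace QBFSim

/-! ### Running time of the refutation of negated formulas -/

section
variable {A : Type} [Enc A] {t s n B : A → List Unit} {xs Sx : A → List ℕ}

@[fun_prop]
theorem PT.negClause (k : Kind) {L : A → List (List Lit × List Bool)} (hs : PT s) (hL : PT L) :
    PT fun a => negClause (s a) k (L a) := by
  unfold QBFSim.negClause
  fun_prop

theorem PT.clauseDefs (k : Kind) {R : A → List Lit → List Lit}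
    {L : A → List (List Lit × List Bool)} (ht : PT t) (hR : PT fun p : A × List Lit => R p.1 p.2)
    (hL : PT L) : PT fun a => clauseDefs (t a) k (R a) (L a) := by
  unfold QBFSim.clauseDefs
  have : PT fun p : A × (List Lit × List Bool) => R p.1 p.2.1 :=
    PT.comp₂ hR PT.fst (PT.comp PT.fst PT.snd)
  fun_prop

@[fun_prop]
theorem PT.subPairs {L L' : A → List (List Lit × List Bool)} (hL : PT L) (hL' : PT L') :
    PT fun a => subPairs (L a) (L' a) := by
  unfold QBFSim.subPairs
  fun_prop

@[fun_prop]
theorem PT.transferItems (k : Kind) {E : A → List Lit} {L : A → List (List Lit × List Bool)}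
    {N Ks : A → List (List Lit)} (hE : PT E) (hs : PT s) (hL : PT L) (ht : PT t) (hN : PT N)
    (hK : PT Ks) : PT fun a => transferItems (E a) (s a) k (L a) (t a) (N a) (Ks a) := by
  unfold QBFSim.transferItems
  fun_prop

theorem PT.ren₂ {f : A → ℕ → ℕ} (hf : PT fun p : A × ℕ => f p.1 p.2) :
    PT fun p : A × List Lit => QBFSim.ren (f p.1) p.2 :=
  PT.ren (f := fun p : A × List Lit => f p.1)
    (PT.comp₂ hf (PT.comp PT.fst PT.fst) PT.snd) PT.snd

theorem PT.transferScript {f : A → ℕ → ℕ} {N N' Ks : A → List (List Lit)} (ht : PT t)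
    (hxs : PT xs) (hf : PT fun p : A × ℕ => f p.1 p.2) (hs : PT s) (hN : PT N) (hN' : PT N')
    (hK : PT Ks) : PT fun a => transferScript (t a) (xs a) (f a) (s a) (N a) (N' a) (Ks a) := by
  unfold QBFSim.transferScript
  have h1 := PT.clauseDefs (L := fun a => QBFSim.labels (N' a))
    (R := fun a => QBFSim.ren (QBFSim.newMap (t a) (xs a))) kClause ht
    (PT.ren₂ (f := fun a => QBFSim.newMap (t a) (xs a)) (by fun_prop)) (by fun_prop)
  fun_prop

theorem PT.qrateScript {f : A → ℕ → ℕ} {sel : A → Lit → Bool} {N : A → List (List Lit)}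
    {K : A → List Lit} {l : A → Lit} (ht : PT t) (hxs : PT xs) (hS : PT Sx)
    (hf : PT fun p : A × ℕ => f p.1 p.2) (hsel : PT fun p : A × Lit => sel p.1 p.2) (hs : PT s)
    (hN : PT N) (hK : PT K) (hl : PT l) :
    PT fun a => qrateScript (t a) (xs a) (Sx a) (f a) (sel a) (s a) (N a) (K a) (l a) := by
  unfold QBFSim.qrateScript
  simp only
  have hv : PT fun p : A × ℕ => QBFSim.condMap (t p.1) (Sx p.1) (f p.1) p.2 :=
    PT.condMap (f := fun p : A × ℕ => f p.1) (PT.comp₂ hf (PT.comp PT.fst PT.fst) PT.snd)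
      (by fun_prop) (by fun_prop) PT.snd
  have hD : PT fun a => (QBFSim.labels ((N a).erase (K a))).filter fun d =>
    decide ((l a).neg ∈ d.1) := by fun_prop
  have hV : PT fun a => (QBFSim.labels (N a)).filter fun d => decide (l a ∉ d.1) := by fun_prop
  have h1 := PT.gates hf hsel ht hD
  have h2 := PT.condItems hf ht hS hl
  have h3 := PT.clauseDefs (R := fun a D => QBFSim.ren (QBFSim.condMap (t a) (Sx a) (f a))
    (Clause.without D (l a).neg)) kReduced ht
    (PT.comp₂ (f := fun a D => QBFSim.ren (QBFSim.condMap (t a) (Sx a) (f a)) D)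
      (PT.ren₂ (f := fun a => QBFSim.condMap (t a) (Sx a) (f a)) hv) PT.fst (by fun_prop)) hV
  have h4 := PT.iteItems (v := fun a => QBFSim.condMap (t a) (Sx a) (f a)) hf hv ht hxs hS
  have h5 := PT.clauseDefs (L := fun a => QBFSim.labels ((N a).erase (K a)))
    (R := fun a => QBFSim.ren (QBFSim.newMap (t a) (xs a))) kClause ht
    (PT.ren₂ (f := fun a => QBFSim.newMap (t a) (xs a)) (by fun_prop)) (by fun_prop)
  have h6 : PT fun a => QBFSim.ren (f a) (K a) := PT.ren hf hK
  fun_prop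

theorem PT.sat_script {f : A → ℕ → ℕ} {Φ : A → PCNF} {st : A → QRATSatStep} (ht : PT t)
    (hxs : PT xs) (hf : PT fun p : A × ℕ => f p.1 p.2) (hs : PT s) (hΦ : PT Φ) (hst : PT st) :
    PT fun a => (st a).script (t a) (xs a) (f a) (s a) (Φ a) := by
  have hv : PT fun a => (st a).view := by fun_prop
  have hN : PT fun a => (Φ a).matrix := by fun_prop
  have hp : PT fun a => Prefix.dual (Φ a).pre := by fun_prop
  have hK : PT fun a => (st a).view.2.2.1 := by fun_prop
  have hl : PT fun a => (st a).view.2.2.2 := by fun_prop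
  have hr := PT.rightVars hp (PT.lit_var hl) hxs
  have h0 := PT.transferScript (N' := fun a => (Φ a).matrix.erase (st a).view.2.2.1)
    (Ks := fun a => [(st a).view.2.2.1]) ht hxs hf hs hN (by fun_prop) (by fun_prop)
  have h1 := PT.qrateScript (sel := fun a => QBFSim.outerSel (Prefix.dual (Φ a).pre)
      (st a).view.2.2.2.var
      (QBFSim.rightVars (xs a) (Prefix.dual (Φ a).pre) (st a).view.2.2.2.var)
      (QBFSim.rightVars (xs a) (Prefix.dual (Φ a).pre) (st a).view.2.2.2.var))
    ht hxs hr hf (by fun_prop) hs hN hK hl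
  have h2 := PT.transferScript (N' := fun a => (st a).view.2.2.1 :: (Φ a).matrix)
    (Ks := fun _ => []) ht hxs hf hs hN (by fun_prop) (by fun_prop)
  have h3 := PT.transferScript (N' := fun a => Clause.without (st a).view.2.2.1 (st a).view.2.2.2 ::
    (Φ a).matrix.erase (st a).view.2.2.1) (Ks := fun _ => []) ht hxs hf hs hN (by fun_prop)
    (by fun_prop)
  have h4 := PT.transferScript (N' := fun a => (Φ a).matrix)
    (Ks := fun _ => []) ht hxs hf hs hN hN (by fun_prop)
  have htag : ∀ m : List Bool, PT fun a => decide ((st a).view.1 = m) := fun m => by fun_prop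
  refine PT.of_enc (PT.cond (htag []) h0 (PT.cond (htag [true]) h1
    (PT.cond (htag [true, true]) h2 (PT.cond (htag [true, true, true]) h3 h4)))) fun a => ?_
  congr 1
  cases st a <;> rfl

@[fun_prop]
theorem PT.sat_history {Φ : A → PCNF} {R : A → List QRATSatStep} (hΦ : PT Φ) (hR : PT R) :
    PT fun a => QRATSatStep.history (Φ a) (R a) := by
  refine PT.formulas (ap := fun Φ s => QRATSatStep.apply Φ s)
    (c := fun s => decide (s.view.1 = [true, true]) ||
      decide (s.view.1 = [true, true, true, true]))
    (e := fun s => decide (s.view.1 = []) || (decide (s.view.1 = [true]) ||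
      decide (s.view.1 = [true, true, true])))
    (Q := fun s => s.view.2.1)
    (N := fun s => bif decide (s.view.1 = [true, true]) then [s.view.2.2.1] else
      bif decide (s.view.1 = [true, true, true]) then
        [Clause.without s.view.2.2.1 s.view.2.2.2] else [])
    (K := fun s => s.view.2.2.1)
    (by fun_prop) (by fun_prop) (by fun_prop) (by fun_prop) (by fun_prop) ?_ hΦ hR
  intro Φ s
  cases s <;> rfl

theorem PT.sat_scripts {Φ : A → PCNF} {R : A → List QRATSatStep} (hB : PT B) (hxs : PT xs)
    (hΦ : PT Φ) (hR : PT R) : PT fun a => QRATSatStep.scripts (B a) (xs a) (Φ a) (R a) := by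
  unfold QRATSatStep.scripts
  refine PT.flatMap ?_ (by fun_prop)
  exact PT.sat_script (t := fun q : A × (QRATSatStep × List QRATSatStep) =>
      () :: QBFSim.units q.2.2 ++ B q.1) (s := fun q => QBFSim.units q.2.2 ++ B q.1)
    (f := fun q => QBFSim.stageMap (QBFSim.units q.2.2) (B q.1) (xs q.1))
    (Φ := fun q => QRATSatStep.history (Φ q.1) q.2.2) (st := fun q => q.2.1)
    (by fun_prop) (by fun_prop) (by fun_prop) (by fun_prop) (by fun_prop) (by fun_prop)

theorem PT.negScript {Φ : A → PCNF} {R : A → List QRATSatStep} (hΦ : PT Φ) (hR : PT R) :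
    PT fun a => negScript (Φ a) (R a) := by
  unfold QBFSim.negScript
  have hp : PT fun a => Prefix.dual (QRATSatStep.history (Φ a) (R a)).pre := by fun_prop
  have hB : PT fun a => () :: QBFSim.baseTime (Prefix.dual (QRATSatStep.history (Φ a) (R a)).pre) :=
    by fun_prop
  have hN : PT fun a => QBFSim.labels (Φ a).matrix := by fun_prop
  have h1 := PT.introItems hp (PT.dual (PT.pcnf_pre hΦ))
  have h2 := PT.clauseDefs (R := fun _ => QBFSim.ren fun x => x) kClause hB
    (PT.ren₂ (A := A) (f := fun _ x => x) (by fun_prop)) hN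
  have h3 := PT.sat_scripts hB (PT.quantified Quant.ex hp) hΦ hR
  refine PT.append h1 (PT.append h2 (PT.append ?_ h3))
  fun_prop

end

/-- The refutation of the negation of a formula that is proved true. -/
noncomputable def refuteNeg (F : FregeSystem) (π : QRATSatProof) : DProof :=
  ⟨π.formula.negDQBF, compileScript F (negScript π.formula π.steps.reverse)⟩

theorem PT.refuteNeg (F : FregeSystem) : PT (refuteNeg F) := by
  have h := PT.negScript (Φ := fun π : QRATSatProof => π.formula)
    (R := fun π => π.steps.reverse) (by fun_prop) (by fun_prop)
  exact PT.dproof_mk (PT.negDQBF (by fun_prop)) (PT.compileScript h)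

theorem refuteNeg_correct (F : FregeSystem) (π : QRATSatProof) (h : π.IsSatisfactionProof) :
    (refuteNeg F π).IsRefutation F := by
  obtain ⟨h1, h2, h3⟩ := h
  rw [← List.reverse_reverse π.steps, QRATSatStep.history_eq] at h3
  obtain ⟨h4, S, h5, _, h6⟩ := compileScript_correct (F := F)
    (toD_inv (Q := π.formula.pre.dual) ((dual_names _).symm ▸ h1.1))
    (negScript_correct h1 (R := π.steps.reverse) (by simpa using h2) h3)
  exact ⟨h4, h5.2 _ h6⟩

end QBFSim

/-! ### The two simulations together -/

theorem mainTheorem6 (F : FregeSystem) :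
    (∃ p : QRATProof → DProof,
      PolyTimeOn encQRATProof encDProof QRATProof.IsDerivation p ∧
      ∀ π : QRATProof, π.IsDerivation →
        (p π).formula = π.formula.toDQBF ∧
        (p π).IsDerivation F ∧
        (∀ i ≤ π.steps.length, (p π).final.ContainsCopy (π.stage i)) ∧
        (π.IsRefutation → (p π).IsRefutation F)) ∧
    (∃ p : QRATSatProof → DProof,
      PolyTimeOn encQRATSatProof encDProof QRATSatProof.IsSatisfactionProof p ∧
      ∀ π : QRATSatProof, π.IsSatisfactionProof →
        (p π).formula = π.formula.negDQBF ∧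
        (p π).IsRefutation F) := by
  refine ⟨⟨simulate F, ?_, fun π h => ⟨rfl, simulate_correct F π h⟩⟩,
    ⟨refuteNeg F, ?_, fun π h => ⟨rfl, refuteNeg_correct F π h⟩⟩⟩
  -- The translations are total functions that run in polynomial time on all inputs, so the
  -- restriction to correct proofs can be dropped here.
  · obtain ⟨c, P, h⟩ := PT.simulate F
    exact ⟨c, P, fun π _ => h π⟩
  · obtain ⟨c, P, h⟩ := PT.refuteNeg F
    exact ⟨c, P, fun π _ => h π⟩
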